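/- All graphs are finite, undirected, without loops, and nonempty; $n$ and $m$ are the numbers of vertices and edges of $G$. **Definitions.** For a connected graph $G=(V,E)$, a set $R\subseteq V$ is a *resolving set* if for all $u\neq v$ in $V$ there is $w\in R$ with $d_G(u,w)\neq d_G(v,w)$; it is a *minimum* resolving set if no resolving set has fewer vertices. The *metric dimension* of $G$ is the smallest positive integer that is the size of a resolving set. A graph with at least three vertices is *biconnected* if any two distinct vertices are joined by two different simple paths with no common inner vertex; a *biconnected component* of $G$ is an inclusion-maximal biconnected induced subgraph. A *leg* is a path $(u_1,\dots,u_l)$, $l\ge 2$, where $u_1$ has degree one, $u_2,\dots,u_{l-1}$ have degree two and the *root* $u_l$ has degree at least three; it is *hooked* if removing $u_l$ leaves exactly two connected components. An *extended biconnected component* (EBC) is a biconnected component together with the vertices of all hooked legs whose roots lie in it. A *$k$-EBC-bounded resolving set* is a resolving set $R$ such that every EBC contains at most $k$ vertices of $R$; it is *minimum* if no $k$-EBC-bounded resolving set has fewer vertices. Let $\mathcal G_k$ be the class of connected graphs that have a $k$-EBC-bounded resolving set, and $\mathcal G_k^{\min}$ the class of connected graphs that have a minimum resolving set with at most $k$ vertices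 in every EBC. A set $B$ of graphs is *EBC-bounded* if every $G\in B$ lies in $\mathcal G_k$ for some positive integer $k$. **Statement.** On a word RAM (words of $O(\log n)$ bits, the graph given by its adjacency matrix, every instruction and every test counted as one step) the following can be solved: 1. For every fixed $k\ge 1$: given a graph $G$, decide whether $G\in\mathcal G_k$, in $O(n^k\cdot n\cdot(n+m))$ steps. 2. Given a member $G$ of an EBC-bounded set $B$ of graphs, find the smallest positive integer $k'$ with $G\in\mathcal G_{k'}$, by a single program (the same for all $B$), in $O(n^{k'}\cdot n\cdot(n+m))$ steps, where the implied constant depends only on $k'$; in particular in $O(n^k\cdot n\cdot(n+m))$ steps for $G\in\mathcal G_k$ and fixed $k$. 3. For every fixed $k\ge 1$: given $G\in\mathcal G_k$, compute a minimum $k$-EBC-bounded resolving set for $G$, in $O(n^k\cdot n\cdot(n+m))$ steps. 4. For every fixed $k\ge 1$: given $G\in\mathcal G_k^{\min}$, compute a minimum resolving set for $G$ and the metric dimension of $G$, in $O(n^k\cdot n\cdot(n+m))$ steps. In 1, 3 and 4 the program and the implied constant depend only on $k$. -/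

import Mathlib

namespace EBC

/-! ## Graph notions -/

section Graphs

variable {V : Type*}

/-- `R` is a resolving set for `G`: any two distinct vertices have different distances to some
vertex of `R`. (Used for connected `G` only.) -/
def IsResolving (G : SimpleGraph V) (R : Finset V) : Prop :=
  ∀ u v : V, u ≠ v → ∃ w ∈ R, G.dist u w ≠ G.dist v w

/-- `R` is a minimum resolving set for `G`. -/
def IsMinResolving (G : SimpleGraph V) (R : Finset V) : Prop :=
  IsResolving G R ∧ ∀ R' : Finset V, IsResolving G R' → R.card ≤ R'.card

/-- `d` is the metric dimension of `G`: the smallest positive integer such that `G` has a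
resolving set of that size. -/
def HasMetricDimension (G : SimpleGraph V) (d : ℕ) : Prop :=
  IsLeast {d : ℕ | 0 < d ∧ ∃ R : Finset V, IsResolving G R ∧ R.card = d} d

/-- A graph is biconnected if it has at least three vertices and any two distinct vertices are
joined by two different simple paths that share no vertices but their ends. -/
def IsBiconnected (G : SimpleGraph V) : Prop :=
  3 ≤ Nat.card V ∧
  ∀ u v : V, u ≠ v → ∃ p q : G.Walk u v, p.IsPath ∧ q.IsPath ∧ p ≠ q ∧
    ∀ x, x ∈ p.support → x ∈ q.support → x = u ∨ x = v

/-- `B` is the vertex set of a biconnected component of `G`: a maximal set of vertices that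
induces a biconnected subgraph. -/
def IsBiconnectedComponent (G : SimpleGraph V) (B : Set V) : Prop :=
  Maximal (fun B : Set V => IsBiconnected (G.induce B)) B

/-- The path `p` from `u` to `r` is a leg with leaf `u` and root `r`: the end `u` has degree one,
the inner vertices have degree two, and `r` has degree at least three. -/
def IsLeg (G : SimpleGraph V) {u r : V} (p : G.Walk u r) : Prop :=
  p.IsPath ∧ (G.neighborSet u).ncard = 1 ∧ 3 ≤ (G.neighborSet r).ncard ∧
  ∀ x ∈ p.support, x ≠ u → x ≠ r → (G.neighborSet x).ncard = 2

/-- A leg is hooked if the removal of its root separates `G` into exactly two connected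
components. -/
def IsHookedLeg (G : SimpleGraph V) {u r : V} (p : G.Walk u r) : Prop :=
  IsLeg G p ∧ Nat.card (G.induce {x | x ≠ r}).ConnectedComponent = 2

/-- `S` is the vertex set of an extended biconnected component (EBC) of `G`: a biconnected
component together with all vertices of the hooked legs whose root lies in it. -/
def IsEBC (G : SimpleGraph V) (S : Set V) : Prop :=
  ∃ B : Set V, IsBiconnectedComponent G B ∧
    S = B ∪ {x | ∃ (u r : V) (p : G.Walk u r), IsHookedLeg G p ∧ r ∈ B ∧ x ∈ p.support}

/-- Every EBC of `G` contains at most `k` vertices of `R`. -/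
def AtMostPerEBC (G : SimpleGraph V) (k : ℕ) (R : Finset V) : Prop :=
  ∀ S : Set V, IsEBC G S → ((R : Set V) ∩ S).ncard ≤ k

/-- `R` is a `k`-EBC-bounded resolving set for `G`. -/
def IsEBCBoundedResolving (G : SimpleGraph V) (k : ℕ) (R : Finset V) : Prop :=
  IsResolving G R ∧ AtMostPerEBC G k R

/-- `R` is a `k`-EBC-bounded resolving set for `G`, and none has fewer vertices. -/
def IsMinEBCBoundedResolving (G : SimpleGraph V) (k : ℕ) (R : Finset V) : Prop :=
  IsEBCBoundedResolving G k R ∧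
    ∀ R' : Finset V, IsEBCBoundedResolving G k R' → R.card ≤ R'.card

/-- `G` is `k`-EBC-bounded (the class `𝒢_k`). Resolving sets are a notion for connected graphs,
so a disconnected graph is not `k`-EBC-bounded. -/
def IsEBCBounded (G : SimpleGraph V) (k : ℕ) : Prop :=
  G.Connected ∧ ∃ R : Finset V, IsEBCBoundedResolving G k R

/-- `G` is minimum-`k`-EBC-bounded: it has a minimum resolving set with at most `k` vertices in
every EBC. -/
def IsMinimumEBCBounded (G : SimpleGraph V) (k : ℕ) : Prop :=
  G.Connected ∧ ∃ R : Finset V, IsMinResolving G R ∧ AtMostPerEBC G k R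

end Graphs

/-- A finite graph, on the vertex set `{0, …, n - 1}` for some `n`. -/
abbrev FinGraph : Type := Σ n : ℕ, SimpleGraph (Fin n)

/-- A set of graphs is EBC-bounded if each of its members is `k`-EBC-bounded for some `k ≥ 1`. -/
def IsEBCBoundedSet (B : Set FinGraph) : Prop :=
  ∀ H ∈ B, ∃ k : ℕ, 0 < k ∧ IsEBCBounded H.2 k

/-! ## A word RAM with step count

Programs are structured programs over registers and one-dimensional arrays that are named by
natural numbers; a program mentions finitely many of them. All contents are natural numbers below
a word bound `W`; a step that would exceed it is not allowed. Every instruction and every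
evaluation of a branch or loop condition takes one step. -/

/-- Memory contents: `reg r` is register `r`, and `arr A i` is cell `i` of array `A`. -/
structure State where
  reg : ℕ → ℕ
  arr : ℕ → ℕ → ℕ

/-- Set register `r` to `v`. -/
def State.setReg (s : State) (r v : ℕ) : State :=
  { s with reg := Function.update s.reg r v }

/-- Set cell `i` of array `A` to `v`. -/
def State.setArr (s : State) (A i v : ℕ) : State :=
  { s with arr := Function.update s.arr A (Function.update (s.arr A) i v) }

/-- The arithmetic operations on words. -/
inductive Op where
  | add
  | sub
  | mul

/-- Subtraction is truncated at zero. -/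
def Op.eval : Op → ℕ → ℕ → ℕ
  | .add, a, b => a + b
  | .sub, a, b => a - b
  | .mul, a, b => a * b

/-- Programs. -/
inductive Prog where
  /-- do nothing -/
  | skip : Prog
  /-- register `r` becomes the constant `v` -/
  | const (r v : ℕ) : Prog
  /-- register `r` becomes the result of `o` on registers `a` and `b` -/
  | arith (o : Op) (r a b : ℕ) : Prog
  /-- register `r` becomes the cell of array `A` whose index is in register `i` -/
  | load (r A i : ℕ) : Prog
  /-- the cell of array `A` whose index is in register `i` becomes the content of register `r` -/
  | store (A i r : ℕ) : Prog
  /-- first `p`, then `q` -/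
  | seq (p q : Prog) : Prog
  /-- `p` if register `r` is nonzero, else `q` -/
  | ite (r : ℕ) (p q : Prog) : Prog
  /-- while register `r` is nonzero, do `p` -/
  | loop (r : ℕ) (p : Prog) : Prog

/-- `Exec W P s t s'`: with word bound `W`, the program `P` started in `s` halts in `s'` after
exactly `t` steps. -/
inductive Exec (W : ℕ) : Prog → State → ℕ → State → Prop where
  | skip (s : State) : Exec W .skip s 1 s
  | const (s : State) (r v : ℕ) : v < W → Exec W (.const r v) s 1 (s.setReg r v)
  | arith (s : State) (o : Op) (r a b : ℕ) : o.eval (s.reg a) (s.reg b) < W →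
      Exec W (.arith o r a b) s 1 (s.setReg r (o.eval (s.reg a) (s.reg b)))
  | load (s : State) (r A i : ℕ) :
      Exec W (.load r A i) s 1 (s.setReg r (s.arr A (s.reg i)))
  | store (s : State) (A i r : ℕ) :
      Exec W (.store A i r) s 1 (s.setArr A (s.reg i) (s.reg r))
  | seq {p q : Prog} {s s' s'' : State} {t t' : ℕ} :
      Exec W p s t s' → Exec W q s' t' s'' → Exec W (.seq p q) s (t + t') s''
  | ite_true {r : ℕ} {p q : Prog} {s s' : State} {t : ℕ} :
      s.reg r ≠ 0 → Exec W p s t s' → Exec W (.ite r p q) s (t + 1) s'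
  | ite_false {r : ℕ} {p q : Prog} {s s' : State} {t : ℕ} :
      s.reg r = 0 → Exec W q s t s' → Exec W (.ite r p q) s (t + 1) s'
  | loop_done {r : ℕ} {p : Prog} {s : State} :
      s.reg r = 0 → Exec W (.loop r p) s 1 s
  | loop_step {r : ℕ} {p : Prog} {s s' s'' : State} {t t' : ℕ} :
      s.reg r ≠ 0 → Exec W p s t s' → Exec W (.loop r p) s' t' s'' →
      Exec W (.loop r p) s (t + t' + 1) s''

open Classical in
/-- The initial memory for a graph `G` on `{0, …, n - 1}`: register `0` holds `n`, array `0` holds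
the adjacency matrix row by row (cell `i * n + j` is `1` if `i` and `j` are adjacent and `0` if
not), and everything else is `0`. -/
noncomputable def initState {n : ℕ} (G : SimpleGraph (Fin n)) : State where
  reg r := if r = 0 then n else 0
  arr A x := if A = 0 ∧ ∃ i j : Fin n, G.Adj i j ∧ x = (i : ℕ) * n + (j : ℕ) then 1 else 0

/-- On input `G`, on a machine whose words have `O(log n)` bits (word bound `(n + 2) ^ w`), the
program `P` halts within `T` steps in a state that satisfies `post`. -/
def HaltsWithin (P : Prog) (w : ℕ) {n : ℕ} (G : SimpleGraph (Fin n)) (T : ℕ)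
    (post : State → Prop) : Prop :=
  ∃ (t : ℕ) (s : State), Exec ((n + 2) ^ w) P (initState G) t s ∧ t ≤ T ∧ post s

/-- The number output by a halting run: the final content of register `0`. -/
def outNum (s : State) : ℕ := s.reg 0

/-- The vertex set output by a halting run: the vertices whose cell in array `1` is nonzero. -/
def outSet (n : ℕ) (s : State) : Finset (Fin n) :=
  Finset.univ.filter fun i => s.arr 1 (i : ℕ) ≠ 0

/-- The quantity `n ^ k * n * (n + m)` for a graph with `n` vertices and `m` edges. -/
noncomputable def timeBound (k : ℕ) {n : ℕ} (G : SimpleGraph (Fin n)) : ℕ :=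
  n ^ k * n * (n + G.edgeSet.ncard)

end EBC

/-!
Resolving sets with few vertices in every EBC are found by dynamic programming along the tree of
biconnected components.

*Graphs.* Everything is expressed by the relation `Cn G c x y`: the vertices `x` and `y` are
connected in `G - c`. The biconnected components are the sets of all vertices that no vertex
separates from two given ones (`isBiconnectedComponent_iff`, by Whitney's theorem); a leg at `r` is a
component of `G - r` in which the distances to `r` are all different (`Leglike.exists_isLeg`,
`IsLeg.leglike`). So the EBCs are the sets `ext G B`, for the blocks `B` (`isEBC_iff`). Two EBCs
only share joints (`IsBlk.eq_of_mem_ext`): cut vertices of degree at least three without a hooked leg.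

*Resolving sets.* Seen from an EBC, the vertices of a set `R` outside of it lie beyond joints, and
may be replaced by these. Conversely, a resolving set has vertices beyond every joint. Hence
`R` is resolving if and only if inside each EBC the pairs are resolved by the joints and
the vertices of `R` there, and at each joint `c` at most one of the parts that meet in `c` has a
neighbor of `c` from which all of `R` is seen through `c`. Such a part is either a leg
disjoint from `R`, or a block that is *bad* at `c`, which again depends only on the joints and the
vertices of `R` in its EBC. These are the conditions `Local G R`; see `local_of_res` and `Local.res`.
Paths have neither blocks nor joints and are treated separately.

*Dynamic program.* The blocks form a tree, rooted at the vertex `0`; the vertex of a block closest to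
the root is its gate, and the other joints in it are its children. For each EBC a set of at most `K`
vertices is chosen, so that no joint has more than one bad block (`Task`, `graphTask`). If no
block is bad at a joint, one leg there may be left out. The blocks are dealt with from the leaves to
the root. For each vertex `x`, two numbers are kept: the least cost of the part below `x`, if
no block, or at most one block, may be bad at `x` there (`Task.Inv`). A block is dealt with by an
exhaustive search over the sets that may be chosen for it, given as tuples with `K` entries
(`tri_search`); `Task.Inv.step` shows that the two numbers for its gate can be updated from
the best choices that are bad at the gate and the best ones that are not.

*Time.* A set chosen for an EBC with `s` vertices is tested in time proportional to `K * s ^ 2`. Since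
two EBCs share at most one vertex, the numbers `s ^ 2` add up to at most `2 * n ^ 2`
(`sum_ncard_sq_le`). With `(n + 1) ^ K` tuples for each block, this makes a time of order
`n ^ K * n ^ 2` for fixed `K ≥ 1`. The distances, the components of all graphs `G - c` and the tables
of the graph notions only take cubic time. Bounds `k` greater than `n` are replaced by `n`. To find
the least `k`, all bounds from `1` on are tried.

*Programs.* Programs are written with expressions that may contain sums and searches (`Ex`), which
are compiled to the machine (`Ex.code_exec`), and are verified by Hoare triples with a number of
steps (`Tri`). All values that are stored are cut down to `(n + 2) ^ 2`, so that the values of all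
expressions fit into words with a fixed multiple of `log n` bits; costs from `(n + 2) ^ 2` on count
as infinite.
-/



namespace EBC

/-! ### Expressions and their compilation -/

/-- The first `x < b` with `f x ≠ 0`, and `b` if there is none. -/
def firstBelow : ℕ → (ℕ → ℕ) → ℕ
  | 0, _ => 0
  | b + 1, f => if f 0 ≠ 0 then 0 else firstBelow b (fun x => f (x + 1)) + 1

theorem firstBelow_le (b : ℕ) (f : ℕ → ℕ) : firstBelow b f ≤ b := by
  induction b generalizing f with
  | zero => simp [firstBelow]
  | succ b ih =>
    rw [firstBelow]
    split_ifs
    · omega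
    · have := ih (fun x => f (x + 1)); omega

theorem firstBelow_min (b : ℕ) (f : ℕ → ℕ) : ∀ x < firstBelow b f, f x = 0 := by
  induction b generalizing f with
  | zero => simp [firstBelow]
  | succ b ih =>
    intro x hx
    rw [firstBelow] at hx
    split_ifs at hx with h
    · omega
    · cases x with
      | zero => simpa using h
      | succ x => exact ih (fun x => f (x + 1)) x (by omega)

theorem firstBelow_ne (b : ℕ) (f : ℕ → ℕ) (h : firstBelow b f < b) : f (firstBelow b f) ≠ 0 := by
  induction b generalizing f with
  | zero => omega
  | succ b ih =>
    rw [firstBelow] at h ⊢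
    split_ifs with h0
    · exact h0
    · rw [if_neg h0] at h
      exact ih (fun x => f (x + 1)) (by omega)

theorem firstBelow_unique {b r : ℕ} {f : ℕ → ℕ} (h1 : r ≤ b) (h2 : ∀ x < r, f x = 0)
    (h3 : r < b → f r ≠ 0) : r = firstBelow b f := by
  rcases lt_trichotomy r (firstBelow b f) with h | h | h
  · exact absurd (firstBelow_min b f r h) (h3 (h.trans_le (firstBelow_le b f)))
  · exact h
  · exact absurd (h2 _ h) (firstBelow_ne b f (h.trans_le h1))

theorem firstBelow_lt_iff {b : ℕ} {f : ℕ → ℕ} : firstBelow b f < b ↔ ∃ x < b, f x ≠ 0 := by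
  constructor
  · intro h
    exact ⟨_, h, firstBelow_ne b f h⟩
  · rintro ⟨x, hx, hf⟩
    by_contra h
    exact hf (firstBelow_min b f x (by omega))

/-- Memory contents, array by array. -/
abbrev Mem : Type := ℕ → ℕ → ℕ

/-- Expressions over the arrays and over the variables `0, 1, …` bound by enclosing loops.
The binders `sum A e` and `find A e` let the next variable run over all numbers below cell `0` of
the array `A`. Numbers also serve as truth values, nonzero meaning true. -/
inductive Ex where
  | num (c : ℕ)
  | var (i : ℕ)
  | get (A : ℕ) (e : Ex)
  | bin (o : Op) (a b : Ex)
  | ite (c a b : Ex)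
  | sum (A : ℕ) (e : Ex)
  | find (A : ℕ) (e : Ex)

namespace Ex

/-- The value of an expression below `d` binders, in the environment `ρ`. -/
def eval (m : Mem) : Ex → ℕ → (ℕ → ℕ) → ℕ
  | num c, _, _ => c
  | var i, _, ρ => ρ i
  | get A e, d, ρ => m A (e.eval m d ρ)
  | bin o a b, d, ρ => o.eval (a.eval m d ρ) (b.eval m d ρ)
  | ite c a b, d, ρ => if c.eval m d ρ ≠ 0 then a.eval m d ρ else b.eval m d ρ
  | sum A e, d, ρ => ∑ x ∈ Finset.range (m A 0), e.eval m (d + 1) (Function.update ρ d x)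
  | find A e, d, ρ => firstBelow (m A 0) fun x => e.eval m (d + 1) (Function.update ρ d x)

/-- A bound for the number of steps that the evaluation takes. -/
def cost (m : Mem) : Ex → ℕ
  | num _ => 1
  | var _ => 2
  | get _ e => e.cost m + 1
  | bin _ a b => a.cost m + b.cost m + 1
  | ite c a b => c.cost m + a.cost m + b.cost m + 1
  | sum A e => 4 + m A 0 * (e.cost m + 3)
  | find A e => 5 + m A 0 * (e.cost m + 5)

/-- An exponent `x` such that the evaluation only meets numbers up to `M ^ x`, provided that the
variables and the arrays hold numbers up to `M ^ 2`. -/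
def ex : Ex → ℕ
  | num c => c
  | var _ => 2
  | get _ e => e.ex + 2
  | bin _ a b => a.ex + b.ex + 1
  | ite c a b => c.ex + a.ex + b.ex
  | sum _ e => e.ex + 2
  | find _ e => e.ex + 2

/-- All variables are bound. -/
def closed : Ex → ℕ → Bool
  | num _, _ => true
  | var i, d => decide (i < d)
  | get _ e, d => e.closed d
  | bin _ a b, d => a.closed d && b.closed d
  | ite c a b, d => c.closed d && a.closed d && b.closed d
  | sum _ e, d => e.closed (d + 1)
  | find _ e, d => e.closed (d + 1)

/-- The program that evaluates an expression below `d` binders. Variable `i` is kept in register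
`2 * i + 3`; the registers `2 * j + 2` with `j ≥ t` are scratch, and the first of them receives the
value. -/
def code : Ex → ℕ → ℕ → Prog
  | num c, _, t => .const (2 * t + 2) c
  | var i, _, t => .seq (.const (2 * t + 2) 0) (.arith .add (2 * t + 2) (2 * i + 3) (2 * t + 2))
  | get A e, d, t => .seq (e.code d t) (.load (2 * t + 2) A (2 * t + 2))
  | bin o a b, d, t => .seq (a.code d t) (.seq (b.code d (t + 1))
      (.arith o (2 * t + 2) (2 * t + 2) (2 * (t + 1) + 2)))
  | ite c a b, d, t => .seq (c.code d t) (.ite (2 * t + 2) (a.code d t) (b.code d t))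
  | sum A e, d, t =>
    .seq (.const (2 * t + 2) 0) <| .seq (.load (2 * d + 3) A (2 * t + 2)) <|
    .seq (.const (2 * (t + 1) + 2) 1) <|
    .loop (2 * d + 3) <| .seq (.arith .sub (2 * d + 3) (2 * d + 3) (2 * (t + 1) + 2)) <|
      .seq (e.code (d + 1) (t + 2)) (.arith .add (2 * t + 2) (2 * t + 2) (2 * (t + 2) + 2))
  | find A e, d, t =>
    .seq (.const (2 * t + 2) 0) <| .seq (.load (2 * d + 3) A (2 * t + 2)) <|
    .seq (.load (2 * t + 2) A (2 * t + 2)) <| .seq (.const (2 * (t + 1) + 2) 1) <|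
    .loop (2 * d + 3) <| .seq (.arith .sub (2 * d + 3) (2 * d + 3) (2 * (t + 1) + 2)) <|
      .seq (e.code (d + 1) (t + 2)) <|
        .ite (2 * (t + 2) + 2) (.seq (.const (2 * (t + 2) + 2) 0)
          (.arith .add (2 * t + 2) (2 * d + 3) (2 * (t + 2) + 2))) .skip

end Ex

/-- From `s` to `s'`, the variables below `d`, the scratch registers below `t` and the register `1`
have kept their contents. -/
structure Keep (d t : ℕ) (s s' : State) : Prop where
  var : ∀ i < d, s'.reg (2 * i + 3) = s.reg (2 * i + 3)
  tmp : ∀ j < t, s'.reg (2 * j + 2) = s.reg (2 * j + 2)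
  one : s'.reg 1 = s.reg 1

theorem Keep.refl (d t : ℕ) (s : State) : Keep d t s s := ⟨by simp, by simp, rfl⟩

theorem Keep.trans {d t : ℕ} {s s' s'' : State} (h : Keep d t s s') (h' : Keep d t s' s'') :
    Keep d t s s'' :=
  ⟨fun i hi => (h'.var i hi).trans (h.var i hi), fun j hj => (h'.tmp j hj).trans (h.tmp j hj),
    h'.one.trans h.one⟩

theorem Keep.mono {d t d' t' : ℕ} {s s' : State} (h : Keep d t s s') (hd : d' ≤ d) (ht : t' ≤ t) :
    Keep d' t' s s' :=
  ⟨fun i hi => h.var i (by omega), fun j hj => h.tmp j (by omega), h.one⟩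

@[simp] theorem State.setReg_reg (s : State) (r v x : ℕ) :
    (s.setReg r v).reg x = if x = r then v else s.reg x := by
  simp [State.setReg, Function.update_apply]

@[simp] theorem State.setReg_arr (s : State) (r v : ℕ) : (s.setReg r v).arr = s.arr := rfl

theorem Keep.setTmp {d t r : ℕ} (s : State) (v : ℕ) (h : t ≤ r) :
    Keep d t s (s.setReg (2 * r + 2) v) := by
  refine ⟨fun i hi => ?_, fun j hj => ?_, ?_⟩ <;> simp <;> omega

theorem Keep.setVar {d t r : ℕ} (s : State) (v : ℕ) (h : d ≤ r) :
    Keep d t s (s.setReg (2 * r + 3) v) := by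
  refine ⟨fun i hi => ?_, fun j hj => ?_, ?_⟩ <;> simp <;> omega

/-- A counting-down loop: the register `r` runs through `b - 1, …, 0`, and `I x` holds when the
values from `x` on have been dealt with. -/
theorem exec_countdown {W r : ℕ} {p : Prog} {I : ℕ → State → Prop} {C : ℕ} :
    ∀ (b : ℕ) (s : State), s.reg r = b → I b s →
    (∀ x s, I (x + 1) s → s.reg r = x + 1 → x < b →
      ∃ τ s', Exec W p s τ s' ∧ τ ≤ C ∧ I x s' ∧ s'.reg r = x) →
    ∃ τ s', Exec W (.loop r p) s τ s' ∧ τ ≤ b * (C + 1) + 1 ∧ I 0 s' ∧ s'.reg r = 0 := by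
  intro b
  induction b with
  | zero =>
    intro s hs hI _
    exact ⟨1, s, .loop_done hs, by omega, hI, hs⟩
  | succ b ih =>
    intro s hs hI hstep
    obtain ⟨τ, s', he, hτ, hI', hs'⟩ := hstep b s hI hs (by omega)
    obtain ⟨τ', s'', he', hτ', hI'', hs''⟩ := ih s' hs' hI'
      (fun x s h1 h2 h3 => hstep x s h1 h2 (by omega))
    refine ⟨_, s'', .loop_step (by omega) he he', ?_, hI'', hs''⟩
    nlinarith

@[simp] theorem even_ne_odd (t d : ℕ) : ¬ 2 * t = 2 * d + 1 := by omega

@[simp] theorem odd_ne_even (t d : ℕ) : ¬ 2 * d + 1 = 2 * t := by omega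

namespace Ex

theorem one_le_pow' {M : ℕ} (hM : 2 ≤ M) (x : ℕ) : 1 ≤ M ^ x := Nat.one_le_pow _ _ (by omega)

theorem pow_le {M x y : ℕ} (hM : 2 ≤ M) (h : x ≤ y) : M ^ x ≤ M ^ y :=
  Nat.pow_le_pow_right (by omega) h

theorem pow_lt {M x y : ℕ} (hM : 2 ≤ M) (h : x < y) : M ^ x < M ^ y :=
  Nat.pow_lt_pow_right (by omega) h

theorem num_le {M : ℕ} (hM : 2 ≤ M) (c : ℕ) : c ≤ M ^ c :=
  (Nat.lt_pow_self (by omega : 1 < M)).le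

/-- The values of an expression are bounded by a power of `M` that depends on the expression only.
So they fit into words. -/
theorem eval_le {M : ℕ} (hM : 2 ≤ M) {m : Mem} (hm : ∀ A i, m A i ≤ M ^ 2) (e : Ex) :
    ∀ (d : ℕ) (ρ : ℕ → ℕ), (∀ i < d, ρ i ≤ M ^ 2) → e.closed d = true →
        e.eval m d ρ ≤ M ^ e.ex := by
  induction e with
  | num c => intro d ρ _ _; exact num_le hM c
  | var i => intro d ρ hρ hc; exact hρ i (by simpa [closed] using hc)
  | get A e ih => intro d ρ hρ hc; exact (hm _ _).trans (pow_le hM (by simp [ex]))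
  | bin o a b iha ihb =>
    intro d ρ hρ hc
    simp only [closed, Bool.and_eq_true] at hc
    have ha := iha d ρ hρ hc.1
    have hb := ihb d ρ hρ hc.2
    simp only [eval, ex]
    have h1 := one_le_pow' hM a.ex
    have h2 := one_le_pow' hM b.ex
    have h3 : M ^ (a.ex + b.ex + 1) = M ^ a.ex * M ^ b.ex * M := by rw [pow_succ, pow_add]
    rw [h3]
    have h4 : M ^ a.ex * M ^ b.ex * 2 ≤ M ^ a.ex * M ^ b.ex * M := Nat.mul_le_mul_left _ hM
    cases o <;> simp only [Op.eval]
    · nlinarith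
    · nlinarith [Nat.sub_le (a.eval m d ρ) (b.eval m d ρ)]
    · nlinarith [Nat.mul_le_mul ha hb]
  | ite c a b ihc iha ihb =>
    intro d ρ hρ hc
    simp only [closed, Bool.and_eq_true] at hc
    have ha := iha d ρ hρ hc.1.2
    have hb := ihb d ρ hρ hc.2
    simp only [eval, ex]
    split_ifs
    · exact ha.trans (pow_le hM (by omega))
    · exact hb.trans (pow_le hM (by omega))
  | sum A e ih =>
    intro d ρ hρ hc
    simp only [eval, ex]
    calc _ ≤ ∑ x ∈ Finset.range (m A 0), M ^ e.ex := by
          refine Finset.sum_le_sum fun x hx => ih (d + 1) _ (fun i hi => ?_) hc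
          rw [Function.update_apply]
          split_ifs with h
          · exact (Finset.mem_range.1 hx).le.trans (hm _ _)
          · exact hρ i (by omega)
      _ = m A 0 * M ^ e.ex := by simp
      _ ≤ M ^ 2 * M ^ e.ex := Nat.mul_le_mul_right _ (hm _ _)
      _ = _ := by ring
  | find A e ih =>
    intro d ρ hρ hc
    exact (firstBelow_le _ _).trans ((hm _ _).trans (pow_le hM (by simp [ex])))

/-- The compiled program computes the value of the expression within `cost` steps. It does not write
to the arrays, and of the registers it changes only the scratch registers and those of deeper
variables. -/
theorem code_exec {M w : ℕ} (hM : 2 ≤ M) {m : Mem} (hm : ∀ A i, m A i ≤ M ^ 2) (e : Ex) :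
    ∀ (d t : ℕ) (ρ : ℕ → ℕ) (s : State), (∀ i < d, ρ i ≤ M ^ 2) → e.closed d = true → e.ex + 2 < w →
      s.arr = m → (∀ i < d, s.reg (2 * i + 3) = ρ i) →
      ∃ τ s', Exec (M ^ w) (e.code d t) s τ s' ∧ τ ≤ e.cost m ∧ Keep d t s s' ∧ s'.arr = m ∧
        s'.reg (2 * t + 2) = e.eval m d ρ := by
  induction e with
  | num c =>
    intro d t ρ s hρ hc hw hs hv
    exact ⟨1, _, .const _ _ _ ((num_le hM c).trans_lt (pow_lt hM (by simp only [ex] at hw; omega))),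
      by simp [cost], Keep.setTmp _ _ le_rfl, by simpa, by simp [eval]⟩
  | var i =>
    intro d t ρ s hρ hc hw hs hv
    have hi : i < d := by simpa [closed] using hc
    have h0 : 0 < M ^ w := one_le_pow' hM w
    have hlt : ρ i < M ^ w := (hρ i hi).trans_lt (pow_lt hM (by simp only [ex] at hw; omega))
    refine ⟨_, _, .seq (.const _ _ _ h0) (.arith _ _ _ _ _ ?_), by simp [cost],
      (Keep.setTmp _ _ le_rfl).trans (Keep.setTmp _ _ le_rfl), by simpa, ?_⟩
    · have : ¬ (2 * i + 3 = 2 * t + 2) := by omega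
      simpa [Op.eval, this, hv i hi] using hlt
    · have : ¬ (2 * i + 3 = 2 * t + 2) := by omega
      simp [Op.eval, eval, this, hv i hi]
  | get A e ih =>
    intro d t ρ s hρ hc hw hs hv
    obtain ⟨τ, s', he, hτ, hk, ha, hr⟩ := ih d t ρ s hρ hc (by simp only [ex] at hw; omega) hs hv
    exact ⟨_, _, .seq he (.load _ _ _ _), by simp only [cost]; omega,
      hk.trans (Keep.setTmp _ _ le_rfl), by simpa, by simp [eval, hr, ha]⟩
  | bin o a b iha ihb =>
    intro d t ρ s hρ hc hw hs hv
    have hle := eval_le hM hm (bin o a b) d ρ hρ hc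
    have hc' := hc
    simp only [closed, Bool.and_eq_true] at hc'
    simp only [ex] at hw
    obtain ⟨τ, s', he, hτ, hk, ha, hr⟩ := iha d t ρ s hρ hc'.1 (by omega) hs hv
    obtain ⟨τ', s'', he', hτ', hk', ha', hr'⟩ := ihb d (t + 1) ρ s' hρ hc'.2 (by omega) ha
      (fun i hi => (hk.var i hi).trans (hv i hi))
    have e1 : s''.reg (2 * t + 2) = a.eval m d ρ := (hk'.tmp t (by omega)).trans hr
    refine ⟨_, _, .seq he (.seq he' (.arith _ _ _ _ _ ?_)), ?_,
      hk.trans ((hk'.mono le_rfl (by omega)).trans (Keep.setTmp _ _ le_rfl)), by simpa, ?_⟩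
    · rw [e1, hr']
      exact hle.trans_lt (pow_lt hM (by simp only [ex]; omega))
    · simp only [cost]; omega
    · rw [e1, hr']; simp [eval]
  | ite c a b ihc iha ihb =>
    intro d t ρ s hρ hc hw hs hv
    simp only [closed, Bool.and_eq_true] at hc
    simp only [ex] at hw
    obtain ⟨τ, s', he, hτ, hk, ha, hr⟩ := ihc d t ρ s hρ hc.1.1 (by omega) hs hv
    have hv' : ∀ i < d, s'.reg (2 * i + 3) = ρ i := fun i hi => (hk.var i hi).trans (hv i hi)
    by_cases h : c.eval m d ρ = 0
    · obtain ⟨τ', s'', he', hτ', hk', ha', hr'⟩ := ihb d t ρ s' hρ hc.2 (by omega) ha hv'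
      exact ⟨_, _, .seq he (.ite_false (by rw [hr, h]) he'), by simp only [cost]; omega,
        hk.trans hk', ha', by simp [eval, hr', h]⟩
    · obtain ⟨τ', s'', he', hτ', hk', ha', hr'⟩ := iha d t ρ s' hρ hc.1.2 (by omega) ha hv'
      exact ⟨_, _, .seq he (.ite_true (by rwa [hr]) he'), by simp only [cost]; omega,
        hk.trans hk', ha', by simp [eval, hr', h]⟩
  | sum A e ih =>
    intro d t ρ s hρ hc hw hs hv
    simp only [ex] at hw
    have h0 : 0 < M ^ w := one_le_pow' hM w
    have h1 : 1 < M ^ w := lt_of_lt_of_le (by omega) (Nat.le_self_pow (by omega) M)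
    have hN : M ^ 2 < M ^ w := pow_lt hM (by omega)
    set s1 := ((s.setReg (2 * t + 2) 0).setReg (2 * d + 3)
      ((s.setReg (2 * t + 2) 0).arr A ((s.setReg (2 * t + 2) 0).reg (2 * t + 2)))).setReg
        (2 * (t + 1) + 2) 1 with hs1
    set f : ℕ → ℕ := fun x => e.eval m (d + 1) (Function.update ρ d x) with hf
    have hρ' : ∀ x < m A 0, ∀ i < d + 1, Function.update ρ d x i ≤ M ^ 2 := by
      intro x hx i hi
      rw [Function.update_apply]
      split_ifs with h
      · exact hx.le.trans (hm _ _)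
      · exact hρ i (by omega)
    obtain ⟨τ, s', he, hτ, hI, hz⟩ := exec_countdown (W := M ^ w) (r := 2 * d + 3)
      (p := .seq (.arith .sub (2 * d + 3) (2 * d + 3) (2 * (t + 1) + 2)) <|
        .seq (e.code (d + 1) (t + 2)) (.arith .add (2 * t + 2) (2 * t + 2) (2 * (t + 2) + 2)))
      (I := fun x s' => Keep d t s s' ∧ s'.arr = m ∧ s'.reg (2 * (t + 1) + 2) = 1 ∧
        s'.reg (2 * t + 2) = ∑ y ∈ Finset.Ico x (m A 0), f y) (C := e.cost m + 2) (m A 0) s1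
      (by
        have h1 : ¬ (2 * d + 3 = 2 * (t + 1) + 2) := by omega
        have h2 : ¬ (2 * d + 3 = 2 * t + 2) := by omega
        simp [hs1, h1, hs])
      ⟨((Keep.setTmp s 0 le_rfl).trans (Keep.setVar _ _ le_rfl)).trans
          (Keep.setTmp (r := t + 1) _ _ (by omega)), by simp [hs1, hs], by simp [hs1], by
          have h2 : ¬ (2 * t + 2 = 2 * d + 3) := by omega
          simp [hs1]⟩ (by
        rintro x u ⟨hk, ha, ho, hacc⟩ hu hx
        have e1 : ¬ (2 * (t + 1) + 2 = 2 * d + 3) := by omega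
        have e2 : ¬ (2 * t + 2 = 2 * d + 3) := by omega
        have e3 : ¬ (2 * t + 2 = 2 * (t + 1) + 2) := by omega
        have e4 : ¬ (2 * d + 3 = 2 * t + 2) := by omega
        have e5 : ¬ (2 * (t + 1) + 2 = 2 * t + 2) := by omega
        set u1 := u.setReg (2 * d + 3) x with hu1
        have st1 : Exec (M ^ w) (.arith .sub (2 * d + 3) (2 * d + 3) (2 * (t + 1) + 2)) u 1 u1 := by
          have := Exec.arith (W := M ^ w) u .sub (2 * d + 3) (2 * d + 3) (2 * (t + 1) + 2)
            (by simp only [Op.eval]; rw [hu, ho]; have := hm A 0; omega)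
          simpa [Op.eval, hu, ho] using this
        obtain ⟨τ', u2, he', hτ', hk', ha', hr'⟩ := ih (d + 1) (t + 2) (Function.update ρ d x) u1
          (hρ' x hx) hc (by omega) (by simp [hu1, ha]) (by
            intro i hi
            by_cases h : i = d
            · subst h; simp [hu1]
            · have : ¬ (2 * i + 3 = 2 * d + 3) := by omega
              simp [hu1, h, hk.var i (by omega), hv i (by omega)])
        have r1 : u2.reg (2 * t + 2) = ∑ y ∈ Finset.Ico (x + 1) (m A 0), f y := by
          rw [hk'.tmp t (by omega)]; simp [hu1, hacc]
        have r2 : u2.reg (2 * (t + 2) + 2) = f x := hr'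
        have hsum : u2.reg (2 * t + 2) + u2.reg (2 * (t + 2) + 2)
            = ∑ y ∈ Finset.Ico x (m A 0), f y := by
          rw [r1, r2, Finset.sum_eq_sum_Ico_succ_bot hx, add_comm]
        have hbound : ∑ y ∈ Finset.Ico x (m A 0), f y ≤ M ^ (e.ex + 2) := by
          refine le_trans ?_ (eval_le hM hm (sum A e) d ρ hρ hc)
          simp only [eval]
          exact Finset.sum_le_sum_of_subset (fun y hy => by
            rw [Finset.mem_Ico] at hy; exact Finset.mem_range.2 hy.2)
        refine ⟨_, _, .seq st1 (.seq he' (.arith _ _ _ _ _ ?_)), by omega,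
          ⟨?_, by simpa, ?_, ?_⟩, ?_⟩
        · simp only [Op.eval]; rw [hsum]; exact hbound.trans_lt (pow_lt hM (by omega))
        · exact ((hk.trans (Keep.setVar u x le_rfl)).trans (hk'.mono (by omega) (by omega))).trans
            (Keep.setTmp _ _ le_rfl)
        · simp only [State.setReg_reg, e5, if_false]
          rw [hk'.tmp (t + 1) (by omega)]; simp [hu1, ho]
        · simp only [State.setReg_reg, if_true, Op.eval]; exact hsum
        · simp only [State.setReg_reg, e4, if_false]
          rw [hk'.var d (by omega)]; simp [hu1])
    refine ⟨_, s', .seq (.const _ _ _ h0) (.seq (.load _ _ _ _) (.seq (.const _ _ _ h1) he)), ?_,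
      hI.1, hI.2.1, ?_⟩
    · simp only [cost]; have : e.cost m + 2 + 1 = e.cost m + 3 := rfl
      rw [this] at hτ; omega
    · rw [hI.2.2.2, eval, Finset.range_eq_Ico]
  | find A e ih =>
    intro d t ρ s hρ hc hw hs hv
    simp only [ex] at hw
    have h0 : 0 < M ^ w := one_le_pow' hM w
    have h1 : 1 < M ^ w := lt_of_lt_of_le (by omega) (Nat.le_self_pow (by omega) M)
    have hN : M ^ 2 < M ^ w := pow_lt hM (by omega)
    set f : ℕ → ℕ := fun x => e.eval m (d + 1) (Function.update ρ d x) with hf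
    have hρ' : ∀ x < m A 0, ∀ i < d + 1, Function.update ρ d x i ≤ M ^ 2 := by
      intro x hx i hi
      rw [Function.update_apply]
      split_ifs with h
      · exact hx.le.trans (hm _ _)
      · exact hρ i (by omega)
    set sa := (s.setReg (2 * t + 2) 0).setReg (2 * d + 3)
      ((s.setReg (2 * t + 2) 0).arr A ((s.setReg (2 * t + 2) 0).reg (2 * t + 2))) with hsa
    set s1 := (sa.setReg (2 * t + 2) (sa.arr A (sa.reg (2 * t + 2)))).setReg
        (2 * (t + 1) + 2) 1 with hs1
    obtain ⟨τ, s', he, hτ, hI, hz⟩ := exec_countdown (W := M ^ w) (r := 2 * d + 3)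
      (p := .seq (.arith .sub (2 * d + 3) (2 * d + 3) (2 * (t + 1) + 2)) <|
        .seq (e.code (d + 1) (t + 2)) <|
        .ite (2 * (t + 2) + 2) (.seq (.const (2 * (t + 2) + 2) 0)
          (.arith .add (2 * t + 2) (2 * d + 3) (2 * (t + 2) + 2))) .skip)
      (I := fun x s' => Keep d t s s' ∧ s'.arr = m ∧ s'.reg (2 * (t + 1) + 2) = 1 ∧
        ∃ r, s'.reg (2 * t + 2) = r ∧ r ≤ m A 0 ∧ (∀ y, x ≤ y → y < r → f y = 0) ∧
          (r < m A 0 → f r ≠ 0)) (C := e.cost m + 4) (m A 0) s1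
      (by
        have h1 : ¬ (2 * d + 3 = 2 * (t + 1) + 2) := by omega
        have h2 : ¬ (2 * d + 3 = 2 * t + 2) := by omega
        simp [hs1, hsa, h1, h2, hs])
      ⟨(((Keep.setTmp s 0 le_rfl).trans (Keep.setVar _ _ le_rfl)).trans
          (Keep.setTmp _ _ le_rfl)).trans
          (Keep.setTmp (r := t + 1) _ _ (by omega)), by simp [hs1, hsa, hs], by simp [hs1], by
          have h2 : ¬ (2 * t + 2 = 2 * d + 3) := by omega
          refine ⟨m A 0, by simp [hs1, hsa, hs], le_rfl, fun y h3 h4 => by omega,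
            fun h => by omega⟩⟩ (by
        rintro x u ⟨hk, ha, ho, r, hacc, hr1, hr2, hr3⟩ hu hx
        have e1 : ¬ (2 * (t + 1) + 2 = 2 * d + 3) := by omega
        have e2 : ¬ (2 * t + 2 = 2 * d + 3) := by omega
        have e4 : ¬ (2 * d + 3 = 2 * t + 2) := by omega
        have e5 : ¬ (2 * (t + 1) + 2 = 2 * t + 2) := by omega
        have e6 : ¬ (2 * d + 3 = 2 * (t + 2) + 2) := by omega
        have e7 : ¬ (2 * (t + 1) + 2 = 2 * (t + 2) + 2) := by omega
        set u1 := u.setReg (2 * d + 3) x with hu1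
        have st1 : Exec (M ^ w) (.arith .sub (2 * d + 3) (2 * d + 3) (2 * (t + 1) + 2)) u 1 u1 := by
          have := Exec.arith (W := M ^ w) u .sub (2 * d + 3) (2 * d + 3) (2 * (t + 1) + 2)
            (by simp only [Op.eval]; rw [hu, ho]; have := hm A 0; omega)
          simpa [Op.eval, hu, ho] using this
        obtain ⟨τ', u2, he', hτ', hk', ha', hr'⟩ := ih (d + 1) (t + 2) (Function.update ρ d x) u1
          (hρ' x hx) hc (by omega) (by simp [hu1, ha]) (by
            intro i hi
            by_cases h : i = d
            · subst h; simp [hu1]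
            · have : ¬ (2 * i + 3 = 2 * d + 3) := by omega
              simp [hu1, h, hk.var i (by omega), hv i (by omega)])
        have r1 : u2.reg (2 * t + 2) = r := by
          rw [hk'.tmp t (by omega)]; simp [hu1, hacc]
        have r2 : u2.reg (2 * (t + 2) + 2) = f x := hr'
        have r3 : u2.reg (2 * d + 3) = x := by
          rw [hk'.var d (by omega)]; simp [hu1]
        have r4 : u2.reg (2 * (t + 1) + 2) = 1 := by
          rw [hk'.tmp (t + 1) (by omega)]; simp [hu1, ho]
        have hk2 : Keep d t s u2 :=
          (hk.trans (Keep.setVar u x le_rfl)).trans (hk'.mono (by omega) (by omega))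
        by_cases hfx : f x = 0
        · refine ⟨_, _, .seq st1 (.seq he' (.ite_false (by rw [r2, hfx]) (.skip _))), by omega,
            ⟨hk2, ha', r4, r, r1, hr1, fun y hy1 hy2 => ?_, hr3⟩, r3⟩
          rcases eq_or_lt_of_le hy1 with h | h
          · rwa [← h]
          · exact hr2 y h hy2
        · refine ⟨_, _, .seq st1 (.seq he' (.ite_true (by rwa [r2]) (.seq (.const _ _ _ h0)
            (.arith _ _ _ _ _ ?_)))), by omega, ⟨?_, by simpa, ?_, x, ?_, hx.le,
              fun y h3 h4 => by omega, fun _ => hfx⟩, ?_⟩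
          · have := hm A 0
            simp [Op.eval, e6, r3]; omega
          · exact (hk2.trans (Keep.setTmp (r := t + 2) _ _ (by omega))).trans
              (Keep.setTmp _ _ le_rfl)
          · simp [r4]
          · simp [Op.eval, e6, r3]
          · simp [e4, e6, r3])
    refine ⟨_, s', .seq (.const _ _ _ h0) (.seq (.load _ _ _ _) (.seq (.load _ _ _ _)
      (.seq (.const _ _ _ h1) he))), ?_, hI.1, hI.2.1, ?_⟩
    · simp only [cost]; have : e.cost m + 4 + 1 = e.cost m + 5 := rfl
      rw [this] at hτ; omega
    · obtain ⟨r, e1, h1, h2, h3⟩ := hI.2.2.2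
      rw [e1]
      exact firstBelow_unique h1 (fun y hy => h2 y (by omega) hy) h3

end Ex

/-! ### Statements and their Hoare triples -/

/-- The arrays that a program may write to. -/
def Prog.stores : Prog → List ℕ
  | .skip => []
  | .const _ _ => []
  | .arith _ _ _ _ => []
  | .load _ _ _ => []
  | .store A _ _ => [A]
  | .seq p q => p.stores ++ q.stores
  | .ite _ p q => p.stores ++ q.stores
  | .loop _ p => p.stores

theorem Exec.arr_eq {W : ℕ} {P : Prog} {s s' : State} {τ : ℕ} (h : Exec W P s τ s') :
    ∀ A, A ∉ P.stores → s'.arr A = s.arr A := by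
  induction h with
  | skip s => intros; rfl
  | const s r v h => intros; rfl
  | arith s o r a b h => intros; rfl
  | load s r A i => intros; rfl
  | store s A i r =>
    intro B hB
    simp only [Prog.stores, List.mem_singleton] at hB
    simp [State.setArr, Function.update_of_ne hB]
  | seq h1 h2 ih1 ih2 =>
    intro B hB
    simp only [Prog.stores, List.mem_append, not_or] at hB
    rw [ih2 B hB.2, ih1 B hB.1]
  | ite_true h0 h1 ih =>
    intro B hB
    simp only [Prog.stores, List.mem_append, not_or] at hB
    rw [ih B hB.1]
  | ite_false h0 h1 ih =>
    intro B hB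
    simp only [Prog.stores, List.mem_append, not_or] at hB
    rw [ih B hB.2]
  | loop_done h => intros; rfl
  | loop_step h0 h1 h2 ih1 ih2 =>
    intro B hB
    rw [ih2 B hB, ih1 B (by simpa [Prog.stores] using hB)]

@[simp] theorem Ex.code_stores (e : Ex) (d t : ℕ) : (e.code d t).stores = [] := by
  induction e generalizing d t <;> simp_all [Ex.code, Prog.stores]

/-- A statement: a program that depends on the numbers of variables and of scratch registers in
use by its context. -/
abbrev Pg : Type := ℕ → ℕ → Prog

/-- Sequential composition. -/
def seqS (p q : Pg) : Pg := fun d t => .seq (p d t) (q d t)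

/-- Do nothing. -/
def skipS : Pg := fun _ _ => .skip

/-- Cell `i` of the array `A` becomes `e`, cut down to the number in register `1`. -/
def storeS (A : ℕ) (i e : Ex) : Pg := fun d t =>
  .seq (i.code d t) <| .seq (e.code d (t + 1)) <|
  .seq (.arith .sub (2 * (t + 2) + 2) (2 * (t + 1) + 2) 1) <|
  .seq (.arith .sub (2 * (t + 1) + 2) (2 * (t + 1) + 2) (2 * (t + 2) + 2)) <|
  .store A (2 * t + 2) (2 * (t + 1) + 2)

/-- Branching on an expression. -/
def iteS (c : Ex) (p q : Pg) : Pg := fun d t =>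
  .seq (c.code d t) (.ite (2 * t + 2) (p d t) (q d t))

/-- The next variable runs upwards over all numbers below cell `0` of the array `A`. -/
def forS (A : ℕ) (p : Pg) : Pg := fun d t =>
  .seq (.const (2 * t + 2) 0) <| .seq (.load (2 * t + 2) A (2 * t + 2)) <|
  .seq (.const (2 * d + 3) 0) <| .seq (.const (2 * (t + 1) + 2) 1) <|
  .loop (2 * t + 2) <| .seq (p (d + 1) (t + 2)) <|
    .seq (.arith .add (2 * d + 3) (2 * d + 3) (2 * (t + 1) + 2))
      (.arith .sub (2 * t + 2) (2 * t + 2) (2 * (t + 1) + 2))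

/-- Repetition as long as cell `0` of the array `A` is nonzero. -/
def whileS (A : ℕ) (p : Pg) : Pg := fun d t =>
  .seq (.const (2 * t + 2) 0) <| .seq (.load (2 * t + 2) A (2 * t + 2)) <|
  .loop (2 * t + 2) <| .seq (p d (t + 1)) <|
    .seq (.const (2 * t + 2) 0) (.load (2 * t + 2) A (2 * t + 2))

@[simp] theorem seqS_stores (p q : Pg) (d t : ℕ) :
    (seqS p q d t).stores = (p d t).stores ++ (q d t).stores := rfl

@[simp] theorem skipS_stores (d t : ℕ) : (skipS d t).stores = [] := rfl

@[simp] theorem storeS_stores (A : ℕ) (i e : Ex) (d t : ℕ) : (storeS A i e d t).stores = [A] := by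
  simp [storeS, Prog.stores]

@[simp] theorem iteS_stores (c : Ex) (p q : Pg) (d t : ℕ) :
    (iteS c p q d t).stores = (p d t).stores ++ (q d t).stores := by
  simp [iteS, Prog.stores]

@[simp] theorem forS_stores (A : ℕ) (p : Pg) (d t : ℕ) :
    (forS A p d t).stores = (p (d + 1) (t + 2)).stores := by
  simp [forS, Prog.stores]

@[simp] theorem whileS_stores (A : ℕ) (p : Pg) (d t : ℕ) :
    (whileS A p d t).stores = (p d (t + 1)).stores := by
  simp [whileS, Prog.stores]

/-- Hoare triple with running time: started with the variables `ρ` and the memory `m`, the program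
`P` halts within `T` steps in a memory that satisfies `Q`. All cells and variables hold numbers up
to `M ^ 2`, the content of register `1`, and words are bounded by `M ^ w`. -/
def Tri (M w d t : ℕ) (ρ : ℕ → ℕ) (m : Mem) (P : Prog) (T : ℕ) (Q : Mem → Prop) : Prop :=
  2 ≤ M → 1003 ≤ w → (∀ A i, m A i ≤ M ^ 2) → (∀ i < d, ρ i ≤ M ^ 2) →
  ∀ s : State, s.arr = m → s.reg 1 = M ^ 2 → (∀ i < d, s.reg (2 * i + 3) = ρ i) →
  ∃ τ s', Exec (M ^ w) P s τ s' ∧ τ ≤ T ∧ Keep d t s s' ∧ (∀ A i, s'.arr A i ≤ M ^ 2) ∧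
    (∀ A, A ∉ P.stores → s'.arr A = m A) ∧ Q s'.arr

/-- A well-formed expression below `d` binders. -/
def Ex.wf (e : Ex) (d : ℕ) : Bool := e.closed d && decide (e.ex ≤ 1000)

section Rules

variable {M w d t : ℕ} {ρ : ℕ → ℕ} {m : Mem}

theorem Tri.mono {P : Prog} {T T' : ℕ} {Q Q' : Mem → Prop} (h : Tri M w d t ρ m P T Q)
    (hT : T ≤ T')
    (hQ : ∀ m', (∀ A, A ∉ P.stores → m' A = m A) → (∀ A i, m' A i ≤ M ^ 2) → Q m' → Q' m') :
    Tri M w d t ρ m P T' Q' := by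
  intro h1 h2 h3 h4 s h5 h6 h7
  obtain ⟨τ, s', a, b, c, e, f, g⟩ := h h1 h2 h3 h4 s h5 h6 h7
  exact ⟨τ, s', a, b.trans hT, c, e, f, hQ _ f e g⟩

/-- In proofs of triples, the bounds for the cells and the variables may be assumed. -/
theorem Tri.bounded {P : Prog} {T : ℕ} {Q : Mem → Prop}
    (h : 2 ≤ M → (∀ A i, m A i ≤ M ^ 2) → (∀ i < d, ρ i ≤ M ^ 2) → Tri M w d t ρ m P T Q) :
    Tri M w d t ρ m P T Q :=
  fun h1 h2 h3 h4 => h h1 h3 h4 h1 h2 h3 h4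

theorem Tri.skip {Q : Mem → Prop} (hQ : Q m) : Tri M w d t ρ m (skipS d t) 1 Q := by
  intro h1 h2 h3 h4 s h5 h6 h7
  exact ⟨1, s, .skip s, le_rfl, Keep.refl _ _ _, by rw [h5]; exact h3, fun A _ => by rw [h5],
    by rwa [h5]⟩

theorem Tri.seq {p q : Pg} {T₁ T₂ T : ℕ} {Q₁ Q : Mem → Prop}
    (hp : Tri M w d t ρ m (p d t) T₁ Q₁) (hT : T₁ + T₂ ≤ T)
    (hq : ∀ m', (∀ A, A ∉ (p d t).stores → m' A = m A) → (∀ A i, m' A i ≤ M ^ 2) → Q₁ m' →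
      Tri M w d t ρ m' (q d t) T₂ Q) :
    Tri M w d t ρ m (seqS p q d t) T Q := by
  intro h1 h2 h3 h4 s h5 h6 h7
  obtain ⟨τ, s', a, b, c, e, f, g⟩ := hp h1 h2 h3 h4 s h5 h6 h7
  obtain ⟨τ', s'', a', b', c', e', f', g'⟩ := hq s'.arr f e g h1 h2 e h4 s' rfl
    (c.one.trans h6) (fun i hi => (c.var i hi).trans (h7 i hi))
  have he := Exec.seq a a'
  exact ⟨_, _, he, by omega, c.trans c', e', fun A hA => by rw [he.arr_eq A hA, h5], g'⟩

/-- Memory after a store. -/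
def Mem.set (m : Mem) (A i v : ℕ) : Mem := Function.update m A (Function.update (m A) i v)

theorem Mem.set_self (m : Mem) (A i v j : ℕ) :
    m.set A i v A j = if j = i then v else m A j := by
  simp [Mem.set, Function.update_apply]

theorem Mem.set_ne (m : Mem) {A B : ℕ} (i v : ℕ) (h : B ≠ A) : m.set A i v B = m B := by
  simp [Mem.set, Function.update_of_ne h]

/-- The rule for stores. The smaller one of the value `a` and the bound `b` is computed as `a - (a -
b)`. -/
theorem Tri.store {A : ℕ} {i e : Ex} {Q : Mem → Prop} (hi : i.wf d = true) (he : e.wf d = true)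
    (hQ : Q (m.set A (i.eval m d ρ) (min (e.eval m d ρ) (M ^ 2)))) :
    Tri M w d t ρ m (storeS A i e d t) (i.cost m + e.cost m + 3) Q := by
  intro h1 h2 h3 h4 s h5 h6 h7
  simp only [Ex.wf, Bool.and_eq_true, decide_eq_true_eq] at hi he
  obtain ⟨τ, s', a, b, c, f, g⟩ := Ex.code_exec (w := w) h1 h3 i d t ρ s h4 hi.1 (by omega) h5 h7
  obtain ⟨τ', s'', a', b', c', f', g'⟩ := Ex.code_exec (w := w) h1 h3 e d (t + 1) ρ s' h4 he.1
    (by omega) f (fun i hi => (c.var i hi).trans (h7 i hi))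
  have hle := Ex.eval_le h1 h3 e d ρ h4 he.1
  have hlt : e.eval m d ρ < M ^ w := hle.trans_lt (Ex.pow_lt h1 (by omega))
  have e1 : s''.reg 1 = M ^ 2 := by rw [c'.one, c.one, h6]
  have e2 : s''.reg (2 * t + 2) = i.eval m d ρ := by rw [c'.tmp t (by omega), g]
  have n1 : ¬ (2 * t = 2 * (t + 2)) := by omega
  have n2 : ¬ (2 * t = 2 * (t + 1)) := by omega
  have n3 : ¬ (2 * (t + 1) = 2 * (t + 2)) := by omega
  set u1 := s''.setReg (2 * (t + 2) + 2) (e.eval m d ρ - M ^ 2) with hu1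
  set u2 := u1.setReg (2 * (t + 1) + 2) (min (e.eval m d ρ) (M ^ 2)) with hu2
  have x1 : Exec (M ^ w) (.arith .sub (2 * (t + 2) + 2) (2 * (t + 1) + 2) 1) s'' 1 u1 := by
    have := Exec.arith (W := M ^ w) s'' .sub (2 * (t + 2) + 2) (2 * (t + 1) + 2) 1
      (by simp only [Op.eval]; rw [g']; omega)
    simpa [Op.eval, g', e1] using this
  have x2 : Exec (M ^ w) (.arith .sub (2 * (t + 1) + 2) (2 * (t + 1) + 2) (2 * (t + 2) + 2)) u1 1
      u2 := by
    have q1 : u1.reg (2 * (t + 1) + 2) = e.eval m d ρ := by simp [hu1, n3, g']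
    have q2 : u1.reg (2 * (t + 2) + 2) = e.eval m d ρ - M ^ 2 := by simp [hu1]
    have := Exec.arith (W := M ^ w) u1 .sub (2 * (t + 1) + 2) (2 * (t + 1) + 2) (2 * (t + 2) + 2)
      (by simp only [Op.eval]; rw [q1, q2]; omega)
    simp only [Op.eval, q1, q2] at this
    rwa [show e.eval m d ρ - (e.eval m d ρ - M ^ 2) = min (e.eval m d ρ) (M ^ 2) by omega] at this
  have x3 := Exec.store (W := M ^ w) u2 A (2 * t + 2) (2 * (t + 1) + 2)
  have harr : (u2.setArr A (u2.reg (2 * t + 2)) (u2.reg (2 * (t + 1) + 2))).arr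
      = m.set A (i.eval m d ρ) (min (e.eval m d ρ) (M ^ 2)) := by
    simp [State.setArr, Mem.set, hu2, hu1, n1, n2, e2, f']
  have ht := Exec.seq a (.seq a' (.seq x1 (.seq x2 x3)))
  refine ⟨_, _, ht, by omega, ?_, ?_, fun B hB => ?_, ?_⟩
  · have k1 : Keep d t s u2 := (((c.trans (c'.mono le_rfl (by omega))).trans
      (Keep.setTmp (r := t + 2) _ _ (by omega))).trans (Keep.setTmp (r := t + 1) _ _ (by omega)))
    exact ⟨k1.var, k1.tmp, k1.one⟩
  · intro B j
    rw [harr]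
    by_cases hB : B = A
    · subst hB
      rw [Mem.set_self]
      split_ifs
      · exact min_le_right _ _
      · exact h3 _ _
    · rw [Mem.set_ne _ _ _ hB]; exact h3 _ _
  · rw [ht.arr_eq B hB, h5]
  · rwa [harr]

theorem Tri.ite {c : Ex} {p q : Pg} {T : ℕ} {Q : Mem → Prop} (hc : c.wf d = true)
    (hp : c.eval m d ρ ≠ 0 → Tri M w d t ρ m (p d t) T Q)
    (hq : c.eval m d ρ = 0 → Tri M w d t ρ m (q d t) T Q) :
    Tri M w d t ρ m (iteS c p q d t) (c.cost m + T + 1) Q := by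
  intro h1 h2 h3 h4 s h5 h6 h7
  simp only [Ex.wf, Bool.and_eq_true, decide_eq_true_eq] at hc
  obtain ⟨τ, s', a, b, k, f, g⟩ := Ex.code_exec (w := w) h1 h3 c d t ρ s h4 hc.1 (by omega) h5 h7
  by_cases h : c.eval m d ρ = 0
  · obtain ⟨τ', s'', a', b', c', e', f', g'⟩ := hq h h1 h2 h3 h4 s' f (k.one.trans h6)
      (fun i hi => (k.var i hi).trans (h7 i hi))
    have ht := Exec.seq a (Exec.ite_false (p := p d t) (by rw [g, h]) a')
    exact ⟨_, _, ht, by omega, k.trans c', e', fun A hA => by rw [ht.arr_eq A hA, h5], g'⟩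
  · obtain ⟨τ', s'', a', b', c', e', f', g'⟩ := hp h h1 h2 h3 h4 s' f (k.one.trans h6)
      (fun i hi => (k.var i hi).trans (h7 i hi))
    have ht := Exec.seq a (Exec.ite_true (q := q d t) (by rwa [g]) a')
    exact ⟨_, _, ht, by omega, k.trans c', e', fun A hA => by rw [ht.arr_eq A hA, h5], g'⟩

/-- The rule for `forS`: the invariant `I x` holds when `x` iterations are done, and the iteration
with the number `x` takes at most `T x` steps. -/
theorem Tri.for {A : ℕ} {p : Pg} {T : ℕ → ℕ} {Q : Mem → Prop} (I : ℕ → Mem → Prop)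
    (h0 : I 0 m)
    (hstep : ∀ x < m A 0, ∀ m', (∀ B, B ∉ (p (d + 1) (t + 2)).stores → m' B = m B) →
      (∀ A i, m' A i ≤ M ^ 2) → I x m' →
      Tri M w (d + 1) (t + 2) (Function.update ρ d x) m' (p (d + 1) (t + 2)) (T x) (I (x + 1)))
    (hQ : ∀ m', (∀ B, B ∉ (p (d + 1) (t + 2)).stores → m' B = m B) → (∀ A i, m' A i ≤ M ^ 2) →
      I (m A 0) m' → Q m') :
    Tri M w d t ρ m (forS A p d t) (∑ x ∈ Finset.range (m A 0), (T x + 3) + 5) Q := by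
  intro h1 h2 h3 h4 s h5 h6 h7
  have hW : M ^ 2 < M ^ w := Ex.pow_lt h1 (by omega)
  have hpos : 0 < M ^ w := Ex.one_le_pow' h1 w
  have h1W : 1 < M ^ w := lt_of_lt_of_le (by omega) (Nat.le_self_pow (by omega) M)
  have hb := h3 A 0
  -- the loop, started with `x` iterations done
  have main : ∀ k x : ℕ, x + k = m A 0 → ∀ u : State, Keep d t s u → u.reg (2 * t + 2) = k →
      u.reg (2 * d + 3) = x → u.reg (2 * (t + 1) + 2) = 1 → (∀ A i, u.arr A i ≤ M ^ 2) →
      (∀ B, B ∉ (p (d + 1) (t + 2)).stores → u.arr B = m B) → I x u.arr →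
      ∃ τ s', Exec (M ^ w) (.loop (2 * t + 2) <| .seq (p (d + 1) (t + 2)) <|
        .seq (.arith .add (2 * d + 3) (2 * d + 3) (2 * (t + 1) + 2))
          (.arith .sub (2 * t + 2) (2 * t + 2) (2 * (t + 1) + 2))) u τ s' ∧
        τ ≤ ∑ x ∈ Finset.Ico x (m A 0), (T x + 3) + 1 ∧ Keep d t s s' ∧
        (∀ A i, s'.arr A i ≤ M ^ 2) ∧ I (m A 0) s'.arr := by
    intro k
    induction k with
    | zero =>
      intro x hx u hk hu1 hu2 hu3 hu4 hu5 hI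
      have : x = m A 0 := by omega
      subst this
      exact ⟨1, u, .loop_done hu1, by omega, hk, hu4, hI⟩
    | succ k ih =>
      intro x hx u hk hu1 hu2 hu3 hu4 hu5 hI
      have hxb : x < m A 0 := by omega
      obtain ⟨τ, u', a, b, c, e, f, g⟩ := hstep x hxb u.arr hu5 hu4 hI h1 h2 hu4
        (by
          intro i hi
          rw [Function.update_apply]
          split_ifs
          · omega
          · exact h4 i (by omega)) u rfl (hk.one.trans h6)
        (by
          intro i hi
          rw [Function.update_apply]
          split_ifs with h
          · rw [h, hu2]
          · rw [hk.var i (by omega), h7 i (by omega)])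
      have q1 : u'.reg (2 * d + 3) = x := (c.var d (by omega)).trans hu2
      have q2 : u'.reg (2 * t + 2) = k + 1 := (c.tmp t (by omega)).trans hu1
      have q3 : u'.reg (2 * (t + 1) + 2) = 1 := (c.tmp (t + 1) (by omega)).trans hu3
      have x1 : Exec (M ^ w) (.arith .add (2 * d + 3) (2 * d + 3) (2 * (t + 1) + 2)) u' 1
          (u'.setReg (2 * d + 3) (x + 1)) := by
        have := Exec.arith (W := M ^ w) u' .add (2 * d + 3) (2 * d + 3) (2 * (t + 1) + 2)
          (by simp only [Op.eval]; rw [q1, q3]; omega)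
        simpa only [Op.eval, q1, q3] using this
      have x2 : Exec (M ^ w) (.arith .sub (2 * t + 2) (2 * t + 2) (2 * (t + 1) + 2))
          (u'.setReg (2 * d + 3) (x + 1)) 1
          ((u'.setReg (2 * d + 3) (x + 1)).setReg (2 * t + 2) k) := by
        have r1 : (u'.setReg (2 * d + 3) (x + 1)).reg (2 * t + 2) = k + 1 := by simp [q2]
        have r2 : (u'.setReg (2 * d + 3) (x + 1)).reg (2 * (t + 1) + 2) = 1 := by simp [q3]
        have := Exec.arith (W := M ^ w) (u'.setReg (2 * d + 3) (x + 1)) .sub (2 * t + 2)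
          (2 * t + 2) (2 * (t + 1) + 2) (by simp only [Op.eval]; rw [r1, r2]; omega)
        simpa only [Op.eval, r1, r2, Nat.add_sub_cancel] using this
      have n1 : ¬ (2 * (t + 1) = 2 * t) := by omega
      obtain ⟨τ', s', a', b', c', e', g'⟩ := ih (x + 1) (by omega)
        ((u'.setReg (2 * d + 3) (x + 1)).setReg (2 * t + 2) k)
        (((hk.trans (c.mono (by omega) (by omega))).trans (Keep.setVar _ _ le_rfl)).trans
          (Keep.setTmp _ _ le_rfl)) (by simp) (by simp) (by simp [n1, q3]) e
        (fun B hB => (f B hB).trans (hu5 B hB)) g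
      refine ⟨_, s', .loop_step (by omega) (.seq a (.seq x1 x2)) a', ?_, c', e', g'⟩
      rw [Finset.sum_eq_sum_Ico_succ_bot hxb]
      omega
  have n1 : ¬ (2 * t = 2 * (t + 1)) := by omega
  obtain ⟨τ, s', a, b, c, e, g⟩ := main (m A 0) 0 (by omega)
    ((((s.setReg (2 * t + 2) 0).setReg (2 * t + 2) (m A 0)).setReg (2 * d + 3) 0).setReg
      (2 * (t + 1) + 2) 1)
    ((((Keep.setTmp _ _ le_rfl).trans (Keep.setTmp _ _ le_rfl)).trans
        (Keep.setVar _ _ le_rfl)).trans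
      (Keep.setTmp (r := t + 1) _ _ (by omega))) (by simp [n1]) (by simp) (by simp)
    (by simpa [h5] using h3) (by simp [h5]) (by simpa [h5] using h0)
  have l1 : Exec (M ^ w) (.load (2 * t + 2) A (2 * t + 2)) (s.setReg (2 * t + 2) 0) 1
      ((s.setReg (2 * t + 2) 0).setReg (2 * t + 2) (m A 0)) := by
    have := Exec.load (W := M ^ w) (s.setReg (2 * t + 2) 0) (2 * t + 2) A (2 * t + 2)
    simpa [h5] using this
  have ht := Exec.seq (.const s (2 * t + 2) 0 hpos) (.seq l1 (.seq (.const _ (2 * d + 3) 0 hpos)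
    (.seq (.const _ (2 * (t + 1) + 2) 1 h1W) a)))
  have hst : ∀ B, B ∉ (forS A p d t).stores → s'.arr B = m B := fun B hB => by
    rw [ht.arr_eq B (by simpa [forS] using hB), h5]
  refine ⟨_, s', ht, ?_, c, e, hst, hQ _ (fun B hB => hst B (by simpa using hB)) e g⟩
  rw [Finset.range_eq_Ico]; omega

/-- The rule for loops whose body has a uniform time bound. -/
theorem Tri.for' {A : ℕ} {p : Pg} {T T' : ℕ} {Q : Mem → Prop} (I : ℕ → Mem → Prop)
    (hT : m A 0 * (T + 3) + 5 ≤ T')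
    (h0 : I 0 m)
    (hstep : ∀ x < m A 0, ∀ m', (∀ B, B ∉ (p (d + 1) (t + 2)).stores → m' B = m B) →
      (∀ A i, m' A i ≤ M ^ 2) → I x m' →
      Tri M w (d + 1) (t + 2) (Function.update ρ d x) m' (p (d + 1) (t + 2)) T (I (x + 1)))
    (hQ : ∀ m', (∀ B, B ∉ (p (d + 1) (t + 2)).stores → m' B = m B) → (∀ A i, m' A i ≤ M ^ 2) →
      I (m A 0) m' → Q m') :
    Tri M w d t ρ m (forS A p d t) T' Q :=
  (Tri.for (T := fun _ => T) I h0 hstep hQ).mono (by simpa using hT) (fun _ _ _ h => h)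

/-- The rule for `whileS`, for loops that make exactly `J` rounds: the invariant `I j` holds after
`j` rounds, and it decides whether cell `0` of the array `A` is zero. -/
theorem Tri.while {A : ℕ} {p : Pg} {T T' : ℕ} {Q : Mem → Prop} (J : ℕ) (I : ℕ → Mem → Prop)
    (hT : J * (T + 3) + 3 ≤ T')
    (h0 : I 0 m)
    (hstep : ∀ j < J, ∀ m', (∀ B, B ∉ (p d (t + 1)).stores → m' B = m B) →
      (∀ A i, m' A i ≤ M ^ 2) → I j m' →
      m' A 0 ≠ 0 ∧ Tri M w d (t + 1) ρ m' (p d (t + 1)) T (I (j + 1)))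
    (hQ : ∀ m', (∀ B, B ∉ (p d (t + 1)).stores → m' B = m B) → (∀ A i, m' A i ≤ M ^ 2) →
      I J m' → m' A 0 = 0 ∧ Q m') :
    Tri M w d t ρ m (whileS A p d t) T' Q := by
  intro h1 h2 h3 h4 s h5 h6 h7
  have hpos : 0 < M ^ w := Ex.one_le_pow' h1 w
  have main : ∀ k x : ℕ, x + k = J → ∀ u : State, Keep d t s u →
      u.reg (2 * t + 2) = u.arr A 0 → (∀ A i, u.arr A i ≤ M ^ 2) →
      (∀ B, B ∉ (p d (t + 1)).stores → u.arr B = m B) → I x u.arr →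
      ∃ τ s', Exec (M ^ w) (.loop (2 * t + 2) <| .seq (p d (t + 1)) <|
        .seq (.const (2 * t + 2) 0) (.load (2 * t + 2) A (2 * t + 2))) u τ s' ∧
        τ ≤ k * (T + 3) + 1 ∧ Keep d t s s' ∧
        (∀ A i, s'.arr A i ≤ M ^ 2) ∧ I J s'.arr := by
    intro k
    induction k with
    | zero =>
      intro x hx u hk hu1 hu4 hu5 hI
      have : x = J := by omega
      subst this
      exact ⟨1, u, .loop_done (by rw [hu1]; exact (hQ _ hu5 hu4 hI).1), by omega, hk, hu4, hI⟩
    | succ k ih =>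
      intro x hx u hk hu1 hu4 hu5 hI
      obtain ⟨hne, htri⟩ := hstep x (by omega) u.arr hu5 hu4 hI
      obtain ⟨τ, u', a, b, c, e, f, g⟩ := htri h1 h2 hu4 h4 u rfl (hk.one.trans h6)
        (fun i hi => (hk.var i hi).trans (h7 i hi))
      have l1 : Exec (M ^ w) (.load (2 * t + 2) A (2 * t + 2)) (u'.setReg (2 * t + 2) 0) 1
          ((u'.setReg (2 * t + 2) 0).setReg (2 * t + 2) (u'.arr A 0)) := by
        have := Exec.load (W := M ^ w) (u'.setReg (2 * t + 2) 0) (2 * t + 2) A (2 * t + 2)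
        simpa using this
      obtain ⟨τ', s', a', b', c', e', g'⟩ := ih (x + 1) (by omega)
        ((u'.setReg (2 * t + 2) 0).setReg (2 * t + 2) (u'.arr A 0))
        (((hk.trans (c.mono le_rfl (by omega))).trans (Keep.setTmp _ _ le_rfl)).trans
          (Keep.setTmp _ _ le_rfl)) (by simp) e (fun B hB => (f B hB).trans (hu5 B hB)) g
      refine ⟨_, s', .loop_step (by rwa [hu1]) (.seq a (.seq (.const _ _ _ hpos) l1)) a', ?_, c',
        e', g'⟩
      nlinarith
  obtain ⟨τ, s', a, b, c, e, g⟩ := main J 0 (by omega)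
    ((s.setReg (2 * t + 2) 0).setReg (2 * t + 2) (m A 0))
    ((Keep.setTmp _ _ le_rfl).trans (Keep.setTmp _ _ le_rfl)) (by simp [h5])
    (by simpa [h5] using h3) (by simp [h5]) (by simpa [h5] using h0)
  have l1 : Exec (M ^ w) (.load (2 * t + 2) A (2 * t + 2)) (s.setReg (2 * t + 2) 0) 1
      ((s.setReg (2 * t + 2) 0).setReg (2 * t + 2) (m A 0)) := by
    have := Exec.load (W := M ^ w) (s.setReg (2 * t + 2) 0) (2 * t + 2) A (2 * t + 2)
    simpa [h5] using this
  have ht := Exec.seq (.const s (2 * t + 2) 0 hpos) (.seq l1 a)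
  have hst : ∀ B, B ∉ (whileS A p d t).stores → s'.arr B = m B := fun B hB => by
    rw [ht.arr_eq B (by simpa [whileS] using hB), h5]
  exact ⟨_, s', ht, by omega, c, e, hst, (hQ _ (fun B hB => hst B (by simpa using hB)) e g).2⟩

end Rules

/-! ### Separation by a vertex, blocks and legs -/

section Separation

variable {V : Type*} {G : SimpleGraph V}

/-- The graph `G` with all edges at `c` removed. -/
def del (G : SimpleGraph V) (c : V) : SimpleGraph V where
  Adj a b := G.Adj a b ∧ a ≠ c ∧ b ≠ c
  symm := ⟨fun _ _ h => ⟨h.1.symm, h.2.2, h.2.1⟩⟩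
  loopless := ⟨fun _ h => G.irrefl h.1⟩

/-- The vertices `x` and `y` are connected in `G - c`. (The vertex `c` counts as connected to itself
only.) -/
def Cn (G : SimpleGraph V) (c x y : V) : Prop := (del G c).Reachable x y

theorem Cn.refl (c x : V) : Cn G c x x := SimpleGraph.Reachable.refl x

theorem Cn.symm {c x y : V} (h : Cn G c x y) : Cn G c y x := SimpleGraph.Reachable.symm h

theorem Cn.trans {c x y z : V} (h : Cn G c x y) (h' : Cn G c y z) : Cn G c x z :=
  SimpleGraph.Reachable.trans h h'

theorem Cn.of_adj {c x y : V} (h : G.Adj x y) (hx : x ≠ c) (hy : y ≠ c) : Cn G c x y :=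
  SimpleGraph.Adj.reachable (G := del G c) ⟨h, hx, hy⟩

theorem Cn.induct {c x y : V} (h : Cn G c x y) {P : V → Prop} (h0 : P x)
    (hs : ∀ a b, P a → G.Adj a b → a ≠ c → b ≠ c → P b) : P y := by
  obtain ⟨p⟩ := h
  induction p with
  | nil => exact h0
  | cons h p ih => exact ih (hs _ _ h0 h.1 h.2.1 h.2.2)

theorem Cn.eq_of_left {c y : V} (h : Cn G c c y) : y = c :=
  h.induct (P := fun z => z = c) rfl (fun _ _ ha _ h _ => absurd ha h)

theorem Cn.eq_of_right {c x : V} (h : Cn G c x c) : x = c := h.symm.eq_of_left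

theorem Cn.ne_of_ne {c x y : V} (h : Cn G c x y) (hx : x ≠ c) : y ≠ c := fun hy =>
  hx (by subst hy; exact h.eq_of_right)

theorem Cn.of_walk {c x y : V} (p : G.Walk x y) (hc : c ∉ p.support) : Cn G c x y := by
  induction p with
  | nil => exact Cn.refl _ _
  | cons h p ih =>
    simp only [SimpleGraph.Walk.support_cons, List.mem_cons, not_or] at hc
    exact (Cn.of_adj h (Ne.symm hc.1) (fun h' => hc.2 (h' ▸ p.start_mem_support))).trans (ih hc.2)

theorem Cn.exists_walk {c x y : V} (h : Cn G c x y) (hx : x ≠ c) :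
    ∃ p : G.Walk x y, c ∉ p.support := by
  obtain ⟨p⟩ := h
  induction p with
  | nil => exact ⟨.nil, by simpa using hx.symm⟩
  | cons h p ih =>
    obtain ⟨q, hq⟩ := ih h.2.2
    exact ⟨.cons h.1 q, by simpa using ⟨hx.symm, hq⟩⟩

theorem dist_of_not_cn (hG : G.Connected) {c x w : V} (h : ¬ Cn G c x w) :
    G.dist x w = G.dist x c + G.dist c w := by
  classical
  obtain ⟨p, hp⟩ := hG.exists_walk_length_eq_dist x w
  have hc : c ∈ p.support := by
    by_contra hc
    exact h (Cn.of_walk p hc)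
  refine le_antisymm hG.dist_triangle ?_
  rw [← hp, ← p.take_spec hc, SimpleGraph.Walk.length_append]
  exact add_le_add (SimpleGraph.dist_le _) (SimpleGraph.dist_le _)

theorem Cn.of_dist_lt (hG : G.Connected) {c x w : V} (h : G.dist x w < G.dist x c) :
    Cn G c x w := by
  by_contra hn
  have := dist_of_not_cn hG hn
  omega

theorem exists_adj_dist (hG : G.Connected) {x c : V} (h : x ≠ c) :
    ∃ y, G.Adj x y ∧ G.dist y c + 1 = G.dist x c := by
  obtain ⟨p, hp⟩ := hG.exists_walk_length_eq_dist x c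
  cases p with
  | nil => exact absurd rfl h
  | @cons _ y _ hxy p =>
    refine ⟨y, hxy, ?_⟩
    have h1 : G.dist y c ≤ p.length := SimpleGraph.dist_le p
    have h2 : G.dist x c ≤ G.dist x y + G.dist y c := hG.dist_triangle
    rw [SimpleGraph.dist_eq_one_iff_adj.2 hxy] at h2
    simp only [SimpleGraph.Walk.length_cons] at hp
    omega

/-- Every component of `G - c` contains a neighbor of `c`. -/
theorem exists_adj_cn (hG : G.Connected) {c x : V} (h : x ≠ c) : ∃ u, G.Adj c u ∧ Cn G c u x := by
  induction hn : G.dist x c using Nat.strong_induction_on generalizing x with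
  | _ n ih =>
    obtain ⟨y, hxy, hd⟩ := exists_adj_dist hG h
    by_cases hy : y = c
    · subst hy
      exact ⟨x, hxy.symm, Cn.refl _ _⟩
    · obtain ⟨u, hu, hc⟩ := ih (G.dist y c) (by omega) hy rfl
      exact ⟨u, hu, hc.trans (Cn.of_adj hxy.symm hy h)⟩

theorem dist_adj_le (hG : G.Connected) {x y c : V} (h : G.Adj x y) :
    G.dist x c ≤ G.dist y c + 1 := by
  have h2 : G.dist x c ≤ G.dist x y + G.dist y c := hG.dist_triangle
  rw [SimpleGraph.dist_eq_one_iff_adj.2 h] at h2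
  omega

theorem one_le_dist (hG : G.Connected) {x y : V} (h : x ≠ y) : 1 ≤ G.dist x y :=
  (hG.pos_dist_of_ne h)

/-- No vertex separates `u` from `v`. -/
def Nosep (G : SimpleGraph V) (u v : V) : Prop := ∀ c, c ≠ u → c ≠ v → Cn G c u v

theorem Nosep.refl (u : V) : Nosep G u u := fun _ _ _ => Cn.refl _ _

theorem Nosep.symm {u v : V} (h : Nosep G u v) : Nosep G v u :=
  fun c h1 h2 => (h c h2 h1).symm

theorem Nosep.of_adj {u v : V} (h : G.Adj u v) : Nosep G u v :=
  fun _ h1 h2 => Cn.of_adj h h1.symm h2.symm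

/-- To see that no vertex separates `x` from `y`, only a common partner has to be looked at. -/
theorem Nosep.of_common {x y u : V} (hx : Nosep G x u) (hy : Nosep G y u) (h : Cn G u x y) :
    Nosep G x y := by
  intro c hcx hcy
  by_cases hcu : c = u
  · exact hcu ▸ h
  · exact (hx c hcx hcu).trans (hy c hcy hcu).symm

theorem Nosep.merge {x y u v : V} (huv : u ≠ v) (h1 : Nosep G x u) (h2 : Nosep G x v)
    (h3 : Nosep G y u) (h4 : Nosep G y v) : Nosep G x y := by
  intro c hcx hcy
  by_cases hcu : c = u
  · have hcv : c ≠ v := fun h => huv (hcu.symm.trans h)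
    exact (h2 c hcx hcv).trans (h4 c hcy hcv).symm
  · exact (h1 c hcx hcu).trans (h3 c hcy hcu).symm

/-- A block with at least three vertices: a maximal set of at least three vertices no two of which
are separated by a vertex. It is determined by any two of its vertices `u` and `v`. -/
def IsBlk (G : SimpleGraph V) (B : Set V) : Prop :=
  ∃ u v x, u ≠ v ∧ x ≠ u ∧ x ≠ v ∧ Nosep G u v ∧ Nosep G x u ∧ Nosep G x v ∧
    B = {y | Nosep G y u ∧ Nosep G y v}

theorem IsBlk.of_triple {u v x : V} (h1 : u ≠ v) (h2 : x ≠ u) (h3 : x ≠ v) (h4 : Nosep G u v)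
    (h5 : Nosep G x u) (h6 : Nosep G x v) : ∃ B, IsBlk G B ∧ u ∈ B ∧ v ∈ B ∧ x ∈ B :=
  ⟨_, ⟨u, v, x, h1, h2, h3, h4, h5, h6, rfl⟩, ⟨Nosep.refl _, h4⟩, ⟨h4.symm, Nosep.refl _⟩, h5, h6⟩

section Blk

variable {B : Set V} (hB : IsBlk G B)
include hB

theorem IsBlk.nosep {a b : V} (ha : a ∈ B) (hb : b ∈ B) : Nosep G a b := by
  obtain ⟨u, v, x, h1, h2, h3, h4, h5, h6, rfl⟩ := hB
  exact Nosep.merge h1 ha.1 ha.2 hb.1 hb.2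

theorem IsBlk.mem {a b y : V} (hab : a ≠ b) (ha : a ∈ B) (hb : b ∈ B) (hya : Nosep G y a)
    (hyb : Nosep G y b) : y ∈ B := by
  obtain ⟨u, v, x, h1, h2, h3, h4, h5, h6, rfl⟩ := hB
  exact ⟨Nosep.merge hab hya hyb ha.1.symm hb.1.symm, Nosep.merge hab hya hyb ha.2.symm hb.2.symm⟩

theorem IsBlk.eq_setOf {a b : V} (hab : a ≠ b) (ha : a ∈ B) (hb : b ∈ B) :
    B = {y | Nosep G y a ∧ Nosep G y b} :=
  Set.ext fun _ => ⟨fun h => ⟨hB.nosep h ha, hB.nosep h hb⟩, fun h => hB.mem hab ha hb h.1 h.2⟩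

theorem IsBlk.eq {B' : Set V} (hB' : IsBlk G B') {a b : V} (hab : a ≠ b) (ha : a ∈ B)
    (hb : b ∈ B) (ha' : a ∈ B') (hb' : b ∈ B') : B = B' := by
  rw [hB.eq_setOf hab ha hb, hB'.eq_setOf hab ha' hb']

theorem IsBlk.exists_third (a b : V) : ∃ c ∈ B, c ≠ a ∧ c ≠ b := by
  obtain ⟨u, v, x, h1, h2, h3, h4, h5, h6, rfl⟩ := hB
  by_cases hu : u = a ∨ u = b
  · by_cases hv : v = a ∨ v = b
    · refine ⟨x, ⟨h5, h6⟩, ?_, ?_⟩ <;> rintro rfl <;> grind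
    · exact ⟨v, ⟨h4.symm, Nosep.refl _⟩, fun h => hv (Or.inl h), fun h => hv (Or.inr h)⟩
  · exact ⟨u, ⟨Nosep.refl _, h4⟩, fun h => hu (Or.inl h), fun h => hu (Or.inr h)⟩

theorem IsBlk.cn {a b c : V} (ha : a ∈ B) (hb : b ∈ B) (hac : a ≠ c) (hbc : b ≠ c) :
    Cn G c a b := hB.nosep ha hb c hac.symm hbc.symm

theorem IsBlk.mem_of_adj {x u b : V} (hx : x ∈ B) (hb : b ∈ B) (hbx : b ≠ x) (hu : G.Adj x u)
    (h : Cn G x u b) : u ∈ B :=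
  hB.mem hbx hb hx (Nosep.of_common (Nosep.of_adj hu.symm) (hB.nosep hb hx) h)
    (Nosep.of_adj hu.symm)

theorem IsBlk.two_nbrs (hG : G.Connected) {x : V} (hx : x ∈ B) :
    ∃ u v, u ∈ B ∧ v ∈ B ∧ u ≠ v ∧ G.Adj x u ∧ G.Adj x v := by
  obtain ⟨b, hb, hbx, -⟩ := hB.exists_third x x
  obtain ⟨u, hu, huc⟩ := exists_adj_cn hG hbx
  have huB := hB.mem_of_adj hx hb hbx hu huc
  obtain ⟨b', hb', hbx', hbu'⟩ := hB.exists_third x u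
  by_contra hcon
  push Not at hcon
  have hcn : Cn G u b' x := hB.cn hb' hx hbu' hu.ne
  refine (hcn.induct (P := fun y => y ≠ x ∧ Cn G x y b) ⟨hbx', hB.cn hb' hb hbx' hbx⟩ ?_).1 rfl
  rintro y z ⟨h1, h2⟩ hyz hyu hzu
  have hzx : z ≠ x := by
    rintro rfl
    exact hcon u y huB (hB.mem_of_adj hx hb hbx hyz.symm h2) hyu.symm hu hyz.symm
  exact ⟨hzx, (Cn.of_adj hyz.symm hzx h1).trans h2⟩

/-- Every vertex `x` has a gate `g` in the block `B`: the vertex `g` separates `x` from the rest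
of `B`. -/
theorem IsBlk.exists_gate (hG : G.Connected) (x : V) :
    ∃ g ∈ B, ∀ b ∈ B, b ≠ g → ¬ Cn G g x b := by
  induction hn : sInf ((fun b => G.dist x b) '' B) using Nat.strong_induction_on generalizing x with
  | _ n ih =>
    by_cases hx : x ∈ B
    · exact ⟨x, hx, fun b _ hbx h => hbx h.eq_of_left⟩
    · have hne : ((fun b => G.dist x b) '' B).Nonempty := by
        obtain ⟨b, hb, -⟩ := hB.exists_third x x
        exact ⟨_, b, hb, rfl⟩
      obtain ⟨g, hg, hgd⟩ := Nat.sInf_mem hne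
      simp only at hgd
      have hmin : ∀ b ∈ B, G.dist x g ≤ G.dist x b := fun b hb => by
        rw [hgd]; exact Nat.sInf_le ⟨b, hb, rfl⟩
      refine ⟨g, hg, fun b hb hbg hcn => ?_⟩
      -- the last vertex `y` before `g` on a shortest path from `x` lies in `B`
      have hxg : x ≠ g := fun h => hx (h ▸ hg)
      obtain ⟨y, hy, hyd⟩ := exists_adj_dist hG hxg.symm
      have hyg : y ≠ g := hy.ne'
      have hyx : Cn G g y x := by
        rw [SimpleGraph.dist_comm (u := g)] at hyd
        exact (Cn.of_dist_lt hG (c := g) (x := x) (w := y)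
          (by rw [SimpleGraph.dist_comm (u := x) (v := y)]; omega)).symm
      have hyB := hB.mem_of_adj hg hb hbg hy (hyx.trans hcn)
      have := hmin y hyB
      rw [SimpleGraph.dist_comm (u := g), SimpleGraph.dist_comm (u := y)] at hyd
      omega

end Blk

/-- The component of `u` in `G - c` is a path that is attached to `c` by one of its ends. This is
expressed by the distances to `c`, which tell its vertices apart. -/
def Leglike (G : SimpleGraph V) (c u : V) : Prop :=
  u ≠ c ∧ ∀ y z, Cn G c u y → Cn G c u z → G.dist y c = G.dist z c → y = z

theorem Leglike.of_cn {c u v : V} (h : Leglike G c u) (huv : Cn G c u v) : Leglike G c v :=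
  ⟨huv.ne_of_ne h.1, fun y z hy hz => h.2 y z (huv.trans hy) (huv.trans hz)⟩

/-- On a leg, a vertex closer to the root separates the vertices farther away from the root. -/
theorem Leglike.not_cn (hG : G.Connected) {c a b : V} (h : Leglike G c a) (hab : Cn G c a b)
    (hd : G.dist a c < G.dist b c) : ¬ Cn G a b c := by
  intro hcn
  refine (hcn.induct (P := fun y => y ≠ c ∧ Cn G c a y ∧ G.dist a c < G.dist y c)
    ⟨hab.ne_of_ne h.1, hab, hd⟩ ?_).1 rfl
  rintro y z ⟨h1, h2, h3⟩ hyz hya hza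
  have h4 := dist_adj_le hG (c := c) hyz
  have h5 := one_le_dist hG h.1
  have hzc : z ≠ c := by
    rintro rfl
    rw [SimpleGraph.dist_self] at h4
    omega
  have h6 : Cn G c a z := h2.trans (Cn.of_adj hyz h1 hzc)
  refine ⟨hzc, h6, lt_of_le_of_ne (by omega) fun h7 => ?_⟩
  exact hza (h.2 z a h6 (Cn.refl _ _) h7.symm)

theorem Leglike.not_blk (hG : G.Connected) {c b : V} {B : Set V} (h : Leglike G c b)
    (hB : IsBlk G B) (hb : b ∈ B) : False := by
  have hin : ∀ a ∈ B, a ≠ c → Cn G c b a := fun a ha hac => hB.cn hb ha h.1 hac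
  have key : ∀ a a' : V, a ∈ B → a' ∈ B → a ≠ c → a' ≠ c → G.dist a c < G.dist a' c →
      ¬ Cn G a a' c := fun a a' ha ha' h1 h2 hd =>
    (h.of_cn (hin a ha h1)).not_cn hG (((hin a ha h1).symm).trans (hin a' ha' h2)) hd
  have hinj : ∀ a a' : V, a ∈ B → a' ∈ B → a ≠ c → a' ≠ c → a ≠ a' →
      G.dist a c ≠ G.dist a' c := fun a a' ha ha' h1 h2 hne hd =>
    hne (h.2 a a' (hin a ha h1) (hin a' ha' h2) hd)
  -- two vertices of `B`, of which the nearer one to `c` separates the farther one from `c`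
  have two : ∀ a a' : V, a ∈ B → a' ∈ B → a ≠ c → a' ≠ c → G.dist a c < G.dist a' c → False := by
    intro a a' ha ha' h1 h2 hd
    by_cases hc : c ∈ B
    · exact key a a' ha ha' h1 h2 hd (hB.cn ha' hc (fun h => by rw [h] at hd; omega) h1.symm)
    · obtain ⟨e, he, hea, hea'⟩ := hB.exists_third a a'
      have h3 : e ≠ c := fun h => hc (h ▸ he)
      -- of three vertices, the middle one separates the outer ones
      have three : ∀ x y z : V, x ∈ B → y ∈ B → z ∈ B → x ≠ c → y ≠ c → z ≠ c →
          G.dist x c < G.dist y c → G.dist y c < G.dist z c → False := by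
        intro x y z hx hy hz hxc hyc hzc hxy hyz
        refine key y z hy hz hyc hzc hyz ((hB.cn hz hx (fun h => by rw [h] at hyz; omega)
          (fun h => by rw [h] at hxy; omega)).trans ?_)
        by_contra hn
        have h8 := dist_of_not_cn hG hn
        omega
      have d1 := hinj e a he ha h3 h1 hea
      have d2 := hinj e a' he ha' h3 h2 hea'
      rcases lt_or_gt_of_ne d1 with d1 | d1
      · exact three e a a' he ha ha' h3 h1 h2 d1 hd
      · rcases lt_or_gt_of_ne d2 with d2 | d2
        · exact three a e a' ha he ha' h1 h3 h2 d1 d2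
        · exact three a a' e ha ha' he h1 h2 h3 hd d2
  obtain ⟨a, ha, hab, hac⟩ := hB.exists_third b c
  rcases lt_or_gt_of_ne (hinj a b ha hb hac h.1 hab) with hd | hd
  · exact two a b ha hb hac h.1 hd
  · exact two b a hb ha h.1 hac hd

/-- The vertices of a leg have degree at most two: their neighbors are at pairwise different
distances to the root, and none is at the same distance as the vertex itself. -/
theorem Leglike.ncard_le [Finite V] (hG : G.Connected) {c u : V} (h : Leglike G c u) :
    (G.neighborSet u).ncard ≤ 2 := by
  classical
  have h0 : ∀ z ∈ G.neighborSet u, z ≠ c → Cn G c u z := fun z hz hzc => Cn.of_adj hz h.1 hzc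
  have h1 : ∀ z ∈ G.neighborSet u, G.dist z c ∈ ({G.dist u c - 1, G.dist u c + 1} : Set ℕ) := by
    intro z hz
    have a1 := dist_adj_le hG (c := c) hz
    have a2 := dist_adj_le hG (c := c) (SimpleGraph.Adj.symm hz)
    have a3 : G.dist z c ≠ G.dist u c := by
      intro he
      by_cases hzc : z = c
      · subst hzc
        rw [SimpleGraph.dist_self] at he
        have := one_le_dist hG h.1
        omega
      · exact hz.ne (h.2 u z (Cn.refl _ _) (h0 z hz hzc) he.symm)
    simp only [Set.mem_insert_iff, Set.mem_singleton_iff]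
    omega
  calc (G.neighborSet u).ncard ≤ ({G.dist u c - 1, G.dist u c + 1} : Set ℕ).ncard := by
        refine Set.ncard_le_ncard_of_injOn _ h1 ?_ (Set.toFinite _)
        intro z hz z' hz' hzz
        simp only at hzz
        by_cases hzc : z = c
        · subst hzc
          rw [SimpleGraph.dist_self] at hzz
          exact ((hG.dist_eq_zero_iff).1 hzz.symm).symm
        · by_cases hzc' : z' = c
          · subst hzc'
            rw [SimpleGraph.dist_self] at hzz
            exact (hG.dist_eq_zero_iff).1 hzz
          · exact h.2 z z' (h0 z hz hzc) (h0 z' hz' hzc') hzz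
    _ ≤ 2 := (Set.ncard_insert_le _ _).trans (by simp)

/-- Two roots of degree at least three of the same leg agree. -/
theorem Leglike.root_unique [Finite V] (hG : G.Connected) {x r r' : V} (h : Leglike G r x)
    (h' : Leglike G r' x) (hr : 3 ≤ (G.neighborSet r).ncard) (hr' : 3 ≤ (G.neighborSet r').ncard) :
    r = r' := by
  by_contra hne
  have h1 : ¬ Cn G r x r' := fun hc => by have := (h.of_cn hc).ncard_le hG; omega
  have h2 : ¬ Cn G r' x r := fun hc => by have := (h'.of_cn hc).ncard_le hG; omega
  have e1 := dist_of_not_cn hG h1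
  have e2 := dist_of_not_cn hG h2
  have := one_le_dist hG hne
  rw [SimpleGraph.dist_comm (u := r')] at e2
  omega

/-- The vertex `x` lies on a hooked leg with root `r ≠ x`. -/
def Hooked (G : SimpleGraph V) (x r : V) : Prop :=
  Leglike G r x ∧ 3 ≤ (G.neighborSet r).ncard ∧ (∃ y, y ≠ r ∧ ¬ Cn G r x y) ∧
    ∀ y z, y ≠ r → z ≠ r → ¬ Cn G r x y → ¬ Cn G r x z → Cn G r y z

/-- A joint: a cut vertex of degree at least three that is not the root of a hooked leg. -/
def Joint (G : SimpleGraph V) (c : V) : Prop :=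
  3 ≤ (G.neighborSet c).ncard ∧ (∃ x y, x ≠ c ∧ y ≠ c ∧ ¬ Cn G c x y) ∧ ∀ x, ¬ Hooked G x c

/-- A block together with the vertices of the hooked legs that are attached to it. -/
def ext (G : SimpleGraph V) (B : Set V) : Set V := {x | x ∈ B ∨ ∃ r ∈ B, Hooked G x r}

section Ext

variable [Finite V] (hG : G.Connected)
include hG

theorem Joint.not_leglike {c r : V} (hc : Joint G c) : ¬ Leglike G r c := fun h => by
  have := h.ncard_le hG
  have := hc.1
  omega

theorem Joint.mem_of_mem_ext {c : V} {B : Set V} (hc : Joint G c) (h : c ∈ ext G B) : c ∈ B := by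
  rcases h with h | ⟨r, hr, h⟩
  · exact h
  · exact absurd h.1 (hc.not_leglike hG)

theorem IsBlk.three_le {B : Set V} (hB : IsBlk G B) {c y b : V} (hc : c ∈ B) (hb : b ∈ B)
    (hbc : b ≠ c) (hy : y ≠ c) (h : ¬ Cn G c b y) : 3 ≤ (G.neighborSet c).ncard := by
  classical
  obtain ⟨u, v, hu, hv, huv, hcu, hcv⟩ := hB.two_nbrs hG hc
  obtain ⟨z, hz, hzy⟩ := exists_adj_cn hG hy
  have h1 : ∀ a ∈ B, G.Adj c a → z ≠ a := by
    rintro a ha hca rfl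
    exact h ((hB.cn hb ha hbc hca.ne').trans hzy)
  have : ({z, u, v} : Finset V).card = 3 :=
    Finset.card_eq_three.2 ⟨z, u, v, h1 u hu hcu, h1 v hv hcv, huv, rfl⟩
  rw [← this, ← Set.ncard_coe_finset]
  refine Set.ncard_le_ncard ?_ (Set.toFinite _)
  intro a ha
  simp only [Finset.coe_insert, Finset.coe_singleton, Set.mem_insert_iff,
    Set.mem_singleton_iff] at ha
  rcases ha with rfl | rfl | rfl
  exacts [hz, hcu, hcv]

/-- If `c` separates a vertex `y` from a block that contains `c`, then either `c` is a joint or `y`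
lies on a hooked leg with root `c`. -/
theorem IsBlk.joint_or_hooked {B : Set V} (hB : IsBlk G B) {c y b : V} (hc : c ∈ B) (hb : b ∈ B)
    (hbc : b ≠ c) (hy : y ≠ c) (h : ¬ Cn G c b y) : Joint G c ∨ Hooked G y c := by
  by_contra hcon
  push Not at hcon
  refine hcon.1 ⟨hB.three_le hG hc hb hbc hy h, ⟨b, y, hbc, hy, h⟩, fun x hx => hcon.2 ?_⟩
  have h1 : ¬ Cn G c x b := fun h1 => (hx.1.of_cn h1).not_blk hG hB hb
  have h2 : Cn G c x y := by
    by_contra h2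
    exact h (hx.2.2.2 b y hbc hy h1 h2)
  exact ⟨hx.1.of_cn h2, hx.2.1, ⟨b, hbc, fun h3 => h1 (h2.trans h3)⟩,
    fun a a' ha ha' h3 h4 => hx.2.2.2 a a' ha ha' (fun h5 => h3 (h2.symm.trans h5))
      (fun h5 => h4 (h2.symm.trans h5))⟩

theorem IsBlk.eq_of_mem_of_not_joint {B B' : Set V} (hB : IsBlk G B) (hB' : IsBlk G B') {c : V}
    (hc : c ∈ B) (hc' : c ∈ B') (hj : ¬ Joint G c) : B = B' := by
  obtain ⟨b, hb, hbc, -⟩ := hB.exists_third c c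
  obtain ⟨b', hb', hbc', -⟩ := hB'.exists_third c c
  by_cases h : Cn G c b b'
  · have : b' ∈ B := hB.mem hbc hb hc
      (Nosep.of_common (hB'.nosep hb' hc') (hB.nosep hb hc) h.symm) (hB'.nosep hb' hc')
    exact hB.eq hB' hbc' this hc hb' hc'
  · rcases hB.joint_or_hooked hG hc hb hbc hbc' h with h1 | h1
    · exact absurd h1 hj
    · exact absurd hb' fun h2 => h1.1.not_blk hG hB' h2

/-- Different EBCs only share joints. -/
theorem IsBlk.eq_of_mem_ext {B B' : Set V} (hB : IsBlk G B) (hB' : IsBlk G B') {x : V}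
    (hx : x ∈ ext G B) (hx' : x ∈ ext G B') (hj : ¬ Joint G x) : B = B' := by
  rcases hx with hx | ⟨r, hr, h⟩
  · rcases hx' with hx' | ⟨r', hr', h'⟩
    · exact hB.eq_of_mem_of_not_joint hG hB' hx hx' hj
    · exact (h'.1.not_blk hG hB hx).elim
  · rcases hx' with hx' | ⟨r', hr', h'⟩
    · exact (h.1.not_blk hG hB' hx').elim
    · have := h.1.root_unique hG h'.1 h.2.1 h'.2.1
      subst this
      exact hB.eq_of_mem_of_not_joint hG hB' hr hr' fun h1 => h1.2.2 x h

/-- A leg at a joint does not meet any EBC. -/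
theorem Joint.leg_not_mem_ext {B : Set V} (hB : IsBlk G B) {c x : V} (hc : Joint G c)
    (h : Leglike G c x) : x ∉ ext G B := by
  rintro (hx | ⟨r, hr, h'⟩)
  · exact h.not_blk hG hB hx
  · have := h.root_unique hG h'.1 hc.1 h'.2.1
    subst this
    exact hc.2.2 x h'

/-- The vertices of an EBC other than a joint `g` of it lie in one component of `G - g`. -/
theorem IsBlk.cn_ext {B : Set V} (hB : IsBlk G B) {g u v : V} (hg : Joint G g)
    (hu : u ∈ ext G B) (hv : v ∈ ext G B) (hug : u ≠ g) (hvg : v ≠ g) : Cn G g u v := by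
  have key : ∀ u, u ∈ ext G B → u ≠ g → ∃ b ∈ B, b ≠ g ∧ Cn G g u b := by
    rintro u (hu | ⟨r, hr, h⟩) hug
    · exact ⟨u, hu, hug, Cn.refl _ _⟩
    · have hrg : r ≠ g := by
        rintro rfl
        exact hg.2.2 _ h
      refine ⟨r, hr, hrg, ?_⟩
      by_contra hn
      have h1 := dist_of_not_cn hG hn
      have h2 : ¬ Cn G r u g := fun h2 => hg.not_leglike hG (h.1.of_cn h2)
      have h3 := dist_of_not_cn hG h2
      have := one_le_dist hG hrg
      rw [SimpleGraph.dist_comm (u := g)] at h1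
      omega
  obtain ⟨b, hb, hbg, h1⟩ := key u hu hug
  obtain ⟨b', hb', hbg', h2⟩ := key v hv hvg
  exact h1.trans ((hB.cn hb hb' hbg hbg').trans h2.symm)

/-- A vertex outside an EBC is separated from it by a joint of the EBC. -/
theorem IsBlk.exists_joint {B : Set V} (hB : IsBlk G B) {w : V} (hw : w ∉ ext G B) :
    ∃ g ∈ B, Joint G g ∧ w ≠ g ∧ ∀ u ∈ ext G B, u ≠ g → ¬ Cn G g u w := by
  obtain ⟨g, hg, hsep⟩ := hB.exists_gate hG w
  obtain ⟨b, hb, hbg, -⟩ := hB.exists_third g g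
  have hwg : w ≠ g := fun h => hw (Or.inl (h ▸ hg))
  have h1 : ¬ Cn G g b w := fun h => hsep b hb hbg h.symm
  rcases hB.joint_or_hooked hG hg hb hbg hwg h1 with h2 | h2
  · exact ⟨g, hg, h2, hwg, fun u hu hug h3 =>
        h1 ((hB.cn_ext hG h2 (Or.inl hb) hu hbg hug).trans h3)⟩
  · exact absurd (Or.inr ⟨g, hg, h2⟩) hw

end Ext

end Separation

/-! ### Biconnected components and hooked legs, described by separation -/

section Char

variable {V : Type*} {G : SimpleGraph V}

theorem IsBlk.support_subset {B : Set V} (hB : IsBlk G B) (hG : G.Connected) {u v : V}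
    (hu : u ∈ B) (hv : v ∈ B) {p : G.Walk u v} (hp : p.IsPath) {x : V} (hx : x ∈ p.support) :
    x ∈ B := by
  classical
  by_contra hxB
  obtain ⟨g, hg, hsep⟩ := hB.exists_gate hG x
  have hgx : g ≠ x := fun h => hxB (h ▸ hg)
  have h1 : g ∈ (p.takeUntil x hx).support := by
    by_contra hn
    have hug : u ≠ g := fun h => hn (h ▸ SimpleGraph.Walk.start_mem_support _)
    exact hsep u hu hug (Cn.of_walk _ hn).symm
  have h2 : g ∈ (p.dropUntil x hx).support := by
    by_contra hn
    have hvg : v ≠ g := fun h => hn (h ▸ SimpleGraph.Walk.end_mem_support _)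
    exact hsep v hv hvg (Cn.of_walk _ hn)
  have h3 : g ∈ (p.dropUntil x hx).support.tail := by
    rw [← SimpleGraph.Walk.cons_tail_support] at h2
    exact (List.mem_cons.1 h2).resolve_left hgx
  have h4 := hp.support_nodup
  rw [← p.take_spec hx, SimpleGraph.Walk.support_append] at h4
  exact List.disjoint_of_nodup_append h4 h1 h3

/-- The final part of a walk, from its last vertex in `S` on. -/
theorem exists_last {u v : V} (S : Set V) (R : G.Walk u v) (h : ∃ y ∈ R.support, y ∈ S) :
    ∃ x, ∃ R' : G.Walk x v, x ∈ S ∧ (∀ y ∈ R'.support, y ∈ R.support) ∧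
      ∀ y ∈ R'.support, y ∈ S → y = x := by
  induction R with
  | nil =>
    obtain ⟨y, hy, hyS⟩ := h
    simp only [SimpleGraph.Walk.support_nil, List.mem_singleton] at hy
    subst hy
    exact ⟨_, .nil, hyS, by simp, by simp⟩
  | @cons a b c hab p ih =>
    by_cases h' : ∃ y ∈ p.support, y ∈ S
    · obtain ⟨x, R', h1, h2, h3⟩ := ih h'
      exact ⟨x, R', h1, fun y hy => by simp [h2 y hy], h3⟩
    · push Not at h'
      obtain ⟨y, hy, hyS⟩ := h
      have hya : y = a := by
        simp only [SimpleGraph.Walk.support_cons, List.mem_cons] at hy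
        exact hy.resolve_right fun hy => h' y hy hyS
      subst hya
      refine ⟨y, .cons hab p, hyS, fun _ h => h, fun z hz hzS => ?_⟩
      simp only [SimpleGraph.Walk.support_cons, List.mem_cons] at hz
      exact hz.resolve_right fun hz => h' z hz hzS

/-- Whitney's theorem: two vertices of a block are joined by two paths that share no inner vertex.
(For adjacent vertices the two paths may be equal here.) The proof is by induction on the distance:
two paths to the neighbor `w` of `v` on a shortest path are rerouted along a path to `v` that
avoids `w`. -/
theorem IsBlk.exists_disjoint_paths {B : Set V} (hB : IsBlk G B) (hG : G.Connected) :
    ∀ (n : ℕ) (u v : V), u ∈ B → v ∈ B → u ≠ v → G.dist u v = n →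
      ∃ p q : G.Walk u v, p.IsPath ∧ q.IsPath ∧ ∀ x ∈ p.support, x ∈ q.support → x = u ∨ x = v := by
  classical
  intro n
  induction n using Nat.strong_induction_on with
  | _ n ih =>
    intro u v hu hv huv hd
    obtain ⟨w, hvw, hwd⟩ := exists_adj_dist hG huv.symm
    rw [SimpleGraph.dist_comm (u := w), SimpleGraph.dist_comm (u := v), hd] at hwd
    by_cases hwu : w = u
    · subst hwu
      have hp : (SimpleGraph.Walk.cons hvw.symm .nil : G.Walk w v).IsPath := by simpa using huv
      exact ⟨_, _, hp, hp, by simp⟩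
    have hwB : w ∈ B := by
      obtain ⟨p, hp, hpl⟩ := hG.exists_path_of_dist u w
      have hvp : v ∉ p.support := by
        intro hvp
        have h1 := SimpleGraph.dist_le (p.takeUntil v hvp)
        have h2 := p.length_takeUntil_le_length hvp
        omega
      refine hB.support_subset hG hu hv (hp.concat hvp hvw.symm) ?_
      simp [SimpleGraph.Walk.support_concat]
    obtain ⟨P, Q, hP, hQ, hPQ⟩ := ih (n - 1) (by omega) u w hu hwB (Ne.symm hwu) (by omega)
    obtain ⟨R, hR⟩ := (hB.nosep hu hv w hwu hvw.ne').exists_walk (Ne.symm hwu)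
    obtain ⟨x, R', hxS, hR1, hR2⟩ := exists_last {y | y ∈ P.support ∨ y ∈ Q.support} R
      ⟨u, R.start_mem_support, Or.inl P.start_mem_support⟩
    have hwR' : w ∉ R'.support := fun h => hR (hR1 w h)
    have hwx : w ≠ x := fun h => hwR' (h ▸ R'.start_mem_support)
    -- the construction, for `x` on the path `P`
    have build : ∀ P Q : G.Walk u w, P.IsPath →
        (∀ y ∈ P.support, y ∈ Q.support → y = u ∨ y = w) → x ∈ P.support →
        (∀ y ∈ R'.support, y ∈ P.support ∨ y ∈ Q.support → y = x) →
        ∃ p q : G.Walk u v, p.IsPath ∧ q.IsPath ∧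
          ∀ x ∈ p.support, x ∈ q.support → x = u ∨ x = v := by
      intro P Q hP hPQ hx hR2
      refine ⟨((P.takeUntil x hx).append R').bypass, (Q.concat hvw.symm).bypass,
        SimpleGraph.Walk.bypass_isPath _, SimpleGraph.Walk.bypass_isPath _, fun y hy1 hy2 => ?_⟩
      replace hy1 := SimpleGraph.Walk.support_bypass_subset_support _ hy1
      replace hy2 := SimpleGraph.Walk.support_bypass_subset_support _ hy2
      rw [SimpleGraph.Walk.mem_support_append_iff] at hy1
      rw [SimpleGraph.Walk.support_concat, List.mem_append,
        List.mem_singleton] at hy2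
      rcases hy2 with hy2 | hy2
      · have hyw : y ≠ w := by
          rintro rfl
          rcases hy1 with hy1 | hy1
          · exact SimpleGraph.Walk.endpoint_notMem_support_takeUntil hP hx hwx hy1
          · exact hwR' hy1
        rcases hy1 with hy1 | hy1
        · rcases hPQ y (SimpleGraph.Walk.support_takeUntil_subset_support _ _ hy1) hy2 with h | h
          · exact Or.inl h
          · exact absurd h hyw
        · have := hR2 y hy1 (Or.inr hy2)
          subst this
          rcases hPQ y hx hy2 with h | h
          · exact Or.inl h
          · exact absurd h hyw
      · exact Or.inr hy2
    rcases hxS with hx | hx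
    · exact build P Q hP hPQ hx hR2
    · exact build Q P hQ (fun y h1 h2 => hPQ y h2 h1) hx (fun y h1 h2 => hR2 y h1 h2.symm)

theorem IsBlk.exists_two_paths {B : Set V} (hB : IsBlk G B) (hG : G.Connected) {u v : V}
    (hu : u ∈ B) (hv : v ∈ B) (huv : u ≠ v) :
    ∃ p q : G.Walk u v, p.IsPath ∧ q.IsPath ∧ p ≠ q ∧
      ∀ x ∈ p.support, x ∈ q.support → x = u ∨ x = v := by
  classical
  by_cases hadj : G.Adj u v
  · obtain ⟨x, hx, hxu, hxv⟩ := hB.exists_third u v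
    obtain ⟨P, hP⟩ := (hB.nosep hu hx v huv.symm hxv.symm).exists_walk huv
    obtain ⟨Q, hQ⟩ := (hB.nosep hx hv u hxu.symm huv).exists_walk hxu
    have hp : (SimpleGraph.Walk.cons hadj .nil : G.Walk u v).IsPath := by simpa using huv
    refine ⟨_, (P.append Q).bypass, hp, SimpleGraph.Walk.bypass_isPath _, fun he => ?_, by simp⟩
    have h1 : s(u, v) ∈ (P.append Q).bypass.edges := by rw [← he]; simp
    replace h1 := SimpleGraph.Walk.edges_bypass_subset_edges _ h1
    rw [SimpleGraph.Walk.edges_append, List.mem_append] at h1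
    rcases h1 with h1 | h1
    · exact hP (P.snd_mem_support_of_mem_edges h1)
    · exact hQ (Q.fst_mem_support_of_mem_edges h1)
  · obtain ⟨p, q, hp, hq, hpq⟩ := hB.exists_disjoint_paths hG _ u v hu hv huv rfl
    refine ⟨p, q, hp, hq, fun he => ?_, hpq⟩
    subst he
    cases p with
    | nil => exact huv rfl
    | @cons _ y _ h r =>
      rcases hpq y (by simp) (by simp) with h' | h'
      · exact h.ne h'.symm
      · exact hadj (h' ▸ h)

theorem IsBlk.isBiconnected [Finite V] {B : Set V} (hB : IsBlk G B) (hG : G.Connected) :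
    IsBiconnected (G.induce B) := by
  constructor
  · obtain ⟨a, ha, -⟩ := hB.exists_third (Classical.choice hG.nonempty)
        (Classical.choice hG.nonempty)
    obtain ⟨b, hb, hba, -⟩ := hB.exists_third a a
    obtain ⟨c, hc, hca, hcb⟩ := hB.exists_third a b
    rw [Nat.card_coe_set_eq]
    exact (Set.two_lt_ncard_iff (Set.toFinite _)).2
      ⟨a, b, c, ha, hb, hc, hba.symm, hca.symm, hcb.symm⟩
  · rintro ⟨u, hu⟩ ⟨v, hv⟩ huv
    obtain ⟨p, q, hp, hq, hne, hpq⟩ := hB.exists_two_paths hG hu hv (fun h => huv (by simp [h]))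
    have hp' : ∀ x ∈ p.support, x ∈ B := fun x hx => hB.support_subset hG hu hv hp hx
    have hq' : ∀ x ∈ q.support, x ∈ B := fun x hx => hB.support_subset hG hu hv hq hx
    refine ⟨p.induce B hp', q.induce B hq', ?_, ?_, fun he => hne ?_, ?_⟩
    · refine SimpleGraph.Walk.IsPath.of_map (f := (SimpleGraph.Embedding.induce B).toHom) ?_
      rw [SimpleGraph.Walk.map_induce]; exact hp
    · refine SimpleGraph.Walk.IsPath.of_map (f := (SimpleGraph.Embedding.induce B).toHom) ?_
      rw [SimpleGraph.Walk.map_induce]; exact hq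
    · rw [← SimpleGraph.Walk.map_induce p hp', ← SimpleGraph.Walk.map_induce q hq', he]
    · rintro ⟨x, hx⟩ hxp hxq
      rw [SimpleGraph.Walk.support_induce, List.mem_attachWith] at hxp hxq
      simpa [Subtype.ext_iff] using hpq x hxp hxq

theorem nosep_of_isBiconnected {B : Set V} (h : IsBiconnected (G.induce B)) {u v : V}
    (hu : u ∈ B) (hv : v ∈ B) : Nosep G u v := by
  by_cases huv : u = v
  · subst huv; exact Nosep.refl _
  intro c hcu hcv
  obtain ⟨p, q, hp, hq, -, hpq⟩ := h.2 ⟨u, hu⟩ ⟨v, hv⟩ (by simpa [Subtype.ext_iff] using huv)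
  have key : ∀ r : (G.induce B).Walk ⟨u, hu⟩ ⟨v, hv⟩, (∀ hc : c ∈ B, ⟨c, hc⟩ ∉ r.support) →
      Cn G c u v := by
    intro r hr
    refine Cn.of_walk (r.map (SimpleGraph.Embedding.induce B).toHom) fun hc => ?_
    have e := SimpleGraph.Walk.support_map (SimpleGraph.Embedding.induce B).toHom r
    obtain ⟨⟨y, hy⟩, hyr, hyc⟩ := List.mem_map.1 (e ▸ hc)
    have : y = c := hyc
    subst this
    exact hr hy hyr
  by_cases hcB : c ∈ B
  · by_cases hcp : (⟨c, hcB⟩ : B) ∈ p.support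
    · refine key q fun _ hcq => ?_
      rcases hpq _ hcp hcq with h' | h'
      · exact hcu (congrArg Subtype.val h')
      · exact hcv (congrArg Subtype.val h')
    · exact key p fun _ => hcp
  · exact key p fun hc => absurd hc hcB

/-- The blocks are the biconnected components: blocks induce biconnected graphs by Whitney's
theorem, and no vertex separates two vertices of a biconnected set. -/
theorem isBiconnectedComponent_iff [Finite V] (hG : G.Connected) (B : Set V) :
    IsBiconnectedComponent G B ↔ IsBlk G B := by
  constructor
  · intro h
    have h3 : 2 < B.ncard := by have := h.prop.1; rwa [Nat.card_coe_set_eq] at this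
    obtain ⟨u, v, x, hu, hv, hx, huv, hux, hvx⟩ := (Set.two_lt_ncard_iff (Set.toFinite _)).1 h3
    have hn : ∀ a b : V, a ∈ B → b ∈ B → Nosep G a b := fun a b ha hb =>
      nosep_of_isBiconnected h.prop ha hb
    have hB' : IsBlk G {y | Nosep G y u ∧ Nosep G y v} :=
      ⟨u, v, x, huv, hux.symm, hvx.symm, hn u v hu hv, hn x u hx hu, hn x v hx hv, rfl⟩
    have hsub : B ⊆ {y | Nosep G y u ∧ Nosep G y v} := fun y hy => ⟨hn y u hy hu, hn y v hy hv⟩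
    have := h.eq_of_subset (hB'.isBiconnected hG) hsub
    rwa [this]
  · intro h
    refine ⟨h.isBiconnected hG, fun C hC hBC y hy => ?_⟩
    obtain ⟨a, ha, -⟩ := h.exists_third (Classical.choice hG.nonempty)
        (Classical.choice hG.nonempty)
    obtain ⟨b, hb, hba, -⟩ := h.exists_third a a
    exact h.mem hba hb ha (nosep_of_isBiconnected hC hy (hBC hb))
      (nosep_of_isBiconnected hC hy (hBC ha))

/-- The walk along a leg from `u` to its root. -/
theorem Leglike.exists_walk (hG : G.Connected) {r : V} :
    ∀ (n : ℕ) (u : V), G.dist u r = n → Leglike G r u → ∃ p : G.Walk u r, p.IsPath ∧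
      (∀ y ∈ p.support, y = r ∨ Cn G r u y ∧ G.dist y r ≤ G.dist u r) ∧
      ∀ y, Cn G r u y → G.dist y r ≤ G.dist u r → y ∈ p.support := by
  intro n
  induction n using Nat.strong_induction_on with
  | _ n ih =>
    intro u hn hl
    obtain ⟨w, huw, hd⟩ := exists_adj_dist hG hl.1
    have hd0 := fun y => hG.dist_eq_zero_iff (u := y) (v := r)
    by_cases hwr : w = r
    · subst hwr
      rw [SimpleGraph.dist_self] at hd
      refine ⟨.cons huw .nil, by simpa using hl.1, fun y hy => ?_, fun y hy hyd => ?_⟩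
      · simp only [SimpleGraph.Walk.support_cons, SimpleGraph.Walk.support_nil,
          List.mem_cons, List.not_mem_nil, or_false] at hy
        rcases hy with rfl | rfl
        · exact Or.inr ⟨Cn.refl _ _, le_rfl⟩
        · exact Or.inl rfl
      · have h1 := one_le_dist hG (hy.ne_of_ne hl.1)
        rw [hl.2 y u hy (Cn.refl _ _) (by omega)]
        simp
    · have huw' : Cn G r u w := Cn.of_adj huw hl.1 hwr
      obtain ⟨p, hp, h1, h2⟩ := ih (G.dist w r) (by omega) w rfl (hl.of_cn huw')
      refine ⟨.cons huw p, (SimpleGraph.Walk.cons_isPath_iff _ _).2 ⟨hp, fun hu => ?_⟩,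
        fun y hy => ?_, fun y hy hyd => ?_⟩
      · rcases h1 u hu with h | h
        · exact hl.1 h
        · omega
      · rw [SimpleGraph.Walk.support_cons, List.mem_cons] at hy
        rcases hy with rfl | hy
        · exact Or.inr ⟨Cn.refl _ _, le_rfl⟩
        · rcases h1 y hy with h | h
          · exact Or.inl h
          · exact Or.inr ⟨huw'.trans h.1, by omega⟩
      · by_cases hyu : y = u
        · subst hyu; simp
        · have : G.dist y r ≠ G.dist u r := fun h => hyu (hl.2 y u hy (Cn.refl _ _) h)
          rw [SimpleGraph.Walk.support_cons, List.mem_cons]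
          exact Or.inr (h2 y (huw'.symm.trans hy) (by omega))

theorem Leglike.exists_dist_eq (hG : G.Connected) {r : V} :
    ∀ (n : ℕ) (u : V), G.dist u r = n → u ≠ r → ∀ j, 1 ≤ j → j ≤ n →
      ∃ z, Cn G r u z ∧ G.dist z r = j := by
  intro n
  induction n with
  | zero => intro u _ _ j h1 h2; omega
  | succ n ih =>
    intro u hn hu j h1 h2
    rcases eq_or_lt_of_le h2 with h | h
    · exact ⟨u, Cn.refl _ _, by omega⟩
    · obtain ⟨w, huw, hd⟩ := exists_adj_dist hG hu
      have hwr : w ≠ r := by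
        rintro rfl
        rw [SimpleGraph.dist_self] at hd
        omega
      obtain ⟨z, hz, hzd⟩ := ih w (by omega) hwr j h1 (by omega)
      exact ⟨z, (Cn.of_adj huw hu hwr).trans hz, hzd⟩

/-- A leg in the sense of separation is a leg in the sense of degrees. -/
theorem Leglike.exists_isLeg [Finite V] (hG : G.Connected) {r x : V} (h : Leglike G r x)
    (hr : 3 ≤ (G.neighborSet r).ncard) :
    ∃ (u : V) (p : G.Walk u r), IsLeg G p ∧ x ∈ p.support := by
  classical
  obtain ⟨u, hu, hmax⟩ := Set.exists_max_image {y | Cn G r x y} (fun y => G.dist y r)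
    (Set.toFinite _) ⟨x, Cn.refl _ _⟩
  have hlu : Leglike G r u := h.of_cn hu
  obtain ⟨p, hp, h1, h2⟩ := hlu.exists_walk hG _ u rfl
  refine ⟨u, p, ⟨hp, ?_, hr, fun y hy hyu hyr => ?_⟩, h2 x hu.symm (hmax x (Cn.refl _ _))⟩
  · obtain ⟨w, huw, hd⟩ := exists_adj_dist hG hlu.1
    rw [Set.ncard_eq_one]
    refine ⟨w, Set.ext fun z => ⟨fun hz => ?_, fun hz => hz ▸ huw⟩⟩
    have hz' : G.Adj u z := hz
    rw [Set.mem_singleton_iff]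
    have hle : G.dist z r ≤ G.dist u r := by
      by_cases hzr : z = r
      · subst hzr; rw [SimpleGraph.dist_self]; exact Nat.zero_le _
      · exact hmax z (hu.trans (Cn.of_adj hz' hlu.1 hzr))
    have hne : G.dist z r ≠ G.dist u r := by
      intro he
      by_cases hzr : z = r
      · subst hzr
        rw [SimpleGraph.dist_self] at he
        have := one_le_dist hG hlu.1
        omega
      · exact hz'.ne (hlu.2 u z (Cn.refl _ _) (Cn.of_adj hz' hlu.1 hzr) he.symm)
    have hge := dist_adj_le hG (c := r) hz'
    have hzw : G.dist z r = G.dist w r := by omega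
    by_cases hzr : z = r
    · subst hzr
      rw [SimpleGraph.dist_self] at hzw
      exact ((hG.dist_eq_zero_iff).1 hzw.symm).symm
    · have hwr : w ≠ r := by
        rintro rfl
        rw [SimpleGraph.dist_self] at hzw
        exact hzr ((hG.dist_eq_zero_iff).1 hzw)
      exact hlu.2 z w (Cn.of_adj hz' hlu.1 hzr) (Cn.of_adj huw hlu.1 hwr) hzw
  · have hyc : Cn G r u y := ((h1 y hy).resolve_left hyr).1
    have hyd : G.dist y r < G.dist u r := lt_of_le_of_ne ((h1 y hy).resolve_left hyr).2
      fun he => hyu (hlu.2 y u hyc (Cn.refl _ _) he)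
    have hly := hlu.of_cn hyc
    refine le_antisymm (hly.ncard_le hG) ?_
    obtain ⟨w, hyw, hd⟩ := exists_adj_dist hG hyr
    obtain ⟨z, hz, hzd⟩ := Leglike.exists_dist_eq hG _ u rfl hlu.1 (G.dist y r + 1) (by omega)
      (by omega)
    have hzr : z ≠ r := hz.ne_of_ne hlu.1
    obtain ⟨y', hzy, hd'⟩ := exists_adj_dist hG hzr
    have hy1 := one_le_dist hG hyr
    have hyr' : y' ≠ r := by
      rintro rfl
      rw [SimpleGraph.dist_self] at hd'
      omega
    have hyy : y' = y := hlu.2 y' y (hz.trans (Cn.of_adj hzy hzr hyr')) hyc (by omega)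
    subst hyy
    have hwz : w ≠ z := by
      rintro rfl
      omega
    rw [← Set.ncard_pair hwz]
    refine Set.ncard_le_ncard ?_ (Set.toFinite _)
    rintro a (rfl | rfl)
    exacts [hyw, hzy.symm]

/-- The neighbors of a vertex of a leg other than the root lie on the leg, at most one step farther
along it. -/
theorem IsLeg.adj_mem {u r : V} {p : G.Walk u r} (h : IsLeg G p) {i : ℕ}
    (hi : i < p.length) {z : V} (hz : G.Adj (p.getVert i) z) :
    ∃ j ≤ p.length, j ≤ i + 1 ∧ z = p.getVert j := by
  obtain ⟨hp, h1, h3, h2⟩ := h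
  have hinj := hp.getVert_injOn
  have hnext := p.adj_getVert_succ hi
  rcases Nat.eq_zero_or_pos i with h0 | h0
  · subst h0
    rw [SimpleGraph.Walk.getVert_zero] at hz hnext
    obtain ⟨a, ha⟩ := Set.ncard_eq_one.1 h1
    have e1 : z = a := by
      have : z ∈ G.neighborSet u := hz
      rwa [ha] at this
    have e2 : p.getVert (0 + 1) = a := by
      have : p.getVert (0 + 1) ∈ G.neighborSet u := hnext
      rwa [ha] at this
    exact ⟨0 + 1, hi, le_rfl, e1.trans e2.symm⟩
  · have hprev : G.Adj (p.getVert i) (p.getVert (i - 1)) := by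
      have := p.adj_getVert_succ (i := i - 1) (by omega)
      rw [Nat.sub_add_cancel h0] at this
      exact this.symm
    have hu : p.getVert i ≠ u := by
      intro he
      have := hinj (show i ≤ p.length by omega) (show 0 ≤ p.length by omega)
        (he.trans p.getVert_zero.symm)
      omega
    have hr : p.getVert i ≠ r := by
      intro he
      have := hinj (show i ≤ p.length by omega) (show p.length ≤ p.length from le_rfl)
        (he.trans p.getVert_length.symm)
      omega
    obtain ⟨a, b, hab, hs⟩ := Set.ncard_eq_two.1 (h2 (p.getVert i) (p.getVert_mem_support i) hu hr)
    have hne : p.getVert (i + 1) ≠ p.getVert (i - 1) := by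
      intro he
      have := hinj (show i + 1 ≤ p.length by omega) (show i - 1 ≤ p.length by omega) he
      omega
    have m1 : p.getVert (i + 1) ∈ ({a, b} : Set V) := hs ▸ hnext
    have m2 : p.getVert (i - 1) ∈ ({a, b} : Set V) := hs ▸ hprev
    have m3 : z ∈ ({a, b} : Set V) := hs ▸ hz
    simp only [Set.mem_insert_iff, Set.mem_singleton_iff] at m1 m2 m3
    have : z = p.getVert (i + 1) ∨ z = p.getVert (i - 1) := by grind
    rcases this with h | h
    · exact ⟨i + 1, hi, le_rfl, h⟩
    · exact ⟨i - 1, by omega, by omega, h⟩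

/-- A leg in the sense of degrees is a leg in the sense of separation. -/
theorem IsLeg.leglike (hG : G.Connected) {u r : V} {p : G.Walk u r} (h : IsLeg G p)
    {x : V} (hx : x ∈ p.support) (hxr : x ≠ r) : Leglike G r x := by
  have hinj := h.1.getVert_injOn
  have hin : ∀ y, Cn G r x y → ∃ i ≤ p.length, y = p.getVert i := by
    intro y hy
    refine hy.induct (P := fun y => ∃ i ≤ p.length, y = p.getVert i) ?_ ?_
    · obtain ⟨i, hi, hil⟩ := SimpleGraph.Walk.mem_support_iff_exists_getVert.1 hx
      exact ⟨i, hil, hi.symm⟩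
    · rintro a b ⟨i, hi, rfl⟩ hab ha hb
      have hi' : i < p.length := lt_of_le_of_ne hi fun he => ha (by
        rw [he, SimpleGraph.Walk.getVert_length])
      obtain ⟨j, hj, -, hb'⟩ := h.adj_mem hi' hab
      exact ⟨j, hj, hb'⟩
  have hlow : ∀ n i, i ≤ p.length → G.dist (p.getVert i) r = n → p.length ≤ n + i := by
    intro n
    induction n with
    | zero =>
      intro i hi hd
      have := hinj (show i ≤ p.length from hi) (show p.length ≤ p.length from le_rfl)
        (((hG.dist_eq_zero_iff).1 hd).trans p.getVert_length.symm)
      omega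
    | succ n ih =>
      intro i hi hd
      have hir : p.getVert i ≠ r := by
        intro he
        rw [he, SimpleGraph.dist_self] at hd
        omega
      have hi' : i < p.length := lt_of_le_of_ne hi fun he => hir (by
        rw [he, SimpleGraph.Walk.getVert_length])
      obtain ⟨w, hw, hwd⟩ := exists_adj_dist hG hir
      obtain ⟨j, hj, hji, rfl⟩ := h.adj_mem hi' hw
      have := ih j hj (by omega)
      omega
  have hdist : ∀ i ≤ p.length, G.dist (p.getVert i) r + i = p.length := by
    intro i hi
    have h1 := hlow _ i hi rfl
    have h2 := SimpleGraph.dist_le (p.drop i)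
    rw [SimpleGraph.Walk.drop_length] at h2
    omega
  refine ⟨hxr, fun y z hy hz hyz => ?_⟩
  obtain ⟨i, hi, rfl⟩ := hin y hy
  obtain ⟨j, hj, rfl⟩ := hin z hz
  have h1 := hdist i hi
  have h2 := hdist j hj
  rw [show i = j by omega]

theorem reachable_induce_iff {r : V} (x y : {x | x ≠ r}) :
    (G.induce {x | x ≠ r}).Reachable x y ↔ Cn G r x y := by
  constructor
  · rintro ⟨p⟩
    refine Cn.of_walk (p.map (SimpleGraph.Embedding.induce _).toHom) fun hr => ?_
    have e := SimpleGraph.Walk.support_map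
      (SimpleGraph.Embedding.induce {x | x ≠ r} : _ ↪g G).toHom p
    obtain ⟨⟨z, hz⟩, -, hzr⟩ := List.mem_map.1 (e ▸ hr)
    exact hz hzr
  · intro h
    obtain ⟨p, hp⟩ := h.exists_walk x.2
    exact ⟨p.induce {x | x ≠ r} fun z hz hzr => hp (hzr ▸ hz)⟩

theorem card_components_eq_two_iff {r x : V} (hx : x ≠ r) :
    Nat.card (G.induce {x | x ≠ r}).ConnectedComponent = 2 ↔
      (∃ y, y ≠ r ∧ ¬ Cn G r x y) ∧
        ∀ y z, y ≠ r → z ≠ r → ¬ Cn G r x y → ¬ Cn G r x z → Cn G r y z := by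
  have hmk : ∀ a b : {x | x ≠ r}, (G.induce {x | x ≠ r}).connectedComponentMk a =
      (G.induce {x | x ≠ r}).connectedComponentMk b ↔ Cn G r a b := fun a b => by
    rw [SimpleGraph.ConnectedComponent.eq, reachable_induce_iff]
  rw [Nat.card_eq_two_iff' ((G.induce {x | x ≠ r}).connectedComponentMk ⟨x, hx⟩)]
  constructor
  · rintro ⟨C, hC, huniq⟩
    have key : ∀ y (hy : y ≠ r), ¬ Cn G r x y →
        (G.induce {x | x ≠ r}).connectedComponentMk ⟨y, hy⟩ = C := fun y hy h =>
      huniq _ fun he => h ((hmk _ _).1 he).symm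
    refine ⟨?_, fun y z hy hz h1 h2 =>
      (hmk ⟨y, hy⟩ ⟨z, hz⟩).1 ((key y hy h1).trans (key z hz h2).symm)⟩
    induction C using SimpleGraph.ConnectedComponent.ind with
    | h y => exact ⟨y, y.2, fun h => hC ((hmk _ _).2 h.symm)⟩
  · rintro ⟨⟨y, hy, hxy⟩, h⟩
    refine ⟨(G.induce {x | x ≠ r}).connectedComponentMk ⟨y, hy⟩,
      fun he => hxy ((hmk _ _).1 he).symm, fun C hC => ?_⟩
    induction C using SimpleGraph.ConnectedComponent.ind with
    | h z => exact (hmk z ⟨y, hy⟩).2 (h z y z.2 hy (fun h' => hC ((hmk _ _).2 h'.symm)) hxy)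

theorem hooked_iff [Finite V] (hG : G.Connected) {x r : V} (hx : x ≠ r) :
    Hooked G x r ↔ ∃ (u : V) (p : G.Walk u r), IsHookedLeg G p ∧ x ∈ p.support := by
  constructor
  · rintro ⟨h1, h2, h3⟩
    obtain ⟨u, p, hp, hxp⟩ := h1.exists_isLeg hG h2
    exact ⟨u, p, ⟨hp, (card_components_eq_two_iff hx).2 h3⟩, hxp⟩
  · rintro ⟨u, p, ⟨h1, h2⟩, hxp⟩
    exact ⟨h1.leglike hG hxp hx, h1.2.2.1, (card_components_eq_two_iff hx).1 h2⟩

theorem isEBC_iff [Finite V] (hG : G.Connected) (S : Set V) :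
    IsEBC G S ↔ ∃ B, IsBlk G B ∧ S = ext G B := by
  unfold IsEBC
  refine exists_congr fun B => ?_
  rw [isBiconnectedComponent_iff hG]
  refine and_congr_right fun hB => ?_
  have : B ∪ {x | ∃ (u r : V) (p : G.Walk u r), IsHookedLeg G p ∧ r ∈ B ∧ x ∈ p.support}
      = ext G B := by
    ext x
    constructor
    · rintro (h | ⟨u, r, p, hp, hr, hx⟩)
      · exact Or.inl h
      · by_cases hxr : x = r
        · exact Or.inl (hxr ▸ hr)
        · exact Or.inr ⟨r, hr, (hooked_iff hG hxr).2 ⟨u, p, hp, hx⟩⟩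
    · rintro (h | ⟨r, hr, h⟩)
      · exact Or.inl h
      · obtain ⟨u, p, hp, hx⟩ := (hooked_iff hG h.1.1).1 h
        exact Or.inr ⟨u, r, p, hp, hr, hx⟩
  rw [this]

end Char

/-! ### A criterion for resolving sets -/

section Local

variable {V : Type*} {G : SimpleGraph V}

/-- Some vertex of `R` has different distances to `u` and to `v`. -/
def Res (G : SimpleGraph V) (R : Set V) (u v : V) : Prop := ∃ w ∈ R, G.dist u w ≠ G.dist v w

theorem not_res {R : Set V} {u v : V} : ¬ Res G R u v ↔ ∀ w ∈ R, G.dist u w = G.dist v w := by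
  simp [Res]

theorem dist_eq_succ (hG : G.Connected) {c u w : V} (h : G.Adj c u) (hn : ¬ Cn G c u w) :
    G.dist u w = 1 + G.dist c w := by
  rw [dist_of_not_cn hG hn, SimpleGraph.dist_eq_one_iff_adj.2 h.symm]

/-- If the component of `x` in `G - c` is not a leg, then two of its vertices `y` and `z` are
equally far from `c` and have a common neighbor `p` that is closer to `c`. They are taken as close
to `c` as possible, so that no vertex beyond them can be reached around `p`. -/
theorem exists_fork (hG : G.Connected) {c x : V} (hx : x ≠ c) (h : ¬ Leglike G c x) :
    ∃ p y z, y ≠ z ∧ G.Adj p y ∧ G.Adj p z ∧ Cn G c x y ∧ Cn G c x z ∧ (p = c ∨ Cn G c x p) ∧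
      G.dist y c = G.dist p c + 1 ∧ G.dist z c = G.dist p c + 1 ∧
      (∀ t, Cn G p y t ∨ Cn G p z t → Cn G c x t ∧ G.dist p c < G.dist t c) := by
  classical
  have hex : ∃ n y z, Cn G c x y ∧ Cn G c x z ∧ y ≠ z ∧ G.dist y c = n ∧ G.dist z c = n := by
    unfold Leglike at h
    push Not at h
    obtain ⟨y, z, h1, h2, h3, h4⟩ := h hx
    exact ⟨_, y, z, h1, h2, h4, rfl, h3.symm⟩
  obtain ⟨y, z, hy, hz, hyz, hyd, hzd⟩ := Nat.find_spec hex
  have hmin : ∀ a b, Cn G c x a → Cn G c x b → G.dist a c = G.dist b c →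
      G.dist a c < Nat.find hex → a = b := by
    intro a b ha hb hab hlt
    by_contra hne
    exact Nat.find_min hex hlt ⟨a, b, ha, hb, hne, rfl, hab.symm⟩
  have hyc : y ≠ c := hy.ne_of_ne hx
  have hzc : z ≠ c := hz.ne_of_ne hx
  obtain ⟨p, hyp, hpd⟩ := exists_adj_dist hG hyc
  obtain ⟨q, hzq, hqd⟩ := exists_adj_dist hG hzc
  have hp : p = c ∨ Cn G c x p := by
    by_cases hpc : p = c
    · exact Or.inl hpc
    · exact Or.inr (hy.trans (Cn.of_adj hyp hyc hpc))
  have hq : q = c ∨ Cn G c x q := by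
    by_cases hqc : q = c
    · exact Or.inl hqc
    · exact Or.inr (hz.trans (Cn.of_adj hzq hzc hqc))
  -- by minimality, the neighbors of `y` and `z` closer to `c` agree
  have hpq : p = q := by
    rcases hp with hp | hp <;> rcases hq with hq | hq
    · rw [hp, hq]
    · subst hp
      rw [SimpleGraph.dist_self] at hpd
      have := one_le_dist hG (hq.ne_of_ne hx)
      omega
    · subst hq
      rw [SimpleGraph.dist_self] at hqd
      have := one_le_dist hG (hp.ne_of_ne hx)
      omega
    · exact hmin p q hp hq (by omega) (by omega)
  subst hpq
  have hbelow : ∀ a, Cn G c x a → G.dist p c < G.dist a c → ∀ t, Cn G p a t →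
      Cn G c x t ∧ G.dist p c < G.dist t c := by
    intro a ha had t ht
    refine ht.induct (P := fun t => Cn G c x t ∧ G.dist p c < G.dist t c) ⟨ha, had⟩ ?_
    rintro b d ⟨hb1, hb2⟩ hbd hbp hdp
    have h1 := dist_adj_le hG (c := c) hbd
    have hdc : d ≠ c := by
      rintro rfl
      rw [SimpleGraph.dist_self] at h1
      exact hdp ((hG.dist_eq_zero_iff).1 (by omega)).symm
    have hd : Cn G c x d := hb1.trans (Cn.of_adj hbd (hb1.ne_of_ne hx) hdc)
    refine ⟨hd, lt_of_le_of_ne (by omega) fun he => hdp ?_⟩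
    rcases hp with hp | hp
    · subst hp
      rw [SimpleGraph.dist_self] at he
      exact absurd ((hG.dist_eq_zero_iff).1 he.symm) hdp
    · exact hmin d p hd hp he.symm (by omega)
  exact ⟨p, y, z, hyz, hyp.symm, hzq.symm, hy, hz, hp, by omega, by omega, fun t ht =>
    ht.elim (hbelow y hy (by omega) t) (hbelow z hz (by omega) t)⟩

/-- Two neighbors of `p` that are connected in `G - p` lie on a cycle. -/
theorem nosep_of_fork {p y z : V} (hy : G.Adj p y) (hz : G.Adj p z) (h : Cn G p y z) :
    Nosep G y z :=
  Nosep.of_common (Nosep.of_adj hy.symm) (Nosep.of_adj hz.symm) h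

theorem exists_blk_of_fork {p y z : V} (hyz : y ≠ z) (hy : G.Adj p y) (hz : G.Adj p z)
    (h : Cn G p y z) : ∃ B, IsBlk G B ∧ y ∈ B ∧ z ∈ B ∧ p ∈ B :=
  IsBlk.of_triple hyz hy.ne hz.ne (nosep_of_fork hy hz h) (Nosep.of_adj hy) (Nosep.of_adj hz)

section Criterion

variable {R : Set V} (hG : G.Connected)
  (hA : ∀ c u v, G.Adj c u → G.Adj c v → ¬ Cn G c u v → Res G R u v)
  (hB : ∀ B, IsBlk G B → ∀ u ∈ ext G B, ∀ v ∈ ext G B, u ≠ v → Res G R u v)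
include hG hA hB

theorem leglike_of_free_aux {c x : V} (hx : x ≠ c) (hfree : ∀ w ∈ R, ¬ Cn G c x w) :
    Leglike G c x := by
  by_contra hl
  obtain ⟨p, y, z, hyz, hpy, hpz, hy, hz, -, -, -, hb⟩ := exists_fork hG hx hl
  have hres : Res G R y z := by
    by_cases h : Cn G p y z
    · obtain ⟨B, hBk, h1, h2, -⟩ := exists_blk_of_fork hyz hpy hpz h
      exact hB B hBk y (Or.inl h1) z (Or.inl h2) hyz
    · exact hA p y z hpy hpz h
  obtain ⟨w, hw, hd⟩ := hres
  rw [dist_eq_succ hG hpy fun h => hfree w hw (hb w (Or.inl h)).1,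
    dist_eq_succ hG hpz fun h => hfree w hw (hb w (Or.inr h)).1] at hd
  exact hd rfl

omit hB in
/-- At most one component of `G - c` contains a vertex that sees all of `R` through `c`. -/
theorem not_both_through {c u v : V} (huc : u ≠ c) (hvc : v ≠ c) (huv : ¬ Cn G c u v)
    (hu : ∀ w ∈ R, Cn G c u w → G.dist u w = G.dist u c + G.dist c w)
    (hv : ∀ w ∈ R, Cn G c v w → G.dist v w = G.dist v c + G.dist c w) : False := by
  have key : ∀ u, u ≠ c → (∀ w ∈ R, Cn G c u w → G.dist u w = G.dist u c + G.dist c w) →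
      ∃ a, G.Adj c a ∧ Cn G c a u ∧ ∀ w ∈ R, G.dist a w = 1 + G.dist c w := by
    intro u huc hu
    obtain ⟨a, hca, had⟩ := exists_adj_dist hG huc.symm
    refine ⟨a, hca, ?_, fun w hw => ?_⟩
    · rw [SimpleGraph.dist_comm (u := a), SimpleGraph.dist_comm (u := c)] at had
      exact (Cn.of_dist_lt hG (by omega)).symm
    · have h1 : G.dist u w = G.dist u c + G.dist c w := by
        by_cases h : Cn G c u w
        · exact hu w hw h
        · exact dist_of_not_cn hG h
      have h2 : G.dist u w ≤ G.dist u a + G.dist a w := hG.dist_triangle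
      have h3 := dist_adj_le hG (c := w) hca.symm
      rw [SimpleGraph.dist_comm (u := a), SimpleGraph.dist_comm (u := c)] at had
      omega
  obtain ⟨a, ha, hau, had⟩ := key u huc hu
  obtain ⟨b, hb, hbv, hbd⟩ := key v hvc hv
  obtain ⟨w, hw, hd⟩ := hA c a b ha hb fun h => huv (hau.symm.trans (h.trans hbv))
  exact hd ((had w hw).trans (hbd w hw).symm)

omit hB in
/-- If a vertex `c` separates an unresolved pair, then all of `R` lies on one side. -/
theorem sep_dichotomy {c u v : V} (huc : u ≠ c) (hvc : v ≠ c) (huv : ¬ Cn G c u v)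
    (hun : ∀ w ∈ R, G.dist u w = G.dist v w) :
    (∀ w ∈ R, Cn G c v w) ∨ (∀ w ∈ R, Cn G c u w) := by
  have key : ∀ u v, u ≠ c → v ≠ c → ¬ Cn G c u v → (∀ w ∈ R, G.dist u w = G.dist v w) →
      ∀ w ∈ R, Cn G c v w → G.dist v w ≠ G.dist v c + G.dist c w → ∀ w ∈ R, Cn G c v w := by
    intro u v huc hvc huv hun w hw hvw hne w' hw'
    have h1 := dist_of_not_cn hG (fun h : Cn G c u w => huv (h.trans hvw.symm))
    have h2 := hun w hw
    have h3 : G.dist v w ≤ G.dist v c + G.dist c w := hG.dist_triangle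
    by_contra hn
    have h4 := dist_of_not_cn hG hn
    have h5 := hun w' hw'
    have h6 : G.dist u w' ≤ G.dist u c + G.dist c w' := hG.dist_triangle
    omega
  by_cases h1 : ∀ w ∈ R, Cn G c u w → G.dist u w = G.dist u c + G.dist c w
  · by_cases h2 : ∀ w ∈ R, Cn G c v w → G.dist v w = G.dist v c + G.dist c w
    · exact (not_both_through hG hA huc hvc huv h1 h2).elim
    · push Not at h2
      obtain ⟨w, hw, hvw, hne⟩ := h2
      exact Or.inl (key u v huc hvc huv hun w hw hvw hne)
  · push Not at h1
    obtain ⟨w, hw, huw, hne⟩ := h1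
    exact Or.inr (key v u hvc huc (fun h => huv h.symm) (fun w hw => (hun w hw).symm) w hw huw hne)

/-- One end of an unresolved pair `u`, `v` is pulled towards the other end: it is kept, or replaced
by the root `a` of the hooked leg on which it lies. All vertices that separate `u` from `v` and
have `R` on the side of `v` are passed. -/
theorem exists_pull [Finite V] (hR : R.Nonempty) {u v : V} (huv : u ≠ v)
    (hun : ∀ w ∈ R, G.dist u w = G.dist v w) :
    ∃ a, (a = u ∨ Hooked G u a ∧ a ≠ v ∧ ¬ Cn G a u v ∧ ∀ w ∈ R, Cn G a v w) ∧
      ∀ c, c ≠ u → c ≠ v → ¬ Cn G c u v → (∀ w ∈ R, Cn G c v w) →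
        a ≠ u ∧ G.dist u c ≤ G.dist u a := by
  by_cases hex : ∃ c, c ≠ u ∧ c ≠ v ∧ ¬ Cn G c u v ∧ ∀ w ∈ R, Cn G c v w
  swap
  · exact ⟨u, Or.inl rfl, fun c h1 h2 h3 h4 => absurd ⟨c, h1, h2, h3, h4⟩ hex⟩
  obtain ⟨a, ⟨hau, hav, hsep, hRa⟩, hmax⟩ := Set.exists_max_image
    {c | c ≠ u ∧ c ≠ v ∧ ¬ Cn G c u v ∧ ∀ w ∈ R, Cn G c v w} (fun c => G.dist u c)
    (Set.toFinite _) hex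
  refine ⟨a, Or.inr ⟨?_, hav, hsep, hRa⟩, fun c h1 h2 h3 h4 => ⟨hau, hmax c ⟨h1, h2, h3, h4⟩⟩⟩
  have hfree : ∀ w ∈ R, ¬ Cn G a u w := fun w hw h => hsep (h.trans (hRa w hw).symm)
  have hleg : Leglike G a u := leglike_of_free_aux hG hA hB hau.symm hfree
  -- there are only two components
  have hside : ∀ y, y ≠ a → ¬ Cn G a u y → Cn G a v y := by
    intro y hy huy
    by_contra hvy
    exact not_both_through hG hA hau.symm hy huy (fun w hw h => absurd h (hfree w hw))
      (fun w hw h => absurd ((hRa w hw).trans h.symm) hvy)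
  refine ⟨hleg, ?_, ⟨v, hav.symm, hsep⟩, fun y z hy hz h1 h2 =>
    (hside y hy h1).symm.trans (hside z hz h2)⟩
  -- otherwise the neighbor `b` of `a` towards `v` could replace `a`
  by_contra hdeg
  obtain ⟨b, hab, hbv⟩ := exists_adj_cn hG (Ne.symm hav)
  obtain ⟨e, hae, heu⟩ := exists_adj_cn hG (Ne.symm hau)
  have heb : e ≠ b := by
    rintro rfl
    exact hsep (heu.symm.trans hbv)
  have honly : ∀ y, G.Adj a y → Cn G a y v → y = b := by
    intro y hay hyv
    by_contra hyb
    have hye : e ≠ y := by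
      rintro rfl
      exact hsep (heu.symm.trans hyv)
    exact hdeg ((Set.two_lt_ncard_iff (Set.toFinite _)).2
      ⟨e, b, y, hae, hab, hay, heb, hye, fun h => hyb h.symm⟩)
  have hpass : ∀ y z, Cn G a y v → y ≠ a → Cn G b y z → z ≠ a ∧ Cn G a z v := by
    intro y z hy hya hyz
    refine hyz.induct (P := fun z => z ≠ a ∧ Cn G a z v) ⟨hya, hy⟩ ?_
    rintro s t ⟨h1, h2⟩ hst hsb htb
    have hta : t ≠ a := by
      rintro rfl
      exact hsb (honly s hst.symm h2)
    exact ⟨hta, (Cn.of_adj hst.symm hta h1).trans h2⟩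
  have hub : ¬ Cn G a u b := fun h => hsep (h.trans hbv)
  have hdub := dist_of_not_cn hG hub
  rw [SimpleGraph.dist_eq_one_iff_adj.2 hab] at hdub
  by_cases hbv' : b = v
  · subst hbv'
    obtain ⟨w, hw⟩ := hR
    have h1 := dist_of_not_cn hG (hfree w hw)
    have h2 : G.dist a w = 1 + G.dist b w := by
      have hwa : w ≠ a := fun h => by subst h; exact hav ((hRa _ hw).eq_of_right).symm
      obtain ⟨y, hay, hyd⟩ := exists_adj_dist hG hwa.symm
      have hyw : Cn G a y w := by
        rw [SimpleGraph.dist_comm (u := y), SimpleGraph.dist_comm (u := a)] at hyd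
        exact (Cn.of_dist_lt hG (by omega)).symm
      rw [honly y hay (hyw.trans (hRa w hw).symm)] at hyd
      omega
    have h3 := hun w hw
    omega
  · have hbu : b ≠ u := by
      rintro rfl
      exact hub (Cn.refl _ _)
    have hsepb : ¬ Cn G b u v := fun h =>
      hsep (hpass v u (Cn.refl _ _) (Ne.symm hav) h.symm).2
    have hRb : ∀ w ∈ R, Cn G b v w := by
      rcases sep_dichotomy hG hA hbu.symm (Ne.symm hbv') hsepb hun with h | h
      · exact h
      · obtain ⟨w, hw⟩ := hR
        have hwa : w ≠ a := fun h => by subst h; exact hav ((hRa _ hw).eq_of_right).symm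
        exact absurd (hpass w u (hRa w hw).symm hwa (h w hw).symm).2 hsep
    have := hmax b ⟨hbu, hbv', hsepb, hRb⟩
    omega

/-- Criterion: a nonempty set resolves `G` if it resolves all pairs inside the EBCs, and all pairs
of neighbors of a cut vertex that this vertex separates. -/
theorem res_of_criterion [Finite V] (hR : R.Nonempty) {u v : V} (huv : u ≠ v) : Res G R u v := by
  by_contra hcon
  rw [not_res] at hcon
  have hcon' : ∀ w ∈ R, G.dist v w = G.dist u w := fun w hw => (hcon w hw).symm
  obtain ⟨a, ha, hamax⟩ := exists_pull hG hA hB hR huv hcon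
  obtain ⟨b, hb, hbmax⟩ := exists_pull hG hA hB hR huv.symm hcon'
  obtain ⟨w0, hw0⟩ := hR
  -- the gates `a` and `b` do not pass each other
  have hcross : ∀ {u v a b : V}, (Hooked G u a ∧ a ≠ v ∧ ¬ Cn G a u v ∧ ∀ w ∈ R, Cn G a v w) →
      (b = v ∨ Hooked G v b ∧ b ≠ u ∧ ¬ Cn G b v u ∧ ∀ w ∈ R, Cn G b u w) → ¬ Cn G a u b := by
    rintro u v a b ⟨h1, h2, h3, h4⟩ (rfl | ⟨h5, h6, h7, h8⟩) h
    · exact h3 h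
    · have key : ∀ y, Cn G a v y → Cn G b y a := by
        intro y hy
        have hd := dist_of_not_cn hG (fun h' : Cn G a y b => h3 (h.trans (h'.symm.trans hy.symm)))
        have hab : a ≠ b := fun hab => h1.1.1 (by subst hab; exact h.eq_of_right)
        have := one_le_dist hG hab
        exact Cn.of_dist_lt hG (by omega)
      have h9 := (key v (Cn.refl _ _)).trans (key w0 (h4 w0 hw0)).symm
      exact h7 (h9.trans (h8 w0 hw0).symm)
  have hab : a ≠ b := by
    rintro rfl
    rcases ha with rfl | ha
    · rcases hb with hb | hb
      · exact huv hb
      · exact hb.2.1 rfl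
    · rcases hb with rfl | hb
      · exact ha.2.1 rfl
      · exact ha.2.2.1 ((hb.2.2.2 w0 hw0).trans (ha.2.2.2 w0 hw0).symm)
  have hnear : ∀ {u v a b c : V}, (a = u ∨ Hooked G u a ∧ a ≠ v ∧ ¬ Cn G a u v ∧
      ∀ w ∈ R, Cn G a v w) →
      (b = v ∨ Hooked G v b ∧ b ≠ u ∧ ¬ Cn G b v u ∧ ∀ w ∈ R, Cn G b u w) → c ≠ a → c ≠ b →
      ¬ Cn G c a b → Cn G c u a ∧ c ≠ u ∧ G.dist u c = G.dist u a + G.dist a c := by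
    rintro u v a b c ha hb hca hcb hsep
    rcases ha with rfl | ha
    · exact ⟨Cn.refl _ _, hca, by simp⟩
    · have h1 := dist_of_not_cn hG (hcross ha hb)
      have h2 : ¬ Cn G a u c := by
        intro h
        have h3 := dist_of_not_cn hG (fun h' : Cn G a c b => hcross ha hb (h.trans h'))
        have := one_le_dist hG hca
        refine hsep (Cn.of_dist_lt hG (c := c) (x := b) (w := a) ?_).symm
        rw [SimpleGraph.dist_comm (u := b), SimpleGraph.dist_comm (u := b)]
        omega
      have h3 := dist_of_not_cn hG h2
      have := one_le_dist hG hca.symm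
      refine ⟨Cn.of_dist_lt hG (by omega), ?_, h3⟩
      rintro rfl
      exact h2 (Cn.refl _ _)
  have hnosep : Nosep G a b := by
    intro c hca hcb
    by_contra hsep
    obtain ⟨h1, h2, h3⟩ := hnear ha hb hca hcb hsep
    obtain ⟨h4, h5, h6⟩ := hnear hb ha hcb hca (fun h => hsep h.symm)
    have h7 : ¬ Cn G c u v := fun h => hsep (h1.symm.trans (h.trans h4))
    rcases sep_dichotomy hG hA h2.symm h5.symm h7 hcon with h8 | h8
    · have h9 := hamax c h2 h5 h7 h8
      have := one_le_dist hG hca.symm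
      omega
    · have h9 := hbmax c h5 h2 (fun h => h7 h.symm) h8
      have := one_le_dist hG hcb.symm
      omega
  by_cases hthird : ∃ x, x ≠ a ∧ x ≠ b ∧ Nosep G x a ∧ Nosep G x b
  · obtain ⟨x, h1, h2, h3, h4⟩ := hthird
    obtain ⟨B, hBk, haB, hbB, -⟩ := IsBlk.of_triple hab h1 h2 hnosep h3 h4
    have hu : u ∈ ext G B := by
      rcases ha with rfl | ha
      exacts [Or.inl haB, Or.inr ⟨a, haB, ha.1⟩]
    have hv : v ∈ ext G B := by
      rcases hb with rfl | hb
      exacts [Or.inl hbB, Or.inr ⟨b, hbB, hb.1⟩]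
    obtain ⟨w, hw, hd⟩ := hB B hBk u hu v hv huv
    exact hd (hcon w hw)
  -- without a third vertex between them, `a` and `b` are `u` and `v`
  have hself : ∀ {u v a b : V}, (a = u ∨ Hooked G u a ∧ a ≠ v ∧ ¬ Cn G a u v ∧
      ∀ w ∈ R, Cn G a v w) →
      (b = v ∨ Hooked G v b ∧ b ≠ u ∧ ¬ Cn G b v u ∧ ∀ w ∈ R, Cn G b u w) → a ≠ b →
      Nosep G a b → (¬ ∃ x, x ≠ a ∧ x ≠ b ∧ Nosep G x a ∧ Nosep G x b) → a = u := by
    intro u v a b ha hb hab hn hthird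
    refine ha.resolve_right fun ha => hthird ?_
    have hub := hcross ha hb
    obtain ⟨y1, y2, y3, hy1, hy2, hy3, h12, h13, h23⟩ :=
      (Set.two_lt_ncard_iff (Set.toFinite _)).1 ha.1.2.1
    have hone : ∀ y y', G.Adj a y → G.Adj a y' → Cn G a u y → Cn G a u y' → y = y' := by
      intro y y' hy hy' h h'
      refine ha.1.1.2 y y' h h' ?_
      rw [SimpleGraph.dist_eq_one_iff_adj.2 hy.symm, SimpleGraph.dist_eq_one_iff_adj.2 hy'.symm]
    have hz : ∃ z, G.Adj a z ∧ z ≠ b ∧ ¬ Cn G a u z := by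
      by_contra hno
      push Not at hno
      have p1 := hno y1 hy1
      have p2 := hno y2 hy2
      have p3 := hno y3 hy3
      by_cases e1 : y1 = b
      · exact h23 (hone y2 y3 hy2 hy3 (p2 fun h => h12 (e1.trans h.symm))
          (p3 fun h => h13 (e1.trans h.symm)))
      · by_cases e2 : y2 = b
        · exact h13 (hone y1 y3 hy1 hy3 (p1 e1) (p3 fun h => h23 (e2.trans h.symm)))
        · exact h12 (hone y1 y2 hy1 hy2 (p1 e1) (p2 e2))
    obtain ⟨z, haz, hzb, hzu⟩ := hz
    have h1 : Cn G a z b := ha.1.2.2.2 z b haz.ne' hab.symm hzu hub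
    exact ⟨z, haz.ne', hzb, Nosep.of_adj haz.symm,
      Nosep.of_common (Nosep.of_adj haz.symm) hn.symm h1⟩
  have ea := hself ha hb hab hnosep hthird
  have eb := hself hb ha hab.symm hnosep.symm
      (fun ⟨x, h1, h2, h3, h4⟩ => hthird ⟨x, h2, h1, h4, h3⟩)
  subst ea eb
  -- the neighbor of `u` towards a vertex of `R` is a third vertex
  have hdw := hcon w0 hw0
  have hw : a ≠ w0 := by
    rintro rfl
    rw [SimpleGraph.dist_self] at hdw
    exact hab ((hG.dist_eq_zero_iff).1 hdw.symm).symm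
  obtain ⟨y, hay, hyd⟩ := exists_adj_dist hG hw
  have h1 : Cn G a w0 y := Cn.of_dist_lt hG (by
    rw [SimpleGraph.dist_comm (u := w0), SimpleGraph.dist_comm (u := w0)]; omega)
  have h2 : Cn G a w0 b := by
    by_contra hn
    have h3 := dist_of_not_cn hG hn
    have := one_le_dist hG hab
    rw [SimpleGraph.dist_comm (u := w0), SimpleGraph.dist_comm (u := w0)] at h3
    omega
  refine hthird ⟨y, hay.ne', ?_, Nosep.of_adj hay.symm,
    Nosep.of_common (Nosep.of_adj hay.symm) hnosep.symm (h1.symm.trans h2)⟩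
  rintro rfl
  omega

end Criterion

end Local

/-! ### Local conditions for resolving sets -/

section Local

variable {V : Type*} {G : SimpleGraph V}

/-- The vertices that stand for `R` in the EBC of the block `B`: those of `R`, and all joints, which
stand for the vertices of `R` beyond them. -/
def stand (G : SimpleGraph V) (R B : Set V) : Set V := {w | w ∈ ext G B ∧ (Joint G w ∨ w ∈ R)}

/-- The joint `c` of the block `B` has a neighbor in `B` from which all that stands for `R` is seen
through `c`. -/
def Bad (G : SimpleGraph V) (R B : Set V) (c : V) : Prop :=
  Joint G c ∧ c ∈ B ∧
    ∃ u ∈ ext G B, G.Adj c u ∧ ∀ w ∈ stand G R B, w ≠ c → G.dist u w = 1 + G.dist c w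

/-- The neighbor `u` of the joint `c` lies on a leg at `c`. -/
def Leg (G : SimpleGraph V) (c u : V) : Prop := Joint G c ∧ G.Adj c u ∧ Leglike G c u

/-- Local conditions for a resolving set: what stands for `R` in an EBC resolves it, and at each
joint at most one EBC is bad or one leg is disjoint from `R`. -/
structure Local (G : SimpleGraph V) (R : Set V) : Prop where
  ok : ∀ B, IsBlk G B → ∀ u ∈ ext G B, ∀ v ∈ ext G B, u ≠ v → Res G (stand G R B) u v
  legs : ∀ c u v, Leg G c u → Leg G c v → u ≠ v → (∃ w ∈ R, Cn G c u w) ∨ ∃ w ∈ R, Cn G c v w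
  bad_leg : ∀ B, IsBlk G B → ∀ c u, Bad G R B c → Leg G c u → ∃ w ∈ R, Cn G c u w
  bads : ∀ B B', IsBlk G B → IsBlk G B' → ∀ c, Bad G R B c → Bad G R B' c → B = B'

section Fin

variable [Finite V] (hG : G.Connected)
include hG

/-- A vertex outside an EBC is seen from the EBC through one of its joints. -/
theorem Joint.dist_ext {B : Set V} (hB : IsBlk G B) {w : V} (hw : w ∉ ext G B) :
    ∃ g ∈ B, Joint G g ∧ w ≠ g ∧ ∀ u ∈ ext G B, G.dist u w = G.dist u g + G.dist g w := by
  obtain ⟨g, hg, hj, hwg, h⟩ := hB.exists_joint hG hw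
  refine ⟨g, hg, hj, hwg, fun u hu => ?_⟩
  by_cases hug : u = g
  · subst hug; simp
  · exact dist_of_not_cn hG (h u hu hug)

/-- If a block is bad at `c`, then all of `R` is seen through `c` from some neighbor of `c`. -/
theorem Bad.exists_dist {R B : Set V} (hB : IsBlk G B) {c : V} (h : Bad G R B c) :
    ∃ u ∈ ext G B, G.Adj c u ∧ ∀ w ∈ R, G.dist u w = 1 + G.dist c w := by
  obtain ⟨hj, hc, u, hu, hcu, hd⟩ := h
  refine ⟨u, hu, hcu, fun w hw => ?_⟩
  have huc := SimpleGraph.dist_eq_one_iff_adj.2 hcu.symm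
  by_cases hwB : w ∈ ext G B
  · by_cases hwc : w = c
    · subst hwc; simp [huc]
    · exact hd w ⟨hwB, Or.inr hw⟩ hwc
  · obtain ⟨g, hg, hgj, -, hgd⟩ := Joint.dist_ext hG hB hwB
    by_cases hgc : g = c
    · subst hgc; rw [hgd u hu, huc]
    · rw [hgd u hu, hgd c (Or.inl hc), hd g ⟨Or.inl hg, Or.inl hgj⟩ hgc]; ring

/-- A resolving set satisfies the local conditions. -/
theorem local_of_res {R : Set V} (hR : ∀ u v, u ≠ v → Res G R u v) : Local G R where
  ok B hB u hu v hv huv := by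
    obtain ⟨w, hw, hd⟩ := hR u v huv
    by_cases hwB : w ∈ ext G B
    · exact ⟨w, ⟨hwB, Or.inr hw⟩, hd⟩
    · obtain ⟨g, hg, hgj, -, hgd⟩ := Joint.dist_ext hG hB hwB
      refine ⟨g, ⟨Or.inl hg, Or.inl hgj⟩, fun h => hd ?_⟩
      rw [hgd u hu, hgd v hv, h]
  legs c u v hu hv huv := by
    by_contra hcon
    push Not at hcon
    obtain ⟨w, hw, hd⟩ := hR u v huv
    rw [dist_eq_succ hG hu.2.1 (hcon.1 w hw), dist_eq_succ hG hv.2.1 (hcon.2 w hw)] at hd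
    exact hd rfl
  bad_leg B hB c u hb hu := by
    by_contra hcon
    push Not at hcon
    obtain ⟨a, ha, hca, had⟩ := hb.exists_dist hG hB
    have hau : a ≠ u := by
      rintro rfl
      exact hb.1.leg_not_mem_ext hG hB hu.2.2 ha
    obtain ⟨w, hw, hd⟩ := hR a u hau
    rw [had w hw, dist_eq_succ hG hu.2.1 (hcon w hw)] at hd
    exact hd rfl
  bads B B' hB hB' c hb hb' := by
    obtain ⟨a, ha, hca, had⟩ := hb.exists_dist hG hB
    obtain ⟨a', ha', hca', had'⟩ := hb'.exists_dist hG hB'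
    have haa : a = a' := by
      by_contra hne
      obtain ⟨w, hw, hd⟩ := hR a a' hne
      exact hd ((had w hw).trans (had' w hw).symm)
    subst haa
    by_cases hj : Joint G a
    · exact hB.eq hB' hca.ne hb.2.1 (hj.mem_of_mem_ext hG ha) hb'.2.1 (hj.mem_of_mem_ext hG ha')
    · exact hB.eq_of_mem_ext hG hB' ha ha' hj

omit hG in
/-- A vertex that separates three of its neighbors from each other is a joint. -/
theorem joint_of_three {p y z t : V} (hy : G.Adj p y) (hz : G.Adj p z) (ht : G.Adj p t)
    (hyz : ¬ Cn G p y z) (hyt : ¬ Cn G p y t) (hzt : ¬ Cn G p z t) : Joint G p := by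
  have h1 : y ≠ z := by rintro rfl; exact hyz (Cn.refl _ _)
  have h2 : y ≠ t := by rintro rfl; exact hyt (Cn.refl _ _)
  have h3 : z ≠ t := by rintro rfl; exact hzt (Cn.refl _ _)
  refine ⟨(Set.two_lt_ncard_iff (Set.toFinite _)).2 ⟨y, z, t, hy, hz, ht, h1, h2, h3⟩,
    ⟨y, z, hy.ne', hz.ne', hyz⟩, fun x hx => ?_⟩
  have key : ∀ a b, G.Adj p a → G.Adj p b → ¬ Cn G p a b → Cn G p x a ∨ Cn G p x b := by
    intro a b ha hb hab
    by_contra hcon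
    push Not at hcon
    exact hab (hx.2.2.2 a b ha.ne' hb.ne' hcon.1 hcon.2)
  rcases key y z hy hz hyz with h | h
  · rcases key z t hz ht hzt with h' | h'
    · exact hyz (h.symm.trans h')
    · exact hyt (h.symm.trans h')
  · rcases key y t hy ht hyt with h' | h'
    · exact hyz (h'.symm.trans h)
    · exact hzt (h.symm.trans h')

omit [Finite V] in
/-- If all components at a joint except that of `b` are legs, then one of them meets `R`. -/
theorem Local.exists_beyond_aux {R : Set V} (hL : Local G R) {g b : V} (hg : Joint G g)
    (hb : b ≠ g) (hleg : ∀ t, t ≠ g → ¬ Cn G g b t → Leglike G g t) :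
    ∃ w ∈ R, ¬ Cn G g b w := by
  by_contra hcon
  push Not at hcon
  obtain ⟨t, ht, hbt⟩ : ∃ t, t ≠ g ∧ ¬ Cn G g b t := by
    by_contra hno
    push Not at hno
    obtain ⟨x, y, hx, hy, hxy⟩ := hg.2.1
    exact hxy ((hno x hx).symm.trans (hno y hy))
  obtain ⟨t', ht', hbt', htt'⟩ : ∃ t', t' ≠ g ∧ ¬ Cn G g b t' ∧ ¬ Cn G g t t' := by
    by_contra hno
    push Not at hno
    have key : ∀ y, y ≠ g → ¬ Cn G g t y → Cn G g b y := by
      intro y hy hty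
      by_contra hby
      exact hty (hno y hy hby)
    exact hg.2.2 t ⟨hleg t ht hbt, hg.1, ⟨b, hb, fun h => hbt h.symm⟩,
      fun y z hy hz h1 h2 => (key y hy h1).symm.trans (key z hz h2)⟩
  obtain ⟨u, hu, hut⟩ := exists_adj_cn hG ht
  obtain ⟨u', hu', hut'⟩ := exists_adj_cn hG ht'
  have huu : u ≠ u' := by
    rintro rfl
    exact htt' (hut.symm.trans hut')
  rcases hL.legs g u u' ⟨hg, hu, (hleg t ht hbt).of_cn hut.symm⟩
    ⟨hg, hu', (hleg t' ht' hbt').of_cn hut'.symm⟩ huu with ⟨w, hw, h⟩ | ⟨w, hw, h⟩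
  · exact hbt ((hcon w hw).trans (h.symm.trans hut))
  · exact hbt' ((hcon w hw).trans (h.symm.trans hut'))

/-- Under the local conditions, a component of `G - c` that is disjoint from `R` is a leg. -/
theorem Local.leglike_of_free {R : Set V} (hL : Local G R) :
    ∀ (n : ℕ) (c x : V), {y | Cn G c x y}.ncard = n → x ≠ c → (∀ w ∈ R, ¬ Cn G c x w) →
      Leglike G c x := by
  intro n
  induction n using Nat.strong_induction_on with
  | _ n ih =>
    intro c x hn hx hfree
    by_contra hl
    obtain ⟨p, y, z, hyz, hpy, hpz, hy, hz, hp, hyd, hzd, hb⟩ := exists_fork hG hx hl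
    -- the induction hypothesis, for components inside the given one
    have IH : ∀ q t, Cn G c x q → t ≠ q → (∀ s, Cn G q t s → Cn G c x s) → Leglike G q t := by
      intro q t hq ht hsub
      refine ih _ ?_ q t rfl ht fun w hw h => hfree w hw (hsub w h)
      rw [← hn]
      refine Set.ncard_lt_ncard ⟨hsub, fun h => ?_⟩ (Set.toFinite _)
      exact ht (Cn.eq_of_right (h hq))
    by_cases hcn : Cn G p y z
    · obtain ⟨B, hBk, hyB, hzB, hpB⟩ := exists_blk_of_fork hyz hpy hpz hcn
      obtain ⟨w, ⟨hwB, hw⟩, hd⟩ := hL.ok B hBk y (Or.inl hyB) z (Or.inl hzB) hyz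
      have hin : Cn G p y w ∨ Cn G p z w := by
        by_contra hno
        push Not at hno
        rw [dist_eq_succ hG hpy hno.1, dist_eq_succ hG hpz hno.2] at hd
        exact hd rfl
      obtain ⟨hxw, hpw⟩ := hb w hin
      rcases hw with hw | hw
      · have hwp : w ≠ p := fun h => by rw [h] at hpw; omega
        have hwc : w ≠ c := hxw.ne_of_ne hx
        -- components at `w` that avoid `p` lie inside the given one
        have hsub : ∀ s, s ≠ w → ¬ Cn G w p s → Cn G c x s := by
          intro s hs hps
          by_contra hxs
          have h1 := dist_of_not_cn hG (fun h : Cn G c s w => hxs (hxw.trans h.symm))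
          have h2 := one_le_dist hG hwc
          rw [SimpleGraph.dist_comm (u := c)] at h1
          have h3 : Cn G w s c := Cn.of_dist_lt hG (by omega)
          have h4 : Cn G w c p := Cn.of_dist_lt hG (by
            rw [SimpleGraph.dist_comm (u := c), SimpleGraph.dist_comm (u := c)]; exact hpw)
          exact hps (h3.trans h4).symm
        obtain ⟨w', hw', hpw'⟩ := hL.exists_beyond_aux hG hw hwp.symm (fun t ht hpt =>
          IH w t hxw ht fun s hts => hsub s (hts.ne_of_ne ht) fun h => hpt (h.trans hts.symm))
        by_cases hww : w' = w
        · subst hww; exact hfree _ hw' hxw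
        · exact hfree w' hw' (hsub w' hww hpw')
      · exact hfree w hw hxw
    · have hpc : p ≠ c := by
        rintro rfl
        exact hcn (hy.symm.trans hz)
      have hxp : Cn G c x p := hp.resolve_left hpc
      obtain ⟨t, hpt, htd⟩ := exists_adj_dist hG hpc
      have hyt : ¬ Cn G p y t := fun h => by have := (hb t (Or.inl h)).2; omega
      have hzt : ¬ Cn G p z t := fun h => by have := (hb t (Or.inr h)).2; omega
      have hj := joint_of_three hpy hpz hpt hcn hyt hzt
      have hly := IH p y hxp hpy.ne' fun s hs => (hb s (Or.inl hs)).1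
      have hlz := IH p z hxp hpz.ne' fun s hs => (hb s (Or.inr hs)).1
      rcases hL.legs p y z ⟨hj, hpy, hly⟩ ⟨hj, hpz, hlz⟩ hyz with ⟨w, hw, h⟩ | ⟨w, hw, h⟩
      · exact hfree w hw (hb w (Or.inl h)).1
      · exact hfree w hw (hb w (Or.inr h)).1

theorem Local.leglike {R : Set V} (hL : Local G R) {c x : V} (hx : x ≠ c)
    (hfree : ∀ w ∈ R, ¬ Cn G c x w) : Leglike G c x :=
  hL.leglike_of_free hG _ c x rfl hx hfree

/-- Beyond every joint there are vertices of `R`. This justifies that joints stand for vertices of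
`R` in `stand`. -/
theorem Local.exists_beyond {R : Set V} (hL : Local G R) {g b : V} (hg : Joint G g)
    (hb : b ≠ g) : ∃ w ∈ R, ¬ Cn G g b w := by
  by_contra hcon
  push Not at hcon
  obtain ⟨w, hw, h⟩ := hL.exists_beyond_aux hG hg hb fun t ht hbt =>
    hL.leglike hG ht fun w hw htw => hbt ((hcon w hw).trans htw.symm)
  exact h (hcon w hw)

omit [Finite V] in
/-- If `u` is the only neighbor of `c` in its component, and all of `R` is seen from `u` through
`c`, then the component is disjoint from `R`. -/
theorem free_of_bridge {R : Set V} {c u : V} (hu : G.Adj c u)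
    (hone : ∀ z, G.Adj c z → Cn G c u z → z = u)
    (hd : ∀ w ∈ R, G.dist u w = 1 + G.dist c w) : ∀ w ∈ R, ¬ Cn G c u w := by
  intro w hw h
  have hwc : c ≠ w := (h.ne_of_ne hu.ne').symm
  obtain ⟨z, hz, hzd⟩ := exists_adj_dist hG hwc
  have hzw : Cn G c z w := by
    rw [SimpleGraph.dist_comm (u := z), SimpleGraph.dist_comm (u := c)] at hzd
    exact (Cn.of_dist_lt hG (by omega)).symm
  rw [hone z hz (h.trans hzw.symm)] at hzd
  have := hd w hw
  omega

/-- The local conditions suffice, provided that there is a block or a joint. -/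
theorem Local.res {R : Set V} (hL : Local G R)
    (hX : (∃ B, IsBlk G B) ∨ ∃ c, Joint G c) {u v : V} (huv : u ≠ v) : Res G R u v := by
  have hne : R.Nonempty := by
    rcases hX with ⟨B, hB⟩ | ⟨c, hc⟩
    · by_contra hR
      rw [Set.not_nonempty_iff_eq_empty] at hR
      obtain ⟨a, ha, hau, -⟩ := hB.exists_third u u
      exact (hL.leglike hG hau (by simp [hR])).not_blk hG hB ha
    · obtain ⟨b, -, hb, -⟩ := hc.2.1
      obtain ⟨w, hw, -⟩ := hL.exists_beyond hG hc hb
      exact ⟨w, hw⟩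
  -- pairs inside an EBC: a joint that resolves them is replaced by a vertex of `R` beyond it
  have hB : ∀ B, IsBlk G B → ∀ u ∈ ext G B, ∀ v ∈ ext G B, u ≠ v → Res G R u v := by
    intro B hBk u hu v hv huv
    obtain ⟨w, ⟨hwB, hw⟩, hd⟩ := hL.ok B hBk u hu v hv huv
    rcases hw with hw | hw
    · obtain ⟨b, hb, hbw, -⟩ := hBk.exists_third w w
      obtain ⟨w', hw', hbw'⟩ := hL.exists_beyond hG hw hbw
      have key : ∀ a ∈ ext G B, G.dist a w' = G.dist a w + G.dist w w' := by
        intro a ha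
        by_cases haw : a = w
        · subst haw; simp
        · exact dist_of_not_cn hG fun h =>
            hbw' ((hBk.cn_ext hG hw (Or.inl hb) ha hbw haw).trans h)
      refine ⟨w', hw', fun h => hd ?_⟩
      rw [key u hu, key v hv] at h
      omega
    · exact ⟨w, hw, hd⟩
  refine res_of_criterion hG ?_ hB hne huv
  intro c u v hu hv hsep
  by_contra hun
  rw [not_res] at hun
  have huv : u ≠ v := by rintro rfl; exact hsep (Cn.refl _ _)
  -- if a pair of separated neighbors of `c` is not resolved, both see all of `R` through `c`
  have hsee : ∀ {u v : V}, G.Adj c u → G.Adj c v → ¬ Cn G c u v →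
      (∀ w ∈ R, G.dist u w = G.dist v w) → ∀ w ∈ R, G.dist u w = 1 + G.dist c w := by
    intro u v hu hv hsep hun w hw
    by_cases h : Cn G c u w
    · rw [hun w hw]
      exact dist_eq_succ hG hv fun h' => hsep (h.trans h'.symm)
    · exact dist_eq_succ hG hu h
  have hdu := hsee hu hv hsep hun
  have hdv := hsee hv hu (fun h => hsep h.symm) fun w hw => (hun w hw).symm
  by_cases hj : Joint G c
  -- at a joint, each of the two lies on a leg disjoint from `R` or makes a block bad
  · have key : ∀ u, G.Adj c u → (∀ w ∈ R, G.dist u w = 1 + G.dist c w) →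
        (Leg G c u ∧ ∀ w ∈ R, ¬ Cn G c u w) ∨ ∃ B, IsBlk G B ∧ c ∈ B ∧ u ∈ B ∧ Bad G R B c := by
      intro u hu hdu
      by_cases hone : ∀ z, G.Adj c z → Cn G c u z → z = u
      · have hf := free_of_bridge hG hu hone hdu
        exact Or.inl ⟨⟨hj, hu, hL.leglike hG hu.ne' hf⟩, hf⟩
      · push Not at hone
        obtain ⟨z, hz, huz, hzu⟩ := hone
        obtain ⟨B, hBk, huB, hzB, hcB⟩ := exists_blk_of_fork hzu.symm hu hz huz
        refine Or.inr ⟨B, hBk, hcB, huB, hj, hcB, u, Or.inl huB, hu, ?_⟩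
        rintro w ⟨hwB, hw⟩ hwc
        rcases hw with hw | hw
        · obtain ⟨w', hw', hcw'⟩ := hL.exists_beyond hG hw hwc.symm
          have h1 := dist_of_not_cn hG hcw'
          have h2 : G.dist u w' = G.dist u w + G.dist w w' := by
            by_cases huw : u = w
            · subst huw; simp
            · exact dist_of_not_cn hG fun h => hcw' ((hBk.cn hcB huB hwc.symm huw).trans h)
          have h3 := hdu w' hw'
          omega
        · exact hdu w hw
    rcases key u hu hdu with ⟨h1, h2⟩ | ⟨B, h1, h2, h3, h4⟩
    · rcases key v hv hdv with ⟨h1', h2'⟩ | ⟨B', h1', h2', h3', h4'⟩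
      · rcases hL.legs c u v h1 h1' huv with ⟨w, hw, h⟩ | ⟨w, hw, h⟩
        exacts [h2 w hw h, h2' w hw h]
      · obtain ⟨w, hw, h⟩ := hL.bad_leg B' h1' c u h4' h1
        exact h2 w hw h
    · rcases key v hv hdv with ⟨h1', h2'⟩ | ⟨B', h1', h2', h3', h4'⟩
      · obtain ⟨w, hw, h⟩ := hL.bad_leg B h1 c v h4 h1'
        exact h2' w hw h
      · have := hL.bads B B' h1 h1' c h4 h4'
        subst this
        exact hsep (h1.cn h3 h3' hu.ne' hv.ne')
  -- if `c` is not a joint but in a block, the pair lies in the EBC of this block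
  · by_cases hcB : ∃ B, IsBlk G B ∧ c ∈ B
    · obtain ⟨B, hBk, hcB⟩ := hcB
      obtain ⟨b, hb, hbc, -⟩ := hBk.exists_third c c
      have key : ∀ u, G.Adj c u → u ∈ ext G B := by
        intro u hu
        by_cases h : Cn G c u b
        · exact Or.inl (hBk.mem_of_adj hcB hb hbc hu h)
        · rcases hBk.joint_or_hooked hG hcB hb hbc hu.ne' (fun h' => h h'.symm) with h1 | h1
          · exact absurd h1 hj
          · exact Or.inr ⟨c, hcB, h1⟩
      obtain ⟨w, hw, hd⟩ := hB B hBk u (key u hu) v (key v hv) huv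
      exact hd (hun w hw)
    -- otherwise both sides are legs, and `G` is a path
    · have hone : ∀ u, G.Adj c u → ∀ z, G.Adj c z → Cn G c u z → z = u := by
        intro u hu z hz huz
        by_contra hzu
        obtain ⟨B, hBk, -, -, h⟩ := exists_blk_of_fork (Ne.symm hzu) hu hz huz
        exact hcB ⟨B, hBk, h⟩
      have hlu := hL.leglike hG hu.ne' (free_of_bridge hG hu (hone u hu) hdu)
      have hlv := hL.leglike hG hv.ne' (free_of_bridge hG hv (hone v hv) hdv)
      have honly : ∀ z, z ≠ c → Leglike G c z := by
        intro z hz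
        obtain ⟨a, ha, haz⟩ := exists_adj_cn hG hz
        by_cases h1 : Cn G c u a
        · exact hlu.of_cn (h1.trans haz)
        · by_cases h2 : Cn G c v a
          · exact hlv.of_cn (h2.trans haz)
          · exact absurd (joint_of_three hu hv ha hsep h1 h2) hj
      rcases hX with ⟨B, hBk⟩ | ⟨g, hg⟩
      · obtain ⟨b, hb, hbc, -⟩ := hBk.exists_third c c
        exact (honly b hbc).not_blk hG hBk hb
      · have hgc : g ≠ c := by
          rintro rfl
          exact hj hg
        exact hg.not_leglike hG (honly g hgc)

/-- Without blocks and joints, some single vertex is a resolving set. -/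
theorem exists_single_res (h1 : ¬ ∃ B, IsBlk G B) (h2 : ¬ ∃ c, Joint G c) :
    ∃ x, ∀ u v, u ≠ v → G.dist u x ≠ G.dist v x := by
  obtain ⟨a⟩ := hG.nonempty
  obtain ⟨x, -, hx⟩ := Set.exists_max_image Set.univ (fun y => G.dist a y) (Set.toFinite _)
    ⟨a, trivial⟩
  have hL : Local G (∅ : Set V) :=
    ⟨fun B hB => absurd ⟨B, hB⟩ h1, fun c u v hu => absurd ⟨c, hu.1⟩ h2,
      fun B hB => absurd ⟨B, hB⟩ h1, fun B B' hB => absurd ⟨B, hB⟩ h1⟩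
  -- a vertex `x` farthest from `a` is not a cut vertex
  have hcn : ∀ u v, u ≠ x → v ≠ x → Cn G x u v := by
    have key : ∀ u, u ≠ x → Cn G x a u := by
      intro u hu
      by_contra hn
      have h3 := dist_of_not_cn hG hn
      have h4 := one_le_dist hG hu.symm
      have h5 := hx u trivial
      omega
    exact fun u v hu hv => (key u hu).symm.trans (key v hv)
  refine ⟨x, fun u v huv hd => ?_⟩
  by_cases hux : u = x
  · subst hux
    rw [SimpleGraph.dist_self] at hd
    exact huv ((hG.dist_eq_zero_iff).1 hd.symm).symm
  · by_cases hvx : v = x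
    · subst hvx
      rw [SimpleGraph.dist_self] at hd
      exact huv ((hG.dist_eq_zero_iff).1 hd)
    · exact huv ((hL.leglike hG hux (by simp)).2 u v (Cn.refl _ _) (hcn u v hux hvx) hd)

end Fin

end Local

/-! ### Choosing sets for the blocks of a tree of blocks -/

section Task

open Classical

/-- An optimisation problem on a tree of blocks. A set `σ i` is to be chosen for every block `i`,
subject to `ok i (σ i)`. The choice may make the block *bad* at its gate `gate i` and at its
children `ch i`; no vertex may have more than one bad block. A vertex contributes the set `few x`
to the solution if none of its blocks is bad, and the set `all x` otherwise. -/
structure Task (ι V : Type*) where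
  gate : ι → V
  ch : ι → Finset V
  ok : ι → Finset V → Prop
  bad : ι → Finset V → V → Prop
  all : V → Finset V
  few : V → Finset V
  bad_imp : ∀ i Z x, bad i Z x → x = gate i ∨ x ∈ ch i

variable {ι V α : Type*} [DecidableEq ι] [DecidableEq V]

/-- Of two tables, the second one applies to the vertices without a bad block. -/
def sel (f₀ f₁ : V → α) (b : ℕ) (x : V) : α := if b = 0 then f₁ x else f₀ x

omit [DecidableEq V] in
theorem sel_congr {f₀ f₁ f₀' f₁' : V → α} (b : ℕ) (x : V) (h₀ : f₀' x = f₀ x)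
    (h₁ : f₁' x = f₁ x) : sel f₀' f₁' b x = sel f₀ f₁ b x := by
  simp [sel, h₀, h₁]

namespace Task

variable (𝒯 : Task ι V)

/-- The number of blocks in `D` that are bad at `x`. -/
noncomputable def bads (D : Finset ι) (σ : ι → Finset V) (x : V) : ℕ :=
  ∑ i ∈ D, if 𝒯.bad i (σ i) x then 1 else 0

omit [DecidableEq ι] [DecidableEq V] in
theorem bads_congr {D : Finset ι} {σ τ : ι → Finset V} (h : ∀ i ∈ D, σ i = τ i) (x : V) :
    𝒯.bads D σ x = 𝒯.bads D τ x :=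
  Finset.sum_congr rfl fun i hi => by rw [h i hi]

omit [DecidableEq V] in
theorem bads_erase {D : Finset ι} {u : ι} (hu : u ∈ D) (σ : ι → Finset V) (x : V) :
    𝒯.bads D σ x = (if 𝒯.bad u (σ u) x then 1 else 0) + 𝒯.bads (D.erase u) σ x :=
  (Finset.add_sum_erase D _ hu).symm

/-- The cost of completing a partial solution: the blocks in `D` are still undecided, and for a
vertex `x` of `op` the decisions already made below `x` cost `a₀ x` or `a₁ x`. -/
noncomputable def val (D : Finset ι) (a₀ a₁ : V → ℕ) (op : Finset V) (σ : ι → Finset V) : ℕ :=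
  ∑ x ∈ op, sel a₀ a₁ (𝒯.bads D σ x) x + ∑ i ∈ D, (σ i).card

/-- A choice for the blocks in `U` that satisfies all constraints. -/
def Feasible (U : Finset ι) (σ : ι → Finset V) : Prop :=
  (∀ i ∈ U, 𝒯.ok i (σ i)) ∧ ∀ x, 𝒯.bads U σ x ≤ 1

/-- How the sum over the open vertices changes when the block `u` is decided. -/
theorem val_eq {𝒯 : Task ι V} {D : Finset ι} {op : Finset V} {a₀ a₁ : V → ℕ} {u : ι} (hu : u ∈ D)
    (hgate : 𝒯.gate u ∈ op) (hch : 𝒯.ch u ⊆ op) (hgc : 𝒯.gate u ∉ 𝒯.ch u)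
    (hfree : ∀ i ∈ D.erase u, 𝒯.gate i ∉ 𝒯.ch u ∧ Disjoint (𝒯.ch i) (𝒯.ch u))
    (σ : ι → Finset V) :
    ∑ x ∈ op, sel a₀ a₁ (𝒯.bads D σ x) x =
      sel a₀ a₁ (𝒯.bads D σ (𝒯.gate u)) (𝒯.gate u)
      + ∑ x ∈ 𝒯.ch u, (if 𝒯.bad u (σ u) x then a₀ x else a₁ x)
      + ∑ x ∈ (op \ 𝒯.ch u).erase (𝒯.gate u), sel a₀ a₁ (𝒯.bads (D.erase u) σ x) x := by
  rw [← Finset.sum_sdiff hch, ← Finset.add_sum_erase (op \ 𝒯.ch u) _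
    (Finset.mem_sdiff.2 ⟨hgate, hgc⟩)]
  have h1 : ∑ x ∈ 𝒯.ch u, sel a₀ a₁ (𝒯.bads D σ x) x
      = ∑ x ∈ 𝒯.ch u, (if 𝒯.bad u (σ u) x then a₀ x else a₁ x) := by
    refine Finset.sum_congr rfl fun x hx => ?_
    have h0 : 𝒯.bads (D.erase u) σ x = 0 := by
      refine Finset.sum_eq_zero fun i hi => if_neg fun hb => ?_
      rcases 𝒯.bad_imp _ _ _ hb with h | h
      · exact (hfree i hi).1 (h ▸ hx)
      · exact Finset.disjoint_left.1 (hfree i hi).2 h hx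
    rw [𝒯.bads_erase hu, h0]
    by_cases hb : 𝒯.bad u (σ u) x <;> simp [hb, sel]
  have h2 : ∑ x ∈ (op \ 𝒯.ch u).erase (𝒯.gate u), sel a₀ a₁ (𝒯.bads D σ x) x
      = ∑ x ∈ (op \ 𝒯.ch u).erase (𝒯.gate u), sel a₀ a₁ (𝒯.bads (D.erase u) σ x) x := by
    refine Finset.sum_congr rfl fun x hx => ?_
    simp only [Finset.mem_erase, Finset.mem_sdiff] at hx
    rw [𝒯.bads_erase hu, if_neg, zero_add]
    intro hb
    rcases 𝒯.bad_imp _ _ _ hb with h | h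
    · exact hx.1 h
    · exact hx.2.2 h
  rw [h1, h2]; ring

variable [Fintype V]

/-- The number of vertices used by a choice, counted with multiplicity. -/
noncomputable def total (U : Finset ι) (σ : ι → Finset V) : ℕ :=
  𝒯.val U (fun x => (𝒯.all x).card) (fun x => (𝒯.few x).card) Finset.univ σ

/-- The set of vertices determined by a choice. -/
noncomputable def result (U : Finset ι) (σ : ι → Finset V) : Finset V :=
  U.biUnion σ ∪ Finset.univ.biUnion fun x => sel 𝒯.all 𝒯.few (𝒯.bads U σ x) x

/-- The invariant of the dynamic program on a task with blocks `U`, of which those in `D` are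
undecided. For an open vertex `x`, the numbers `a₀ x` and `a₁ x` are the optimal costs of the
decided part below `x` if no block, respectively at most one block, may be bad at `x` there; the
sets `S₀ x`, `S₁ x` attain them. Costs from `N` on count as infinite. -/
structure Inv (N : ℕ) (U D : Finset ι) (op : Finset V) (a₀ a₁ : V → ℕ) (S₀ S₁ : V → Finset V) :
    Prop where
  lower : ∀ σ, 𝒯.Feasible U σ → 𝒯.val D a₀ a₁ op σ ≤ 𝒯.total U σ
  upper : ∀ σ, 𝒯.Feasible D σ → ∑ x ∈ op, sel a₀ a₁ (𝒯.bads D σ x) x < N →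
    ∃ τ, (∀ i ∈ D, τ i = σ i) ∧ 𝒯.Feasible U τ ∧ 𝒯.total U τ ≤ 𝒯.val D a₀ a₁ op σ ∧
      (U \ D).biUnion τ ∪ Finset.univ.biUnion (fun x => sel 𝒯.all 𝒯.few (𝒯.bads U τ x) x)
        = op.biUnion fun x => sel S₀ S₁ (𝒯.bads D σ x) x

variable {𝒯}

theorem Inv.init (N : ℕ) (U : Finset ι) : 𝒯.Inv N U U Finset.univ (fun x => (𝒯.all x).card)
    (fun x => (𝒯.few x).card) 𝒯.all 𝒯.few where
  lower σ _ := le_rfl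
  upper σ hσ _ := ⟨σ, fun _ _ => rfl, hσ, le_rfl, by simp⟩

/-- The cost of the choice `Z` for the block `u`, with the parts below its children. -/
noncomputable def optCost (𝒯 : Task ι V) (a₀ a₁ : V → ℕ) (u : ι) (Z : Finset V) : ℕ :=
  Z.card + ∑ x ∈ 𝒯.ch u, if 𝒯.bad u Z x then a₀ x else a₁ x

/-- The vertices of the choice `Z` for the block `u`, with the parts below its children. -/
noncomputable def optSet (𝒯 : Task ι V) (S₀ S₁ : V → Finset V) (u : ι) (Z : Finset V) : Finset V :=
  Z ∪ (𝒯.ch u).biUnion fun x => if 𝒯.bad u Z x then S₀ x else S₁ x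

/-- `g` is the optimal cost of a choice for the block `u` that is bad at the gate if and only if
`β` holds, and `Y` is the set belonging to such a choice. -/
def IsBest (𝒯 : Task ι V) (N : ℕ) (a₀ a₁ : V → ℕ) (S₀ S₁ : V → Finset V) (u : ι) (β : Prop)
    (g : ℕ) (Y : Finset V) : Prop :=
  (∀ Z, 𝒯.ok u Z → (𝒯.bad u Z (𝒯.gate u) ↔ β) → g ≤ 𝒯.optCost a₀ a₁ u Z) ∧
  (g < N → ∃ Z, 𝒯.ok u Z ∧ (𝒯.bad u Z (𝒯.gate u) ↔ β) ∧ 𝒯.optCost a₀ a₁ u Z ≤ g ∧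
    Y = 𝒯.optSet S₀ S₁ u Z)

/-- Deciding one more block keeps the invariant. -/
theorem Inv.step {N : ℕ} {U D : Finset ι} {op : Finset V} {a₀ a₁ a₀' a₁' : V → ℕ}
    {S₀ S₁ S₀' S₁' : V → Finset V} (h : 𝒯.Inv N U D op a₀ a₁ S₀ S₁) {u : ι} (hDU : D ⊆ U)
    (hu : u ∈ D) (hgate : 𝒯.gate u ∈ op) (hch : 𝒯.ch u ⊆ op) (hgc : 𝒯.gate u ∉ 𝒯.ch u)
    (hfree : ∀ i ∈ D.erase u, 𝒯.gate i ∉ 𝒯.ch u ∧ Disjoint (𝒯.ch i) (𝒯.ch u))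
    {g₀ g₁ : ℕ} {Y₀ Y₁ : Finset V}
    (h₀ : 𝒯.IsBest N a₀ a₁ S₀ S₁ u False g₀ Y₀) (h₁ : 𝒯.IsBest N a₀ a₁ S₀ S₁ u True g₁ Y₁)
    (ha₀ : a₀' (𝒯.gate u) = min (a₀ (𝒯.gate u) + g₀) N)
    (ha₁ : a₁' (𝒯.gate u) = min (min (a₁ (𝒯.gate u) + g₀) (a₀ (𝒯.gate u) + g₁)) N)
    (hS₀ : S₀' (𝒯.gate u) = S₀ (𝒯.gate u) ∪ Y₀)
    (hS₁ : S₁' (𝒯.gate u) = if a₁ (𝒯.gate u) + g₀ ≤ a₀ (𝒯.gate u) + g₁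
      then S₁ (𝒯.gate u) ∪ Y₀ else S₀ (𝒯.gate u) ∪ Y₁)
    (hne : ∀ x, x ≠ 𝒯.gate u → a₀' x = a₀ x ∧ a₁' x = a₁ x ∧ S₀' x = S₀ x ∧ S₁' x = S₁ x) :
    𝒯.Inv N U (D.erase u) (op \ 𝒯.ch u) a₀' a₁' S₀' S₁' := by
  have hg' : 𝒯.gate u ∈ op \ 𝒯.ch u := Finset.mem_sdiff.2 ⟨hgate, hgc⟩
  -- the new sum over the open vertices
  have hsum : ∀ σ, ∑ x ∈ op \ 𝒯.ch u, sel a₀' a₁' (𝒯.bads (D.erase u) σ x) x =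
      sel a₀' a₁' (𝒯.bads (D.erase u) σ (𝒯.gate u)) (𝒯.gate u) +
      ∑ x ∈ (op \ 𝒯.ch u).erase (𝒯.gate u), sel a₀ a₁ (𝒯.bads (D.erase u) σ x) x := by
    intro σ
    rw [← Finset.add_sum_erase _ _ hg']
    congr 1
    refine Finset.sum_congr rfl fun x hx => ?_
    exact sel_congr _ _ (hne x (Finset.ne_of_mem_erase hx)).1
        (hne x (Finset.ne_of_mem_erase hx)).2.1
  constructor
  · intro σ hσ
    refine le_trans ?_ (h.lower σ hσ)
    have hle : 𝒯.bads D σ (𝒯.gate u) ≤ 1 :=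
      (Finset.sum_le_sum_of_subset hDU).trans (hσ.2 (𝒯.gate u))
    have hok := hσ.1 u (hDU hu)
    rw [val, val, hsum, val_eq hu hgate hch hgc hfree, ← Finset.add_sum_erase D _ hu]
    have hb := 𝒯.bads_erase hu σ (𝒯.gate u)
    rw [hb] at hle
    rw [hb]
    -- at the gate, the new value is at most the old one plus the cost of the choice for `u`
    have key : sel a₀' a₁' (𝒯.bads (D.erase u) σ (𝒯.gate u)) (𝒯.gate u) ≤
        sel a₀ a₁ ((if 𝒯.bad u (σ u) (𝒯.gate u) then 1 else 0)
          + 𝒯.bads (D.erase u) σ (𝒯.gate u)) (𝒯.gate u) + 𝒯.optCost a₀ a₁ u (σ u) := by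
      by_cases hbad : 𝒯.bad u (σ u) (𝒯.gate u)
      · have := h₁.1 _ hok (by simp [hbad])
        rw [if_pos hbad] at hle ⊢
        have e : 𝒯.bads (D.erase u) σ (𝒯.gate u) = 0 := by omega
        rw [e]
        simp only [sel, if_true, add_zero, one_ne_zero, if_false, ha₁]
        omega
      · have := h₀.1 _ hok (by simp [hbad])
        rw [if_neg hbad] at hle ⊢
        rw [zero_add]
        simp only [sel, ha₀, ha₁]
        split_ifs <;> omega
    rw [optCost] at key
    omega
  · intro σ hσ hlt
    rw [hsum] at hlt
    -- the choice for `u`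
    obtain ⟨Z, hok, hcost, hset, hb1⟩ : ∃ Z, 𝒯.ok u Z ∧
        sel a₀ a₁ ((if 𝒯.bad u Z (𝒯.gate u) then 1 else 0)
          + 𝒯.bads (D.erase u) σ (𝒯.gate u)) (𝒯.gate u) + 𝒯.optCost a₀ a₁ u Z ≤
          sel a₀' a₁' (𝒯.bads (D.erase u) σ (𝒯.gate u)) (𝒯.gate u) ∧
        sel S₀ S₁ ((if 𝒯.bad u Z (𝒯.gate u) then 1 else 0)
          + 𝒯.bads (D.erase u) σ (𝒯.gate u)) (𝒯.gate u) ∪ 𝒯.optSet S₀ S₁ u Z =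
          sel S₀' S₁' (𝒯.bads (D.erase u) σ (𝒯.gate u)) (𝒯.gate u) ∧
        (if 𝒯.bad u Z (𝒯.gate u) then 1 else 0) + 𝒯.bads (D.erase u) σ (𝒯.gate u) ≤ 1 := by
      have hle := hσ.2 (𝒯.gate u)
      by_cases hb : 𝒯.bads (D.erase u) σ (𝒯.gate u) = 0
      · rw [hb] at hlt ⊢
        simp only [sel, if_true, ha₁] at hlt ⊢
        by_cases hc : a₁ (𝒯.gate u) + g₀ ≤ a₀ (𝒯.gate u) + g₁
        · obtain ⟨Z, z1, z2, z3, z4⟩ := h₀.2 (by omega)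
          simp only [iff_false] at z2
          refine ⟨Z, z1, ?_, ?_, by simp [z2]⟩
          · simp only [if_neg z2, if_true]; omega
          · simp only [if_neg z2, if_true, hS₁, if_pos hc, z4]
        · obtain ⟨Z, z1, z2, z3, z4⟩ := h₁.2 (by omega)
          simp only [iff_true] at z2
          refine ⟨Z, z1, ?_, ?_, by simp [z2]⟩
          · simp only [if_pos z2, add_zero, one_ne_zero, if_false]; omega
          · simp only [if_pos z2, add_zero, one_ne_zero, if_false, hS₁, if_neg hc, z4]
      · have hb1 : 𝒯.bads (D.erase u) σ (𝒯.gate u) = 1 := by omega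
        rw [hb1] at hlt ⊢
        simp only [sel, one_ne_zero, if_false, ha₀] at hlt ⊢
        obtain ⟨Z, z1, z2, z3, z4⟩ := h₀.2 (by omega)
        simp only [iff_false] at z2
        refine ⟨Z, z1, ?_, ?_, by simp [z2]⟩
        · simp only [if_neg z2, zero_add, one_ne_zero, if_false]; omega
        · simp only [if_neg z2, zero_add, one_ne_zero, if_false, hS₀, z4]
    set ρ : ι → Finset V := Function.update σ u Z with hρ
    have hρu : ρ u = Z := by simp [hρ]
    have hρe : ∀ i ∈ D.erase u, ρ i = σ i := fun i hi =>
      Function.update_of_ne (Finset.ne_of_mem_erase hi) _ _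
    have hbe : ∀ x, 𝒯.bads (D.erase u) ρ x = 𝒯.bads (D.erase u) σ x := 𝒯.bads_congr hρe
    have hbD : ∀ x, 𝒯.bads D ρ x = (if 𝒯.bad u Z x then 1 else 0) + 𝒯.bads (D.erase u) σ x := by
      intro x; rw [𝒯.bads_erase hu, hρu, hbe]
    -- no other undecided block contains a child of `u`
    have hch0 : ∀ x ∈ 𝒯.ch u, 𝒯.bads (D.erase u) σ x = 0 := by
      intro x hx
      refine Finset.sum_eq_zero fun i hi => if_neg fun hb => ?_
      rcases 𝒯.bad_imp _ _ _ hb with h | h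
      · exact (hfree i hi).1 (h ▸ hx)
      · exact Finset.disjoint_left.1 (hfree i hi).2 h hx
    have hother : ∀ x, x ≠ 𝒯.gate u → x ∉ 𝒯.ch u → 𝒯.bads D ρ x = 𝒯.bads (D.erase u) σ x := by
      intro x h1 h2
      rw [hbD, if_neg, zero_add]
      intro hb
      rcases 𝒯.bad_imp _ _ _ hb with h | h
      · exact h1 h
      · exact h2 h
    have hfeas : 𝒯.Feasible D ρ := by
      refine ⟨fun i hi => ?_, fun x => ?_⟩
      · by_cases hiu : i = u
        · rw [hiu, hρu]; exact hok
        · rw [hρe i (Finset.mem_erase.2 ⟨hiu, hi⟩)]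
          exact hσ.1 i (Finset.mem_erase.2 ⟨hiu, hi⟩)
      · by_cases hx : x = 𝒯.gate u
        · rw [hbD, hx]; exact hb1
        · by_cases hx' : x ∈ 𝒯.ch u
          · rw [hbD, hch0 x hx']; split_ifs <;> omega
          · rw [hother x hx hx']; exact hσ.2 x
    have hval := val_eq (a₀ := a₀) (a₁ := a₁) hu hgate hch hgc hfree ρ
    simp only [hbe, hρu] at hval
    rw [hbD (𝒯.gate u)] at hval
    rw [optCost] at hcost
    obtain ⟨τ, t1, t2, t3, t4⟩ := h.upper ρ hfeas (by rw [hval]; omega)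
    refine ⟨τ, fun i hi => ?_, t2, t3.trans ?_, ?_⟩
    · rw [t1 i (Finset.mem_of_mem_erase hi), hρe i hi]
    · have hcard : ∑ i ∈ D.erase u, (ρ i).card = ∑ i ∈ D.erase u, (σ i).card :=
        Finset.sum_congr rfl fun i hi => by rw [hρe i hi]
      rw [val, val, hsum, hval, ← Finset.add_sum_erase D _ hu, hρu, hcard]
      omega
    · have hτu : τ u = Z := by rw [t1 u hu, hρu]
      have hUD : U \ D.erase u = insert u (U \ D) := by
        ext i
        simp only [Finset.mem_sdiff, Finset.mem_erase, Finset.mem_insert, not_and]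
        constructor
        · rintro ⟨h1, h2⟩
          by_cases hiu : i = u
          · exact .inl hiu
          · exact .inr ⟨h1, fun hi => hiu (by by_contra hh; exact (h2 hh) hi)⟩
        · rintro (rfl | ⟨h1, h2⟩)
          · exact ⟨hDU hu, fun h => absurd rfl h⟩
          · exact ⟨h1, fun _ => h2⟩
      rw [hUD, Finset.biUnion_insert, Finset.union_assoc, t4, hτu]
      -- the unions over the open vertices, split like the sums
      have split1 : op.biUnion (fun x => sel S₀ S₁ (𝒯.bads D ρ x) x) =
          sel S₀ S₁ (𝒯.bads D ρ (𝒯.gate u)) (𝒯.gate u) ∪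
          ((𝒯.ch u).biUnion (fun x => if 𝒯.bad u Z x then S₀ x else S₁ x) ∪
          ((op \ 𝒯.ch u).erase (𝒯.gate u)).biUnion
            fun x => sel S₀ S₁ (𝒯.bads (D.erase u) σ x) x) := by
        have e0 : op = insert (𝒯.gate u) (𝒯.ch u ∪ (op \ 𝒯.ch u).erase (𝒯.gate u)) := by
          ext x
          have hc := @hch x
          by_cases h1 : x = 𝒯.gate u
          · simp [h1, hgate]
          · by_cases h2 : x ∈ 𝒯.ch u <;> simp [h1, h2, hc]
        conv_lhs => rw [e0]
        rw [Finset.biUnion_insert, Finset.union_biUnion]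
        congr 2
        · refine Finset.biUnion_congr rfl fun x hx => ?_
          rw [hbD, hch0 x hx]
          by_cases hb : 𝒯.bad u Z x <;> simp [hb, sel]
        · refine Finset.biUnion_congr rfl fun x hx => ?_
          simp only [Finset.mem_erase, Finset.mem_sdiff] at hx
          rw [hother x hx.1 hx.2.2]
      have split2 : (op \ 𝒯.ch u).biUnion (fun x => sel S₀' S₁' (𝒯.bads (D.erase u) σ x) x) =
          sel S₀' S₁' (𝒯.bads (D.erase u) σ (𝒯.gate u)) (𝒯.gate u) ∪
          ((op \ 𝒯.ch u).erase (𝒯.gate u)).biUnion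
            fun x => sel S₀ S₁ (𝒯.bads (D.erase u) σ x) x := by
        conv_lhs => rw [← Finset.insert_erase hg', Finset.biUnion_insert]
        congr 1
        refine Finset.biUnion_congr rfl fun x hx => ?_
        exact sel_congr _ _ (hne x (Finset.ne_of_mem_erase hx)).2.2.1
          (hne x (Finset.ne_of_mem_erase hx)).2.2.2
      rw [split1, split2, ← hset, hbD (𝒯.gate u), optSet]
      ext x
      simp only [Finset.mem_union]
      tauto

/-- When all blocks are decided, the dynamic program has found an optimal choice, if there is any
of total less than `N`. -/
theorem Inv.final {N : ℕ} {U : Finset ι} {op : Finset V} {a₀ a₁ : V → ℕ} {S₀ S₁ : V → Finset V}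
    (h : 𝒯.Inv N U ∅ op a₀ a₁ S₀ S₁) :
    (∀ σ, 𝒯.Feasible U σ → ∑ x ∈ op, a₁ x ≤ 𝒯.total U σ) ∧
    (∑ x ∈ op, a₁ x < N → ∃ τ, 𝒯.Feasible U τ ∧ 𝒯.total U τ ≤ ∑ x ∈ op, a₁ x ∧
      𝒯.result U τ = op.biUnion S₁) := by
  have e : ∀ σ x, 𝒯.bads ∅ σ x = 0 := by simp [bads]
  constructor
  · intro σ hσ
    have := h.lower σ hσ
    simpa [val, e, sel] using this
  · intro hlt
    obtain ⟨τ, t1, t2, t3, t4⟩ := h.upper (fun _ => ∅) ⟨by simp, by simp [e]⟩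
      (by simpa [e, sel] using hlt)
    refine ⟨τ, t2, by simpa [val, e, sel] using t3, ?_⟩
    simpa [result, e, sel] using t4

end Task

end Task

/-! ### The task of a graph -/

section GraphTask

open Classical

variable {V : Type*} [Fintype V] [LinearOrder V] {G : SimpleGraph V}

/-- The block spanned by the vertices `c` and `v`. -/
def blk (G : SimpleGraph V) (c v : V) : Set V := {y | Nosep G y c ∧ Nosep G y v}

/-- The pair of `c` and `v` names a block: `c` is its vertex closest to the vertex `o`, and `v` its
first other vertex. -/
structure IsUnit (G : SimpleGraph V) (o c v : V) : Prop where
  ne : c ≠ v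
  nosep : Nosep G c v
  third : ∃ x, x ≠ c ∧ x ≠ v ∧ Nosep G x c ∧ Nosep G x v
  near : ∀ x ∈ blk G c v, G.dist o c ≤ G.dist o x
  least : ∀ x ∈ blk G c v, x ≠ c → v ≤ x

/-- The task of finding a resolving set with at most `K` vertices in each EBC. Blocks are named by
pairs of vertices. -/
noncomputable def graphTask (G : SimpleGraph V) (K : ℕ) : Task (V × V) V where
  gate i := i.1
  ch i := Finset.univ.filter fun x => x ∈ blk G i.1 i.2 ∧ Joint G x ∧ x ≠ i.1
  ok i Z := Z.card ≤ K ∧ (∀ x ∈ Z, x ∈ ext G (blk G i.1 i.2) ∧ ¬ Joint G x) ∧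
    ∀ u ∈ ext G (blk G i.1 i.2), ∀ v ∈ ext G (blk G i.1 i.2), u ≠ v →
      Res G (stand G Z (blk G i.1 i.2)) u v
  bad i Z x := Bad G Z (blk G i.1 i.2) x
  all c := Finset.univ.filter fun u => Leg G c u
  few c := Finset.univ.filter fun u => Leg G c u ∧ ∃ u' < u, Leg G c u'
  bad_imp i Z x h := by
    by_cases hx : x = i.1
    · exact .inl hx
    · exact .inr (by simp [h.1, h.2.1, hx])

/-- The names of the blocks. -/
noncomputable def units (G : SimpleGraph V) (o : V) : Finset (V × V) :=
  Finset.univ.filter fun i => IsUnit G o i.1 i.2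

omit [Fintype V] [LinearOrder V] in
theorem stand_congr {R R' B : Set V} (h : ∀ w ∈ ext G B, ¬ Joint G w → (w ∈ R ↔ w ∈ R')) :
    stand G R B = stand G R' B := by
  ext w
  refine and_congr_right fun hw => ?_
  by_cases hj : Joint G w
  · simp [hj]
  · simp [hj, h w hw hj]

omit [Fintype V] [LinearOrder V] in
theorem bad_congr {R R' B : Set V} (h : ∀ w ∈ ext G B, ¬ Joint G w → (w ∈ R ↔ w ∈ R')) (c : V) :
    Bad G R B c ↔ Bad G R' B c := by
  unfold Bad; rw [stand_congr h]

variable (hG : G.Connected) {o : V} {K : ℕ}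

section

omit [Fintype V]

theorem IsUnit.isBlk {c v : V} (h : IsUnit G o c v) : IsBlk G (blk G c v) := by
  obtain ⟨x, h1, h2, h3, h4⟩ := h.third
  exact ⟨c, v, x, h.ne, h1, h2, h.nosep, h3, h4, rfl⟩

theorem IsUnit.fst_mem {c v : V} (h : IsUnit G o c v) : c ∈ blk G c v := ⟨Nosep.refl _, h.nosep⟩

theorem IsUnit.snd_mem {c v : V} (h : IsUnit G o c v) : v ∈ blk G c v :=
  ⟨h.nosep.symm, Nosep.refl _⟩

include hG in
/-- The vertex of a block closest to `o` separates the others from `o`. -/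
theorem IsUnit.sep {c v x : V} (h : IsUnit G o c v) (hx : x ∈ blk G c v) (hxc : x ≠ c) :
    ¬ Cn G c o x := by
  obtain ⟨g, hg, hsep⟩ := h.isBlk.exists_gate hG o
  by_cases hgc : c = g
  · subst hgc; exact hsep x hx hxc
  · have h1 := dist_of_not_cn hG (hsep c h.fst_mem hgc)
    have h2 := h.near g hg
    have h3 := one_le_dist hG (Ne.symm hgc)
    omega

include hG in
theorem IsUnit.dist_eq {c v x : V} (h : IsUnit G o c v) (hx : x ∈ blk G c v) :
    G.dist o x = G.dist o c + G.dist c x := by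
  by_cases hxc : x = c
  · subst hxc; simp
  · exact dist_of_not_cn hG (h.sep hG hx hxc)

include hG in
theorem IsUnit.dist_lt {c v x : V} (h : IsUnit G o c v) (hx : x ∈ blk G c v) (hxc : x ≠ c) :
    G.dist o c < G.dist o x := by
  have := one_le_dist hG hxc.symm
  rw [h.dist_eq hG hx]; omega

include hG in
theorem IsUnit.eq_of_blk {c v c' v' : V} (h : IsUnit G o c v) (h' : IsUnit G o c' v')
    (he : blk G c v = blk G c' v') : c = c' ∧ v = v' := by
  have hc : c = c' := by
    by_contra hne
    have h1 := h.dist_lt hG (he ▸ h'.fst_mem) (Ne.symm hne)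
    have h2 := h'.dist_lt hG (he ▸ h.fst_mem) hne
    omega
  subst hc
  exact ⟨rfl, le_antisymm (h.least _ (he ▸ h'.snd_mem) h'.ne.symm)
    (h'.least _ (he ▸ h.snd_mem) h.ne.symm)⟩

include hG in
/-- Different blocks do not share a vertex other than the closest ones to `o`. -/
theorem IsUnit.eq_of_mem {c v c' v' x : V} (h : IsUnit G o c v) (h' : IsUnit G o c' v')
    (hx : x ∈ blk G c v) (hx' : x ∈ blk G c' v') (hxc : x ≠ c) (hxc' : x ≠ c') :
    c = c' ∧ v = v' := by
  refine h.eq_of_blk hG h' ?_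
  by_cases hcc : Cn G x c c'
  · have : c' ∈ blk G c v := h.isBlk.mem hxc.symm h.fst_mem hx
      (Nosep.of_common (h'.isBlk.nosep h'.fst_mem hx') (h.isBlk.nosep h.fst_mem hx) hcc.symm)
      (h'.isBlk.nosep h'.fst_mem hx')
    exact h.isBlk.eq h'.isBlk hxc' hx this hx' h'.fst_mem
  · exfalso
    have h1 := h.dist_lt hG hx hxc
    have h2 := h'.dist_lt hG hx' hxc'
    have h3 : Cn G x o c := by
      have := Cn.of_dist_lt hG (c := x) (x := c) (w := o)
      by_contra hn
      have := dist_of_not_cn hG hn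
      omega
    have h4 : Cn G x o c' := by
      by_contra hn
      have := dist_of_not_cn hG hn
      omega
    exact hcc (h3.symm.trans h4)

end

/-- Every block has a name. -/
theorem IsBlk.exists_unit {B : Set V} (hB : IsBlk G B) (o : V) :
    ∃ c v, IsUnit G o c v ∧ B = blk G c v := by
  obtain ⟨b, hb, -⟩ := hB.exists_third o o
  obtain ⟨c, hc, hmin⟩ := Set.exists_min_image B (fun x => G.dist o x) (Set.toFinite _) ⟨b, hb⟩
  obtain ⟨b', hb', hbc, -⟩ := hB.exists_third c c
  obtain ⟨v, ⟨hv, hvc⟩, hvmin⟩ := Set.exists_min_image {x | x ∈ B ∧ x ≠ c} id (Set.toFinite _)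
    ⟨b', hb', hbc⟩
  have hvc' : c ≠ v := fun h => hvc h.symm
  have he : B = blk G c v := hB.eq_setOf hvc' hc hv
  obtain ⟨x, hx, hxc, hxv⟩ := hB.exists_third c v
  exact ⟨c, v, ⟨hvc', hB.nosep hc hv, ⟨x, hxc, hxv, hB.nosep hx hc, hB.nosep hx hv⟩,
    fun x hx => hmin x (he ▸ hx), fun x hx hxc => hvmin x ⟨he ▸ hx, hxc⟩⟩, he⟩

theorem mem_units {i : V × V} : i ∈ units G o ↔ IsUnit G o i.1 i.2 := by simp [units]

theorem mem_ch {i : V × V} {x : V} : x ∈ (graphTask G K).ch i ↔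
    x ∈ blk G i.1 i.2 ∧ Joint G x ∧ x ≠ i.1 := by simp [graphTask]

include hG in
/-- Blocks farther from `o` can be dealt with first. -/
theorem free_of_dist_le {u i : V × V} (hu : u ∈ units G o) (hi : i ∈ units G o) (hne : i ≠ u)
    (hd : G.dist o i.1 ≤ G.dist o u.1) :
    (graphTask G K).gate i ∉ (graphTask G K).ch u ∧
      Disjoint ((graphTask G K).ch i) ((graphTask G K).ch u) := by
  rw [mem_units] at hu hi
  constructor
  · intro h
    obtain ⟨h1, h2, h3⟩ := mem_ch.1 h
    have := hu.dist_lt hG h1 h3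
    simp only [graphTask] at this
    omega
  · rw [Finset.disjoint_left]
    intro x hx hx'
    rw [mem_ch] at hx hx'
    obtain ⟨e1, e2⟩ := hi.eq_of_mem hG hu hx.1 hx'.1 hx.2.2 hx'.2.2
    exact hne (Prod.ext e1 e2)

omit [Fintype V] [LinearOrder V] in
theorem Leg.eq_of_cn {c u v : V} (h : Leg G c u) (h' : Leg G c v) (huv : Cn G c u v) : u = v := by
  refine h.2.2.2 u v (Cn.refl _ _) huv ?_
  rw [SimpleGraph.dist_eq_one_iff_adj.2 h.2.1.symm, SimpleGraph.dist_eq_one_iff_adj.2 h'.2.1.symm]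

theorem few_subset_all (c : V) : (graphTask G K).few c ⊆ (graphTask G K).all c := by
  intro u hu
  simp only [graphTask, Finset.mem_filter, Finset.mem_univ, true_and] at hu ⊢
  exact hu.1

theorem card_few_lt {c u : V} (hu : Leg G c u) :
    ((graphTask G K).few c).card < ((graphTask G K).all c).card := by
  refine Finset.card_lt_card ((Finset.ssubset_iff_of_subset (few_subset_all c)).2 ?_)
  obtain ⟨v, hv, hmin⟩ := Set.exists_min_image {x | Leg G c x} id (Set.toFinite _) ⟨u, hu⟩
  refine ⟨v, by simpa [graphTask] using hv, ?_⟩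
  simp only [graphTask, Finset.mem_filter, Finset.mem_univ, true_and, not_and, not_exists]
  intro _ x hx hx'
  exact absurd hx (not_lt.2 (hmin x hx'))

include hG in
/-- A resolving set is at least as large as some feasible choice: the block `i` chooses the vertices
of `R` in its EBC that are not joints, and at a joint, at most one leg can be disjoint from `R`, and
none if some EBC is bad there. -/
theorem exists_feasible {R : Finset V} (hR : ∀ u v, u ≠ v → Res G (R : Set V) u v)
    (hK : ∀ B, IsBlk G B → ((R : Set V) ∩ ext G B).ncard ≤ K) :
    ∃ σ, (graphTask G K).Feasible (units G o) σ ∧ (graphTask G K).total (units G o) σ ≤ R.card := by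
  have hL := local_of_res hG hR
  set σ : V × V → Finset V := fun i =>
    R.filter fun x => x ∈ ext G (blk G i.1 i.2) ∧ ¬ Joint G x with hσ
  have hiff : ∀ i : V × V, ∀ w ∈ ext G (blk G i.1 i.2), ¬ Joint G w →
      (w ∈ (R : Set V) ↔ w ∈ (σ i : Set V)) := by
    intro i w hw hj; simp [hσ, hw, hj]
  have hbad : ∀ i x, (graphTask G K).bad i (σ i) x ↔ Bad G R (blk G i.1 i.2) x :=
    fun i x => (bad_congr (hiff i) x).symm
  refine ⟨σ, ⟨fun i hi => ⟨?_, fun x hx => ?_, ?_⟩, fun x => ?_⟩, ?_⟩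
  · refine le_trans ?_ (hK _ (mem_units.1 hi).isBlk)
    rw [← Set.ncard_coe_finset]
    refine Set.ncard_le_ncard (fun x hx => ?_) (Set.toFinite _)
    simp only [hσ, Finset.coe_filter, Set.mem_ofPred_eq] at hx
    exact ⟨hx.1, hx.2.1⟩
  · exact (Finset.mem_filter.1 hx).2
  · rw [← stand_congr (hiff i)]
    exact hL.ok _ (mem_units.1 hi).isBlk
  · rw [Task.bads, Finset.sum_boole, Nat.cast_id, Finset.card_le_one]
    intro i hi j hj
    simp only [Finset.mem_filter, hbad] at hi hj
    obtain ⟨e1, e2⟩ := (mem_units.1 hi.1).eq_of_blk hG (mem_units.1 hj.1)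
      (hL.bads _ _ (mem_units.1 hi.1).isBlk (mem_units.1 hj.1).isBlk x hi.2 hj.2)
    exact Prod.ext e1 e2
  · -- the legs that meet `R`, and a vertex of `R` on each of them
    set M : V → Finset V := fun c => ((graphTask G K).all c).filter fun u => ∃ w ∈ R, Cn G c u w
      with hM
    have hMm : ∀ c u, u ∈ M c ↔ Leg G c u ∧ ∃ w ∈ R, Cn G c u w := by
      intro c u; simp [hM, graphTask]
    have hex : ∀ c u, ∃ w, u ∈ M c → w ∈ R ∧ Cn G c u w := by
      intro c u
      by_cases h : u ∈ M c
      · obtain ⟨w, h1, h2⟩ := ((hMm c u).1 h).2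
        exact ⟨w, fun _ => ⟨h1, h2⟩⟩
      · exact ⟨c, fun h' => absurd h' h⟩
    choose f hf using hex
    have hleg : ∀ c u, u ∈ M c → Leglike G c (f c u) ∧ 3 ≤ (G.neighborSet c).ncard := fun c u hu =>
      ⟨((hMm c u).1 hu).1.2.2.of_cn (hf c u hu).2, ((hMm c u).1 hu).1.1.1⟩
    -- at most one leg at `c` is disjoint from `R`, and none if a block is bad at `c`
    have hle : ∀ c, sel (fun x => ((graphTask G K).all x).card)
        (fun x => ((graphTask G K).few x).card) ((graphTask G K).bads (units G o) σ c) c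
          ≤ ((M c).image (f c)).card := by
      intro c
      rw [Finset.card_image_of_injOn]
      · by_cases hb : (graphTask G K).bads (units G o) σ c = 0
        · simp only [sel, hb, if_true]
          by_cases hall : ∀ u, Leg G c u → u ∈ M c
          · refine Finset.card_le_card ((few_subset_all c).trans fun u hu => hall u ?_)
            simpa [graphTask] using hu
          · push Not at hall
            obtain ⟨u, hu, huM⟩ := hall
            have h1 := card_few_lt (K := K) hu
            have h2 : (graphTask G K).all c ⊆ insert u (M c) := by
              intro v hv
              have hv' : Leg G c v := by simpa [graphTask] using hv
              by_cases huv : v = u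
              · simp [huv]
              · rcases hL.legs c u v hu hv' (Ne.symm huv) with h | h
                · exact absurd ((hMm c u).2 ⟨hu, h⟩) huM
                · exact Finset.mem_insert_of_mem ((hMm c v).2 ⟨hv', h⟩)
            have h3 := (Finset.card_le_card h2).trans (Finset.card_insert_le _ _)
            omega
        · simp only [sel, hb, if_false]
          obtain ⟨i, hi, hne⟩ := Finset.exists_ne_zero_of_sum_ne_zero hb
          have hib : (graphTask G K).bad i (σ i) c := by
            by_contra h; simp [h] at hne
          refine Finset.card_le_card fun u hu => ?_
          have hu' : Leg G c u := by simpa [graphTask] using hu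
          exact (hMm c u).2 ⟨hu', hL.bad_leg _ (mem_units.1 hi).isBlk c u ((hbad i c).1 hib) hu'⟩
      · intro u hu v hv huv
        have h1 := (hf c u hu).2
        have h2 := (hf c v hv).2
        rw [← huv] at h2
        exact ((hMm c u).1 hu).1.eq_of_cn ((hMm c v).1 hv).1 (h1.trans h2.symm)
    -- the chosen vertices of all blocks and the vertices on the legs are different
    have hA : ((units G o).biUnion σ).card = ∑ i ∈ units G o, (σ i).card := by
      refine Finset.card_biUnion fun i hi j hj hij => Finset.disjoint_left.2 fun x hx hx' => hij ?_
      have h1 := (Finset.mem_filter.1 hx).2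
      have h2 := (Finset.mem_filter.1 hx').2
      obtain ⟨e1, e2⟩ := (mem_units.1 hi).eq_of_blk hG (mem_units.1 hj)
        ((mem_units.1 hi).isBlk.eq_of_mem_ext hG (mem_units.1 hj).isBlk h1.1 h2.1 h1.2)
      exact Prod.ext e1 e2
    have hP : (Finset.univ.biUnion fun c => (M c).image (f c)).card
        = ∑ c, ((M c).image (f c)).card := by
      refine Finset.card_biUnion fun c _ c' _ hcc => Finset.disjoint_left.2 fun x hx hx' => hcc ?_
      obtain ⟨u, hu, rfl⟩ := Finset.mem_image.1 hx
      obtain ⟨u', hu', he⟩ := Finset.mem_image.1 hx'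
      have h1 := hleg c u hu
      have h2 := hleg c' u' hu'
      rw [he] at h2
      exact h1.1.root_unique hG h2.1 h1.2 h2.2
    have hdis : Disjoint ((units G o).biUnion σ)
        (Finset.univ.biUnion fun c => (M c).image (f c)) := by
      rw [Finset.disjoint_left]
      intro x hx hx'
      simp only [Finset.mem_biUnion, Finset.mem_univ, true_and, Finset.mem_image] at hx hx'
      obtain ⟨i, hi, hxi⟩ := hx
      obtain ⟨c, u, hu, rfl⟩ := hx'
      exact ((hMm c u).1 hu).1.1.leg_not_mem_ext hG (mem_units.1 hi).isBlk (hleg c u hu).1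
        (Finset.mem_filter.1 hxi).2.1
    have hsub : (units G o).biUnion σ ∪ (Finset.univ.biUnion fun c => (M c).image (f c)) ⊆ R := by
      intro x hx
      simp only [Finset.mem_union, Finset.mem_biUnion, Finset.mem_univ, true_and,
        Finset.mem_image] at hx
      rcases hx with ⟨i, hi, hxi⟩ | ⟨c, u, hu, rfl⟩
      · exact (Finset.mem_filter.1 hxi).1
      · exact (hf c u hu).1
    have := Finset.card_le_card hsub
    rw [Finset.card_union_of_disjoint hdis, hA, hP] at this
    rw [Task.total, Task.val]
    have h2 := Finset.sum_le_sum fun c (_ : c ∈ (Finset.univ : Finset V)) => hle c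
    omega

variable {σ : V × V → Finset V} (hσ : (graphTask G K).Feasible (units G o) σ)

include hG hσ in
/-- In its EBCs, the result of a feasible choice is what has been chosen for them. -/
theorem result_inter {i : V × V} (hi : i ∈ units G o) {w : V} (hw : w ∈ ext G (blk G i.1 i.2)) :
    w ∈ (graphTask G K).result (units G o) σ ↔ w ∈ σ i := by
  constructor
  · intro h
    simp only [Task.result, Finset.mem_union, Finset.mem_biUnion, Finset.mem_univ, true_and] at h
    rcases h with ⟨j, hj, hw'⟩ | ⟨c, hw'⟩
    · have h1 := (hσ.1 j hj).2.1 w hw'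
      obtain ⟨e1, e2⟩ := (mem_units.1 hj).eq_of_blk hG (mem_units.1 hi)
        ((mem_units.1 hj).isBlk.eq_of_mem_ext hG (mem_units.1 hi).isBlk h1.1 hw h1.2)
      rwa [Prod.ext e1 e2] at hw'
    · exfalso
      have h1 : w ∈ (graphTask G K).all c := by
        unfold sel at hw'
        split_ifs at hw'
        · exact few_subset_all c hw'
        · exact hw'
      have h2 : Leg G c w := by simpa [graphTask] using h1
      exact h2.1.leg_not_mem_ext hG (mem_units.1 hi).isBlk h2.2.2 hw
  · intro h
    exact Finset.mem_union_left _ (Finset.mem_biUnion.2 ⟨i, hi, h⟩)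

include hG hσ in
/-- The result of a feasible choice satisfies the local conditions. -/
theorem Task.Feasible.local : Local G ((graphTask G K).result (units G o) σ : Set V) := by
  have hiff : ∀ i ∈ units G o, ∀ w ∈ ext G (blk G i.1 i.2), ¬ Joint G w →
      (w ∈ ((graphTask G K).result (units G o) σ : Set V) ↔ w ∈ (σ i : Set V)) :=
    fun i hi w hw _ => by simpa using result_inter hG hσ hi hw
  have hbad : ∀ i ∈ units G o, ∀ x,
      Bad G ((graphTask G K).result (units G o) σ) (blk G i.1 i.2) x →
        (graphTask G K).bad i (σ i) x := fun i hi x h => (bad_congr (hiff i hi) x).1 h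
  refine ⟨fun B hB => ?_, fun c u v hu hv huv => ?_, fun B hB c u hb hu => ?_,
    fun B B' hB hB' c hb hb' => ?_⟩
  · obtain ⟨c, v, hi, rfl⟩ := hB.exists_unit o
    have hi' : (c, v) ∈ units G o := mem_units.2 hi
    rw [stand_congr (hiff (c, v) hi')]
    exact (hσ.1 (c, v) hi').2.2
  · have key : ∀ x, x ∈ (graphTask G K).few c →
        x ∈ (graphTask G K).result (units G o) σ := by
      intro x hx
      refine Finset.mem_union_right _ (Finset.mem_biUnion.2 ⟨c, Finset.mem_univ _, ?_⟩)
      unfold sel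
      split_ifs
      · exact hx
      · exact few_subset_all c hx
    rcases lt_or_gt_of_ne huv with h | h
    · exact .inr ⟨v, key v (by simpa [graphTask] using ⟨hv, u, h, hu⟩), Cn.refl _ _⟩
    · exact .inl ⟨u, key u (by simpa [graphTask] using ⟨hu, v, h, hv⟩), Cn.refl _ _⟩
  · obtain ⟨d, v, hi, rfl⟩ := hB.exists_unit o
    have hi' : (d, v) ∈ units G o := mem_units.2 hi
    have hne : (graphTask G K).bads (units G o) σ c ≠ 0 := by
      have := Finset.single_le_sum (s := units G o)
        (f := fun i => if (graphTask G K).bad i (σ i) c then 1 else 0)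
        (fun _ _ => Nat.zero_le _) hi'
      simp only [hbad _ hi' c hb, if_true] at this
      rw [Task.bads]; omega
    refine ⟨u, Finset.mem_union_right _ (Finset.mem_biUnion.2 ⟨c, Finset.mem_univ _, ?_⟩),
      Cn.refl _ _⟩
    rw [sel, if_neg hne]
    simpa [graphTask] using hu
  · obtain ⟨d, v, hi, rfl⟩ := hB.exists_unit o
    obtain ⟨d', v', hi', rfl⟩ := hB'.exists_unit o
    have h1 := hbad (d, v) (mem_units.2 hi) c hb
    have h2 := hbad (d', v') (mem_units.2 hi') c hb'
    have := hσ.2 c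
    rw [Task.bads, Finset.sum_boole, Nat.cast_id, Finset.card_le_one] at this
    have he := this (d, v) (by simp [h1, mem_units, hi]) (d', v')
      (by simp [h2, mem_units, hi'])
    simp only [Prod.mk.injEq] at he
    rw [he.1, he.2]

include hG hσ in
theorem Task.Feasible.ncard_le {B : Set V} (hB : IsBlk G B) :
    (((graphTask G K).result (units G o) σ : Set V) ∩ ext G B).ncard ≤ K := by
  obtain ⟨c, v, hi, rfl⟩ := hB.exists_unit o
  have hi' : (c, v) ∈ units G o := mem_units.2 hi
  refine le_trans ?_ (hσ.1 (c, v) hi').1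
  rw [← Set.ncard_coe_finset]
  exact Set.ncard_le_ncard (fun w hw => (result_inter hG hσ hi' hw.2).1 hw.1) (Set.toFinite _)

theorem card_result_le :
    ((graphTask G K).result (units G o) σ).card ≤ (graphTask G K).total (units G o) σ := by
  rw [Task.result, Task.total, Task.val, add_comm]
  refine (Finset.card_union_le _ _).trans (Nat.add_le_add Finset.card_biUnion_le
    (Finset.card_biUnion_le.trans (Finset.sum_le_sum fun c _ => ?_)))
  unfold sel
  split_ifs <;> rfl

end GraphTask

/-! ### Truth values, running times and tables -/

namespace Ex

/-- The expression has a nonzero value. -/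
def tr (m : Mem) (e : Ex) (d : ℕ) (ρ : ℕ → ℕ) : Prop := e.eval m d ρ ≠ 0

/-- Conjunction. -/
def conj (a b : Ex) : Ex := bin .mul a b
/-- Disjunction. -/
def disj (a b : Ex) : Ex := bin .add a b
/-- Negation. -/
def neg (a : Ex) : Ex := ite a (num 0) (num 1)
/-- Implication. -/
def imp (a b : Ex) : Ex := disj (neg a) b
/-- The relation `<`. -/
def less (a b : Ex) : Ex := bin .sub b a
/-- Equality. -/
def same (a b : Ex) : Ex := neg (disj (less a b) (less b a))
/-- Existence of a number below cell `0` of the array `A`. -/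
def exi (A : ℕ) (e : Ex) : Ex := less (find A e) (get A (num 0))
/-- Universal quantification over the numbers below cell `0` of the array `A`. -/
def all (A : ℕ) (e : Ex) : Ex := neg (exi A (neg e))

variable (m : Mem) (a b c e : Ex) (A d : ℕ) (ρ : ℕ → ℕ)

theorem tr_iff : e.tr m d ρ ↔ e.eval m d ρ ≠ 0 := Iff.rfl

@[simp] theorem tr_conj : (conj a b).tr m d ρ ↔ a.tr m d ρ ∧ b.tr m d ρ := by
  simp [tr, conj, eval, Op.eval]

@[simp] theorem tr_disj : (disj a b).tr m d ρ ↔ a.tr m d ρ ∨ b.tr m d ρ := by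
  simp only [tr, disj, eval, Op.eval]; omega

@[simp] theorem tr_neg : (neg a).tr m d ρ ↔ ¬ a.tr m d ρ := by
  by_cases h : a.eval m d ρ = 0 <;> simp [tr, neg, eval, h]

@[simp] theorem tr_imp : (imp a b).tr m d ρ ↔ (a.tr m d ρ → b.tr m d ρ) := by
  simp [imp, imp_iff_not_or]

@[simp] theorem tr_less : (less a b).tr m d ρ ↔ a.eval m d ρ < b.eval m d ρ := by
  simp only [tr, less, eval, Op.eval]; omega

@[simp] theorem tr_same : (same a b).tr m d ρ ↔ a.eval m d ρ = b.eval m d ρ := by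
  simp only [same, tr_neg, tr_disj, tr_less]; omega

@[simp] theorem tr_exi : (exi A e).tr m d ρ ↔
    ∃ x < m A 0, e.tr m (d + 1) (Function.update ρ d x) := by
  simp only [exi, tr_less, eval]
  exact firstBelow_lt_iff

@[simp] theorem tr_all : (all A e).tr m d ρ ↔
    ∀ x < m A 0, e.tr m (d + 1) (Function.update ρ d x) := by
  simp only [all, tr_neg, tr_exi, not_exists, not_and, not_not]

@[simp] theorem tr_get : (get A e).tr m d ρ ↔ m A (e.eval m d ρ) ≠ 0 := Iff.rfl

@[simp] theorem eval_num (c : ℕ) : (num c).eval m d ρ = c := rfl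
@[simp] theorem eval_var (i : ℕ) : (var i).eval m d ρ = ρ i := rfl
@[simp] theorem eval_get : (get A e).eval m d ρ = m A (e.eval m d ρ) := rfl
@[simp] theorem eval_add : (bin .add a b).eval m d ρ = a.eval m d ρ + b.eval m d ρ := rfl
@[simp] theorem eval_sub : (bin .sub a b).eval m d ρ = a.eval m d ρ - b.eval m d ρ := rfl
@[simp] theorem eval_mul : (bin .mul a b).eval m d ρ = a.eval m d ρ * b.eval m d ρ := rfl

open Classical in
@[simp] theorem eval_ite : (ite c a b).eval m d ρ =
    if c.tr m d ρ then a.eval m d ρ else b.eval m d ρ := by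
  simp only [eval, tr]
  congr

@[simp] theorem eval_sum : (sum A e).eval m d ρ =
    ∑ x ∈ Finset.range (m A 0), e.eval m (d + 1) (Function.update ρ d x) := rfl

/-- The arrays that an expression refers to. -/
def reads : Ex → List ℕ
  | num _ => []
  | var _ => []
  | get A e => A :: e.reads
  | bin _ a b => a.reads ++ b.reads
  | ite c a b => c.reads ++ a.reads ++ b.reads
  | sum A e => A :: e.reads
  | find A e => A :: e.reads

theorem eval_congr {m m' : Mem} (e : Ex) : (∀ A ∈ e.reads, m' A = m A) → ∀ (d : ℕ) (ρ : ℕ → ℕ),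
    e.eval m' d ρ = e.eval m d ρ := by
  induction e with
  | num c => intros; rfl
  | var i => intros; rfl
  | get A e ih => intro h d ρ; simp_all [reads]
  | bin o a b iha ihb => intro h d ρ; simp_all [reads, eval]
  | ite c a b ihc iha ihb => intro h d ρ; simp_all [reads, eval]
  | sum A e ih => intro h d ρ; simp_all [reads, eval]
  | find A e ih => intro h d ρ; simp_all [reads, eval]

theorem cost_congr {m m' : Mem} (e : Ex) (h : ∀ A ∈ e.reads, m' A = m A) :
    e.cost m' = e.cost m := by
  induction e <;> simp_all [reads, cost]

/-- The constant in the bound `cost_le`. -/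
def cst : Ex → ℕ
  | num _ => 1
  | var _ => 2
  | get _ e => e.cst + 1
  | bin _ a b => a.cst + b.cst + 1
  | ite c a b => c.cst + a.cst + b.cst + 1
  | sum _ e => e.cst + 7
  | find _ e => e.cst + 10

/-- The nesting depth of the binders that run below cell `0` of `B`. -/
def deg (B : ℕ) : Ex → ℕ
  | num _ => 0
  | var _ => 0
  | get _ e => e.deg B
  | bin _ a b => max (a.deg B) (b.deg B)
  | ite c a b => max (c.deg B) (max (a.deg B) (b.deg B))
  | sum A e => e.deg B + if A = B then 1 else 0
  | find A e => e.deg B + if A = B then 1 else 0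

/-- All binders run below cell `0` of one of the arrays `2`, `3` and `4`. -/
def bnd : Ex → Bool
  | num _ => true
  | var _ => true
  | get _ e => e.bnd
  | bin _ a b => a.bnd && b.bnd
  | ite c a b => c.bnd && a.bnd && b.bnd
  | sum A e => (A == 2 || A == 3 || A == 4) && e.bnd
  | find A e => (A == 2 || A == 3 || A == 4) && e.bnd

theorem cost_le_aux {x y z : ℕ} (hx : 1 ≤ x) (hy : 1 ≤ y) (hz : 1 ≤ z) {a b c a' b' c' : ℕ}
    (ha : a ≤ a') (hb : b ≤ b') (hc : c ≤ c') :
    x ^ a * y ^ b * z ^ c ≤ x ^ a' * y ^ b' * z ^ c' :=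
  Nat.mul_le_mul (Nat.mul_le_mul (Nat.pow_le_pow_right hx ha) (Nat.pow_le_pow_right hy hb))
    (Nat.pow_le_pow_right hz hc)

/-- The running time of an expression is at most a constant times the product of the bounds of the
nested binders. -/
theorem cost_le {m : Mem} {x y z : ℕ} (hx : 1 ≤ x) (hy : 1 ≤ y) (hz : 1 ≤ z) (h2 : m 2 0 ≤ x)
    (h3 : m 3 0 ≤ y) (h4 : m 4 0 ≤ z) (e : Ex) (he : e.bnd = true) :
    e.cost m ≤ e.cst * (x ^ e.deg 2 * y ^ e.deg 3 * z ^ e.deg 4) := by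
  have hpos : ∀ a b c : ℕ, 1 ≤ x ^ a * y ^ b * z ^ c := fun a b c =>
    Nat.mul_pos (Nat.mul_pos (Nat.pow_pos hx) (Nat.pow_pos hy)) (Nat.pow_pos hz)
  have hbind : ∀ (A : ℕ) (e : Ex) (q : ℕ), (A == 2 || A == 3 || A == 4) = true →
      e.cost m ≤ e.cst * (x ^ e.deg 2 * y ^ e.deg 3 * z ^ e.deg 4) →
      m A 0 * (e.cost m + q) ≤ (e.cst + q) * (x ^ (e.deg 2 + if A = 2 then 1 else 0) *
        y ^ (e.deg 3 + if A = 3 then 1 else 0) * z ^ (e.deg 4 + if A = 4 then 1 else 0)) := by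
    intro A e q hA ih
    have h1 : e.cost m + q ≤ (e.cst + q) * (x ^ e.deg 2 * y ^ e.deg 3 * z ^ e.deg 4) := by
      nlinarith [hpos (e.deg 2) (e.deg 3) (e.deg 4)]
    simp only [Bool.or_eq_true, beq_iff_eq] at hA
    rcases hA with (rfl | rfl) | rfl
    · calc _ ≤ x * ((e.cst + q) * (x ^ e.deg 2 * y ^ e.deg 3 * z ^ e.deg 4)) :=
            Nat.mul_le_mul h2 h1
        _ = _ := by simp; ring
    · calc _ ≤ y * ((e.cst + q) * (x ^ e.deg 2 * y ^ e.deg 3 * z ^ e.deg 4)) :=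
            Nat.mul_le_mul h3 h1
        _ = _ := by simp; ring
    · calc _ ≤ z * ((e.cst + q) * (x ^ e.deg 2 * y ^ e.deg 3 * z ^ e.deg 4)) :=
            Nat.mul_le_mul h4 h1
        _ = _ := by simp; ring
  induction e with
  | num c => simp [cost, cst, deg]
  | var i => simp [cost, cst, deg]
  | get A e ih =>
    have := ih he
    simp only [cost, cst, deg]
    nlinarith [hpos (e.deg 2) (e.deg 3) (e.deg 4)]
  | bin o a b iha ihb =>
    simp only [bnd, Bool.and_eq_true] at he
    simp only [cost, cst, deg]
    have h1 := (iha he.1).trans (Nat.mul_le_mul_left a.cst (cost_le_aux hx hy hz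
      (le_max_left _ (b.deg 2)) (le_max_left _ (b.deg 3)) (le_max_left _ (b.deg 4))))
    have h2 := (ihb he.2).trans (Nat.mul_le_mul_left b.cst (cost_le_aux hx hy hz
      (le_max_right (a.deg 2) _) (le_max_right (a.deg 3) _) (le_max_right (a.deg 4) _)))
    nlinarith [hpos (max (a.deg 2) (b.deg 2)) (max (a.deg 3) (b.deg 3)) (max (a.deg 4) (b.deg 4))]
  | ite c a b ihc iha ihb =>
    simp only [bnd, Bool.and_eq_true] at he
    simp only [cost, cst, deg]
    have h0 := (ihc he.1.1).trans (Nat.mul_le_mul_left c.cst (cost_le_aux hx hy hz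
      (le_max_left _ (max (a.deg 2) (b.deg 2))) (le_max_left _ (max (a.deg 3) (b.deg 3)))
      (le_max_left _ (max (a.deg 4) (b.deg 4)))))
    have h1 := (iha he.1.2).trans (Nat.mul_le_mul_left a.cst (cost_le_aux hx hy hz
      ((le_max_left _ (b.deg 2)).trans (le_max_right (c.deg 2) _))
      ((le_max_left _ (b.deg 3)).trans (le_max_right (c.deg 3) _))
      ((le_max_left _ (b.deg 4)).trans (le_max_right (c.deg 4) _))))
    have h2 := (ihb he.2).trans (Nat.mul_le_mul_left b.cst (cost_le_aux hx hy hz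
      ((le_max_right (a.deg 2) _).trans (le_max_right (c.deg 2) _))
      ((le_max_right (a.deg 3) _).trans (le_max_right (c.deg 3) _))
      ((le_max_right (a.deg 4) _).trans (le_max_right (c.deg 4) _))))
    nlinarith [hpos (max (c.deg 2) (max (a.deg 2) (b.deg 2)))
      (max (c.deg 3) (max (a.deg 3) (b.deg 3))) (max (c.deg 4) (max (a.deg 4) (b.deg 4)))]
  | sum A e ih =>
    simp only [bnd, Bool.and_eq_true] at he
    have h1 := hbind A e 3 he.1 (ih he.2)
    simp only [cost, cst, deg]
    nlinarith [hpos (e.deg 2 + if A = 2 then 1 else 0) (e.deg 3 + if A = 3 then 1 else 0)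
      (e.deg 4 + if A = 4 then 1 else 0)]
  | find A e ih =>
    simp only [bnd, Bool.and_eq_true] at he
    have h1 := hbind A e 5 he.1 (ih he.2)
    simp only [cost, cst, deg]
    nlinarith [hpos (e.deg 2 + if A = 2 then 1 else 0) (e.deg 3 + if A = 3 then 1 else 0)
      (e.deg 4 + if A = 4 then 1 else 0)]

/-- The number of vertices, which is kept in array `2`. -/
def nn : Ex := get 2 (num 0)

/-- The entry of the square table `A` in row `a` and column `b`. -/
def ix (A : ℕ) (a b : Ex) : Ex := get A (bin .add (bin .mul a nn) b)

@[simp] theorem eval_nn : nn.eval m d ρ = m 2 0 := rfl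

@[simp] theorem eval_ix : (ix A a b).eval m d ρ = m A (a.eval m d ρ * m 2 0 + b.eval m d ρ) := rfl

@[simp] theorem tr_ix : (ix A a b).tr m d ρ ↔ m A (a.eval m d ρ * m 2 0 + b.eval m d ρ) ≠ 0 :=
  Iff.rfl

end Ex

theorem idx_inj {n i j i' j' : ℕ} (hj : j < n) (hj' : j' < n) :
    i * n + j = i' * n + j' ↔ i = i' ∧ j = j' := by
  constructor
  · intro h
    have h1 : (i * n + j) / n = i := by
      rw [mul_comm, Nat.mul_add_div (by omega), Nat.div_eq_of_lt hj, add_zero]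
    have h2 : (i' * n + j') / n = i' := by
      rw [mul_comm, Nat.mul_add_div (by omega), Nat.div_eq_of_lt hj', add_zero]
    have h3 : i = i' := by rw [← h1, h, h2]
    subst h3
    exact ⟨rfl, by omega⟩
  · rintro ⟨rfl, rfl⟩; rfl

section Rules

variable {M w d t : ℕ} {ρ : ℕ → ℕ} {m : Mem}

/-- The rule for stores with a bound for the time. -/
theorem Tri.store' {A : ℕ} {i e : Ex} {T : ℕ} {Q : Mem → Prop} (hi : i.wf d = true)
    (he : e.wf d = true) (hT : i.cost m + e.cost m + 3 ≤ T)
    (hQ : Q (m.set A (i.eval m d ρ) (min (e.eval m d ρ) (M ^ 2)))) :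
    Tri M w d t ρ m (storeS A i e d t) T Q :=
  (Tri.store hi he hQ).mono hT fun _ _ _ h => h

/-- The rule for branching with a bound for the time. -/
theorem Tri.ite' {c : Ex} {p q : Pg} {T T' : ℕ} {Q : Mem → Prop} (hc : c.wf d = true)
    (hT : c.cost m + T + 1 ≤ T')
    (hp : c.tr m d ρ → Tri M w d t ρ m (p d t) T Q)
    (hq : ¬ c.tr m d ρ → Tri M w d t ρ m (q d t) T Q) :
    Tri M w d t ρ m (iteS c p q d t) T' Q :=
  (Tri.ite hc hp fun h => hq (fun h' => h' h)).mono hT fun _ _ _ h => h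

theorem Tri.one_le (h : 2 ≤ M) : 1 ≤ M ^ 2 := Nat.one_le_pow _ _ (by omega)

/-- Filling cells of the array `A` in a loop. The expressions may refer to the cell of `A` that is
about to be overwritten. -/
theorem Tri.fill {A B : ℕ} {i e : Ex} {T c : ℕ} {Q : Mem → Prop} (f v : ℕ → ℕ)
    (hAB : B ≠ A) (hi : i.wf (d + 1) = true) (he : e.wf (d + 1) = true)
    (hT : m B 0 * (c + 6) + 5 ≤ T)
    (hinj : ∀ x < m B 0, ∀ y < m B 0, f x = f y → x = y)
    (heval : ∀ x < m B 0, ∀ m' : Mem, (∀ C, C ≠ A → m' C = m C) → m' A (f x) = m A (f x) →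
      i.eval m' (d + 1) (Function.update ρ d x) = f x ∧
      e.eval m' (d + 1) (Function.update ρ d x) = v x ∧ i.cost m' + e.cost m' ≤ c)
    (hQ : ∀ m', (∀ C, C ≠ A → m' C = m C) → (∀ A i, m' A i ≤ M ^ 2) →
      (∀ x < m B 0, m' A (f x) = min (v x) (M ^ 2)) →
      (∀ z, (∀ x < m B 0, z ≠ f x) → m' A z = m A z) → Q m') :
    Tri M w d t ρ m (forS B (storeS A i e) d t) T Q := by
  refine Tri.for' (T := c + 3) (fun x m' => (∀ y < x, m' A (f y) = min (v y) (M ^ 2)) ∧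
    ∀ z, (∀ y < x, z ≠ f y) → m' A z = m A z) (by simpa using hT) ⟨by simp, by simp⟩ ?_ ?_
  · rintro x hx m' hfr - ⟨h1, h2⟩
    have hfr' : ∀ C, C ≠ A → m' C = m C := fun C hC => hfr C (by simpa using hC)
    have hxs : m' A (f x) = m A (f x) := h2 _ fun y hy he => by
      have := hinj x hx y (by omega) he
      omega
    obtain ⟨e1, e2, e3⟩ := heval x hx m' hfr' hxs
    refine Tri.store' hi he (by omega) ⟨fun y hy => ?_, fun z hz => ?_⟩
    · rw [Mem.set_self, e1, e2]
      split_ifs with h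
      · rcases Nat.lt_succ_iff_lt_or_eq.1 hy with h' | h'
        · have := hinj y (by omega) x hx h
          omega
        · rw [h']
      · exact h1 y (lt_of_le_of_ne (by omega) fun h' => h (by rw [h']))
    · rw [Mem.set_self, e1, if_neg (hz x (by omega))]
      exact h2 z fun y hy => hz y (by omega)
  · rintro m' hfr hb ⟨h1, h2⟩
    exact hQ m' (fun C hC => hfr C (by simpa using hC)) hb h1 h2

/-- Filling a table with one row. -/
def tab1 (A : ℕ) (e : Ex) : Pg := forS 2 (storeS A (.var 0) e)

/-- Filling a square table. -/
def tab2 (A : ℕ) (e : Ex) : Pg :=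
  forS 2 (forS 2 (storeS A (.bin .add (.bin .mul (.var 0) .nn) (.var 1)) e))

@[simp] theorem tab1_stores (A : ℕ) (e : Ex) (d t : ℕ) : (tab1 A e d t).stores = [A] := by
  simp [tab1]

@[simp] theorem tab2_stores (A : ℕ) (e : Ex) (d t : ℕ) : (tab2 A e d t).stores = [A] := by
  simp [tab2]

/-- The variables `0` and `1`. -/
def env2 (i j : ℕ) : ℕ → ℕ := Function.update (Function.update (fun _ => 0) 0 i) 1 j

/-- The variable `0`. -/
def env1 (i : ℕ) : ℕ → ℕ := Function.update (fun _ => 0) 0 i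

/-- The value of an expression depends on the bound variables only. -/
theorem Ex.eval_env {m : Mem} (e : Ex) : ∀ {d : ℕ} {ρ ρ' : ℕ → ℕ}, e.closed d = true →
    (∀ i < d, ρ i = ρ' i) → e.eval m d ρ = e.eval m d ρ' := by
  have hup : ∀ {d : ℕ} {ρ ρ' : ℕ → ℕ} (x : ℕ), (∀ i < d, ρ i = ρ' i) →
      ∀ i < d + 1, Function.update ρ d x i = Function.update ρ' d x i := by
    intro d ρ ρ' x h i hi
    simp only [Function.update_apply]
    split_ifs
    · rfl
    · exact h i (by omega)
  induction e with
  | num c => intros; rfl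
  | var i => intro d ρ ρ' hc h; exact h i (by simpa [closed] using hc)
  | get A e ih => intro d ρ ρ' hc h; rw [eval_get, eval_get, ih hc h]
  | bin o a b iha ihb =>
    intro d ρ ρ' hc h
    simp only [closed, Bool.and_eq_true] at hc
    simp only [eval]
    rw [iha hc.1 h, ihb hc.2 h]
  | ite c a b ihc iha ihb =>
    intro d ρ ρ' hc h
    simp only [closed, Bool.and_eq_true] at hc
    simp only [eval]
    rw [ihc hc.1.1 h, iha hc.1.2 h, ihb hc.2 h]
  | sum A e ih =>
    intro d ρ ρ' hc h
    simp only [eval]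
    exact Finset.sum_congr rfl fun x _ => ih hc (hup x h)
  | find A e ih =>
    intro d ρ ρ' hc h
    simp only [eval]
    congr 1
    funext x
    exact ih hc (hup x h)

/-- The rule for `tab1`, with the time bound of a loop over an expression with `D` nested binders.
-/
theorem Tri.fill1 {A : ℕ} {e : Ex} {n D T : ℕ} {Q : Mem → Prop} (hn : m 2 0 = n) (h1n : 1 ≤ n)
    (hA : (A ∉ e.reads ∧ A ≠ 2) ∧ e.wf 1 = true ∧ e.bnd = true ∧ e.deg 2 ≤ D ∧ e.deg 3 = 0 ∧
      e.deg 4 = 0)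
    (hT : (e.cst + 13) * n ^ (D + 1) ≤ T)
    (hQ : ∀ m' : Mem, (∀ C, C ≠ A → m' C = m C) →
      (∀ x < n, m' A x = min (e.eval m 1 (env1 x)) (M ^ 2)) →
      (∀ x, n ≤ x → m' A x = m A x) → Q m') :
    Tri M w 0 t ρ m (tab1 A e 0 t) T Q := by
  obtain ⟨⟨hA1, hA2⟩, hwf, hb, hd2, hd3, hd4⟩ := hA
  have hpos : 1 ≤ n ^ D := Nat.one_le_pow _ _ h1n
  have hcost : e.cost m ≤ e.cst * n ^ D := by
    have := Ex.cost_le (m := m) (x := n) (y := m 3 0 + 1) (z := m 4 0 + 1) h1n (by omega) (by omega)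
      hn.le (by omega) (by omega) e hb
    rw [hd3, hd4] at this
    simp only [pow_zero, mul_one] at this
    exact this.trans (Nat.mul_le_mul_left _ (Nat.pow_le_pow_right h1n hd2))
  refine Tri.fill (c := 2 + e.cst * n ^ D) id (fun x => e.eval m 1 (env1 x)) hA2.symm rfl hwf ?_
    (fun x _ y _ h => h) (fun x hx m' hm' _ => ⟨by simp [Ex.eval], ?_, ?_⟩) ?_
  · refine le_trans ?_ hT
    rw [hn, pow_succ]; nlinarith
  · have hr : ∀ C ∈ e.reads, m' C = m C := fun C hC => hm' C fun h => hA1 (h ▸ hC)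
    rw [Ex.eval_congr e hr]
    refine Ex.eval_env e (by simp [Ex.wf] at hwf; exact hwf.1) fun i hi => ?_
    obtain rfl : i = 0 := by omega
    simp [env1]
  · have hr : ∀ C ∈ e.reads, m' C = m C := fun C hC => hm' C fun h => hA1 (h ▸ hC)
    rw [Ex.cost_congr e hr]
    simp only [Ex.cost]; omega
  · intro m' h1 _ h2 h3
    refine hQ m' h1 (fun x hx => h2 x (by omega)) fun x hx => h3 x fun y hy => ?_
    simp only [id]; omega

/-- The rule for `tab2`, with the time bound of two nested loops over an expression with `D` nested
binders. -/
theorem Tri.fill2 {A : ℕ} {e : Ex} {n D T : ℕ} {Q : Mem → Prop} (hn : m 2 0 = n) (h1n : 1 ≤ n)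
    (hA : (A ∉ e.reads ∧ A ≠ 2) ∧ e.wf 2 = true ∧ e.bnd = true ∧ e.deg 2 ≤ D ∧ e.deg 3 = 0 ∧
      e.deg 4 = 0)
    (hT : (e.cst + 27) * n ^ (D + 2) ≤ T)
    (hQ : ∀ m' : Mem, (∀ C, C ≠ A → m' C = m C) →
      (∀ i < n, ∀ j < n, m' A (i * n + j) = min (e.eval m 2 (env2 i j)) (M ^ 2)) → Q m') :
    Tri M w 0 t ρ m (tab2 A e 0 t) T Q := by
  obtain ⟨⟨hA1, hA2⟩, hwf, hb, hd2, hd3, hd4⟩ := hA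
  have hpos : 1 ≤ n ^ D := Nat.one_le_pow _ _ h1n
  have hcost : e.cost m ≤ e.cst * n ^ D := by
    have := Ex.cost_le (m := m) (x := n) (y := m 3 0 + 1) (z := m 4 0 + 1) h1n (by omega) (by omega)
      hn.le (by omega) (by omega) e hb
    rw [hd3, hd4] at this
    simp only [pow_zero, mul_one] at this
    exact this.trans (Nat.mul_le_mul_left _ (Nat.pow_le_pow_right h1n hd2))
  refine Tri.for' (T := n * (8 + e.cst * n ^ D + 6) + 5) (fun x m' => ∀ i < x, ∀ j < n,
      m' A (i * n + j) = min (e.eval m 2 (env2 i j)) (M ^ 2)) ?_ (by simp) ?_ ?_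
  · refine le_trans ?_ hT
    rw [hn, pow_succ, pow_succ]
    nlinarith [Nat.mul_le_mul hpos h1n, Nat.mul_le_mul (Nat.mul_le_mul hpos h1n) h1n]
  · intro x hx m' hm' _ hI
    have hfr : ∀ C, C ≠ A → m' C = m C := fun C hC => hm' C (by simpa using hC)
    have hn' : m' 2 0 = n := by rw [hfr 2 hA2.symm, hn]
    refine Tri.fill (c := 8 + e.cst * n ^ D) (fun y => x * n + y)
      (fun y => e.eval m 2 (env2 x y)) hA2.symm rfl hwf (by rw [hn']) ?_
      (fun y hy m'' hm'' _ => ⟨?_, ?_, ?_⟩) ?_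
    · intro y _ z _ h; simpa using h
    · simp [hm'' 2 hA2.symm, hn']
    · have hr : ∀ C ∈ e.reads, m'' C = m C := fun C hC => by
        have hCA : C ≠ A := fun h => hA1 (h ▸ hC)
        rw [hm'' C hCA, hfr C hCA]
      rw [Ex.eval_congr e hr]
      refine Ex.eval_env e (by simp [Ex.wf] at hwf; exact hwf.1) fun i hi => ?_
      interval_cases i <;> simp [env2]
    · have hr : ∀ C ∈ e.reads, m'' C = m C := fun C hC => by
        have hCA : C ≠ A := fun h => hA1 (h ▸ hC)
        rw [hm'' C hCA, hfr C hCA]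
      rw [Ex.cost_congr e hr]
      simp only [Ex.cost, Ex.nn]; omega
    · intro m'' h1 _ h2 h3 i hi j hj
      rcases Nat.lt_succ_iff_lt_or_eq.1 hi with h | rfl
      · rw [h3 _ fun y hy he => ?_, hI i h j hj]
        have := (idx_inj hj (hn' ▸ hy)).1 he
        omega
      · exact h2 j (by omega)
  · intro m' hm' _ hI
    exact hQ m' (fun C hC => hm' C (by simpa using hC)) (by simpa [hn] using hI)

/-- Cutting numbers down to `M ^ 2` does not change their truth values. -/
theorem min_ne_zero_iff (hM : 2 ≤ M) (x : ℕ) : min x (M ^ 2) ≠ 0 ↔ x ≠ 0 := by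
  have := Tri.one_le hM; omega

end Rules

/-! ### Distances -/

/-- The memory holds the graph: array `0` is the adjacency matrix and cell `0` of array `2` the
number of vertices. -/
structure Holds {n : ℕ} (G : SimpleGraph (Fin n)) (m : Mem) : Prop where
  size : m 2 0 = n
  adj : ∀ i j : Fin n, m 0 (i * n + j) ≠ 0 ↔ G.Adj i j

theorem Holds.congr {n : ℕ} {G : SimpleGraph (Fin n)} {m m' : Mem} (h : Holds G m)
    (h0 : m' 0 = m 0) (h2 : m' 2 = m 2) : Holds G m' :=
        ⟨by rw [h2, h.size], by rw [h0]; exact h.adj⟩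

/-- The Floyd–Warshall algorithm, filling the array `5`. -/
def distS : Pg :=
  seqS (tab2 5 (.ite (.same (.var 0) (.var 1)) (.num 0)
      (.ite (.ix 0 (.var 0) (.var 1)) (.num 1) .nn))) <|
  forS 2 <| forS 2 <| forS 2 <| storeS 5 (.bin .add (.bin .mul (.var 1) .nn) (.var 2))
    (.ite (.less (.bin .add (.ix 5 (.var 1) (.var 0)) (.ix 5 (.var 0) (.var 2)))
        (.ix 5 (.var 1) (.var 2)))
      (.bin .add (.ix 5 (.var 1) (.var 0)) (.ix 5 (.var 0) (.var 2))) (.ix 5 (.var 1) (.var 2)))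

section Dist

variable {n : ℕ} {G : SimpleGraph (Fin n)}

/-- The entries of array `5` less than `n` are lengths of walks. -/
def DistSound (G : SimpleGraph (Fin n)) (m : Mem) : Prop :=
  ∀ i j : Fin n, m 5 (i * n + j) ≤ n ∧ (m 5 (i * n + j) < n → ∃ p : G.Walk i j,
      p.length = m 5 (i * n + j))

/-- The entries of array `5` are at most the lengths of walks with inner vertices below `t`. -/
def DistComplete (G : SimpleGraph (Fin n)) (t : ℕ) (m : Mem) : Prop :=
  ∀ (i j : Fin n) (p : G.Walk i j), (∀ k, 0 < k → k < p.length → (p.getVert k : ℕ) < t) →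
    m 5 (i * n + j) ≤ p.length

/-- One round of the Floyd–Warshall algorithm: a walk with inner vertices up to `t` is cut at its
first and its last visit to `t`. -/
theorem DistComplete.succ {t : Fin n} {m m' : Mem} (h : DistComplete G t m)
    (h1 : ∀ i j : Fin n, m' 5 (i * n + j) ≤ m 5 (i * n + j))
    (h2 : ∀ i j : Fin n, m' 5 (i * n + j) ≤ m 5 (i * n + t) + m 5 (t * n + j)) :
    DistComplete G (t + 1) m' := by
  intro i j p hp
  by_cases hex : ∃ k, 0 < k ∧ k < p.length ∧ p.getVert k = t
  · classical
    have hk := Nat.find_spec hex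
    set k := Nat.find hex with hkdef
    -- the last visit to `t`
    obtain ⟨l, ⟨hl0, hl1, hl2⟩, hmax⟩ := Set.exists_max_image
      {k | 0 < k ∧ k < p.length ∧ p.getVert k = t} id
      ((Set.finite_lt_nat p.length).subset fun x hx => hx.2.1) hex
    have hkl : k ≤ l := Nat.find_min' hex ⟨hl0, hl1, hl2⟩
    have e1 : m 5 (i * n + t) ≤ k := by
      have := h i (p.getVert k) (p.take k) (fun q hq1 hq2 => ?_)
      · rw [SimpleGraph.Walk.take_length, hk.2.2] at this
        omega
      · simp only [SimpleGraph.Walk.take_length] at hq2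
        rw [SimpleGraph.Walk.take_getVert]
        have hq : min k q = q := by omega
        rw [hq]
        have h3 := hp q hq1 (by omega)
        have h4 : p.getVert q ≠ t := fun h => Nat.find_min hex (m := q) (by omega)
          ⟨hq1, by omega, h⟩
        have h5 : (p.getVert q : ℕ) ≠ t := fun h => h4 (Fin.ext h)
        omega
    have e2 : m 5 (t * n + j) ≤ p.length - l := by
      have := h (p.getVert l) j (p.drop l) (fun q hq1 hq2 => ?_)
      · rwa [SimpleGraph.Walk.drop_length, hl2] at this
      · simp only [SimpleGraph.Walk.drop_length] at hq2
        rw [SimpleGraph.Walk.drop_getVert]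
        have h3 := hp (l + q) (by omega) (by omega)
        have h4 : p.getVert (l + q) ≠ t := fun h => by
          have := hmax (l + q) ⟨by omega, by omega, h⟩
          simp only [id] at this
          omega
        have h5 : (p.getVert (l + q) : ℕ) ≠ t := fun h => h4 (Fin.ext h)
        omega
    have := h2 i j
    omega
  · refine (h1 i j).trans (h i j p fun k hk1 hk2 => ?_)
    have h3 := hp k hk1 hk2
    have h5 : (p.getVert k : ℕ) ≠ t := fun h => hex ⟨k, hk1, hk2, Fin.ext h⟩
    omega

/-- The program fills array `5` with the distances, if `G` is connected. In general, an entry less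
than `n` shows that two vertices are connected. -/
theorem tri_dist : ∃ C : ℕ, ∀ {n : ℕ} {G : SimpleGraph (Fin n)} {m : Mem} {w t : ℕ} {ρ : ℕ → ℕ},
    0 < n → Holds G m → Tri (n + 2) w 0 t ρ m (distS 0 t) (C * n ^ 3) fun m' =>
      (∀ i j : Fin n, m' 5 (i * n + j) < n → G.Reachable i j) ∧
      (G.Connected → ∀ i j : Fin n, m' 5 (i * n + j) = G.dist i j) := by
  refine ⟨1000, fun {n G m w t ρ} hn0 hm => ?_⟩
  have hn := hm.size
  have hnM : n ≤ (n + 2) ^ 2 := by nlinarith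
  have hn2 : n ≤ n ^ 2 := Nat.le_self_pow (by omega) n
  have hn3 : n ^ 2 ≤ n ^ 3 := Nat.pow_le_pow_right hn0 (by omega)
  refine Tri.seq (T₁ := 100 * n ^ 2) (T₂ := 900 * n ^ 3) (Tri.fill2 (D := 0) (Q := fun m' =>
    DistSound G m' ∧ DistComplete G 0 m') hn hn0 (by decide) ?_ ?_) (by omega) ?_
  · refine Nat.mul_le_mul_right _ (by decide)
  · intro m' hfr hval
    classical
    have hv : ∀ i j : Fin n, m' 5 (i * n + j) = if i = j then 0 else
        if G.Adj i j then 1 else n := by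
      intro i j
      rw [hval i i.2 j j.2]
      have h1 : m 0 (i * n + j) = 0 ↔ ¬ G.Adj i j := by rw [← hm.adj]; simp
      by_cases hij : i = j
      · simp [env2, hij, Ex.tr_same]
      · have hij' : (i : ℕ) ≠ j := fun h => hij (Fin.ext h)
        by_cases ha : G.Adj i j
        · simp [env2, hij, hij', Ex.tr_same, hn, h1, ha]; omega
        · simp [env2, hij, hij', Ex.tr_same, hn, h1, ha, hnM]
    refine ⟨fun i j => ?_, fun i j p hp => ?_⟩
    · rw [hv]
      split_ifs with h1 h2
      · subst h1
        exact ⟨by omega, fun _ => ⟨.nil, rfl⟩⟩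
      · exact ⟨by omega, fun _ => ⟨.cons h2 .nil, rfl⟩⟩
      · exact ⟨by omega, fun h => by omega⟩
    · rw [hv]
      split_ifs with h1 h2
      · omega
      · rcases Nat.eq_zero_or_pos p.length with h | h
        · exact absurd (SimpleGraph.Walk.eq_of_length_eq_zero h) h1
        · omega
      · exfalso
        rcases Nat.lt_or_ge 1 p.length with h | h
        · have := hp 1 (by omega) h
          omega
        · rcases Nat.eq_zero_or_pos p.length with h' | h'
          · exact h1 (SimpleGraph.Walk.eq_of_length_eq_zero h')
          · exact h2 (SimpleGraph.Walk.adj_of_length_eq_one (p := p) (by omega))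
  · rintro m1 hfr1 - ⟨hs, hc⟩
    have hn1 : m1 2 0 = n := by rw [hfr1 2 (by simp), hn]
    refine Tri.for' (T := 300 * n ^ 2) (fun s m' => DistSound G m' ∧ DistComplete G s m') ?_
      ⟨hs, hc⟩ ?_ ?_
    · rw [hn1]; nlinarith
    · rintro s hsn m2 hfr2 - ⟨hs2, hc2⟩
      rw [hn1] at hsn
      have hn2' : m2 2 0 = n := by rw [hfr2 2 (by simp), hn1]
      refine Tri.for' (T := 100 * n) (fun x m' => DistSound G m' ∧
        (∀ i j : Fin n, m' 5 (i * n + j) ≤ m2 5 (i * n + j)) ∧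
        ∀ i j : Fin n, (i : ℕ) < x → m' 5 (i * n + j) ≤ m2 5 (i * n + s) + m2 5 (s * n + j)) ?_
        ⟨hs2, fun _ _ => le_rfl, fun i j h => by omega⟩ ?_ ?_
      · rw [hn2']; nlinarith
      · rintro x hx m3 hfr3 - ⟨hs3, hle3, hx3⟩
        rw [hn2'] at hx
        have hn3' : m3 2 0 = n := by rw [hfr3 2 (by simp), hn2']
        refine Tri.for' (T := 90) (fun y m' => DistSound G m' ∧
          (∀ i j : Fin n, m' 5 (i * n + j) ≤ m2 5 (i * n + j)) ∧
          ∀ i j : Fin n, ((i : ℕ) < x ∨ (i : ℕ) = x ∧ (j : ℕ) < y) →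
            m' 5 (i * n + j) ≤ m2 5 (i * n + s) + m2 5 (s * n + j)) ?_
          ⟨hs3, hle3, fun i j h => hx3 i j (by omega)⟩ ?_ ?_
        · rw [hn3']; nlinarith
        · rintro y hy m4 hfr4 - ⟨hs4, hle4, hx4⟩
          rw [hn3'] at hy
          have hn4 : m4 2 0 = n := by rw [hfr4 2 (by simp), hn3']
          have ha := hle4 ⟨x, hx⟩ ⟨s, hsn⟩
          have hb := hle4 ⟨s, hsn⟩ ⟨y, hy⟩
          have hc := hle4 ⟨x, hx⟩ ⟨y, hy⟩
          have ka := hs4 ⟨x, hx⟩ ⟨s, hsn⟩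
          have kb := hs4 ⟨s, hsn⟩ ⟨y, hy⟩
          have kc := hs4 ⟨x, hx⟩ ⟨y, hy⟩
          simp only at ha hb hc ka kb kc
          refine Tri.store' (by rfl) (by rfl) ?_ ?_
          · simp [Ex.cost, Ex.less, Ex.ix, Ex.nn]
          · simp only [Ex.eval_ite, Ex.tr_less, Ex.eval_add, Ex.eval_mul, Ex.eval_ix, Ex.eval_nn,
              Ex.eval_var, hn4]
            simp only [Function.update_apply]
            simp only [show (1 : ℕ) ≠ 2 by decide, show (0 : ℕ) ≠ 2 by decide,
              show (0 : ℕ) ≠ 1 by decide, if_true, if_false, zero_add]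
            set v := if m4 5 (x * n + s) + m4 5 (s * n + y) < m4 5 (x * n + y) then
              m4 5 (x * n + s) + m4 5 (s * n + y) else m4 5 (x * n + y) with hv
            have hv1 : v ≤ m4 5 (x * n + y) := by rw [hv]; split_ifs <;> omega
            have hv2 : v ≤ m4 5 (x * n + s) + m4 5 (s * n + y) := by rw [hv]; split_ifs <;> omega
            have hmin : min v ((n + 2) ^ 2) = v := min_eq_left (by omega)
            rw [hmin]
            have hset : ∀ i j : Fin n, (m4.set 5 (x * n + y) v) 5 (i * n + j) =
                if (i : ℕ) = x ∧ (j : ℕ) = y then v else m4 5 (i * n + j) := by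
              intro i j
              rw [Mem.set_self]
              simp only [idx_inj j.2 hy]
            refine ⟨fun i j => ?_, fun i j => ?_, fun i j hij => ?_⟩
            · rw [hset]
              split_ifs with h
              · obtain ⟨rfl, rfl⟩ := h
                refine ⟨by omega, fun hlt => ?_⟩
                rw [hv]
                split_ifs with h'
                · obtain ⟨p, hp⟩ := ka.2 (by omega)
                  obtain ⟨q, hq⟩ := kb.2 (by omega)
                  exact ⟨p.append q, by rw [SimpleGraph.Walk.length_append, hp, hq]⟩
                · exact kc.2 (by rw [hv, if_neg h'] at hlt; exact hlt)
              · exact hs4 i j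
            · rw [hset]
              split_ifs with h
              · obtain ⟨rfl, rfl⟩ := h
                omega
              · exact hle4 i j
            · rw [hset]
              split_ifs with h
              · obtain ⟨rfl, rfl⟩ := h
                omega
              · exact hx4 i j (by omega)
        · rintro m4 hfr4 - ⟨hs4, hle4, hx4⟩
          rw [hn3'] at hx4
          exact ⟨hs4, hle4, fun i j hi => hx4 i j (by have := j.2; omega)⟩
      · rintro m3 hfr3 - ⟨hs3, hle3, hx3⟩
        rw [hn2'] at hx3
        exact ⟨hs3, DistComplete.succ (t := ⟨s, hsn⟩) hc2 hle3 fun i j => hx3 i j i.2⟩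
    · rintro m2 hfr2 - ⟨hs2, hc2⟩
      rw [hn1] at hc2
      refine ⟨fun i j h => ⟨((hs2 i j).2 h).choose⟩, fun hG i j => ?_⟩
      obtain ⟨p, hp⟩ := hG.exists_walk_length_eq_dist i j
      have h1 : m2 5 (i * n + j) ≤ G.dist i j := hp ▸ hc2 i j p fun k _ _ => (p.getVert k).2
      have h2 : G.dist i j < n := by
        have hp' : p.IsPath := SimpleGraph.Walk.isPath_of_length_eq_dist p hp
        have := hp'.length_lt
        simp only [Fintype.card_fin] at this
        omega
      obtain ⟨q, hq⟩ := (hs2 i j).2 (by omega)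
      have := SimpleGraph.dist_le q
      omega

end Dist

/-! ### The components left by a vertex -/

section Comp

open Classical

/-- Merging the components of all neighbors of the vertex `1`, in the graph without the vertex `0`.
Row `c` of the array `6` labels the components of `G - c`. -/
def mergeS : Pg :=
  seqS (storeS 8 (.num 0) (.ix 6 (.var 0) (.var 1))) <|
  seqS (forS 2 (storeS 7 (.var 2) (.num 0))) <|
  seqS (storeS 7 (.get 8 (.num 0)) (.num 1)) <|
  seqS (forS 2 (storeS 7 (.ix 6 (.var 0) (.var 2)) (.disj (.get 7 (.ix 6 (.var 0) (.var 2)))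
    (.conj (.ix 0 (.var 1) (.var 2)) (.neg (.same (.var 2) (.var 0))))))) <|
  forS 2 (storeS 6 (.bin .add (.bin .mul (.var 0) .nn) (.var 2))
    (.ite (.get 7 (.ix 6 (.var 0) (.var 2))) (.get 8 (.num 0)) (.ix 6 (.var 0) (.var 2))))

/-- Labelling the components of `G - c` for all vertices `c`. -/
def compS : Pg :=
  forS 2 <| seqS (forS 2 (storeS 6 (.bin .add (.bin .mul (.var 0) .nn) (.var 1)) (.var 1))) <|
    forS 2 (iteS (.same (.var 0) (.var 1)) skipS mergeS)

variable {n : ℕ} {G : SimpleGraph (Fin n)}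

/-- The entries of row `c` of array `6` are labels of the components of `G - c`. -/
def Labels (G : SimpleGraph (Fin n)) (c : Fin n) (m : Mem) : Prop :=
  ∀ x y : Fin n, m 6 (c * n + x) = m 6 (c * n + y) ↔ Cn G c x y

/-- The labels in row `c` of array `6` after the vertices below `v` have been treated. -/
structure PartLabels (G : SimpleGraph (Fin n)) (c : Fin n) (v : ℕ) (m : Mem) : Prop where
  lt : ∀ x : Fin n, m 6 (c * n + x) < n
  cn : ∀ x y : Fin n, m 6 (c * n + x) = m 6 (c * n + y) → Cn G c x y
  adj : ∀ x y : Fin n, (x : ℕ) < v → G.Adj x y → x ≠ c → y ≠ c →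
    m 6 (c * n + x) = m 6 (c * n + y)

theorem PartLabels.labels {c : Fin n} {m : Mem} (h : PartLabels G c n m) : Labels G c m := by
  refine fun x y => ⟨h.cn x y, fun hc => ?_⟩
  by_cases hx : x = c
  · subst hx
    rw [hc.eq_of_left]
  · refine hc.induct (P := fun y => m 6 (c * n + x) = m 6 (c * n + y)) rfl ?_
    intro a b h1 hab hac hbc
    exact h1.trans (h.adj a b a.2 hab hac hbc)

/-- After the labels of the neighbors of `v` have been replaced by the label of `v`, the labels
respect one vertex more. -/
theorem PartLabels.succ {c v : Fin n} {m m' : Mem} (h : PartLabels G c v m) (hvc : v ≠ c)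
    (h' : ∀ x : Fin n, m' 6 (c * n + x) =
      if m 6 (c * n + x) = m 6 (c * n + v) ∨
        ∃ y : Fin n, (G.Adj v y ∧ y ≠ c) ∧ m 6 (c * n + y) = m 6 (c * n + x)
      then m 6 (c * n + v) else m 6 (c * n + x)) : PartLabels G c (v + 1) m' := by
  have key : ∀ x : Fin n, (m 6 (c * n + x) = m 6 (c * n + v) ∨
      ∃ y : Fin n, (G.Adj v y ∧ y ≠ c) ∧ m 6 (c * n + y) = m 6 (c * n + x)) → Cn G c x v := by
    rintro x (hx | ⟨y, ⟨hy, hyc⟩, hx⟩)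
    · exact h.cn _ _ hx
    · exact (h.cn _ _ hx).symm.trans (Cn.of_adj hy hvc hyc).symm
  refine ⟨fun x => ?_, fun x y hxy => ?_, fun x y hx ha hxc hyc => ?_⟩
  · rw [h']; split_ifs
    · exact h.lt v
    · exact h.lt x
  · rw [h', h'] at hxy
    split_ifs at hxy with h1 h2 h2
    · exact (key x h1).trans (key y h2).symm
    · exact absurd (Or.inl hxy.symm) h2
    · exact absurd (Or.inl hxy) h1
    · exact h.cn x y hxy
  · rw [h', h']
    rcases Nat.lt_succ_iff_lt_or_eq.1 hx with h1 | h1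
    · rw [h.adj x y h1 ha hxc hyc]
    · have h2 : x = v := Fin.ext h1
      subst h2
      rw [if_pos (Or.inl rfl), if_pos (Or.inr ⟨y, ⟨ha, hyc⟩, rfl⟩)]

/-- The rule for `mergeS`: one more vertex is treated, in linear time. -/
theorem tri_merge {m : Mem} {w t : ℕ} {c v : Fin n} {ρ : ℕ → ℕ} (h0 : ρ 0 = c) (h1 : ρ 1 = v)
    (hn0 : 0 < n) (hm : Holds G m) (hvc : v ≠ c) (hp : PartLabels G c v m)
    (hold : ∀ c' < c, Labels G c' m) :
    Tri (n + 2) w 2 t ρ m (mergeS 2 t) (200 * n) fun m' =>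
      PartLabels G c (v + 1) m' ∧ ∀ c' < c, Labels G c' m' := by
  have hn := hm.size
  have hnM : n ≤ (n + 2) ^ 2 := by nlinarith
  refine Tri.seq (T₁ := 20) (T₂ := 180 * n) (Q₁ := fun m' => m' 8 0 = m 6 (c * n + v))
    (Tri.store' rfl rfl (by simp [Ex.cost, Ex.ix, Ex.nn]) ?_) (by omega) ?_
  · rw [Mem.set_self]
    have := hp.lt v
    simp [h0, h1, hn]
    omega
  rintro m1 hf1 - hcur
  have hf1' : ∀ A, A ≠ 8 → m1 A = m A := fun A hA => hf1 A (by simpa using hA)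
  refine Tri.seq (T₁ := 15 * n) (T₂ := 165 * n) (Q₁ := fun m' => ∀ x < n, m' 7 x = 0)
    (Tri.fill (c := 3) id (fun _ => 0) (by decide) rfl rfl ?_ (fun x _ y _ h => h) ?_ ?_)
        (by omega) ?_
  · rw [hf1' 2 (by decide), hn]; omega
  · intro x hx m' hm' _
    exact ⟨by simp, by simp, by simp [Ex.cost]⟩
  · intro m' _ _ h2 _ x hx
    simpa using h2 x (by rwa [hf1' 2 (by decide), hn])
  rintro m2 hf2 - hz
  have hf2' : ∀ A, A ≠ 7 → m2 A = m1 A := fun A hA => hf2 A (by simpa using hA)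
  refine Tri.seq (T₁ := 6) (T₂ := 159 * n) (Q₁ := fun m' => ∀ l < n, m' 7 l ≠ 0 ↔
    l = m 6 (c * n + v)) (Tri.store' rfl rfl (by simp [Ex.cost]) ?_) (by omega) ?_
  · intro l hl
    rw [Mem.set_self]
    have hN := Tri.one_le (M := n + 2) (by omega)
    simp only [Ex.eval_get, Ex.eval_num, hf2' 8 (by decide), hcur]
    split_ifs with h
    · simp [h]
    · simp [hz l hl, h]
  rintro m3 hf3 - hmk
  have hf3' : ∀ A, A ≠ 7 → m3 A = m2 A := fun A hA => hf3 A (by simpa using hA)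
  have hn3 : m3 2 0 = n := by rw [hf3' 2 (by decide), hf2' 2 (by decide), hf1' 2 (by decide), hn]
  have h63 : m3 6 = m 6 := by rw [hf3' 6 (by decide), hf2' 6 (by decide), hf1' 6 (by decide)]
  have h03 : m3 0 = m 0 := by rw [hf3' 0 (by decide), hf2' 0 (by decide), hf1' 0 (by decide)]
  have h83 : m3 8 0 = m 6 (c * n + v) := by rw [hf3' 8 (by decide), hf2' 8 (by decide), hcur]
  refine Tri.seq (T₁ := 100 * n) (T₂ := 59 * n) (Q₁ := fun m' => ∀ l < n, m' 7 l ≠ 0 ↔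
    l = m 6 (c * n + v) ∨ ∃ y : Fin n, (G.Adj v y ∧ y ≠ c) ∧ m 6 (c * n + y) = l) ?_ (by omega) ?_
  · refine Tri.for' (T := 90) (fun s m' => ∀ l < n, m' 7 l ≠ 0 ↔
      l = m 6 (c * n + v) ∨ ∃ y : Fin n, (y : ℕ) < s ∧ (G.Adj v y ∧ y ≠ c) ∧ m 6 (c * n + y) = l)
      (by rw [hn3]; omega) (by simpa using hmk) ?_ ?_
    · rintro s hs m4 hf4 - hI
      rw [hn3] at hs
      have hf4' : ∀ A, A ≠ 7 → m4 A = m3 A := fun A hA => hf4 A (by simpa using hA)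
      refine Tri.store' rfl rfl (by simp [Ex.cost, Ex.ix, Ex.nn, Ex.disj, Ex.conj, Ex.neg, Ex.same,
        Ex.less]) ?_
      intro l hl
      rw [Mem.set_self]
      have e0 : m4 2 0 = n := by rw [hf4' 2 (by decide), hn3]
      have e1 : ∀ x, m4 6 x = m 6 x := fun x => by rw [hf4' 6 (by decide), h63]
      have hadj := hm.adj v ⟨s, hs⟩
      have hls := hp.lt ⟨s, hs⟩
      simp only [Ex.eval_ix, Ex.eval_var, h0, e0, e1, Function.update_apply]
      simp only [show (0 : ℕ) ≠ 2 by decide, if_false, if_true]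
      split_ifs with h
      · subst h
        rw [min_ne_zero_iff (by omega), ← Ex.tr_iff]
        simp only [Ex.tr_disj, Ex.tr_get, Ex.tr_conj, Ex.tr_ix, Ex.tr_neg, Ex.tr_same, Ex.eval_ix,
          Ex.eval_var, Function.update_apply, h0, h1, e0, e1, show (0 : ℕ) ≠ 2 by decide,
          show (1 : ℕ) ≠ 2 by decide, if_false, if_true, hf4' 0 (by decide), h03]
        rw [hI _ hls, hadj]
        constructor
        · rintro ((h | ⟨y, hy, h⟩) | h)
          · exact .inl h
          · exact .inr ⟨y, by omega, h⟩
          · exact .inr ⟨⟨s, hs⟩, by simp, ⟨h.1, fun h' => h.2 (congrArg Fin.val h')⟩, rfl⟩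
        · rintro (h | ⟨y, hy, h⟩)
          · exact .inl (.inl h)
          · rcases Nat.lt_succ_iff_lt_or_eq.1 hy with h' | h'
            · exact .inl (.inr ⟨y, h', h⟩)
            · have : y = ⟨s, hs⟩ := Fin.ext h'
              subst this
              exact .inr ⟨h.1.1, fun h' => h.1.2 (Fin.ext h')⟩
      · rw [hI l hl]
        refine or_congr_right ⟨fun ⟨y, hy, h⟩ => ⟨y, by omega, h⟩, fun ⟨y, hy, h'⟩ => ⟨y, ?_, h'⟩⟩
        rcases Nat.lt_succ_iff_lt_or_eq.1 hy with hy' | hy'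
        · exact hy'
        · have : y = ⟨s, hs⟩ := Fin.ext hy'
          subst this
          exact absurd h'.2.symm h
    · intro m4 _ _ hI l hl
      rw [hI l hl]
      simp [hn3]
  rintro m4 hf4 - hmk4
  have hf4' : ∀ A, A ≠ 7 → m4 A = m3 A := fun A hA => hf4 A (by simpa using hA)
  have hn4 : m4 2 0 = n := by rw [hf4' 2 (by decide), hn3]
  have h64 : m4 6 = m 6 := by rw [hf4' 6 (by decide), h63]
  have h84 : m4 8 0 = m 6 (c * n + v) := by rw [hf4' 8 (by decide), h83]
  refine Tri.fill (c := 40) (fun x => c * n + x) (fun x => if m4 7 (m 6 (c * n + x)) ≠ 0 then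
    m 6 (c * n + v) else m 6 (c * n + x)) (by decide) rfl rfl (by rw [hn4]; omega)
    (fun x _ y _ h => by simpa using h) ?_ ?_
  · intro x hx m5 hf5 hsame
    refine ⟨by simp [hf5 2 (by decide), hn4, h0], ?_, by
      simp [Ex.cost, Ex.ix, Ex.nn]⟩
    simp [hf5 2 (by decide), hf5 7 (by decide), hf5 8 (by decide), hn4, h0, hsame, h64, h84]
  · rintro m5 hf5 - hin hout
    rw [hn4] at hin hout
    have hin' : ∀ x : Fin n, m5 6 (c * n + x) =
        if m 6 (c * n + x) = m 6 (c * n + v) ∨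
          ∃ y : Fin n, (G.Adj v y ∧ y ≠ c) ∧ m 6 (c * n + y) = m 6 (c * n + x)
        then m 6 (c * n + v) else m 6 (c * n + x) := by
      intro x
      have a1 := hp.lt x
      have a2 := hp.lt v
      rw [hin x x.2, min_eq_left]
      · simp only [hmk4 _ a1]
      · split_ifs <;> omega
    refine ⟨hp.succ hvc hin', fun c' hc' => ?_⟩
    have he : ∀ x : Fin n, m5 6 (c' * n + x) = m 6 (c' * n + x) := fun x => by
      rw [hout, h64]
      intro y hy he
      have := (idx_inj x.2 hy).1 he
      have := Fin.lt_def.1 hc'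
      omega
    intro x y
    rw [he, he]
    exact hold c' hc' x y

/-- The rule for `compS`: the components of all graphs `G - c` are labelled, in cubic time. -/
theorem tri_comp : ∃ C : ℕ, ∀ {n : ℕ} {G : SimpleGraph (Fin n)} {m : Mem} {w t : ℕ} {ρ : ℕ → ℕ},
    0 < n → Holds G m → Tri (n + 2) w 0 t ρ m (compS 0 t) (C * n ^ 3) fun m' =>
      ∀ c : Fin n, Labels G c m' := by
  refine ⟨400, fun {n G m w t ρ} hn0 hm => ?_⟩
  have hn := hm.size
  have hnM : n ≤ (n + 2) ^ 2 := by nlinarith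
  have hn2 : n ≤ n ^ 2 := Nat.le_self_pow (by omega) n
  have hn3 : n ^ 2 ≤ n ^ 3 := Nat.pow_le_pow_right hn0 (by omega)
  refine Tri.for' (T := 350 * n ^ 2) (fun s m' => ∀ c : Fin n, (c : ℕ) < s → Labels G c m') ?_
    (by simp) ?_ fun m' _ _ h c => h c (by rw [hn]; exact c.2)
  · rw [hn]; nlinarith
  rintro s hs m1 hf1 - hold
  rw [hn] at hs
  have hf1' : ∀ A, A ≠ 6 → A ≠ 7 → A ≠ 8 → m1 A = m A := fun A h1 h2 h3 =>
    hf1 A (by simp [mergeS, h1, h2, h3])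
  have hm1 : Holds G m1 := hm.congr (hf1' 0 (by decide) (by decide) (by decide))
    (hf1' 2 (by decide) (by decide) (by decide))
  have hn1 := hm1.size
  refine Tri.seq (T₁ := 30 * n) (T₂ := 300 * n ^ 2) (Q₁ := fun m' => PartLabels G ⟨s, hs⟩ 0 m' ∧
    ∀ c : Fin n, (c : ℕ) < s → Labels G c m')
    (Tri.fill (c := 10) (fun x => s * n + x) id (by decide) rfl rfl (by rw [hn1]; omega)
      (fun x _ y _ h => by simpa using h) ?_ ?_) (by nlinarith) ?_
  · intro x hx m' hm' _
    exact ⟨by simp [hm' 2 (by decide), hn1], by simp, by simp [Ex.cost, Ex.nn]⟩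
  · intro m' _ _ h1 h2
    rw [hn1] at h1 h2
    have hv : ∀ x : Fin n, m' 6 (s * n + x) = x := fun x => by
      rw [h1 x x.2, id]; exact min_eq_left (by omega)
    refine ⟨⟨fun x => by simp only [hv]; exact x.2, fun x y hxy => ?_,
      fun x y hx => by omega⟩, fun c' hc' x y => ?_⟩
    · simp only [hv] at hxy
      rw [Fin.ext hxy]
      exact Cn.refl _ _
    · have he : ∀ x : Fin n, m' 6 (c' * n + x) = m1 6 (c' * n + x) := fun x => by
        rw [h2]
        intro y hy he
        have := (idx_inj x.2 hy).1 he
        omega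
      rw [he, he]
      exact hold c' hc' x y
  rintro m2 hf2 - ⟨hp2, hold2⟩
  have hf2' : ∀ A, A ≠ 6 → m2 A = m1 A := fun A hA => hf2 A (by simpa using hA)
  have hm2 : Holds G m2 := hm1.congr (hf2' 0 (by decide)) (hf2' 2 (by decide))
  refine Tri.for' (T := 200 * n + 30) (fun v m' => PartLabels G ⟨s, hs⟩ v m' ∧
    ∀ c : Fin n, (c : ℕ) < s → Labels G c m') (by rw [hm2.size]; nlinarith) ⟨hp2, hold2⟩ ?_ ?_
  · rintro v hv m3 hf3 - ⟨hp3, hold3⟩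
    rw [hm2.size] at hv
    have hf3' : ∀ A, A ≠ 6 → A ≠ 7 → A ≠ 8 → m3 A = m2 A := fun A h1 h2 h3 =>
      hf3 A (by simp [mergeS, h1, h2, h3])
    have hm3 : Holds G m3 := hm2.congr (hf3' 0 (by decide) (by decide) (by decide))
      (hf3' 2 (by decide) (by decide) (by decide))
    refine Tri.ite' (T := 200 * n) rfl (by simp [Ex.cost, Ex.same, Ex.less, Ex.neg, Ex.disj]; omega)
      (fun h => (Tri.skip ?_).mono (by omega) fun _ _ _ h => h) fun h => ?_
    · have hsv : s = v := by simpa using h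
      subst hsv
      refine ⟨⟨hp3.lt, hp3.cn, fun x y hx ha hxc hyc => ?_⟩, hold3⟩
      rcases Nat.lt_succ_iff_lt_or_eq.1 hx with h' | h'
      · exact hp3.adj x y h' ha hxc hyc
      · exact absurd (Fin.ext h') hxc
    · have hsv : s ≠ v := by simpa using h
      exact tri_merge (c := ⟨s, hs⟩) (v := ⟨v, hv⟩) (by simp) (by simp) hn0 hm3
        (fun h => hsv (congrArg Fin.val h).symm) hp3 fun c hc => hold3 c hc
  · rintro m3 _ _ ⟨hp3, hold3⟩ c hc
    rw [hm2.size] at hp3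
    rcases Nat.lt_succ_iff_lt_or_eq.1 hc with h' | h'
    · exact hold3 c h'
    · obtain rfl : c = ⟨s, hs⟩ := Fin.ext h'
      exact hp3.labels

end Comp

/-! ### Tables of the graph notions -/

theorem exists_lt_iff {n : ℕ} {P : ℕ → Prop} : (∃ x < n, P x) ↔ ∃ x : Fin n, P x :=
  ⟨fun ⟨x, hx, h⟩ => ⟨⟨x, hx⟩, h⟩, fun ⟨x, h⟩ => ⟨x, x.2, h⟩⟩

theorem forall_lt_iff {n : ℕ} {P : ℕ → Prop} : (∀ x < n, P x) ↔ ∀ x : Fin n, P x :=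
  ⟨fun h x => h x x.2, fun h x hx => h ⟨x, hx⟩⟩

@[simp] theorem env2_zero (i j : ℕ) : env2 i j 0 = i := rfl
@[simp] theorem env2_one (i j : ℕ) : env2 i j 1 = j := rfl
@[simp] theorem env1_zero (i : ℕ) : env1 i 0 = i := rfl

section Tables

variable {n w t : ℕ} {ρ : ℕ → ℕ} {m : Mem}

/-- The rule for square tables that are filled in cubic time. -/
theorem Tri.table2 {A : ℕ} {e : Ex} (hn : m 2 0 = n) (h1n : 0 < n)
    (hA : (A ∉ e.reads ∧ A ≠ 2) ∧ e.wf 2 = true ∧ e.bnd = true ∧ e.deg 2 ≤ 1 ∧ e.deg 3 = 0 ∧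
      e.deg 4 = 0) (hC : e.cst ≤ 900) :
    Tri (n + 2) w 0 t ρ m (tab2 A e 0 t) (1000 * n ^ 3)
      fun m' => (∀ C, C ≠ A → m' C = m C) ∧ (∀ i j : Fin n,
          m' A (i * n + j) = min (e.eval m 2 (env2 i j)) ((n + 2) ^ 2)) :=
  Tri.fill2 (D := 1) hn h1n hA (Nat.mul_le_mul_right _ (by omega)) fun m' h1 h2 =>
    ⟨h1, fun i j => h2 i i.2 j j.2⟩

/-- The rule for tables with one row that are filled in cubic time. -/
theorem Tri.table1 {A : ℕ} {e : Ex} (hn : m 2 0 = n) (h1n : 0 < n)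
    (hA : (A ∉ e.reads ∧ A ≠ 2) ∧ e.wf 1 = true ∧ e.bnd = true ∧ e.deg 2 ≤ 2 ∧ e.deg 3 = 0 ∧
      e.deg 4 = 0) (hC : e.cst ≤ 900) :
    Tri (n + 2) w 0 t ρ m (tab1 A e 0 t) (1000 * n ^ 3)
      fun m' => (∀ C, C ≠ A → m' C = m C) ∧ (∀ i : Fin n,
          m' A i = min (e.eval m 1 (env1 i)) ((n + 2) ^ 2)) :=
  Tri.fill1 (D := 2) hn h1n hA (Nat.mul_le_mul_right _ (by omega)) fun m' h1 h2 _ =>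
    ⟨h1, fun i => h2 i i.2⟩

/-- The rule for square tables of truth values. -/
theorem Tri.truth2 {A : ℕ} {e : Ex} (hn : m 2 0 = n) (h1n : 0 < n)
    (hA : (A ∉ e.reads ∧ A ≠ 2) ∧ e.wf 2 = true ∧ e.bnd = true ∧ e.deg 2 ≤ 1 ∧ e.deg 3 = 0 ∧
      e.deg 4 = 0) (hC : e.cst ≤ 900) {P : Fin n → Fin n → Prop}
    (hP : ∀ i j : Fin n, e.tr m 2 (env2 i j) ↔ P i j) :
    Tri (n + 2) w 0 t ρ m (tab2 A e 0 t) (1000 * n ^ 3)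
      fun m' => (∀ C, C ≠ A → m' C = m C) ∧ (∀ i j : Fin n, m' A (i * n + j) ≠ 0 ↔ P i j) :=
  (Tri.table2 hn h1n hA hC).mono le_rfl fun m' _ _ ⟨h1, h2⟩ => ⟨h1, fun i j => by
    rw [h2, min_ne_zero_iff (by omega), ← Ex.tr_iff, hP]⟩

/-- The rule for tables of truth values with one row. -/
theorem Tri.truth1 {A : ℕ} {e : Ex} (hn : m 2 0 = n) (h1n : 0 < n)
    (hA : (A ∉ e.reads ∧ A ≠ 2) ∧ e.wf 1 = true ∧ e.bnd = true ∧ e.deg 2 ≤ 2 ∧ e.deg 3 = 0 ∧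
      e.deg 4 = 0) (hC : e.cst ≤ 900) {P : Fin n → Prop}
    (hP : ∀ i : Fin n, e.tr m 1 (env1 i) ↔ P i) :
    Tri (n + 2) w 0 t ρ m (tab1 A e 0 t) (1000 * n ^ 3)
      fun m' => (∀ C, C ≠ A → m' C = m C) ∧ (∀ i : Fin n, m' A i ≠ 0 ↔ P i) :=
  (Tri.table1 hn h1n hA hC).mono le_rfl fun m' _ _ ⟨h1, h2⟩ => ⟨h1, fun i => by
    rw [h2, min_ne_zero_iff (by omega), ← Ex.tr_iff, hP]⟩

open Ex

theorem Ex.find_spec (m : Mem) (A : ℕ) (e : Ex) (d : ℕ) (ρ : ℕ → ℕ) :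
    (find A e).eval m d ρ ≤ m A 0 ∧
    ((find A e).eval m d ρ < m A 0 → e.tr m (d + 1) (Function.update ρ d ((find A e).eval m d ρ))) ∧
    ((find A e).eval m d ρ < m A 0 ↔ ∃ x < m A 0, e.tr m (d + 1) (Function.update ρ d x)) :=
  ⟨firstBelow_le _ _, fun h => firstBelow_ne _ _ h, firstBelow_lt_iff⟩

/-- The vertices `0` and `1` are not separated by a vertex. -/
def nosepE : Ex :=
  all 2 (disj (disj (same (var 2) (var 0)) (same (var 2) (var 1)))
    (same (ix 6 (var 2) (var 0)) (ix 6 (var 2) (var 1))))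

/-- The component of `1` in the graph without `0` has another vertex as far from `0` as `1`. -/
def dupE : Ex :=
  exi 2 (conj (neg (same (var 2) (var 1))) (conj
      (same (ix 6 (var 0) (var 1)) (ix 6 (var 0) (var 2)))
    (same (ix 5 (var 1) (var 0)) (ix 5 (var 2) (var 0)))))

/-- The vertex `1` lies in a component of the graph without `0` that looks like a leg from `0`. -/
def leglikeE : Ex :=
  conj (neg (same (var 1) (var 0))) (all 2 (imp (same (ix 6 (var 0) (var 1)) (ix 6 (var 0) (var 2)))
    (neg (ix 10 (var 0) (var 2)))))

/-- The vertex `0` has at least three neighbors. -/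
def degE : Ex := less (num 2) (sum 2 (ite (ix 0 (var 0) (var 1)) (num 1) (num 0)))

/-- The first vertex that `0` separates from `1`. -/
def otherE : Ex :=
  find 2 (conj (neg (same (var 2) (var 0))) (neg
      (same (ix 6 (var 0) (var 1)) (ix 6 (var 0) (var 2)))))

/-- The vertex `1` lies on a hooked leg with root `0`. -/
def hookedE : Ex :=
  conj (conj (ix 11 (var 0) (var 1)) (get 12 (var 0))) (conj (less (ix 13 (var 0) (var 1)) nn)
    (all 2 (disj (same (var 2) (var 0)) (disj (same (ix 6 (var 0) (var 1)) (ix 6 (var 0) (var 2)))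
      (same (ix 6 (var 0) (ix 13 (var 0) (var 1))) (ix 6 (var 0) (var 2)))))))

/-- The vertex `0` is a joint. -/
def jointE : Ex :=
  conj (get 12 (var 0)) (conj (exi 2 (conj (neg (same (var 1) (var 0)))
    (less (ix 13 (var 0) (var 1)) nn))) (all 2 (neg (ix 14 (var 0) (var 1)))))

/-- The vertex `1` is the first vertex of a leg at the joint `0`. -/
def legE : Ex := conj (get 16 (var 0)) (conj (ix 0 (var 0) (var 1)) (ix 11 (var 0) (var 1)))

/-- The leg at `0` through `1` is not the first one. -/
def fewE : Ex :=
  conj (ix 17 (var 0) (var 1)) (exi 2 (conj (less (var 2) (var 1)) (ix 17 (var 0) (var 2))))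

/-- The vertex `2` lies in the block spanned by `0` and `1`. -/
def blkE : Ex := conj (ix 9 (var 2) (var 0)) (ix 9 (var 2) (var 1))

/-- The pair of `0` and `1` names a block. -/
def unitE : Ex :=
  conj (conj (neg (same (var 0) (var 1))) (ix 9 (var 0) (var 1))) <|
  conj (exi 2 (conj (neg (same (var 2) (var 0))) (conj (neg (same (var 2) (var 1))) blkE))) <|
  conj (all 2 (imp blkE (neg (less (ix 5 (num 0) (var 2)) (ix 5 (num 0) (var 0))))))
    (all 2 (imp blkE (disj (same (var 2) (var 0)) (neg (less (var 2) (var 1))))))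

/-- Filling the tables of the graph notions and the initial tables of the dynamic program. -/
def tablesS : Pg :=
  seqS (tab2 9 nosepE) <| seqS (tab2 10 dupE) <| seqS (tab2 11 leglikeE) <| seqS (tab1 12 degE) <|
  seqS (tab2 13 otherE) <| seqS (tab2 14 hookedE) <|
      seqS (tab1 15 (find 2 (ix 14 (var 1) (var 0)))) <|
  seqS (tab1 16 jointE) <| seqS (tab2 17 legE) <| seqS (tab2 18 fewE) <| seqS (tab2 19 unitE) <|
  seqS (tab1 20 (sum 2 (ite (ix 17 (var 0) (var 1)) (num 1) (num 0)))) <|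
  seqS (tab1 21 (sum 2 (ite (ix 18 (var 0) (var 1)) (num 1) (num 0)))) <|
  seqS (tab2 22 (ix 17 (var 0) (var 1))) <| seqS (tab2 23 (ix 18 (var 0) (var 1))) <|
  tab1 24 (num 1)

/-- The tables of the graph notions. -/
structure Tabs (G : SimpleGraph (Fin n)) (o : Fin n) (m : Mem) : Prop extends Holds G m where
  dist : ∀ i j : Fin n, m 5 (i * n + j) = G.dist i j
  nosep : ∀ i j : Fin n, m 9 (i * n + j) ≠ 0 ↔ Nosep G i j
  hook : ∀ x r : Fin n, m 15 x = r ↔ Hooked G x r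
  joint : ∀ c : Fin n, m 16 c ≠ 0 ↔ Joint G c
  leg : ∀ c u : Fin n, m 17 (c * n + u) ≠ 0 ↔ Leg G c u
  few : ∀ c u : Fin n, m 18 (c * n + u) ≠ 0 ↔ Leg G c u ∧ ∃ u' < u, Leg G c u'
  unit : ∀ c v : Fin n, m 19 (c * n + v) ≠ 0 ↔ IsUnit G o c v

theorem Tabs.congr {G : SimpleGraph (Fin n)} {o : Fin n} {m m' : Mem} (h : Tabs G o m)
    (h' : ∀ A < 20, A ∉ [1, 3, 4, 6, 7, 8] → m' A = m A) : Tabs G o m' := by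
  have e := fun A h1 h2 => h' A h1 h2
  exact ⟨h.toHolds.congr (e 0 (by decide) (by decide)) (e 2 (by decide) (by decide)),
    by rw [e 5 (by decide) (by decide)]; exact h.dist,
    by rw [e 9 (by decide) (by decide)]; exact h.nosep,
    by rw [e 15 (by decide) (by decide)]; exact h.hook,
    by rw [e 16 (by decide) (by decide)]; exact h.joint,
    by rw [e 17 (by decide) (by decide)]; exact h.leg,
    by rw [e 18 (by decide) (by decide)]; exact h.few,
    by rw [e 19 (by decide) (by decide)]; exact h.unit⟩

open Classical in
theorem sum_boole_range {n : ℕ} {p : ℕ → Prop} [DecidablePred p] (q : Fin n → Prop)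
    (h : ∀ i : Fin n, p i ↔ q i) :
    ∑ x ∈ Finset.range n, (if p x then 1 else 0) = (Finset.univ.filter q).card := by
  rw [Finset.sum_range, Finset.card_filter]
  exact Finset.sum_congr rfl fun i _ => by simp [h]

/-- The rule for `tablesS`. The tables hold the notions listed in `Tabs` and the start of the
dynamic program. Every table is computed from earlier ones in cubic time. -/
theorem tri_tables {G : SimpleGraph (Fin n)} {o : Fin n} (ho : (o : ℕ) = 0) (hG : G.Connected)
    (hm : Holds G m) (hd : ∀ i j : Fin n, m 5 (i * n + j) = G.dist i j)
    (hl : ∀ c : Fin n, Labels G c m) (K : ℕ) :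
    Tri (n + 2) w 0 t ρ m (tablesS 0 t) (16000 * n ^ 3) fun m' => Tabs G o m' ∧
      (∀ c : Fin n, m' 20 c = ((graphTask G K).all c).card) ∧
      (∀ c : Fin n, m' 21 c = ((graphTask G K).few c).card) ∧
      (∀ c x : Fin n, m' 22 (c * n + x) ≠ 0 ↔ x ∈ (graphTask G K).all c) ∧
      (∀ c x : Fin n, m' 23 (c * n + x) ≠ 0 ↔ x ∈ (graphTask G K).few c) ∧
      ∀ c : Fin n, m' 24 c ≠ 0 := by
  classical
  have hn0 : 0 < n := o.pos
  have hn := hm.size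
  have hl' : ∀ c x y : Fin n, m 6 (c * n + x) = m 6 (c * n + y) ↔ Cn G c x y := hl
  have hnM : n ≤ (n + 2) ^ 2 := by nlinarith
  refine Tri.seq (T₁ := 1000 * n ^ 3) (T₂ := 15000 * n ^ 3) (Tri.truth2 hn hn0 (by decide)
    (by decide) (P := fun u v => Nosep G u v) (fun u v => ?_)) (by omega) ?_
  · simp [nosepE, hn, hl', forall_lt_iff, Fin.val_inj, Nosep, or_iff_not_imp_left,
      -not_or]
  rintro m1 - - ⟨hf1, h9⟩
  have hn1 : m1 2 0 = n := by simp [hf1, hn]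
  refine Tri.seq (T₁ := 1000 * n ^ 3) (T₂ := 14000 * n ^ 3)
      (Tri.truth2 hn1 hn0 (by decide) (by decide)
    (P := fun c y => ∃ z, z ≠ y ∧ Cn G c y z ∧ G.dist y c = G.dist z c) (fun c y => ?_))
        (by omega) ?_
  · simp [dupE, hf1, hn, hl', hd, exists_lt_iff, Fin.val_inj]
  rintro m2 - - ⟨hf2, h10⟩
  have hn2 : m2 2 0 = n := by simp [hf1, hf2, hn]
  refine Tri.seq (T₁ := 1000 * n ^ 3) (T₂ := 13000 * n ^ 3)
      (Tri.truth2 hn2 hn0 (by decide) (by decide)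
    (P := fun c u => Leglike G c u) (fun c u => ?_)) (by omega) ?_
  · simp only [leglikeE, hf1, hf2, hn, hl', forall_lt_iff, Function.update_apply, Fin.val_inj,
        Ex.tr_conj, Ex.tr_neg, Ex.tr_imp, Ex.tr_same, Ex.tr_all, Ex.tr_ix, Ex.eval_var, Ex.eval_ix,
        env2_zero, env2_one, ne_eq, Nat.reduceEqDiff, reduceIte, not_false_eq_true,
        OfNat.zero_ne_ofNat, OfNat.one_ne_ofNat, h10]
    refine and_congr_right fun _ => ⟨fun h y z hy hz hd => ?_, fun h y hy ⟨z, hzy, hyz, hd⟩ => ?_⟩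
    · by_contra hyz
      exact h y hy ⟨z, Ne.symm hyz, hy.symm.trans hz, hd⟩
    · exact hzy (h y z hy (hy.trans hyz) hd).symm
  rintro m3 - - ⟨hf3, h11⟩
  have hn3 : m3 2 0 = n := by simp [hf1, hf2, hf3, hn]
  refine Tri.seq (T₁ := 1000 * n ^ 3) (T₂ := 12000 * n ^ 3)
      (Tri.truth1 hn3 hn0 (by decide) (by decide)
    (P := fun c => 3 ≤ (G.neighborSet c).ncard) (fun c => ?_)) (by omega) ?_
  · have hc : (G.neighborSet c).ncard = (Finset.univ.filter fun x => G.Adj c x).card := by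
      rw [← Set.ncard_coe_finset]
      congr 1
      ext x; simp
    simp only [degE, hf1, hf2, hf3, hn, Function.update_apply, Ex.tr_less, Ex.tr_ix, Ex.eval_num,
        Ex.eval_var, env1_zero,
      ne_eq, Nat.reduceEqDiff, reduceIte, not_false_eq_true, zero_ne_one, OfNat.zero_ne_ofNat,
      Ex.eval_sum, Ex.eval_ite, Ex.eval_num]
    rw [hc, sum_boole_range (fun x => G.Adj c x) (hm.adj c)]
    omega
  rintro m4 - - ⟨hf4, h12⟩
  have hn4 : m4 2 0 = n := by simp [hf1, hf2, hf3, hf4, hn]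
  refine Tri.seq (T₁ := 1000 * n ^ 3) (T₂ := 11000 * n ^ 3)
      (Tri.table2 hn4 hn0 (by decide) (by decide))
    (by omega) ?_
  rintro m5 - - ⟨hf5, h13⟩
  have hO : ∀ r x : Fin n, (∀ h : m5 13 (r * n + x) < n, (⟨m5 13 (r * n + x), h⟩ : Fin n) ≠ r ∧
      ¬ Cn G r x ⟨m5 13 (r * n + x), h⟩) ∧
      (m5 13 (r * n + x) < n ↔ ∃ y, y ≠ r ∧ ¬ Cn G r x y) := by
    intro r x
    obtain ⟨a1, a2, a3⟩ := Ex.find_spec m4 2 (conj (neg (same (var 2) (var 0)))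
      (neg (same (ix 6 (var 0) (var 1)) (ix 6 (var 0) (var 2))))) 2 (env2 r x)
    have he : m5 13 (r * n + x) = otherE.eval m4 2 (env2 r x) := by
      rw [h13, min_eq_left]
      exact (a1.trans hn4.le).trans hnM
    rw [otherE] at he
    rw [← he, hn4] at a2 a3
    have htr : ∀ y : Fin n, (conj (neg (same (var 2) (var 0)))
        (neg (same (ix 6 (var 0) (var 1)) (ix 6 (var 0) (var 2))))).tr m4 (2 + 1)
        (Function.update (env2 r x) 2 y) ↔ y ≠ r ∧ ¬ Cn G r x y := by
      intro y
      simp [hf1, hf2, hf3, hf4, hn, hl', Fin.val_inj]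
    refine ⟨fun h => (htr ⟨_, h⟩).1 (a2 h), ?_⟩
    rw [a3, exists_lt_iff]
    exact exists_congr htr
  have hn5 : m5 2 0 = n := by simp [hf1, hf2, hf3, hf4, hf5, hn]
  refine Tri.seq (T₁ := 1000 * n ^ 3) (T₂ := 10000 * n ^ 3)
      (Tri.truth2 hn5 hn0 (by decide) (by decide)
    (P := fun r x => Hooked G x r) (fun r x => ?_)) (by omega) ?_
  · simp only [hookedE, hf1, hf2, hf3, hf4, hf5, hn, Ex.tr_conj, Ex.tr_disj, Ex.tr_less, Ex.tr_same,
        Ex.tr_all, Ex.tr_get,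
      Ex.tr_ix, Ex.eval_var, Ex.eval_ix, Ex.eval_nn, env2_zero, env2_one, ne_eq, Nat.reduceEqDiff,
      reduceIte, not_false_eq_true, OfNat.zero_ne_ofNat, OfNat.one_ne_ofNat, Function.update_apply,
      Fin.val_inj, forall_lt_iff, h11, h12, hl']
    rw [(hO r x).2]
    unfold Hooked
    rw [and_assoc]
    refine and_congr_right fun _ => and_congr_right fun _ => and_congr_right fun hy => ?_
    have hlt := (hO r x).2.2 hy
    have hlab : ∀ z : Fin n, m 6 (r * n + m5 13 (r * n + x)) = m 6 (r * n + z) ↔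
        Cn G r ⟨m5 13 (r * n + x), hlt⟩ z := fun z => hl' r ⟨m5 13 (r * n + x), hlt⟩ z
    have hne := (hO r x).1 hlt
    simp only [hlab]
    constructor
    · intro h y z hy hz hxy hxz
      have a1 := (h y).resolve_left hy |>.resolve_left hxy
      have a2 := (h z).resolve_left hz |>.resolve_left hxz
      exact a1.symm.trans a2
    · intro h z
      by_cases h1 : z = r
      · exact .inl h1
      · by_cases h2 : Cn G r x z
        · exact .inr (.inl h2)
        · exact .inr (.inr (h _ z hne.1 h1 hne.2 h2))
  rintro m6 - - ⟨hf6, h14⟩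
  have hn6 : m6 2 0 = n := by simp [hf1, hf2, hf3, hf4, hf5, hf6, hn]
  refine Tri.seq (T₁ := 1000 * n ^ 3) (T₂ := 9000 * n ^ 3)
      (Tri.table1 hn6 hn0 (by decide) (by decide))
    (by omega) ?_
  rintro m7 - - ⟨hf7, h15⟩
  have hR : ∀ x r : Fin n, m7 15 x = r ↔ Hooked G x r := by
    intro x r
    obtain ⟨a1, a2, a3⟩ := Ex.find_spec m6 2 (ix 14 (var 1) (var 0)) 1 (env1 x)
    have he : m7 15 x = (find 2 (ix 14 (var 1) (var 0))).eval m6 1 (env1 x) := by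
      rw [h15, min_eq_left]
      exact (a1.trans hn6.le).trans hnM
    rw [← he, hn6] at a2 a3
    have htr : ∀ y : Fin n, (ix 14 (var 1) (var 0)).tr m6 (1 + 1)
        (Function.update (env1 x) 1 y) ↔ Hooked G x y := by
      intro y
      simp only [Ex.tr_ix, Ex.eval_var, hn6, ← h14]
      simp
    constructor
    · intro h
      have h1 : m7 15 x < n := h ▸ r.2
      have h2 := (htr ⟨_, h1⟩).1 (a2 h1)
      rwa [show (⟨m7 15 x, h1⟩ : Fin n) = r from Fin.ext h] at h2
    · intro h
      have h1 : m7 15 x < n := a3.2 ⟨r, r.2, (htr r).2 h⟩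
      have h2 := (htr ⟨_, h1⟩).1 (a2 h1)
      exact congrArg Fin.val (h2.1.root_unique hG h.1 h2.2.1 h.2.1)
  have hex : ∀ r x : Fin n, m5 13 (r * n + x) < n ↔ ∃ y, y ≠ r ∧ ¬ Cn G r x y :=
    fun r x => (hO r x).2
  have hn7 : m7 2 0 = n := by simp [hf1, hf2, hf3, hf4, hf5, hf6, hf7, hn]
  refine Tri.seq (T₁ := 1000 * n ^ 3) (T₂ := 8000 * n ^ 3)
      (Tri.truth1 hn7 hn0 (by decide) (by decide)
    (P := fun c => Joint G c) (fun c => ?_)) (by omega) ?_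
  · simp only [jointE, hf1, hf2, hf3, hf4, hf5, hf6, hf7, hn, Ex.tr_conj, Ex.tr_neg, Ex.tr_less,
        Ex.tr_same, Ex.tr_exi, Ex.tr_all, Ex.tr_get,
      Ex.tr_ix, Ex.eval_var, Ex.eval_ix, Ex.eval_nn, env1_zero,
      ne_eq, Nat.reduceEqDiff, reduceIte, not_false_eq_true, zero_ne_one, Function.update_apply,
      Fin.val_inj, forall_lt_iff, exists_lt_iff, h12, h14, hex, Joint]
    refine and_congr_right fun _ => and_congr_left fun _ => ?_
    exact ⟨fun ⟨x, hx, y, hy⟩ => ⟨x, y, hx, hy⟩, fun ⟨x, y, hx, hy⟩ => ⟨x, hx, y, hy⟩⟩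
  rintro m8 - - ⟨hf8, h16⟩
  have hn8 : m8 2 0 = n := by simp [hf1, hf2, hf3, hf4, hf5, hf6, hf7, hf8, hn]
  refine Tri.seq (T₁ := 1000 * n ^ 3) (T₂ := 7000 * n ^ 3)
      (Tri.truth2 hn8 hn0 (by decide) (by decide)
    (P := fun c u => Leg G c u) (fun c u => ?_)) (by omega) ?_
  · simp only [legE, hf1, hf2, hf3, hf4, hf5, hf6, hf7, hf8, hn, Ex.tr_conj, Ex.tr_get,
      Ex.tr_ix, Ex.eval_var, env2_zero, env2_one, ne_eq, Nat.reduceEqDiff, not_false_eq_true,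
      OfNat.zero_ne_ofNat, h16, hm.adj, h11, Leg]
  rintro m9 - - ⟨hf9, h17⟩
  have hn9 : m9 2 0 = n := by simp [hf1, hf2, hf3, hf4, hf5, hf6, hf7, hf8, hf9, hn]
  refine Tri.seq (T₁ := 1000 * n ^ 3) (T₂ := 6000 * n ^ 3)
      (Tri.truth2 hn9 hn0 (by decide) (by decide)
    (P := fun c u => Leg G c u ∧ ∃ u' < u, Leg G c u') (fun c u => ?_)) (by omega) ?_
  · simp only [fewE, hf1, hf2, hf3, hf4, hf5, hf6, hf7, hf8, hf9, hn, Ex.tr_conj, Ex.tr_less,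
        Ex.tr_exi, Ex.tr_ix, Ex.eval_var, env2_zero, env2_one, ne_eq, Nat.reduceEqDiff, reduceIte,
        not_false_eq_true, OfNat.zero_ne_ofNat, OfNat.one_ne_ofNat, Function.update_apply, h17,
        exists_lt_iff, Fin.lt_def]
  rintro m10 - - ⟨hf10, h18⟩
  have hn10 : m10 2 0 = n := by simp [hf1, hf2, hf3, hf4, hf5, hf6, hf7, hf8, hf9, hf10, hn]
  refine Tri.seq (T₁ := 1000 * n ^ 3) (T₂ := 5000 * n ^ 3)
      (Tri.truth2 hn10 hn0 (by decide) (by decide)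
    (P := fun c v => IsUnit G o c v) (fun c v => ?_)) (by omega) ?_
  · have h0 : ∀ x : Fin n, m 5 (0 * n + x) = G.dist o x := fun x => by rw [← ho]; exact hd o x
    simp only [unitE, blkE, hf1, hf2, hf3, hf4, hf5, hf6, hf7, hf8, hf9, hf10, hn, Ex.tr_conj,
        Ex.tr_disj, Ex.tr_neg, Ex.tr_imp, Ex.tr_less, Ex.tr_same, Ex.tr_exi, Ex.tr_all, Ex.tr_ix,
        Ex.eval_num, Ex.eval_var, Ex.eval_ix, env2_zero, env2_one, ne_eq, Nat.reduceEqDiff,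
        reduceIte, not_false_eq_true, OfNat.zero_ne_ofNat, OfNat.one_ne_ofNat,
        Function.update_apply, Fin.val_inj, h9, exists_lt_iff, forall_lt_iff, h0, not_lt]
    constructor
    · rintro ⟨⟨a1, a2⟩, a3, a4, a5⟩
      exact ⟨a1, a2, a3, fun x hx => a4 x hx, fun x hx hxc => (a5 x hx).resolve_left hxc⟩
    · rintro ⟨a1, a2, a3, a4, a5⟩
      exact ⟨⟨a1, a2⟩, a3, fun x hx => a4 x hx, fun x hx => or_iff_not_imp_left.2 (a5 x hx)⟩
  rintro m11 - - ⟨hf11, h19⟩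
  have hn11 : m11 2 0 = n := by simp [hf1, hf2, hf3, hf4, hf5, hf6, hf7, hf8, hf9, hf10, hf11, hn]
  refine Tri.seq (T₁ := 1000 * n ^ 3) (T₂ := 4000 * n ^ 3)
      (Tri.table1 hn11 hn0 (by decide) (by decide))
    (by omega) ?_
  rintro m12 - - ⟨hf12, h20⟩
  have hn12 : m12 2 0 = n := by simp [hf1, hf2, hf3, hf4, hf5, hf6, hf7, hf8, hf9, hf10, hf11, hf12,
      hn]
  refine Tri.seq (T₁ := 1000 * n ^ 3) (T₂ := 3000 * n ^ 3)
      (Tri.table1 hn12 hn0 (by decide) (by decide))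
    (by omega) ?_
  rintro m13 - - ⟨hf13, h21⟩
  have hn13 : m13 2 0 = n := by simp [hf1, hf2, hf3, hf4, hf5, hf6, hf7, hf8, hf9, hf10, hf11, hf12,
      hf13, hn]
  refine Tri.seq (T₁ := 1000 * n ^ 3) (T₂ := 2000 * n ^ 3)
      (Tri.truth2 hn13 hn0 (by decide) (by decide)
    (P := fun c x => Leg G c x) (fun c x => ?_)) (by omega) ?_
  · simp only [hf1, hf2, hf3, hf4, hf5, hf6, hf7, hf8, hf9, hf10, hf11, hf12, hf13, hn, Ex.tr_ix,
        Ex.eval_var, env2_zero, env2_one, ne_eq, Nat.reduceEqDiff, not_false_eq_true, h17]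
  rintro m14 - - ⟨hf14, h22⟩
  have hn14 : m14 2 0 = n := by simp [hf1, hf2, hf3, hf4, hf5, hf6, hf7, hf8, hf9, hf10, hf11, hf12,
      hf13, hf14, hn]
  refine Tri.seq (T₁ := 1000 * n ^ 3) (T₂ := 1000 * n ^ 3)
      (Tri.truth2 hn14 hn0 (by decide) (by decide)
    (P := fun c u => Leg G c u ∧ ∃ u' < u, Leg G c u') (fun c u => ?_)) (by omega) ?_
  · simp only [hf1, hf2, hf3, hf4, hf5, hf6, hf7, hf8, hf9, hf10, hf11, hf12, hf13, hf14, hn,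
        Ex.tr_ix, Ex.eval_var, env2_zero, env2_one, ne_eq, Nat.reduceEqDiff, not_false_eq_true, h18]
  rintro m15 - - ⟨hf15, h23⟩
  have hn15 : m15 2 0 = n := by simp [hf1, hf2, hf3, hf4, hf5, hf6, hf7, hf8, hf9, hf10, hf11, hf12,
      hf13, hf14, hf15, hn]
  refine (Tri.table1 hn15 hn0 (by decide) (by decide)).mono (by omega) ?_
  rintro m16 - - ⟨hf16, h24⟩
  refine ⟨⟨hm.congr (by simp [hf2, hf3, hf4, hf5, hf6, hf7, hf8, hf9, hf10, hf11, hf12, hf13, hf14,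
      hf15, hf16, hf1]) (by simp [hf2, hf3, hf4, hf5, hf6, hf7, hf8, hf9, hf10, hf11, hf12, hf13,
      hf14, hf15, hf16, hf1]), ?_, ?_, ?_, ?_, ?_, ?_, ?_⟩,
    ?_, ?_, ?_, ?_, ?_⟩
  · simpa [hf2, hf3, hf4, hf5, hf6, hf7, hf8, hf9, hf10, hf11, hf12, hf13, hf14, hf15, hf16,
        hf1] using hd
  · simpa [hf2, hf3, hf4, hf5, hf6, hf7, hf8, hf9, hf10, hf11, hf12, hf13, hf14, hf15,
        hf16] using h9
  · simpa [hf2, hf3, hf4, hf5, hf6, hf7, hf8, hf9, hf10, hf11, hf12, hf13, hf14, hf15,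
        hf16] using hR
  · simpa [hf2, hf3, hf4, hf5, hf6, hf7, hf8, hf9, hf10, hf11, hf12, hf13, hf14, hf15,
        hf16] using h16
  · simpa [hf2, hf3, hf4, hf5, hf6, hf7, hf8, hf9, hf10, hf11, hf12, hf13, hf14, hf15,
        hf16] using h17
  · simpa [hf2, hf3, hf4, hf5, hf6, hf7, hf8, hf9, hf10, hf11, hf12, hf13, hf14, hf15,
        hf16] using h18
  · simpa [hf2, hf3, hf4, hf5, hf6, hf7, hf8, hf9, hf10, hf11, hf12, hf13, hf14, hf15,
        hf16] using h19
  · intro c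
    have e : m16 20 c = m12 20 c := by simp [hf13, hf14, hf15, hf16]
    rw [e, h20, Ex.eval_sum, hn11]
    simp only [Ex.eval_ite, Ex.eval_num]
    rw [sum_boole_range (fun x => Leg G c x), min_eq_left]
    · rfl
    · exact (Finset.card_filter_le _ _).trans (by simpa using hnM)
    · intro x
      rw [← h17, Ex.tr_ix, hn11]
      simp [hf10, hf11]
  · intro c
    have e : m16 21 c = m13 21 c := by simp [hf14, hf15, hf16]
    rw [e, h21, Ex.eval_sum, hn12]
    simp only [Ex.eval_ite, Ex.eval_num]
    rw [sum_boole_range (fun x => Leg G c x ∧ ∃ u' < x, Leg G c u'), min_eq_left]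
    · simp only [graphTask]
      congr
    · exact (Finset.card_le_univ _).trans (by simpa using hnM)
    · intro x
      rw [← h18, Ex.tr_ix, hn12]
      simp [hf11, hf12]
  · intro c x
    have e : m16 22 (c * n + x) = m14 22 (c * n + x) := by simp [hf15, hf16]
    rw [e, h22]
    simp [graphTask]
  · intro c x
    rw [hf16 23 (by decide), h23]
    simp [graphTask]
  · intro c
    rw [h24]
    simp

end Tables

/-! ### Searching through all tuples -/

section Search

variable {n K w t : ℕ} {ρ : ℕ → ℕ} {m : Mem}

theorem sum_top_digits (n P : ℕ) : ∑ p ∈ Finset.range P, n * (n + 1) ^ p + 1 = (n + 1) ^ P := by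
  induction P with
  | zero => simp
  | succ P ih => rw [Finset.sum_range_succ, pow_succ]; linarith

/-- The number of the tuple `f`, read as an expansion in base `n + 1`. -/
def tupleNum (f : Fin K → Fin (n + 1)) : ℕ := finFunctionFinEquiv f

theorem tupleNum_lt (f : Fin K → Fin (n + 1)) : tupleNum f < (n + 1) ^ K :=
  (finFunctionFinEquiv f).2

theorem tupleNum_inj {f g : Fin K → Fin (n + 1)} (h : tupleNum f = tupleNum g) : f = g :=
  finFunctionFinEquiv.injective (Fin.ext h)

theorem tupleNum_eq (f : Fin K → Fin (n + 1)) :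
    tupleNum f = ∑ p : Fin K, (f p : ℕ) * (n + 1) ^ (p : ℕ) := finFunctionFinEquiv_apply f

theorem tupleNum_top {f : Fin K → Fin (n + 1)} (h : ∀ p, (f p : ℕ) = n) :
    tupleNum f + 1 = (n + 1) ^ K := by
  rw [← sum_top_digits, Finset.sum_range, tupleNum_eq]
  simp [h]

/-- Counting up: the first digit other than `n` is increased, and the digits before it are reset. -/
theorem exists_next_tuple {f : Fin K → Fin (n + 1)} {P : Fin K} (h : ∀ p < P, (f p : ℕ) = n)
    (hP : (f P : ℕ) < n) : ∃ g : Fin K → Fin (n + 1), tupleNum g = tupleNum f + 1 ∧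
      ∀ p, (g p : ℕ) = if p < P then 0 else if p = P then (f p : ℕ) + 1 else f p := by
  have hle : ∀ p, (if p < P then 0 else if p = P then (f p : ℕ) + 1 else f p) < n + 1 := by
    intro p
    split_ifs with h1 h2
    · omega
    · subst h2; omega
    · exact (f p).2
  refine ⟨fun p => ⟨_, hle p⟩, ?_, fun p => rfl⟩
  have h1 : ∑ p : Fin K, (if p < P then 0 else if p = P then (f p : ℕ) + 1 else f p) * (n + 1) ^
      (p : ℕ)
      + ∑ p : Fin K, (if p < P then n * (n + 1) ^ (p : ℕ) else 0)
      = ∑ p : Fin K, (f p : ℕ) * (n + 1) ^ (p : ℕ)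
      + ∑ p : Fin K, (if p = P then (n + 1) ^ (p : ℕ) else 0) := by
    rw [← Finset.sum_add_distrib, ← Finset.sum_add_distrib]
    refine Finset.sum_congr rfl fun p _ => ?_
    rcases lt_trichotomy p P with hp | hp | hp
    · simp [hp, hp.ne, h p hp]
    · subst hp; simp; ring
    · simp [hp.not_gt, hp.ne']
  have h2 : ∑ p : Fin K, (if p < P then n * (n + 1) ^ (p : ℕ) else 0)
      = ∑ p ∈ Finset.range P, n * (n + 1) ^ p := by
    have := Finset.sum_range (n := K) fun p => if p < (P : ℕ) then n * (n + 1) ^ p else 0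
    simp only [Fin.val_fin_lt] at this
    rw [← this, ← Finset.sum_filter]
    congr 1
    ext p
    simp only [Finset.mem_filter, Finset.mem_range]
    omega
  have h3 := sum_top_digits n P
  rw [h2] at h1
  simp only [Finset.sum_ite_eq', Finset.mem_univ, if_true] at h1
  have h4 : tupleNum f + 1 = ∑ p : Fin K,
      (if p < P then 0 else if p = P then (f p : ℕ) + 1 else f p) * (n + 1) ^ (p : ℕ) := by
    rw [tupleNum_eq]; omega
  rw [h4, tupleNum_eq]

theorem Ex.find_min {A x d : ℕ} {e : Ex} (h : x < (find A e).eval m d ρ) :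
    ¬ e.tr m (d + 1) (Function.update ρ d x) :=
  not_not.2 (firstBelow_min _ _ x h)

open Ex

/-- One round of the search: the tuple in array `28` is tested and, if its cost is less than the
least one so far in its class, recorded in the row of array `36` for this class; then the tuple is
replaced by the next one. -/
def roundS (okE beE coE : Ex) : Pg :=
  seqS (storeS 31 (num 0) okE) <| seqS (storeS 33 (num 0) beE) <| seqS (storeS 34 (num 0) coE) <|
  seqS (iteS (conj (get 31 (num 0)) (less (get 34 (num 0)) (get 35 (get 33 (num 0)))))
    (seqS (storeS 35 (get 33 (num 0)) (get 34 (num 0)))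
      (forS 4 (storeS 36 (bin .add (bin .mul (get 33 (num 0)) nn) (var 3))
          (get 28 (var 3))))) skipS) <|
  seqS (storeS 30 (num 0) (find 4 (less (get 28 (var 3)) nn))) <|
  iteS (less (get 30 (num 0)) (get 4 (num 0)))
    (forS 4 (storeS 28 (var 3) (ite (less (var 3) (get 30 (num 0))) (num 0)
      (ite (same (var 3) (get 30 (num 0))) (bin .add (get 28 (var 3)) (num 1)) (get 28 (var 3))))))
    (storeS 29 (num 0) (num 0))

/-- Search for the tuples of least cost in two classes. -/
def searchS (okE beE coE : Ex) : Pg :=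
  seqS (storeS 35 (num 0) (bin .mul (bin .add nn (num 2)) (bin .add nn (num 2)))) <|
  seqS (storeS 35 (num 1) (bin .mul (bin .add nn (num 2)) (bin .add nn (num 2)))) <|
  seqS (storeS 29 (num 0) (num 1)) <| seqS (forS 4 (storeS 28 (var 3) (num 0))) <|
  whileS 29 (roundS okE beE coE)

/-- The arrays that a search changes. -/
abbrev searchA : List ℕ := [28, 29, 30, 31, 33, 34, 35, 36]

/-- The least cost found so far in the class `b`, after `j` rounds. -/
structure Found (ok be : (Fin K → Fin (n + 1)) → Prop) (co : (Fin K → Fin (n + 1)) → ℕ)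
    (j b : ℕ) (m : Mem) : Prop where
  le : m 35 b ≤ (n + 2) ^ 2
  least : ∀ f, tupleNum f < j → ok f → (be f ↔ b = 1) → m 35 b ≤ co f
  attained : m 35 b < (n + 2) ^ 2 → ∃ f, (∀ p : Fin K, m 36 (b * n + p) = f p) ∧ ok f ∧
    (be f ↔ b = 1) ∧ co f ≤ m 35 b

/-- The conditions under which the expressions describe a search. -/
def Describes (okE beE coE : Ex) (ok be : (Fin K → Fin (n + 1)) → Prop)
    (co : (Fin K → Fin (n + 1)) → ℕ) (c : ℕ) (ρ : ℕ → ℕ) (m : Mem) : Prop :=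
  ∀ m' f, (∀ C, C ∉ searchA → m' C = m C) → (∀ p : Fin K, m' 28 p = f p) →
    (okE.tr m' 3 ρ ↔ ok f) ∧ (beE.tr m' 3 ρ ↔ be f) ∧ beE.eval m' 3 ρ ≤ 1 ∧
    coE.eval m' 3 ρ = co f ∧ okE.cost m' + beE.cost m' + coE.cost m' ≤ c

variable {okE beE coE : Ex} {ok be : (Fin K → Fin (n + 1)) → Prop}
  {co : (Fin K → Fin (n + 1)) → ℕ} {c : ℕ}

@[simp] theorem roundS_stores (d t : ℕ) : (roundS okE beE coE d t).stores =
    [31, 33, 34, 35, 36, 30, 28, 29] := by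
  simp [roundS]

@[simp] theorem searchS_stores (d t : ℕ) : (searchS okE beE coE d t).stores =
    [35, 35, 29, 28, 31, 33, 34, 35, 36, 30, 28, 29] := by
  simp [searchS]

/-- The rule for the first part of a round: the tuple `f` is tested and recorded. -/
theorem tri_record (hn : m 2 0 = n) (hK : m 4 0 = K) (hKn : K ≤ n)
    {f : Fin K → Fin (n + 1)} (hf : ∀ p : Fin K, m 28 p = f p) (h31 : m 31 0 ≠ 0 ↔ ok f)
    (h33 : m 33 0 ≤ 1) (h33' : m 33 0 = 1 ↔ be f) (h34 : m 34 0 = min (co f) ((n + 2) ^ 2))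
    (hF : ∀ b < 2, Found ok be co (tupleNum f) b m) :
    Tri (n + 2) w 3 t ρ m (iteS (conj (get 31 (num 0))
        (less (get 34 (num 0)) (get 35 (get 33 (num 0)))))
    (seqS (storeS 35 (get 33 (num 0)) (get 34 (num 0)))
      (forS 4 (storeS 36 (bin .add (bin .mul (get 33 (num 0)) nn) (var 3))
          (get 28 (var 3))))) skipS 3 t)
      (30 * K + 40) fun m' => (∀ C, C ≠ 35 → C ≠ 36 → m' C = m C) ∧
        ∀ b < 2, Found ok be co (tupleNum f + 1) b m' := by
  refine Tri.ite' (T := 30 * K + 20) rfl (by simp [Ex.cost, conj, less]; omega) (fun h => ?_)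
      (fun h => ?_)
  · simp only [Ex.tr_conj, Ex.tr_get, Ex.eval_num, Ex.tr_less, Ex.eval_get] at h
    obtain ⟨h1, h2⟩ := h
    have hok := h31.1 h1
    have hcN : co f < (n + 2) ^ 2 := by
      have := (hF (m 33 0) (by omega)).le
      omega
    refine Tri.seq (T₁ := 10) (T₂ := 30 * K + 10)
        (Tri.store' (Q := fun m' => m' = m.set 35 (m 33 0) (co f))
      rfl rfl (by simp [Ex.cost]) ?_) (by omega) ?_
    · simp [h34, hcN.le]
    rintro m1 - - rfl
    refine Tri.fill (c := 20) (fun p => m 33 0 * n + p) (fun p => m 28 p)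
        (by decide) rfl rfl ?_ ?_ ?_ ?_
    · rw [Mem.set_ne _ _ _ (by decide), hK]; omega
    · intro x _ y _ h; simpa using h
    · intro x hx m' hm' _
      simp [hm', Mem.set_ne, hn, Ex.cost, nn]
    · intro m' hm' _ hv ho
      rw [Mem.set_ne _ _ _ (by decide), hK] at hv ho
      have h35 : ∀ b, m' 35 b = if b = m 33 0 then co f else m 35 b := fun b => by
        rw [hm' 35 (by decide), Mem.set_self]
      refine ⟨fun C h35 h36 => by rw [hm' C h36, Mem.set_ne _ _ _ h35], fun b hb => ?_⟩
      by_cases hbe : b = m 33 0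
      · have hb1 : be f ↔ b = 1 := by rw [← h33', hbe]
        refine ⟨by rw [h35, if_pos hbe]; omega, fun g hg hgo hgb => ?_, fun _ =>
            ⟨f, fun p => ?_, hok, hb1, ?_⟩⟩
        · rw [h35, if_pos hbe]
          rcases Nat.lt_succ_iff_lt_or_eq.1 hg with h | h
          · have := (hF b hb).least g h hgo hgb
            rw [hbe] at this
            omega
          · rw [tupleNum_inj h]
        · rw [hbe, hv p p.2, hf, min_eq_left]
          have := (f p).2
          nlinarith
        · rw [h35, if_pos hbe]
      · refine ⟨by rw [h35, if_neg hbe]; exact (hF b hb).le, fun g hg hgo hgb => ?_, fun h => ?_⟩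
        · rw [h35, if_neg hbe]
          rcases Nat.lt_succ_iff_lt_or_eq.1 hg with h | h
          · exact (hF b hb).least g h hgo hgb
          · rw [tupleNum_inj h] at hgb
            rw [← h33'] at hgb
            omega
        · rw [h35, if_neg hbe] at h ⊢
          obtain ⟨g, hg, hg'⟩ := (hF b hb).attained h
          refine ⟨g, fun p => ?_, hg'⟩
          rw [ho, Mem.set_ne _ _ _ (by decide), hg]
          intro x hx he
          exact hbe ((idx_inj (by omega) (by omega)).1 he).1
  · refine (Tri.skip ?_).mono (by omega) fun _ _ _ h => h
    refine ⟨fun _ _ _ => rfl, fun b hb => ⟨(hF b hb).le, fun g hg hgo hgb => ?_,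
        (hF b hb).attained⟩⟩
    rcases Nat.lt_succ_iff_lt_or_eq.1 hg with h' | h'
    · exact (hF b hb).least g h' hgo hgb
    · rw [tupleNum_inj h'] at hgo hgb ⊢
      have h1 := h31.2 hgo
      simp only [Ex.tr_conj, Ex.tr_get, Ex.eval_num, Ex.tr_less, Ex.eval_get, h1, ne_eq,
        not_false_eq_true, true_and, not_lt, h34] at h
      have hb' : m 33 0 = b := by
        rw [← h33'] at hgb
        omega
      rw [hb'] at h
      exact h.trans (min_le_left _ _)

/-- The rule for the second part of a round: the tuple is replaced by the next one, and the search
ends after the last one. -/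
theorem tri_next (hn : m 2 0 = n) (hK : m 4 0 = K) (hKn : K ≤ n)
    {f : Fin K → Fin (n + 1)} (hf : ∀ p : Fin K, m 28 p = f p) (hrun : m 29 0 ≠ 0) :
    Tri (n + 2) w 3 t ρ m (seqS (storeS 30 (num 0) (find 4 (less (get 28 (var 3)) nn))) (
  iteS (less (get 30 (num 0)) (get 4 (num 0)))
    (forS 4 (storeS 28 (var 3) (ite (less (var 3) (get 30 (num 0))) (num 0)
      (ite (same (var 3) (get 30 (num 0))) (bin .add (get 28 (var 3)) (num 1)) (get 28 (var 3))))))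
    (storeS 29 (num 0) (num 0))) 3 t)
      (100 * K + 50) fun m' => (∀ C, C ∉ searchA → m' C = m C) ∧ m' 35 = m 35 ∧ m' 36 = m 36 ∧
        (tupleNum f + 1 < (n + 1) ^ K → m' 29 0 ≠ 0 ∧ ∃ g : Fin K → Fin (n + 1),
          tupleNum g = tupleNum f + 1 ∧ ∀ p : Fin K, m' 28 p = g p) ∧
        (tupleNum f + 1 = (n + 1) ^ K → m' 29 0 = 0) := by
  have hnM : n < (n + 2) ^ 2 := by nlinarith
  obtain ⟨a1, a2, a3⟩ := Ex.find_spec m 4 (less (get 28 (var 3)) nn) 3 ρ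
  set P := (find 4 (less (get 28 (var 3)) nn)).eval m 3 ρ with hP
  have a4 : ∀ p : Fin K, (p : ℕ) < P → (f p : ℕ) = n := by
    intro p hp
    by_contra hne
    have hlt : (f p : ℕ) < n := by have := (f p).2; omega
    exact Ex.find_min hp (by simpa [hn, hf] using hlt)
  refine Tri.seq (T₁ := 20 * K + 20) (T₂ := 80 * K + 20)
      (Tri.store' (Q := fun m' => m' = m.set 30 0 P)
    rfl rfl ?_ ?_) (by omega) ?_
  · simp [Ex.cost, less, nn, hK]; omega
  · rw [← hP, min_eq_left (by omega)]; rfl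
  rintro m1 - - rfl
  refine Tri.ite' (T := 80 * K + 10) rfl (by simp [Ex.cost, less]; omega) (fun h => ?_)
      (fun h => ?_)
  · simp only [Ex.tr_less, Ex.eval_get, Ex.eval_num, Mem.set_self, if_true] at h
    rw [Mem.set_ne _ _ _ (by decide), hK] at h
    have hfP : (f ⟨P, h⟩ : ℕ) < n := by
      have := a2 (by omega)
      simpa [hn, hf ⟨P, h⟩] using this
    obtain ⟨g, hg1, hg2⟩ := exists_next_tuple (f := f) (P := ⟨P, h⟩) (fun p hp => a4 p hp) hfP
    refine Tri.fill (c := 60) id (fun p => if p < P then 0 else if p = P then m 28 p + 1 else m 28 p)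
      (by decide) rfl rfl ?_ (fun x _ y _ h => h) ?_ ?_
    · rw [Mem.set_ne _ _ _ (by decide), hK]; omega
    · intro x hx m' hm' he
      rw [Mem.set_ne _ _ _ (by decide)] at he
      simp only [id] at he
      refine ⟨by simp, ?_, by simp [Ex.cost, same, neg, disj, less]⟩
      simp [hm' 30 (by decide), Mem.set_self, he]
    · intro m' hm' _ hv ho
      rw [Mem.set_ne _ _ _ (by decide), hK] at hv
      refine ⟨fun C hC => ?_, ?_, ?_, fun _ => ⟨?_, g, hg1, fun p => ?_⟩, fun h => ?_⟩
      · simp at hC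
        rw [hm' C (by tauto), Mem.set_ne _ _ _ (by tauto)]
      · rw [hm' _ (by decide), Mem.set_ne _ _ _ (by decide)]
      · rw [hm' _ (by decide), Mem.set_ne _ _ _ (by decide)]
      · rwa [hm' _ (by decide), Mem.set_ne _ _ _ (by decide)]
      · have := hv p p.2
        simp only [id] at this
        rw [this, hf, hg2]
        simp only [Fin.lt_def, Fin.ext_iff]
        refine min_eq_left ?_
        have := (f p).2
        split_ifs <;> omega
      · have := tupleNum_lt g
        omega
  · simp only [Ex.tr_less, Ex.eval_get, Ex.eval_num, Mem.set_self, if_true] at h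
    rw [Mem.set_ne _ _ _ (by decide), hK] at h
    have htop := tupleNum_top (f := f) fun p => a4 p (by omega)
    refine Tri.store' rfl rfl (by simp [Ex.cost])
        ⟨fun C hC => ?_, ?_, ?_, fun h => by omega, fun _ => ?_⟩
    · simp at hC
      rw [Mem.set_ne _ _ _ (by tauto), Mem.set_ne _ _ _ (by tauto)]
    · rw [Mem.set_ne _ _ _ (by decide), Mem.set_ne _ _ _ (by decide)]
    · rw [Mem.set_ne _ _ _ (by decide), Mem.set_ne _ _ _ (by decide)]
    · simp [Mem.set_self]

/-- The rule for `searchS`: all `(n + 1) ^ K` tuples are tested, so that the least costs are found.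
-/
theorem tri_search (hn : m 2 0 = n) (hK : m 4 0 = K) (hKn : K ≤ n)
    (hwf : okE.wf 3 ∧ beE.wf 3 ∧ coE.wf 3) (hD : Describes okE beE coE ok be co c ρ m) :
    Tri (n + 2) w 3 t ρ m (searchS okE beE coE 3 t)
        ((n + 1) ^ K * (3 * c + 200 * K + 300)) fun m' =>
      ∀ b < 2, Found ok be co ((n + 1) ^ K) b m' := by
  have hpos : 1 ≤ (n + 1) ^ K := Nat.one_le_pow _ _ (by omega)
  refine Tri.seq (T₁ := 20) (T₂ := (n + 1) ^ K * (3 * c + 140 * K + 190) + 20 * K + 60) (Tri.store'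
    (Q := fun m' => m' = m.set 35 0 ((n + 2) ^ 2))
    rfl rfl (by simp [Ex.cost, nn]) ?_) (by nlinarith) ?_
  · simp [hn, sq]
  rintro m1 - - rfl
  refine Tri.seq (T₁ := 20) (T₂ := (n + 1) ^ K * (3 * c + 140 * K + 190) + 20 * K + 40) (Tri.store'
    (Q := fun m' => m' = (m.set 35 0 ((n + 2) ^ 2)).set 35 1 ((n + 2) ^ 2))
    rfl rfl (by simp [Ex.cost, nn]) ?_) (by omega) ?_
  · simp [hn, sq, Mem.set_ne]
  rintro m2 - - rfl
  refine Tri.seq (T₁ := 20) (T₂ := (n + 1) ^ K * (3 * c + 140 * K + 190) + 20 * K + 20) (Tri.store'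
    (Q := fun m' => m' = ((m.set 35 0 ((n + 2) ^ 2)).set 35 1 ((n + 2) ^ 2)).set 29 0 1)
    rfl rfl (by simp [Ex.cost]) ?_) (by omega) ?_
  · have : 1 ≤ (n + 2) ^ 2 := Nat.one_le_pow _ _ (by omega)
    simp [min_eq_left this]
  rintro m3 - - rfl
  set m3 := ((m.set 35 0 ((n + 2) ^ 2)).set 35 1 ((n + 2) ^ 2)).set 29 0 1 with hm3
  have hK3 : m3 4 0 = K := by simp [hm3, Mem.set_ne, hK]
  refine Tri.seq (T₁ := 20 * K + 10) (T₂ := (n + 1) ^ K * (3 * c + 140 * K + 190) + 10) (Tri.fill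
    (Q := fun m' => (∀ C, C ≠ 28 → m' C = m3 C) ∧ ∀ p < K, m' 28 p = 0) (c := 10) id (fun _ => 0)
    (by decide) rfl rfl (by rw [hK3]; omega) (fun x _ y _ h => h)
    (fun x _ m' _ _ => by simp [Ex.cost]) ?_) (by omega) ?_
  · intro m' h1 _ h2 _
    exact ⟨h1, fun p hp => by simpa using h2 p (by omega)⟩
  rintro m4 - - ⟨hf4, h28⟩
  have hfr4 : ∀ C, C ∉ searchA → m4 C = m C := fun C hC => by
    simp at hC
    rw [hf4 C (by tauto), hm3, Mem.set_ne _ _ _ (by tauto), Mem.set_ne _ _ _ (by tauto),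
      Mem.set_ne _ _ _ (by tauto)]
  have h35 : ∀ b < 2, m4 35 b = (n + 2) ^ 2 := fun b hb => by
    rw [hf4 _ (by decide), hm3, Mem.set_ne _ _ _ (by decide), Mem.set_self, Mem.set_self]
    interval_cases b <;> rfl
  have h29 : m4 29 0 = 1 := by rw [hf4 _ (by decide), hm3, Mem.set_self]; rfl
  refine Tri.while ((n + 1) ^ K) (fun j m' => (j < (n + 1) ^ K → m' 29 0 ≠ 0 ∧
      ∃ f : Fin K → Fin (n + 1), tupleNum f = j ∧ ∀ p : Fin K, m' 28 p = f p) ∧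
      (j = (n + 1) ^ K → m' 29 0 = 0) ∧ ∀ b < 2, Found ok be co j b m')
      (T := 3 * c + 140 * K + 180) ?_ ?_ ?_ ?_
  · nlinarith
  · refine ⟨fun _ => ⟨by omega, fun _ => 0, by simp [tupleNum_eq], fun p =>
        by simpa using h28 p p.2⟩,
      fun h => by omega, fun b hb => ⟨(h35 b hb).le, fun f hf => by omega, fun h => ?_⟩⟩
    rw [h35 b hb] at h
    omega
  · rintro j hj m5 hfr5 hb5 ⟨h1, -, h3⟩
    obtain ⟨hrun, f, rfl, hf⟩ := h1 hj
    refine ⟨hrun, ?_⟩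
    have hfr : ∀ C, C ∉ searchA → m5 C = m C := fun C hC => by
      rw [hfr5 C (fun h => hC (by simp at h ⊢; tauto)), hfr4 C hC]
    have hn5 : m5 2 0 = n := by rw [hfr 2 (by decide), hn]
    have hK5 : m5 4 0 = K := by rw [hfr 4 (by decide), hK]
    have hM : 1 ≤ (n + 2) ^ 2 := Nat.one_le_pow _ _ (by omega)
    have hc5 := (hD m5 f hfr hf).2.2.2.2
    refine Tri.seq (T₁ := c + 10) (T₂ := 2 * c + 140 * K + 160) (Tri.store'
      (Q := fun m' => m' = m5.set 31 0 (min (okE.eval m5 3 ρ) ((n + 2) ^ 2)))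
      rfl hwf.1 (by simp only [Ex.cost]; omega) rfl) (by omega) ?_
    rintro m6 - - hm6
    have hfr6 : ∀ C, C ∉ searchA → m6 C = m C := fun C hC => by
      simp at hC
      rw [hm6, Mem.set_ne _ _ _ (by tauto), hfr C (by simp; tauto)]
    have hf6 : ∀ p : Fin K, m6 28 p = f p := fun p => by rw [hm6, Mem.set_ne _ _ _ (by decide), hf]
    have hc6 := (hD m6 f hfr6 hf6).2.2.2.2
    refine Tri.seq (T₁ := c + 10) (T₂ := c + 140 * K + 140) (Tri.store'
      (Q := fun m' => m' = m6.set 33 0 (min (beE.eval m6 3 ρ) ((n + 2) ^ 2)))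
      rfl hwf.2.1 (by simp only [Ex.cost]; omega) rfl) (by omega) ?_
    rintro m7 - - hm7
    have hfr7 : ∀ C, C ∉ searchA → m7 C = m C := fun C hC => by
      simp at hC
      rw [hm7, Mem.set_ne _ _ _ (by tauto), hfr6 C (by simp; tauto)]
    have hf7 : ∀ p : Fin K, m7 28 p = f p := fun p => by rw [hm7, Mem.set_ne _ _ _ (by decide), hf6]
    have hc7 := (hD m7 f hfr7 hf7).2.2.2.2
    refine Tri.seq (T₁ := c + 10) (T₂ := 140 * K + 120) (Tri.store'
      (Q := fun m' => m' = m7.set 34 0 (min (coE.eval m7 3 ρ) ((n + 2) ^ 2)))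
      rfl hwf.2.2 (by simp only [Ex.cost]; omega) rfl) (by omega) ?_
    rintro m8 - - hm8
    have hfr8 : ∀ C, C ∉ searchA → m8 C = m C := fun C hC => by
      simp at hC
      rw [hm8, Mem.set_ne _ _ _ (by tauto), hfr7 C (by simp; tauto)]
    have e35 : ∀ C, C ≠ 31 → C ≠ 33 → C ≠ 34 → m8 C = m5 C := fun C h1 h2 h3 => by
      rw [hm8, Mem.set_ne _ _ _ h3, hm7, Mem.set_ne _ _ _ h2, hm6, Mem.set_ne _ _ _ h1]
    have e31 : m8 31 0 ≠ 0 ↔ ok f := by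
      rw [hm8, Mem.set_ne _ _ _ (by decide), hm7, Mem.set_ne _ _ _ (by decide), hm6, Mem.set_self,
        if_pos rfl, min_ne_zero_iff (by omega), ← (hD m5 f hfr hf).1, Ex.tr_iff]
    have e33 : m8 33 0 = beE.eval m6 3 ρ := by
      rw [hm8, Mem.set_ne _ _ _ (by decide), hm7, Mem.set_self, if_pos rfl, min_eq_left]
      exact (hD m6 f hfr6 hf6).2.2.1.trans hM
    have l33 := (hD m6 f hfr6 hf6).2.2.1
    refine Tri.seq (T₁ := 30 * K + 40) (T₂ := 100 * K + 50)
        (tri_record (f := f) (ok := ok) (be := be) (co := co)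
      (by rw [hfr8 2 (by decide), hn]) (by rw [hfr8 4 (by decide), hK]) hKn
      (fun p => by rw [e35 28 (by decide) (by decide) (by decide), hf]) e31 (e33 ▸ l33) ?_ ?_ ?_)
          (by omega) ?_
    · rw [e33, ← (hD m6 f hfr6 hf6).2.1, Ex.tr_iff]
      omega
    · rw [hm8, Mem.set_self, if_pos rfl, (hD m7 f hfr7 hf7).2.2.2.1]
    · intro b hb
      have := h3 b hb
      have x1 := e35 35 (by decide) (by decide) (by decide)
      have x2 := e35 36 (by decide) (by decide) (by decide)
      exact ⟨x1 ▸ this.le, x1 ▸ this.least, x1 ▸ x2 ▸ this.attained⟩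
    rintro m9 - - ⟨hf9, hF9⟩
    refine (tri_next (f := f) ?_ ?_ hKn (fun p => ?_) ?_).mono le_rfl ?_
    · rw [hf9 2 (by decide) (by decide), hfr8 2 (by decide), hn]
    · rw [hf9 4 (by decide) (by decide), hfr8 4 (by decide), hK]
    · rw [hf9 28 (by decide) (by decide), e35 28 (by decide) (by decide) (by decide), hf]
    · rwa [hf9 29 (by decide) (by decide), e35 29 (by decide) (by decide) (by decide)]
    rintro m10 - - ⟨-, g1, g2, g3, g4⟩
    refine ⟨g3, g4, fun b hb => ?_⟩
    have := hF9 b hb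
    exact ⟨g1 ▸ this.le, g1 ▸ this.least, g1 ▸ g2 ▸ this.attained⟩
  · rintro m' hfr - ⟨-, h2, h3⟩
    exact ⟨h2 rfl, h3⟩

end Search

/-! ### The choices for one block -/

section Choice

open Classical

variable {n K : ℕ} {G : SimpleGraph (Fin n)} {o c v : Fin n}

/-- The set of the entries of a tuple. The entry `n` stands for no vertex. -/
noncomputable def entries (f : Fin K → Fin (n + 1)) : Finset (Fin n) :=
  Finset.univ.filter fun x => ∃ p, (f p : ℕ) = x

theorem mem_entries {f : Fin K → Fin (n + 1)} {x : Fin n} : x ∈ entries f ↔ ∃ p, (f p : ℕ) = x := by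
  simp [entries]

/-- The number of entries that stand for a vertex. -/
noncomputable def entryCount (f : Fin K → Fin (n + 1)) : ℕ := ∑ p, if (f p : ℕ) < n then 1 else 0

theorem card_entries_le (f : Fin K → Fin (n + 1)) : (entries f).card ≤ entryCount f := by
  rw [entryCount, ← Finset.card_filter]
  have : (entries f).image (fun x => x.castSucc) ⊆
      (Finset.univ.filter fun p : Fin K => (f p : ℕ) < n).image f := by
    intro y hy
    obtain ⟨x, hx, rfl⟩ := Finset.mem_image.1 hy
    obtain ⟨p, hp⟩ := mem_entries.1 hx
    exact Finset.mem_image.2 ⟨p, by simp [hp], Fin.ext (by simp [hp])⟩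
  calc (entries f).card = ((entries f).image (fun x => x.castSucc)).card :=
        (Finset.card_image_of_injective _ (Fin.castSucc_injective n)).symm
    _ ≤ _ := Finset.card_le_card this
    _ ≤ _ := Finset.card_image_le

theorem entryCount_le (f : Fin K → Fin (n + 1)) : entryCount f ≤ K := by
  refine (Finset.sum_le_card_nsmul _ _ 1 fun p _ => ?_).trans (by simp)
  split_ifs <;> omega

theorem exists_entries {Z : Finset (Fin n)} (hZ : Z.card ≤ K) :
    ∃ f : Fin K → Fin (n + 1), entries f = Z ∧ entryCount f = Z.card := by
  refine ⟨fun p => if h : (p : ℕ) < Z.card then (Z.orderEmbOfFin rfl ⟨p, h⟩).castSucc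
    else Fin.last n, ?_, ?_⟩
  · ext x
    rw [mem_entries]
    constructor
    · rintro ⟨p, hp⟩
      split_ifs at hp with h
      · have : x = Z.orderEmbOfFin rfl ⟨p, h⟩ := Fin.ext hp.symm
        exact this ▸ Finset.orderEmbOfFin_mem Z rfl _
      · simp at hp
        have := x.2
        omega
    · intro hx
      have : x ∈ Set.range (Z.orderEmbOfFin rfl) := by rw [Finset.range_orderEmbOfFin]; exact hx
      obtain ⟨p, rfl⟩ := this
      exact ⟨⟨p, by omega⟩, by simp⟩
  · have h1 : ∀ p : Fin K, (if (((if h : (p : ℕ) < Z.card then (Z.orderEmbOfFin rfl ⟨p, h⟩).castSucc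
        else Fin.last n) : Fin (n + 1)) : ℕ) < n then 1 else 0) = if
            (p : ℕ) < Z.card then 1 else 0 := by
      intro p
      by_cases h : (p : ℕ) < Z.card <;> simp [h]
    rw [entryCount, Finset.sum_congr rfl fun p _ => h1 p,
      ← Finset.sum_range (n := K) fun p => if p < Z.card then 1 else 0, ← Finset.card_filter]
    have : (Finset.range K).filter (fun p => p < Z.card) = Finset.range Z.card := by
      ext p
      simp only [Finset.mem_filter, Finset.mem_range]
      omega
    rw [this, Finset.card_range]

/-- The choice of the entries of `f` for the block spanned by `c` and `v` is bad at `x`, if all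
entries lie in the EBC of the block. -/
def BadAt (G : SimpleGraph (Fin n)) (c v : Fin n) (f : Fin K → Fin (n + 1)) (x : Fin n) : Prop :=
  Joint G x ∧ ∃ u ∈ ext G (blk G c v), G.Adj x u ∧
    (∀ w ∈ ext G (blk G c v), Joint G w → w ≠ x → G.dist u w = 1 + G.dist x w) ∧
    ∀ w ∈ entries f, w ≠ x → G.dist u w = 1 + G.dist x w

theorem badAt_iff {f : Fin K → Fin (n + 1)} (hf : (graphTask G K).ok (c, v) (entries f)) {x : Fin n}
    (hx : x ∈ blk G c v) : (graphTask G K).bad (c, v) (entries f) x ↔ BadAt G c v f x := by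
  refine and_congr_right fun hj => ?_
  simp only [hx, true_and]
  refine exists_congr fun u => and_congr_right fun hu => and_congr_right fun ha => ?_
  constructor
  · exact fun h => ⟨fun w hw hwj => h w ⟨hw, .inl hwj⟩, fun w hw => h w ⟨(hf.2.1 w hw).1, .inr hw⟩⟩
  · rintro ⟨h1, h2⟩ w ⟨hw, hwj | hwf⟩
    · exact h1 w hw hwj
    · exact h2 w hwf

/-- The cost of a tuple, with the numbers `a₀` and `a₁` for the parts below the children. -/
noncomputable def tupleCost (G : SimpleGraph (Fin n)) (K : ℕ) (c v : Fin n) (a₀ a₁ : Fin n → ℕ)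
    (f : Fin K → Fin (n + 1)) : ℕ :=
  entryCount f + ∑ x ∈ (graphTask G K).ch (c, v), if BadAt G c v f x then a₀ x else a₁ x

/-- The cost of a tuple differs from that of its set of entries by the number of repeated entries.
-/
theorem optCost_le_tupleCost {f : Fin K → Fin (n + 1)} {a₀ a₁ : Fin n → ℕ}
    (hf : (graphTask G K).ok (c, v) (entries f)) :
    (graphTask G K).optCost a₀ a₁ (c, v) (entries f) + entryCount f =
      tupleCost G K c v a₀ a₁ f + (entries f).card := by
  rw [Task.optCost, tupleCost]
  have : ∑ x ∈ (graphTask G K).ch (c, v), (if (graphTask G K).bad (c, v)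
      (entries f) x then a₀ x else a₁ x)
      = ∑ x ∈ (graphTask G K).ch (c, v), if BadAt G c v f x then a₀ x else a₁ x :=
    Finset.sum_congr rfl fun x hx => by rw [badAt_iff hf (mem_ch.1 hx).1]
  rw [this]; omega

/-- The search over tuples finds the best choices for a block. A tuple with repeated entries costs
more than its set of entries does, but every set is that of a tuple without repetitions. -/
theorem isBest_of_found {m : Mem} {a₀ a₁ : Fin n → ℕ} {S₀ S₁ : Fin n → Finset (Fin n)}
    (hu : IsUnit G o c v) {b : ℕ} {Y : Finset (Fin n)}
    (h : Found (fun f : Fin K → Fin (n + 1) => (graphTask G K).ok (c, v) (entries f))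
      (fun f => BadAt G c v f c) (tupleCost G K c v a₀ a₁) ((n + 1) ^ K) b m)
    (hY : ∀ f : Fin K → Fin (n + 1), (∀ p : Fin K, m 36 (b * n + p) = f p) →
      Y = entries f ∪ ((graphTask G K).ch (c, v)).biUnion fun x =>
          if BadAt G c v f x then S₀ x else S₁ x) :
    (graphTask G K).IsBest ((n + 2) ^ 2) a₀ a₁ S₀ S₁ (c, v) (b = 1) (m 35 b) Y := by
  have hgate : (graphTask G K).gate (c, v) = c := rfl
  rw [Task.IsBest, hgate]
  refine ⟨fun Z hZ hb => ?_, fun hlt => ?_⟩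
  · obtain ⟨f, rfl, hc⟩ := exists_entries hZ.1
    have := optCost_le_tupleCost (a₀ := a₀) (a₁ := a₁) hZ
    have := h.least f (tupleNum_lt f) hZ (by rw [← hb, badAt_iff hZ hu.fst_mem])
    omega
  · obtain ⟨f, h1, h2, h3, h4⟩ := h.attained hlt
    refine ⟨entries f, h2, by rw [← h3, badAt_iff h2 hu.fst_mem], ?_, ?_⟩
    · have := optCost_le_tupleCost (a₀ := a₀) (a₁ := a₁) h2
      have := card_entries_le f
      omega
    · rw [hY f h1, Task.optSet]
      congr 1
      refine Finset.biUnion_congr rfl fun x hx => ?_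
      rw [badAt_iff h2 (mem_ch.1 hx).1]

end Choice

section Expressions

open Ex

/-- The vertex `y` lies in the block spanned by `1` and `2`. -/
def inBlkE (y : Ex) : Ex := conj (ix 9 y (var 1)) (ix 9 y (var 2))

/-- The vertex `y` lies in the EBC of the block spanned by `1` and `2`. -/
def inExtE (y : Ex) : Ex := disj (inBlkE y) (conj (less (get 15 y) nn) (inBlkE (get 15 y)))

/-- The list entry with index `k`. -/
def lsE (k : ℕ) : Ex := get 25 (var k)

/-- A joint in the list has different distances to the entries `3` and `4`. -/
def frE : Ex :=
  exi 3 (conj (get 16 (lsE 5)) (neg (same (ix 5 (lsE 3) (lsE 5)) (ix 5 (lsE 4) (lsE 5)))))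

/-- The entry `3` is a joint, and from its neighbor, the entry `4`, all other joints in the list
are seen through it. -/
def fbE : Ex :=
  conj (get 16 (lsE 3)) <| conj (ix 0 (lsE 3) (lsE 4)) <| all 3 <| imp (get 16 (lsE 5)) <|
    disj (same (lsE 5) (lsE 3)) (same (ix 5 (lsE 4) (lsE 5))
        (bin .add (num 1) (ix 5 (lsE 3) (lsE 5))))

/-- The tuple in row `r` of the array `A` is bad at the list entry with index `k`. -/
def badE (A r k d : ℕ) : Ex :=
  exi 3 <| conj (ix 27 (var k) (var d)) <| all 4 <| imp (less (ix A (num r) (var (d + 1))) nn) <|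
    disj (same (ix A (num r) (var (d + 1))) (lsE k))
      (same (ix 5 (lsE d) (ix A (num r) (var (d + 1))))
        (bin .add (num 1) (ix 5 (lsE k) (ix A (num r) (var (d + 1))))))

/-- The current tuple is admissible. -/
def okE : Ex :=
  conj (all 4 (imp (less (get 28 (var 3)) nn)
      (conj (inExtE (get 28 (var 3))) (neg (get 16 (get 28 (var 3)))))))
    (all 3 (all 3 (disj (same (lsE 3) (lsE 4)) (disj (ix 26 (var 3) (var 4)) (exi 4 (conj
      (less (get 28 (var 5)) nn)
      (neg (same (ix 5 (lsE 3) (get 28 (var 5))) (ix 5 (lsE 4) (get 28 (var 5)))))))))))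

/-- The current tuple is bad at the gate. -/
def beE : Ex := neg (neg (exi 3 (conj (same (lsE 3) (var 1)) (badE 28 0 3 4))))

/-- The list entry with index `k` is a child. -/
def chE (k : ℕ) : Ex := conj (get 16 (lsE k)) (neg (same (lsE k) (var 1)))

/-- The cost of the current tuple. -/
def coE : Ex :=
  bin .add (sum 4 (ite (less (get 28 (var 3)) nn) (num 1) (num 0)))
    (sum 3 (ite (chE 3) (ite (badE 28 0 3 4) (get 20 (lsE 3)) (get 21 (lsE 3))) (num 0)))

/-- The vertex `3` belongs to the set of the best tuple in the class `b`. -/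
def yE (b : ℕ) : Ex :=
  disj (exi 4 (same (ix 36 (num b) (var 4)) (var 3))) <|
    exi 3 (conj (chE 4) (ite (badE 36 b 4 5) (ix 22 (lsE 4) (var 3)) (ix 23 (lsE 4) (var 3))))

variable {n K w t s : ℕ} {ρ : ℕ → ℕ} {m : Mem} {G : SimpleGraph (Fin n)} {o c v : Fin n}
  {L : Fin s → Fin n}

@[simp] theorem Ex.tr_ite (a b e : Ex) (d : ℕ) : (ite a b e).tr m d ρ ↔
    (a.tr m d ρ ∧ b.tr m d ρ) ∨ (¬ a.tr m d ρ ∧ e.tr m d ρ) := by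
  rw [Ex.tr_iff, Ex.eval_ite]
  split_ifs with h <;> simp [h, Ex.tr_iff]

/-- The memory while the block spanned by `c` and `v` is dealt with: array `25` lists its EBC. -/
structure Loc (G : SimpleGraph (Fin n)) (o c v : Fin n) (K : ℕ) (L : Fin s → Fin n) (m : Mem) : Prop
    extends Tabs G o m where
  width : m 4 0 = K
  cnt : m 3 0 = s
  list : ∀ i : Fin s, m 25 i = L i
  inj : Function.Injective L
  mem : ∀ x, x ∈ ext G (blk G c v) ↔ ∃ i, L i = x
  fr : ∀ i j : Fin s, m 26 (i * n + j) ≠ 0 ↔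
    ∃ w ∈ ext G (blk G c v), Joint G w ∧ G.dist (L i) w ≠ G.dist (L j) w
  fb : ∀ i j : Fin s, m 27 (i * n + j) ≠ 0 ↔ Joint G (L i) ∧ G.Adj (L i) (L j) ∧
    ∀ w ∈ ext G (blk G c v), Joint G w → w ≠ L i → G.dist (L j) w = 1 + G.dist (L i) w

theorem Loc.congr {m' : Mem} (h : Loc G o c v K L m)
    (h' : ∀ A < 28, A ∉ [1, 6, 7, 8] → m' A = m A) : Loc G o c v K L m' := by
  refine ⟨h.toTabs.congr fun A hA hA' => h' A (by omega) (by simp at hA' ⊢; tauto), ?_, ?_, ?_,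
      h.inj, h.mem, ?_, ?_⟩
  · rw [h' 4 (by decide) (by decide)]; exact h.width
  · rw [h' 3 (by decide) (by decide)]; exact h.cnt
  · rw [h' 25 (by decide) (by decide)]; exact h.list
  · rw [h' 26 (by decide) (by decide)]; exact h.fr
  · rw [h' 27 (by decide) (by decide)]; exact h.fb

theorem tr_inBlk (hT : Tabs G o m) (h1 : ρ 1 = c) (h2 : ρ 2 = v) {y : Ex} {d : ℕ} {x : Fin n}
    (hy : y.eval m d ρ = x) : (inBlkE y).tr m d ρ ↔ x ∈ blk G c v := by
  simp only [inBlkE, Ex.tr_conj, Ex.tr_ix, Ex.eval_var, h1, h2, hy, hT.size, hT.nosep]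
  rfl

theorem tr_inExt (hT : Tabs G o m) (h1 : ρ 1 = c) (h2 : ρ 2 = v) {y : Ex} {d : ℕ} {x : Fin n}
    (hy : y.eval m d ρ = x) : (inExtE y).tr m d ρ ↔ x ∈ ext G (blk G c v) := by
  simp only [inExtE, Ex.tr_disj, tr_inBlk hT h1 h2 hy, Ex.tr_conj, Ex.tr_less, Ex.eval_get,
      Ex.eval_nn,
    hy, hT.size]
  refine or_congr Iff.rfl ⟨fun ⟨h, h'⟩ => ?_, fun ⟨r, hr, hx⟩ => ?_⟩
  · exact ⟨⟨m 15 x, h⟩, (tr_inBlk hT h1 h2 (x := ⟨m 15 x, h⟩) (by simp [hy])).1 h',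
      (hT.hook x ⟨m 15 x, h⟩).1 rfl⟩
  · have := (hT.hook x r).2 hx
    exact ⟨by rw [this]; exact r.2, (tr_inBlk hT h1 h2 (x := r) (by simp [hy, this])).2 hr⟩

/-- The meaning of `badE`, for the tuple `f` and the list entry with index `i`. -/
theorem tr_bad (hL : Loc G o c v K L m) {A r k d : ℕ} {f : Fin K → Fin (n + 1)}
    (hf : ∀ p : Fin K, m A (r * n + p) = f p) (hk : k < d) {i : Fin s} (hi : ρ k = i) :
    (badE A r k d).tr m d ρ ↔ BadAt G c v f (L i) := by
  have h1 : ¬ k = d := by omega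
  have h2 : ¬ k = d + 1 := by omega
  simp only [badE, lsE, Ex.tr_exi, Ex.tr_conj, Ex.tr_all, Ex.tr_imp, Ex.tr_disj, Ex.tr_less,
      Ex.tr_same,
    Ex.tr_ix, Ex.eval_ix, Ex.eval_nn, Ex.eval_num, Ex.eval_var, Ex.eval_get, Ex.eval_add, hL.cnt,
    hL.width, exists_lt_iff,
    forall_lt_iff, Function.update_apply, h1, h2, hi, if_true, if_false, hL.size, hf, hL.list,
    hL.fb,
    Nat.succ_ne_self, (Nat.succ_ne_self _).symm]
  constructor
  · rintro ⟨j, ⟨a1, a2, a3⟩, a4⟩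
    refine ⟨a1, L j, (hL.mem _).2 ⟨j, rfl⟩, a2, a3, fun w hw hne => ?_⟩
    obtain ⟨p, hp⟩ := mem_entries.1 hw
    have := a4 p (by rw [hp]; exact w.2)
    rw [hp, hL.dist, hL.dist] at this
    exact this.resolve_left fun h => hne (Fin.ext h)
  · rintro ⟨a1, u, hu, a2, a3, a4⟩
    obtain ⟨j, rfl⟩ := (hL.mem _).1 hu
    refine ⟨j, ⟨a1, a2, a3⟩, fun p hp => ?_⟩
    have := a4 ⟨f p, hp⟩ (mem_entries.2 ⟨p, rfl⟩)
    rw [← hL.dist, ← hL.dist] at this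
    by_cases h : (f p : ℕ) = L i
    · exact .inl h
    · exact .inr (this fun h' => h (by rw [← h']))

end Expressions

/-! ### Correctness of the expressions for one block -/

section Describing

open Ex

variable {n K w t s : ℕ} {ρ : ℕ → ℕ} {m : Mem} {G : SimpleGraph (Fin n)} {o c v : Fin n}
  {L : Fin s → Fin n}

theorem tr_ok (hL : Loc G o c v K L m) (h1 : ρ 1 = c) (h2 : ρ 2 = v) {f : Fin K → Fin (n + 1)}
    (hf : ∀ p : Fin K, m 28 p = f p) :
    okE.tr m 3 ρ ↔ (graphTask G K).ok (c, v) (entries f) := by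
  have e1 : (∀ p : Fin K, (f p : ℕ) < n →
        (inExtE (get 28 (var 3))).tr m (3 + 1) (Function.update ρ 3 p) ∧ m 16 (f p) = 0) ↔
      ∀ x ∈ entries f, x ∈ ext G (blk G c v) ∧ ¬ Joint G x := by
    constructor
    · intro h x hx
      obtain ⟨p, hp⟩ := mem_entries.1 hx
      obtain ⟨a, b⟩ := h p (by rw [hp]; exact x.2)
      refine ⟨(tr_inExt hL.toTabs (by simpa using h1) (by simpa using h2) (by simp [hf, hp])).1 a,
          ?_⟩
      rw [← hL.joint, ← hp, b]
      simp
    · intro h p hp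
      obtain ⟨a, b⟩ := h ⟨f p, hp⟩ (mem_entries.2 ⟨p, rfl⟩)
      refine ⟨(tr_inExt (x := ⟨f p, hp⟩) hL.toTabs (by simpa using h1) (by simpa using h2)
        (by simp [hf])).2 a, ?_⟩
      rw [← hL.joint] at b
      simpa using b
  have e2 : ∀ i j : Fin s, (∃ p : Fin K, (f p : ℕ) < n ∧
      ¬ m 5 (L i * n + f p) = m 5 (L j * n + f p)) ↔
      ∃ x ∈ entries f, G.dist (L i) x ≠ G.dist (L j) x := by
    intro i j
    constructor
    · rintro ⟨p, hp, h⟩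
      exact ⟨⟨f p, hp⟩, mem_entries.2 ⟨p, rfl⟩, by rw [← hL.dist, ← hL.dist]; exact h⟩
    · rintro ⟨x, hx, h⟩
      obtain ⟨p, hp⟩ := mem_entries.1 hx
      exact ⟨p, by rw [hp]; exact x.2, by rw [hp, hL.dist, hL.dist]; exact h⟩
  simp only [okE, lsE, Ex.tr_exi, Ex.tr_conj, Ex.tr_all, Ex.tr_imp, Ex.tr_disj, Ex.tr_less,
      Ex.tr_same, Ex.tr_neg,
    Ex.tr_ix, Ex.tr_get, Ex.eval_ix, Ex.eval_nn, Ex.eval_var, Ex.eval_get, hL.cnt, hL.width,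
    exists_lt_iff,
    forall_lt_iff, Function.update_apply, if_true, if_false, hL.size, hf, hL.list, hL.fr,
    Nat.reduceEqDiff, Nat.reduceAdd, e2, ne_eq, not_not]
  simp only [Nat.reduceAdd] at e1
  rw [e1]
  have hcard : (entries f).card ≤ K := (card_entries_le f).trans (entryCount_le f)
  constructor
  · rintro ⟨a, b⟩
    refine ⟨hcard, a, fun x hx y hy hne => ?_⟩
    obtain ⟨i, rfl⟩ := (hL.mem x).1 hx
    obtain ⟨j, rfl⟩ := (hL.mem y).1 hy
    rcases b i j with h | ⟨w, h1, h2, h3⟩ | ⟨w, h1, h2⟩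
    · exact absurd (Fin.ext h) hne
    · exact ⟨w, ⟨h1, .inl h2⟩, h3⟩
    · exact ⟨w, ⟨(a w h1).1, .inr h1⟩, h2⟩
  · rintro ⟨-, a, b⟩
    refine ⟨a, fun i j => ?_⟩
    by_cases hij : L i = L j
    · exact .inl (by rw [hij])
    · obtain ⟨w, ⟨hw, hwj | hwf⟩, h⟩ := b _ ((hL.mem _).2 ⟨i, rfl⟩) _ ((hL.mem _).2 ⟨j, rfl⟩) hij
      · exact .inr (.inl ⟨w, hw, hwj, h⟩)
      · exact .inr (.inr ⟨w, hwf, h⟩)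

theorem tr_be (hL : Loc G o c v K L m) (hu : IsUnit G o c v) (h1 : ρ 1 = c)
    {f : Fin K → Fin (n + 1)} (hf : ∀ p : Fin K, m 28 p = f p) :
    beE.tr m 3 ρ ↔ BadAt G c v f c := by
  have e : ∀ i : Fin s, (badE 28 0 3 4).tr m (3 + 1) (Function.update ρ 3 i) ↔
      BadAt G c v f (L i) :=
    fun i => tr_bad hL (by simpa using hf) (by omega) (by simp)
  simp only [beE, lsE, Ex.tr_neg, not_not, Ex.tr_exi, hL.cnt, exists_lt_iff, Ex.tr_conj, Ex.tr_same,
    Ex.eval_get, Ex.eval_var, e, Function.update_apply, Nat.reduceEqDiff, reduceIte, hL.list, h1,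
    Fin.val_inj]
  constructor
  · rintro ⟨i, rfl, h⟩
    exact h
  · intro h
    obtain ⟨i, hi⟩ := (hL.mem c).1 (.inl hu.fst_mem)
    exact ⟨i, hi, hi ▸ h⟩

theorem mem_ch_iff (hG : G.Connected) (hL : Loc G o c v K L m) {x : Fin n} :
    x ∈ (graphTask G K).ch (c, v) ↔ ∃ i, L i = x ∧ Joint G x ∧ x ≠ c := by
  rw [mem_ch]
  constructor
  · rintro ⟨a, b, h⟩
    obtain ⟨i, hi⟩ := (hL.mem x).1 (.inl a)
    exact ⟨i, hi, b, h⟩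
  · rintro ⟨i, hi, b, h⟩
    exact ⟨b.mem_of_mem_ext hG ((hL.mem x).2 ⟨i, hi⟩), b, h⟩

theorem tr_ch (hL : Loc G o c v K L m) (h1 : ρ 1 = c) {k d : ℕ} {i : Fin s} (hi : ρ k = i) :
    (chE k).tr m d ρ ↔ Joint G (L i) ∧ L i ≠ c := by
  simp only [chE, lsE, Ex.tr_conj, Ex.tr_get, Ex.eval_get, Ex.eval_var, Ex.tr_neg, Ex.tr_same, hi,
      h1,
    hL.list, hL.joint, Fin.val_inj, ne_eq]

open Classical in
theorem eval_co (hG : G.Connected) (hL : Loc G o c v K L m) (h1 : ρ 1 = c)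
    {f : Fin K → Fin (n + 1)} (hf : ∀ p : Fin K, m 28 p = f p) :
    coE.eval m 3 ρ = tupleCost G K c v (fun x => m 20 x) (fun x => m 21 x) f := by
  have e : ∀ i : Fin s, (badE 28 0 3 4).tr m (3 + 1) (Function.update ρ 3 i) ↔
      BadAt G c v f (L i) :=
    fun i => tr_bad hL (by simpa using hf) (by omega) (by simp)
  have e' : ∀ i : Fin s, (chE 3).tr m (3 + 1) (Function.update ρ 3 i) ↔ Joint G (L i) ∧ L i ≠ c :=
    fun i => tr_ch hL (by simpa using h1) (by simp)
  simp only [coE, Ex.eval_add, Ex.eval_sum, tupleCost, hL.width, hL.cnt, Finset.sum_range,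
      Ex.eval_ite,
    e, e', Ex.tr_less, Ex.eval_get, Ex.eval_var, Ex.eval_num, Ex.eval_nn, hL.size, lsE, hL.list,
    Function.update_self, hf, entryCount]
  congr 1
  have : (graphTask G K).ch (c, v) = (Finset.univ.filter fun i => Joint G (L i) ∧
      L i ≠ c).image L := by
    ext x
    rw [mem_ch_iff hG hL]
    simp only [Finset.mem_image, Finset.mem_filter, Finset.mem_univ, true_and]
    constructor
    · rintro ⟨i, rfl, h⟩; exact ⟨i, h, rfl⟩
    · rintro ⟨i, h, rfl⟩; exact ⟨i, rfl, h⟩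
  rw [this, Finset.sum_image (fun x _ y _ h => hL.inj h), Finset.sum_filter]

open Classical in
theorem tr_y (hG : G.Connected) (hL : Loc G o c v K L m) (h1 : ρ 1 = c) {x : Fin n} (h3 : ρ 3 = x)
    {b : ℕ} {f : Fin K → Fin (n + 1)} (hf : ∀ p : Fin K, m 36 (b * n + p) = f p)
    {S₀ S₁ : Fin n → Finset (Fin n)} (hS₀ : ∀ y x : Fin n, m 22 (y * n + x) ≠ 0 ↔ x ∈ S₀ y)
    (hS₁ : ∀ y x : Fin n, m 23 (y * n + x) ≠ 0 ↔ x ∈ S₁ y) :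
    (yE b).tr m 4 ρ ↔ x ∈ entries f ∪
      ((graphTask G K).ch (c, v)).biUnion fun y => if BadAt G c v f y then S₀ y else S₁ y := by
  have e : ∀ i : Fin s, (badE 36 b 4 5).tr m (4 + 1) (Function.update ρ 4 i) ↔
      BadAt G c v f (L i) :=
    fun i => tr_bad hL hf (by omega) (by simp)
  have e' : ∀ i : Fin s, (chE 4).tr m (4 + 1) (Function.update ρ 4 i) ↔ Joint G (L i) ∧ L i ≠ c :=
    fun i => tr_ch hL (by simpa using h1) (by simp)
  simp only [yE, lsE, Ex.tr_disj, Ex.tr_exi, Ex.tr_conj, Ex.tr_ite, e, e', hL.cnt, hL.width,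
      exists_lt_iff,
    Ex.tr_same, Ex.tr_ix, Ex.eval_ix, Ex.eval_get, Ex.eval_num, Ex.eval_var, Function.update_apply,
    Nat.reduceEqDiff,
    reduceIte, hL.size, h3, hL.list, hS₀, hS₁, hf, Finset.mem_union, mem_entries,
    Finset.mem_biUnion, mem_ch_iff hG hL]
  refine or_congr Iff.rfl ⟨fun ⟨i, h, h'⟩ => ⟨L i, ⟨i, rfl, h⟩, ?_⟩, fun ⟨y, ⟨i, hi, h⟩, h'⟩ =>
      ⟨i, hi ▸ h, ?_⟩⟩
  · rcases h' with h' | h' <;> simp [h']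
  · subst hi
    by_cases hb : BadAt G c v f (L i)
    · rw [if_pos hb] at h'
      exact .inl ⟨hb, h'⟩
    · rw [if_neg hb] at h'
      exact .inr ⟨hb, h'⟩

/-- A bound for the running time of an expression. -/
theorem Ex.cost_le_of (h2 : m 2 0 = n) (h3 : m 3 0 = s) (h4 : m 4 0 = K) (hn : 1 ≤ n) (hs : 1 ≤ s)
    (hK : 1 ≤ K)
    {e : Ex} {x y z : ℕ} (he : e.bnd = true ∧ e.deg 2 ≤ x ∧ e.deg 3 ≤ y ∧ e.deg 4 ≤ z) {C : ℕ}
        (hC : e.cst ≤ C) :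
    e.cost m ≤ C * (n ^ x * s ^ y * K ^ z) := by
  refine (Ex.cost_le hn hs hK h2.le h3.le h4.le e he.1).trans (Nat.mul_le_mul hC ?_)
  exact Nat.mul_le_mul (Nat.mul_le_mul (Nat.pow_le_pow_right hn he.2.1)
      (Nat.pow_le_pow_right hs he.2.2.1))
    (Nat.pow_le_pow_right hK he.2.2.2)

/-- The expressions `okE`, `beE` and `coE` describe the search for the best choices for a block;
they are evaluated in time quadratic in the size of its EBC. -/
theorem describes (hG : G.Connected) (hL : Loc G o c v K L m) (hu : IsUnit G o c v) (h1 : ρ 1 = c)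
    (h2 : ρ 2 = v)
    (hK : 1 ≤ K) (hs : 1 ≤ s) :
    Describes okE beE coE (fun f : Fin K → Fin (n + 1) => (graphTask G K).ok (c, v) (entries f))
      (fun f => BadAt G c v f c) (tupleCost G K c v (fun x => m 20 x) (fun x => m 21 x))
      (1000 * (s ^ 2 * K)) ρ m := by
  intro m' f hm' hf
  have hL' : Loc G o c v K L m' := hL.congr fun A hA _ => hm' A (by simp; omega)
  refine ⟨tr_ok hL' h1 h2 hf, tr_be hL' hu h1 hf, ?_, ?_, ?_⟩
  · have : ∀ e : Ex, (neg e).eval m' 3 ρ ≤ 1 := fun e => by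
      simp only [neg, Ex.eval]; split_ifs <;> simp
    exact this _
  · rw [eval_co hG hL' h1 hf, hm' 20 (by decide), hm' 21 (by decide)]
  · have a1 := Ex.cost_le_of hL'.size hL'.cnt hL'.width c.pos hs hK (e := okE) (x := 0) (y := 2)
        (z := 1)
      (by decide) (C := 300) (by decide)
    have a2 := Ex.cost_le_of hL'.size hL'.cnt hL'.width c.pos hs hK (e := beE) (x := 0) (y := 2)
        (z := 1)
      (by decide) (C := 300) (by decide)
    have a3 := Ex.cost_le_of hL'.size hL'.cnt hL'.width c.pos hs hK (e := coE) (x := 0) (y := 2)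
        (z := 1)
      (by decide) (C := 300) (by decide)
    simp only [pow_zero, one_mul, pow_one] at a1 a2 a3
    omega

end Describing

/-! ### Lists and tables for one block -/

section UnitProgram

open Ex

variable {n K w t s : ℕ} {ρ : ℕ → ℕ} {m : Mem} {G : SimpleGraph (Fin n)} {o c v : Fin n}

/-- Listing the EBC of the block spanned by `1` and `2`. -/
def listS : Pg :=
  seqS (storeS 3 (num 0) (num 0)) <| forS 2 <| iteS (inExtE (var 3))
    (seqS (storeS 25 (get 3 (num 0)) (var 3))
        (storeS 3 (num 0) (bin .add (get 3 (num 0)) (num 1)))) skipS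

@[simp] theorem listS_stores (d t : ℕ) : (listS d t).stores = [3, 25, 3] := by simp [listS]

/-- The rule for `listS`: the EBC is listed without repetitions. -/
theorem tri_list (hT : Tabs G o m) (h1 : ρ 1 = c) (h2 : ρ 2 = v) :
    Tri (n + 2) w 3 t ρ m (listS 3 t) (100 * n + 20) fun m' => ∃ s, ∃ L : Fin s → Fin n,
        m' 3 0 = s ∧
      (∀ i : Fin s, m' 25 i = L i) ∧ Function.Injective L ∧ ∀ x, x ∈ ext G (blk G c v) ↔ ∃ i,
      L i = x := by
  have hnM : n + 1 ≤ (n + 2) ^ 2 := by nlinarith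
  refine Tri.seq (T₁ := 10) (T₂ := 100 * n + 10) (Tri.store' (Q := fun m' => m' = m.set 3 0 0)
    rfl rfl (by simp [Ex.cost]) (by simp)) (by omega) ?_
  rintro m1 - - rfl
  have hT1 : Tabs G o (m.set 3 0 0) := hT.congr fun A hA hA' => by
    rw [Mem.set_ne _ _ _ (by rintro rfl; simp at hA')]
  refine Tri.for' (T := 90) (fun y m' => ∃ s, ∃ L : Fin s → Fin n, m' 3 0 = s ∧
      (∀ i : Fin s, m' 25 i = L i) ∧ Function.Injective L ∧
      ∀ x, (x ∈ ext G (blk G c v) ∧ (x : ℕ) < y) ↔ ∃ i, L i = x) ?_ ?_ ?_ ?_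
  · rw [hT1.size]; omega
  · exact ⟨0, Fin.elim0, by simp [Mem.set_self], fun i => i.elim0, fun i => i.elim0, fun x =>
        by simp⟩
  · rintro y hy m2 hfr2 - ⟨s, L, hs, hl, hi, hm⟩
    rw [hT1.size] at hy
    have hT2 : Tabs G o m2 := hT1.congr fun A hA hA' => hfr2 A (by
      simp at hA' ⊢; omega)
    have htr : (inExtE (var 3)).tr m2 (3 + 1) (Function.update ρ 3 y) ↔
        (⟨y, hy⟩ : Fin n) ∈ ext G (blk G c v) :=
      tr_inExt hT2 (by simpa using h1) (by simpa using h2) (by simp)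
    refine Tri.ite' (T := 30) rfl (by simp [Ex.cost, inExtE, inBlkE, disj, conj, less, ix, nn])
        (fun h => ?_) (fun h => ?_)
    · have hy' := htr.1 h
      refine Tri.seq (T₁ := 10) (T₂ := 20) (Tri.store' (Q := fun m' => m' = m2.set 25 s y)
        rfl rfl (by simp [Ex.cost]) ?_) (by omega) ?_
      · simp only [Ex.eval_get, Ex.eval_num, Ex.eval_var, Function.update_self, hs]
        rw [min_eq_left (by omega)]
      rintro m3 - - rfl
      have hsn : s ≤ n := by simpa using Fintype.card_le_of_injective L hi
      refine Tri.store' rfl rfl (by simp [Ex.cost]) ⟨s + 1, Fin.snoc L ⟨y, hy⟩, ?_, ?_, ?_, ?_⟩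
      · simp only [Mem.set_self, Ex.eval_num, if_true, Ex.eval_add, Ex.eval_get,
          Mem.set_ne _ _ _ (show 3 ≠ 25 by decide), hs]
        omega
      · intro i
        rw [Mem.set_ne _ _ _ (by decide), Mem.set_self]
        refine Fin.lastCases ?_ (fun i => ?_) i
        · simp
        · rw [Fin.snoc_castSucc, if_neg (by simp; omega)]
          exact hl i
      · have hfresh : ∀ i, L i ≠ ⟨y, hy⟩ := fun i h => by
          have := ((hm (L i)).2 ⟨i, rfl⟩).2
          rw [h] at this
          simp at this
        intro i j
        refine Fin.lastCases ?_ (fun i => ?_) i <;> refine Fin.lastCases ?_ (fun j => ?_) j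
        · simp
        · simp only [Fin.snoc_last, Fin.snoc_castSucc]
          exact fun h => absurd h.symm (hfresh j)
        · simp only [Fin.snoc_last, Fin.snoc_castSucc]
          exact fun h => absurd h (hfresh i)
        · simp only [Fin.snoc_castSucc]
          exact fun h => by rw [hi h]
      · intro x
        constructor
        · rintro ⟨hx, hxy⟩
          rcases Nat.lt_succ_iff_lt_or_eq.1 hxy with h | h
          · obtain ⟨i, hi⟩ := (hm x).1 ⟨hx, h⟩
            exact ⟨i.castSucc, by simpa using hi⟩
          · exact ⟨Fin.last s, by simp [← h]⟩
        · rintro ⟨i, rfl⟩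
          refine Fin.lastCases ?_ (fun i => ?_) i
          · simpa using hy'
          · rw [Fin.snoc_castSucc]
            have := (hm (L i)).2 ⟨i, rfl⟩
            exact ⟨this.1, by omega⟩
    · refine (Tri.skip ?_).mono (by omega) fun _ _ _ h => h
      refine ⟨s, L, hs, hl, hi, fun x => ?_⟩
      rw [← hm]
      refine and_congr_right fun hx => ?_
      constructor
      · intro hxy
        rcases Nat.lt_succ_iff_lt_or_eq.1 hxy with h' | h'
        · exact h'
        · refine absurd (htr.2 ?_) h
          simpa [← h'] using hx
      · intro; omega
  · rintro m' - - ⟨s, L, hs, hl, hi, hm⟩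
    rw [hT1.size] at hm
    exact ⟨s, L, hs, hl, hi, fun x => by rw [← hm]; simp⟩

/-- Filling a table indexed by pairs of list entries. -/
def sqS (A : ℕ) (e : Ex) : Pg :=
  forS 3 (forS 3 (storeS A (.bin .add (.bin .mul (.var 3) .nn) (.var 4)) e))

@[simp] theorem sqS_stores (A : ℕ) (e : Ex) (d t : ℕ) : (sqS A e d t).stores = [A] := by simp [sqS]

/-- The rule for `sqS`, with cubic time in the number of list entries. -/
theorem tri_sq {A : ℕ} {e : Ex} (hn : m 2 0 = n) (hs : m 3 0 = s) (hsn : s ≤ n) (h1s : 1 ≤ s)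
    (hA : (A ∉ e.reads ∧ A ≠ 2 ∧ A ≠ 3) ∧ e.wf 5 = true ∧ e.bnd = true ∧ e.deg 2 = 0 ∧ e.deg 3 ≤ 1 ∧
      e.deg 4 = 0) (hC : e.cst ≤ 900) {P : Fin s → Fin s → Prop}
    (hP : ∀ i j : Fin s, e.tr m 5 (Function.update (Function.update ρ 3 i) 4 j) ↔ P i j) :
    Tri (n + 2) w 3 t ρ m (sqS A e 3 t) (1000 * s ^ 3) fun m' => (∀ C, C ≠ A → m' C = m C) ∧
      ∀ i j : Fin s, m' A (i * n + j) ≠ 0 ↔ P i j := by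
  obtain ⟨⟨hA1, hA2, hA3⟩, hwf, hb, hd2, hd3, hd4⟩ := hA
  have hcost : e.cost m ≤ 900 * s := by
    have := Ex.cost_le (m := m) (x := n) (y := s) (z := m 4 0 + 1) (by omega) h1s (by omega)
      hn.le hs.le (by omega) e hb
    rw [hd2, hd4] at this
    simp only [pow_zero, mul_one, one_mul] at this
    exact this.trans (Nat.mul_le_mul hC (by simpa using Nat.pow_le_pow_right h1s hd3))
  refine Tri.for' (T := s * (8 + 900 * s + 6) + 5) (fun x m' => ∀ i j : Fin s, (i : ℕ) < x →
      (m' A (i * n + j) ≠ 0 ↔ P i j)) ?_ (by simp) ?_ ?_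
  · rw [hs]
    have : s ≤ s ^ 2 := by nlinarith
    have : s ^ 2 ≤ s ^ 3 := Nat.pow_le_pow_right h1s (by omega)
    have : s * (s * (8 + 900 * s + 6) + 5 + 3) = 900 * s ^ 3 + 14 * s ^ 2 + 8 * s := by ring
    omega
  · intro x hx m' hm' _ hI
    have hfr : ∀ C, C ≠ A → m' C = m C := fun C hC => hm' C (by simpa using hC)
    have hn' : m' 2 0 = n := by rw [hfr 2 hA2.symm, hn]
    have hs' : m' 3 0 = s := by rw [hfr 3 hA3.symm, hs]
    refine Tri.fill (c := 8 + 900 * s) (fun y => x * n + y)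
      (fun y => e.eval m 5 (Function.update (Function.update ρ 3 x) 4 y)) hA3.symm rfl hwf
          (by rw [hs'])
      (fun y _ z _ h => by simpa using h)
      (fun y hy m'' hm'' _ => ⟨?_, ?_, ?_⟩) ?_
    · simp [hm'' 2 hA2.symm, hn']
    · have hr : ∀ C ∈ e.reads, m'' C = m C := fun C hC => by
        have hCA : C ≠ A := fun h => hA1 (h ▸ hC)
        rw [hm'' C hCA, hfr C hCA]
      rw [Ex.eval_congr e hr]
    · have hr : ∀ C ∈ e.reads, m'' C = m C := fun C hC => by
        have hCA : C ≠ A := fun h => hA1 (h ▸ hC)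
        rw [hm'' C hCA, hfr C hCA]
      rw [Ex.cost_congr e hr]
      simp only [Ex.cost, Ex.nn]; omega
    · intro m'' h1 _ h2 h3 i j hi
      rw [hs'] at h2 h3
      rw [hs] at hx
      rcases Nat.lt_succ_iff_lt_or_eq.1 hi with h | h
      · rw [h3 _ fun y hy he => ?_, hI i j h]
        have := (idx_inj (by omega) (by omega)).1 he
        omega
      · have := h2 j j.2
        rw [h, this, min_ne_zero_iff (by omega), ← Ex.tr_iff, ← hP, h]
  · intro m' hm' _ hI
    exact ⟨fun C hC => hm' C (by simpa using hC), fun i j => hI i j (by rw [hs]; exact i.2)⟩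

/-- The list of the EBC and the tables indexed by its entries are set up for the search. -/
theorem tri_loc (hT : Tabs G o m) (hK : m 4 0 = K) (hu : IsUnit G o c v) (h1 : ρ 1 = c)
    (h2 : ρ 2 = v) :
    Tri (n + 2) w 3 t ρ m (seqS listS (seqS (sqS 26 frE) (sqS 27 fbE)) 3 t)
      (100 * n + 20 + 2000 * (ext G (blk G c v)).ncard ^ 3) fun m' =>
      ∃ s, ∃ L : Fin s → Fin n, s = (ext G (blk G c v)).ncard ∧ 1 ≤ s ∧ Loc G o c v K L m' := by
  refine Tri.seq (T₁ := 100 * n + 20) (T₂ := 2000 * (ext G (blk G c v)).ncard ^ 3)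
      (tri_list hT h1 h2) (by omega) ?_
  rintro m1 hfr1 - ⟨s, L, hs, hl, hi, hm⟩
  have hT1 : Tabs G o m1 := hT.congr fun A hA hA' => hfr1 A (by simp at hA' ⊢; omega)
  have hcard : (ext G (blk G c v)).ncard = s := by
    have : ext G (blk G c v) = Set.range L := by ext x; rw [hm]; rfl
    rw [this, Set.ncard_eq_toFinset_card', Set.toFinset_range, Finset.card_image_of_injective _ hi]
    simp
  have hsn : s ≤ n := by simpa using Fintype.card_le_of_injective L hi
  have h1s : 1 ≤ s := by
    obtain ⟨i, -⟩ := (hm c).1 (.inl hu.fst_mem)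
    exact i.pos
  rw [hcard]
  refine Tri.seq (T₁ := 1000 * s ^ 3) (T₂ := 1000 * s ^ 3)
      (tri_sq hT1.size hs hsn h1s (by decide) (by decide)
    (P := fun i j => ∃ w ∈ ext G (blk G c v), Joint G w ∧
        G.dist (L i) w ≠ G.dist (L j) w) (fun i j => ?_))
    (by omega) ?_
  · simp only [frE, lsE, Ex.tr_exi, Ex.tr_conj, Ex.tr_neg, Ex.tr_same, Ex.tr_get, Ex.eval_get,
        Ex.eval_var, Ex.eval_ix,
      Function.update_apply, Nat.reduceEqDiff, reduceIte, hs, exists_lt_iff, hl, hT1.size, hT1.dist,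
      hT1.joint]
    constructor
    · rintro ⟨k, h⟩; exact ⟨L k, (hm _).2 ⟨k, rfl⟩, h⟩
    · rintro ⟨w, hw, h⟩
      obtain ⟨k, rfl⟩ := (hm _).1 hw
      exact ⟨k, h⟩
  rintro m2 - - ⟨hf2, hfr⟩
  have hT2 : Tabs G o m2 := hT1.congr fun A hA hA' => hf2 A (by omega)
  have hs2 : m2 3 0 = s := by rw [hf2 3 (by decide), hs]
  have hl2 : ∀ i : Fin s, m2 25 i = L i := by rw [hf2 25 (by decide)]; exact hl
  refine (tri_sq hT2.size hs2 hsn h1s (by decide) (by decide) (P := fun i j => Joint G (L i) ∧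
      G.Adj (L i) (L j) ∧
    ∀ w ∈ ext G (blk G c v), Joint G w → w ≠ L i →
    G.dist (L j) w = 1 + G.dist (L i) w) (fun i j => ?_)).mono le_rfl ?_
  · simp only [fbE, lsE, Ex.tr_all, Ex.tr_conj, Ex.tr_imp, Ex.tr_disj, Ex.tr_same, Ex.tr_get,
        Ex.eval_get, Ex.eval_var, Ex.eval_ix, Ex.tr_ix,
      Ex.eval_add, Ex.eval_num, Function.update_apply, Nat.reduceEqDiff, reduceIte, hs2,
      forall_lt_iff, hl2, hT2.size, hT2.dist, hT2.joint, hT2.adj,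
      Fin.val_inj]
    refine and_congr_right fun _ => and_congr_right fun _ => ?_
    constructor
    · intro h w hw hj hne
      obtain ⟨k, rfl⟩ := (hm _).1 hw
      exact (h k hj).resolve_left hne
    · intro h k hj
      by_cases hk : L k = L i
      · exact .inl hk
      · exact .inr (h _ ((hm _).2 ⟨k, rfl⟩) hj hk)
  · rintro m3 - - ⟨hf3, hfb⟩
    refine ⟨s, L, rfl, h1s, hT2.congr fun A hA hA' => hf3 A (by omega), ?_, ?_, ?_, hi, hm, ?_, hfb⟩
    · rw [hf3 4 (by decide), hf2 4 (by decide), hfr1 4 (by simp), hK]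
    · rw [hf3 3 (by decide), hs2]
    · rw [hf3 25 (by decide)]; exact hl2
    · rw [hf3 26 (by decide)]; exact hfr

end UnitProgram

/-! ### The program for one block -/

section Unit

open Ex

open Classical in
/-- The sets given by the rows of the table `A`. -/
noncomputable def rows {n : ℕ} (m : Mem) (A : ℕ) (x : Fin n) : Finset (Fin n) :=
  Finset.univ.filter fun y => m A (x * n + y) ≠ 0

/-- The numbers given by the table `A`. -/
def nums {n : ℕ} (m : Mem) (A : ℕ) (x : Fin n) : ℕ := m A x

open Classical in
/-- The vertices that are not yet dealt with. -/
noncomputable def opn (n : ℕ) (m : Mem) : Finset (Fin n) := Finset.univ.filter fun x => m 24 x ≠ 0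

theorem mem_rows {n : ℕ} {m : Mem} {A : ℕ} {x y : Fin n} : y ∈ rows m A x ↔
    m A (x * n + y) ≠ 0 := by
  simp [rows]

theorem mem_opn {n : ℕ} {m : Mem} {x : Fin n} : x ∈ opn n m ↔ m 24 x ≠ 0 := by simp [opn]

theorem rows_congr {n : ℕ} {m m' : Mem} {A : ℕ} (h : m' A = m A) :
    (rows m' A : Fin n → Finset (Fin n)) = rows m A := by
  funext x; ext y; rw [mem_rows, mem_rows, h]

theorem nums_congr {n : ℕ} {m m' : Mem} {A : ℕ} (h : m' A = m A) :
    (nums m' A : Fin n → ℕ) = nums m A := by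
  funext x; rw [nums, nums, h]

/-- The cell of `A` for the gate. -/
def atG (A : ℕ) : Ex := get A (var 1)

/-- It is better for the gate to have no bad block here. -/
def pkE : Ex := neg (less (bin .add (atG 20) (get 35 (num 1))) (bin .add (atG 21) (get 35 (num 0))))

/-- The new value for the gate `1` with at most one bad block allowed. -/
def newE : Ex := ite (get 43 (num 0)) (bin .add (atG 21) (get 35 (num 0)))
  (bin .add (atG 20) (get 35 (num 1)))

/-- Updating the tables once the best choices for the block spanned by `1` and `2` are known. -/
def updateS : Pg :=
  seqS (forS 2 (storeS 23 (bin .add (bin .mul (var 1) nn) (var 3)) (ite (get 43 (num 0))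
    (disj (ix 23 (var 1) (var 3)) (get 41 (var 3)))
        (disj (ix 22 (var 1) (var 3)) (get 42 (var 3)))))) <|
  seqS (forS 2 (storeS 22 (bin .add (bin .mul (var 1) nn) (var 3))
    (disj (ix 22 (var 1) (var 3)) (get 41 (var 3))))) <|
  seqS (storeS 21 (var 1) newE) <|
  seqS (storeS 20 (var 1) (bin .add (atG 20) (get 35 (num 0)))) <|
  forS 2 (storeS 24 (var 3) (ite (conj (inBlkE (var 3))
      (conj (get 16 (var 3)) (neg (same (var 3) (var 1)))))
    (num 0) (get 24 (var 3))))

/-- The program for the block spanned by `1` and `2`. -/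
def unitS : Pg :=
  seqS (seqS listS (seqS (sqS 26 frE) (sqS 27 fbE))) <|
  seqS (searchS okE beE coE) <|
  seqS (forS 2 (storeS 41 (var 3) (yE 0))) <| seqS (forS 2 (storeS 42 (var 3) (yE 1))) <|
  seqS (storeS 43 (num 0) pkE) updateS

@[simp] theorem unitS_stores (d t : ℕ) : (unitS d t).stores =
    [3, 25, 3, 26, 27, 35, 35, 29, 28, 31, 33, 34, 35, 36, 30, 28, 29, 41, 42, 43, 23, 22, 21, 20,
        24] := by
  simp [unitS, updateS]

variable {n K w t : ℕ} {ρ : ℕ → ℕ} {m : Mem} {G : SimpleGraph (Fin n)} {o c v : Fin n}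

open Classical in
/-- After the search, the set of a best choice in the class `b` is stored in the array `A`. -/
theorem tri_best {s : ℕ} {L : Fin s → Fin n} (hG : G.Connected) (hL : Loc G o c v K L m)
    (h1 : ρ 1 = c) (hK : 1 ≤ K) (hs : 1 ≤ s) {b A : ℕ}
    (hb : (yE b).wf 4 = true ∧ (yE b).bnd = true ∧ (yE b).deg 2 ≤ 0 ∧ (yE b).deg 3 ≤ 2 ∧
        (yE b).deg 4 ≤ 1)
    (hb' : (yE b).cst ≤ 300) (hA : A ∉ (yE b).reads) (hA2 : A ≠ 2) {a₀ a₁ : Fin n → ℕ}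
        (hu : IsUnit G o c v)
    (hF : Found (fun f : Fin K → Fin (n + 1) => (graphTask G K).ok (c, v) (entries f))
      (fun f => BadAt G c v f c) (tupleCost G K c v a₀ a₁) ((n + 1) ^ K) b m) :
    Tri (n + 2) w 3 t ρ m (forS 2 (storeS A (var 3) (yE b)) 3 t)
        (n * (300 * (s ^ 2 * K) + 20) + 5) fun m' =>
      (∀ C, C ≠ A → m' C = m C) ∧ ∃ Y : Finset (Fin n), (∀ x : Fin n, m' A x ≠ 0 ↔ x ∈ Y) ∧
      (graphTask G K).IsBest ((n + 2) ^ 2) a₀ a₁ (rows m 22) (rows m 23) (c, v) (b = 1)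
      (m 35 b) Y := by
  have hcost : (yE b).cost m ≤ 300 * (s ^ 2 * K) := by
    have := Ex.cost_le_of hL.size hL.cnt hL.width c.pos hs hK hb.2 hb'
    simpa using this
  refine Tri.fill (c := 2 + 300 * (s ^ 2 * K)) id
      (fun x => (yE b).eval m 4 (Function.update ρ 3 x)) hA2.symm rfl hb.1
    ?_ (fun x _ y _ h => h) (fun x hx m' hm' _ => ⟨by simp [Ex.eval], ?_, ?_⟩) ?_
  · rw [hL.size]
    exact Nat.add_le_add_right (Nat.mul_le_mul_left _ (by omega)) _
  · rw [Ex.eval_congr _ fun C hC => hm' C fun h => hA (h ▸ hC)]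
  · rw [Ex.cost_congr _ fun C hC => hm' C fun h => hA (h ▸ hC)]
    simp only [Ex.cost]; omega
  · intro m' h1' _ h2 _
    rw [hL.size] at h2
    refine ⟨h1', Finset.univ.filter fun x : Fin n => m' A x ≠ 0, fun x => by simp, ?_⟩
    refine isBest_of_found hu hF fun f hf => ?_
    ext x
    have := h2 x x.2
    simp only [id] at this
    simp only [Finset.mem_filter, Finset.mem_univ, true_and, this]
    rw [min_ne_zero_iff (by omega), ← Ex.tr_iff]
    exact tr_y hG hL (by simpa using h1) (by simp) hf (fun y x => mem_rows.symm)
        (fun y x => mem_rows.symm)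

/-- The rule for `updateS`: the four tables of the dynamic program change at the gate only, and the
children are closed. -/
theorem tri_update (hT : Tabs G o m) (h1 : ρ 1 = c) (h2 : ρ 2 = v) {Y₀ Y₁ : Finset (Fin n)}
    (hY₀ : ∀ x : Fin n, m 41 x ≠ 0 ↔ x ∈ Y₀) (hY₁ : ∀ x : Fin n, m 42 x ≠ 0 ↔ x ∈ Y₁) {g₀ g₁ : ℕ}
    (hg₀ : m 35 0 = g₀) (hg₁ : m 35 1 = g₁)
    (hq : m 43 0 ≠ 0 ↔ nums m 21 c + g₀ ≤ nums m 20 c + g₁) :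
    Tri (n + 2) w 3 t ρ m (updateS 3 t) (300 * n + 200) fun m' =>
        nums m' 20 c = min (nums m 20 c + g₀) ((n + 2) ^ 2) ∧
        nums m' 21 c = min (min (nums m 21 c + g₀) (nums m 20 c + g₁)) ((n + 2) ^ 2) ∧
        rows m' 22 c = rows m 22 c ∪ Y₀ ∧
        rows m' 23 c = (if nums m 21 c + g₀ ≤ nums m 20 c + g₁ then rows m 23 c ∪ Y₀ else rows m 22 c ∪ Y₁) ∧
        (∀ x, x ≠ c → nums m' 20 x = nums m 20 x ∧ nums m' 21 x = nums m 21 x ∧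
          rows m' 22 x = rows m 22 x ∧ rows m' 23 x = rows m 23 x) ∧
        opn n m' = opn n m \ (graphTask G K).ch (c, v) := by
  have hn := hT.size
  have hM : 2 ≤ n + 2 := by omega
  refine Tri.bounded fun _ hbm _ => ?_
  refine Tri.seq (T₁ := 60 * n + 10) (T₂ := 240 * n + 190) (Tri.fill (c := 50) (fun x => c * n + x)
    (fun x => if m 43 0 ≠ 0 then m 23 (c * n + x) + m 41 x else m 22 (c * n + x) + m 42 x)
        (by decide) rfl rfl
    (by rw [hn]; omega) (fun x _ y _ h => by simpa using h)
    (fun x hx m' hm' he => ⟨?_, ?_, ?_⟩) (Q := fun m' => (∀ C, C ≠ 23 → m' C = m C) ∧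
      rows m' 23 c = (if nums m 21 c + g₀ ≤ nums m 20 c + g₁ then rows m 23 c ∪ Y₀ else rows m 22 c ∪ Y₁) ∧
      ∀ x, x ≠ c → rows m' 23 x = rows m 23 x) ?_) (by omega) ?_
  · simp [hm' 2 (by decide), hn, h1]
  · simp only [Ex.eval_ite, Ex.tr_get, Ex.eval_num, disj, Ex.eval_add, Ex.eval_ix, Ex.eval_get,
        Ex.eval_var,
      Function.update_apply, Nat.reduceEqDiff, reduceIte, hm' 2 (by decide), hn, h1, he,
      hm' 43 (by decide),
      hm' 41 (by decide), hm' 22 (by decide), hm' 42 (by decide)]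
  · simp [Ex.cost, disj, ix, nn]
  · intro m' hf _ hv ho
    rw [hn] at hv ho
    refine ⟨hf, ?_, fun x hx => ?_⟩
    · ext x
      rw [mem_rows]
      have := hv x x.2
      rw [this, min_ne_zero_iff hM]
      split_ifs with h h' h'
      · rw [Finset.mem_union, mem_rows, ← hY₀]; omega
      · exact absurd (hq.1 h) h'
      · exact absurd (hq.2 h') h
      · rw [Finset.mem_union, mem_rows, ← hY₁]; omega
    · ext y
      rw [mem_rows, mem_rows, ho]
      intro z hz he
      exact hx (Fin.ext ((idx_inj y.2 hz).1 he).1)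
  rintro m1 - - ⟨hf1, r1, r2⟩
  have hn1 : m1 2 0 = n := by rw [hf1 2 (by decide), hn]
  refine Tri.seq (T₁ := 60 * n + 10) (T₂ := 180 * n + 180) (Tri.fill (c := 50) (fun x => c * n + x)
    (fun x => m 22 (c * n + x) + m 41 x) (by decide) rfl rfl
    (by rw [hn1]; omega) (fun x _ y _ h => by simpa using h)
    (fun x hx m' hm' he => ⟨?_, ?_, ?_⟩) (Q := fun m' => (∀ C, C ≠ 22 → m' C = m1 C) ∧
      rows m' 22 c = rows m 22 c ∪ Y₀ ∧ ∀ x, x ≠ c → rows m' 22 x = rows m 22 x) ?_) (by omega) ?_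
  · simp [hm' 2 (by decide), hn1, h1]
  · simp only [disj, Ex.eval_add, Ex.eval_ix, Ex.eval_get, Ex.eval_var,
      Function.update_apply, Nat.reduceEqDiff, reduceIte, hm' 2 (by decide), hn1, h1, he,
      hm' 41 (by decide), hf1 41 (by decide), hf1 22 (by decide)]
  · simp [Ex.cost, disj, ix, nn]
  · intro m' hf _ hv ho
    rw [hn1] at hv ho
    refine ⟨hf, ?_, fun x hx => ?_⟩
    · ext x
      rw [mem_rows]
      have := hv x x.2
      rw [this, min_ne_zero_iff hM, Finset.mem_union, mem_rows, ← hY₀]; omega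
    · ext y
      rw [mem_rows, mem_rows, ho, hf1 22 (by decide)]
      intro z hz he
      exact hx (Fin.ext ((idx_inj y.2 hz).1 he).1)
  rintro m2 - - ⟨hf2, r3, r4⟩
  have x20 : m2 20 = m 20 := by rw [hf2 20 (by decide), hf1 20 (by decide)]
  have x21 : m2 21 = m 21 := by rw [hf2 21 (by decide), hf1 21 (by decide)]
  have x35 : m2 35 = m 35 := by rw [hf2 35 (by decide), hf1 35 (by decide)]
  have x43 : m2 43 = m 43 := by rw [hf2 43 (by decide), hf1 43 (by decide)]
  refine Tri.seq (T₁ := 50) (T₂ := 180 * n + 130) (Tri.store' (Q := fun m' =>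
    m' = m2.set 21 c (min (min (nums m 21 c + g₀) (nums m 20 c + g₁)) ((n + 2) ^ 2)))
    rfl rfl (by simp [Ex.cost, newE, atG]) ?_) (by omega) ?_
  · simp only [newE, Ex.eval_ite, Ex.tr_get, Ex.eval_num, atG, Ex.eval_add, Ex.eval_get,
        Ex.eval_var, h1, x20, x21,
      x35, x43, hg₀, hg₁, nums]
    congr 2
    split_ifs with h
    · exact (min_eq_left (hq.1 h)).symm
    · exact (min_eq_right (not_le.1 (mt hq.2 h)).le).symm
  rintro m3 - - hm3
  refine Tri.seq (T₁ := 50) (T₂ := 180 * n + 80) (Tri.store' (Q := fun m' =>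
    m' = m3.set 20 c (min (nums m 20 c + g₀) ((n + 2) ^ 2)))
    rfl rfl (by simp [Ex.cost, atG]) ?_) (by omega) ?_
  · simp only [Ex.eval_num, atG, Ex.eval_add, Ex.eval_get, Ex.eval_var, h1, hm3,
        Mem.set_ne _ _ _ (show 20 ≠ 21 by decide),
      Mem.set_ne _ _ _ (show 35 ≠ 21 by decide), x20, x35, hg₀, nums]
  rintro m4 - - hm4
  have hf4 : ∀ C, C ∉ [20, 21, 22, 23] → m4 C = m C := fun C hC => by
    simp at hC
    rw [hm4, Mem.set_ne _ _ _ (by tauto), hm3, Mem.set_ne _ _ _ (by tauto), hf2 C (by tauto),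
        hf1 C (by tauto)]
  have hT4 : Tabs G o m4 := hT.congr fun A hA _ => hf4 A (by simp; omega)
  refine Tri.fill (c := 100) id (fun x => if ∃ h : x < n,
      (⟨x, h⟩ : Fin n) ∈ (graphTask G K).ch (c, v)
    then 0 else m 24 x) (by decide) rfl rfl (by rw [hT4.size]; omega) (fun x _ y _ h => h)
    (fun x hx m' hm' he => ⟨by simp, ?_, ?_⟩) ?_
  · have hT' : Tabs G o m' := hT4.congr fun A hA _ => hm' A (by omega)
    rw [hT4.size] at hx
    have e1 := tr_inBlk (ρ := Function.update ρ 3 x) (y := var 3) (d := 4) (x := ⟨x, hx⟩) hT'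
        (by simpa using h1)
      (by simpa using h2) (by simp)
    have e2 : m' 16 x ≠ 0 ↔ Joint G ⟨x, hx⟩ := hT'.joint ⟨x, hx⟩
    simp only [id] at he
    have e3 : (conj (inBlkE (var 3)) (conj (get 16 (var 3)) (neg (same (var 3) (var 1))))).tr m'
        (3 + 1)
        (Function.update ρ 3 x) ↔ ∃ h : x < n, (⟨x, h⟩ : Fin n) ∈ (graphTask G K).ch (c, v) := by
      simp only [Ex.tr_conj, Nat.reduceAdd, e1, Ex.tr_get, Ex.eval_var, Function.update_apply,
        Nat.reduceEqDiff, reduceIte, e2, Ex.tr_neg, Ex.tr_same, h1, mem_ch]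
      exact ⟨fun ⟨a, b, d⟩ => ⟨hx, a, b, fun h => d (congrArg Fin.val h)⟩,
        fun ⟨_, a, b, d⟩ => ⟨a, b, fun h => d (Fin.ext h)⟩⟩
    rw [Ex.eval_ite]
    simp only [e3, Ex.eval_num, Ex.eval_get, Ex.eval_var, Function.update_self, he,
        hf4 24 (by simp)]
  · simp [Ex.cost, disj, ix, nn, inBlkE, conj, neg, same, less]
  · intro m' hf _ hv _
    rw [hT4.size] at hv
    refine ⟨?_, ?_, ?_, ?_, fun x hx => ⟨?_, ?_, ?_, ?_⟩, ?_⟩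
    · rw [nums, hf 20 (by decide), hm4, Mem.set_self, if_pos rfl]
    · rw [nums, hf 21 (by decide), hm4, Mem.set_ne _ _ _ (by decide), hm3, Mem.set_self, if_pos rfl]
    · rw [← r3, rows_congr]
      rw [hf 22 (by decide), hm4, Mem.set_ne _ _ _ (by decide), hm3, Mem.set_ne _ _ _ (by decide)]
    · rw [← r1, rows_congr]
      rw [hf 23 (by decide), hm4, Mem.set_ne _ _ _ (by decide), hm3, Mem.set_ne _ _ _ (by decide),
        hf2 23 (by decide)]
    · rw [nums, hf 20 (by decide), hm4, Mem.set_self, if_neg (fun h => hx (Fin.ext h)), hm3,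
        Mem.set_ne _ _ _ (by decide), x20, nums]
    · rw [nums, hf 21 (by decide), hm4, Mem.set_ne _ _ _ (by decide), hm3, Mem.set_self,
        if_neg (fun h => hx (Fin.ext h)), x21, nums]
    · rw [← r4 x hx, rows_congr]
      rw [hf 22 (by decide), hm4, Mem.set_ne _ _ _ (by decide), hm3, Mem.set_ne _ _ _ (by decide)]
    · rw [← r2 x hx, rows_congr]
      rw [hf 23 (by decide), hm4, Mem.set_ne _ _ _ (by decide), hm3, Mem.set_ne _ _ _ (by decide),
        hf2 23 (by decide)]
    · ext x
      rw [Finset.mem_sdiff, mem_opn, mem_opn]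
      have := hv x x.2
      simp only [id] at this
      rw [this, min_ne_zero_iff hM]
      split_ifs with h
      · obtain ⟨h, h'⟩ := h
        simp [h']
      · have : x ∉ (graphTask G K).ch (c, v) := fun h' => h ⟨x.2, h'⟩
        simp [this]

/-- The rule for the program for one block: the tables change as in a step of the dynamic
program. -/
theorem tri_unit (hG : G.Connected) (hT : Tabs G o m) (h4 : m 4 0 = K) (hK : 1 ≤ K) (hKn : K ≤ n)
    (hu : IsUnit G o c v) (h1 : ρ 1 = c) (h2 : ρ 2 = v) :
    Tri (n + 2) w 3 t ρ m (unitS 3 t) (20000 *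
        ((n + 1) ^ K * (ext G (blk G c v)).ncard ^ 2 * K)) fun m' =>
      ∃ (g₀ g₁ : ℕ) (Y₀ Y₁ : Finset (Fin n)),
        (graphTask G K).IsBest ((n + 2) ^ 2) (nums m 20) (nums m 21) (rows m 22) (rows m 23)
        (c, v) False g₀ Y₀ ∧
        (graphTask G K).IsBest ((n + 2) ^ 2) (nums m 20) (nums m 21) (rows m 22) (rows m 23)
        (c, v) True g₁ Y₁ ∧
        nums m' 20 c = min (nums m 20 c + g₀) ((n + 2) ^ 2) ∧
        nums m' 21 c = min (min (nums m 21 c + g₀) (nums m 20 c + g₁)) ((n + 2) ^ 2) ∧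
        rows m' 22 c = rows m 22 c ∪ Y₀ ∧
        rows m' 23 c = (if nums m 21 c + g₀ ≤ nums m 20 c + g₁ then rows m 23 c ∪ Y₀ else rows m 22 c ∪ Y₁) ∧
        (∀ x, x ≠ c → nums m' 20 x = nums m 20 x ∧ nums m' 21 x = nums m 21 x ∧
          rows m' 22 x = rows m 22 x ∧ rows m' 23 x = rows m 23 x) ∧
        opn n m' = opn n m \ (graphTask G K).ch (c, v) := by
  classical
  set s₀ := (ext G (blk G c v)).ncard with hs₀
  set X := (n + 1) ^ K * s₀ ^ 2 * K with hX
  have hnB : n ≤ (n + 1) ^ K := (Nat.le_succ n).trans (Nat.le_self_pow (by omega) _)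
  have hs1 : 1 ≤ s₀ := (Set.ncard_pos (Set.toFinite _)).2 ⟨c, .inl hu.fst_mem⟩
  have hsn : s₀ ≤ n := by
    have := Set.ncard_le_ncard (Set.subset_univ (ext G (blk G c v))) (Set.toFinite _)
    simpa [Set.ncard_univ] using this
  have hs2 : 1 ≤ s₀ ^ 2 := Nat.one_le_pow _ _ hs1
  have b1 : (n + 1) ^ K * K ≤ X := by
    rw [hX, mul_right_comm]; exact Nat.le_mul_of_pos_right _ hs2
  have b2 : (n + 1) ^ K ≤ X := (Nat.le_mul_of_pos_right _ hK).trans b1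
  have b3 : n * (s₀ ^ 2 * K) ≤ X := by
    rw [hX, mul_assoc]; exact Nat.mul_le_mul_right _ hnB
  have b4 : s₀ ^ 3 ≤ X := by
    calc s₀ ^ 3 = s₀ * s₀ ^ 2 := by ring
      _ ≤ n * (s₀ ^ 2 * K) := Nat.mul_le_mul hsn (Nat.le_mul_of_pos_right _ hK)
      _ ≤ X := b3
  have hn1 : 1 ≤ n := c.pos
  have hnX : n ≤ X := hnB.trans b2
  have hM : 1 ≤ (n + 2) ^ 2 := Nat.one_le_pow _ _ (by omega)
  refine Tri.seq (T₁ := 100 * n + 20 + 2000 * s₀ ^ 3) (T₂ := 17000 * X)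
    (tri_loc hT h4 hu h1 h2) (by omega) ?_
  rintro m1 hfr1 - ⟨s, L, rfl, -, hL1⟩
  have hF1 : ∀ C, C ∉ [3, 25, 26, 27] → m1 C = m C := fun C hC => hfr1 C (by simp at hC ⊢; omega)
  refine Tri.seq (T₁ := (n + 1) ^ K * (3 * (1000 * (s₀ ^ 2 * K)) + 200 * K + 300)) (T₂ := 12000 * X)
    (tri_search hL1.size hL1.width hKn (by decide) (describes hG hL1 hu h1 h2 hK hs1)) ?_ ?_
  · have : (n + 1) ^ K * (3 * (1000 * (s₀ ^ 2 * K)) + 200 * K + 300)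
      = 3000 * X + 200 * ((n + 1) ^ K * K) + 300 * (n + 1) ^ K := by rw [hX]; ring
    omega
  rintro m2 hfr2 - hF
  have hF2 : ∀ C, C ∉ searchA → m2 C = m1 C := fun C hC => hfr2 C (by simp at hC ⊢; omega)
  have hL2 : Loc G o c v K L m2 := hL1.congr fun A hA _ => hF2 A (by simp; omega)
  have hb : n * (300 * (s₀ ^ 2 * K) + 20) + 5 ≤ 400 * X := by
    have : n * (300 * (s₀ ^ 2 * K) + 20) + 5 = 300 * (n * (s₀ ^ 2 * K)) + 20 * n + 5 := by ring
    omega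
  refine Tri.seq (T₁ := 400 * X) (T₂ := 11000 * X)
      ((tri_best (A := 41) hG hL2 h1 hK hs1 (by decide) (by decide) (by decide) (by decide)
    hu (hF 0 (by omega))).mono hb fun _ _ _ h => h) (by omega) ?_
  rintro m3 - - ⟨hF3, Y₀, hY₀, hB₀⟩
  have hL3 : Loc G o c v K L m3 := hL2.congr fun A hA _ => hF3 A (by omega)
  have hFo : Found (fun f : Fin K → Fin (n + 1) => (graphTask G K).ok (c, v) (entries f))
      (fun f => BadAt G c v f c) (tupleCost G K c v (fun x => m1 20 x) (fun x => m1 21 x))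
          ((n + 1) ^ K) 1 m3 := by
    have x1 := hF3 35 (by decide)
    have x2 := hF3 36 (by decide)
    have := hF 1 (by omega)
    exact ⟨x1 ▸ this.le, x1 ▸ this.least, x1 ▸ x2 ▸ this.attained⟩
  refine Tri.seq (T₁ := 400 * X) (T₂ := 10000 * X)
      ((tri_best (A := 42) hG hL3 h1 hK hs1 (by decide) (by decide) (by decide) (by decide)
    hu hFo).mono hb fun _ _ _ h => h) (by omega) ?_
  rintro m4 - - ⟨hF4, Y₁, hY₁, hB₁⟩
  -- back to the tables at the start
  have e20 : m4 20 = m 20 := by rw [hF4 20 (by decide), hF3 20 (by decide), hF2 20 (by decide),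
      hF1 20 (by decide)]
  have e21 : m4 21 = m 21 := by rw [hF4 21 (by decide), hF3 21 (by decide), hF2 21 (by decide),
      hF1 21 (by decide)]
  have e22 : m4 22 = m 22 := by rw [hF4 22 (by decide), hF3 22 (by decide), hF2 22 (by decide),
      hF1 22 (by decide)]
  have e23 : m4 23 = m 23 := by rw [hF4 23 (by decide), hF3 23 (by decide), hF2 23 (by decide),
      hF1 23 (by decide)]
  have e24 : m4 24 = m 24 := by rw [hF4 24 (by decide), hF3 24 (by decide), hF2 24 (by decide),
      hF1 24 (by decide)]
  have e35 : m4 35 = m2 35 := by rw [hF4 35 (by decide), hF3 35 (by decide)]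
  have e41 : m4 41 = m3 41 := hF4 41 (by decide)
  have hn4 : m4 2 0 = n := by rw [hF4 2 (by decide), hL3.size]
  have hT4 : Tabs G o m4 := hL3.toTabs.congr fun A hA _ => hF4 A (by omega)
  have f20 : (fun x : Fin n => m1 20 x) = nums m 20 := by rw [hF1 20 (by decide)]; rfl
  have f21 : (fun x : Fin n => m1 21 x) = nums m 21 := by rw [hF1 21 (by decide)]; rfl
  rw [f20, f21, rows_congr ((hF2 22 (by decide)).trans (hF1 22 (by decide))),
    rows_congr ((hF2 23 (by decide)).trans (hF1 23 (by decide)))] at hB₀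
  rw [f20, f21, rows_congr ((hF3 22 (by decide)).trans
      ((hF2 22 (by decide)).trans (hF1 22 (by decide)))),
    rows_congr ((hF3 23 (by decide)).trans ((hF2 23 (by decide)).trans (hF1 23 (by decide)))),
    hF3 35 (by decide)] at hB₁
  set g₀ := m2 35 0 with hg₀
  set g₁ := m2 35 1 with hg₁
  refine Tri.seq (T₁ := 100) (T₂ := 9000 * X) (Tri.store' (Q := fun m' => ∃ q, m' = m4.set 43 0 q ∧
    (q ≠ 0 ↔ nums m 21 c + g₀ ≤ nums m 20 c + g₁)) rfl rfl
    (by simp [Ex.cost, pkE, neg, less, atG]) ?_) (by omega) ?_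
  · refine ⟨_, rfl, ?_⟩
    rw [min_ne_zero_iff (by omega), ← Ex.tr_iff, pkE]
    simp [atG, h1, e20, e21, e35, nums, ← hg₀, ← hg₁]
  rintro m5 - - ⟨q, rfl, hq⟩
  have hT5 : Tabs G o (m4.set 43 0 q) := hT4.congr fun A hA _ => Mem.set_ne _ _ _ (by omega)
  have y : ∀ C, C ≠ 43 → (m4.set 43 0 q) C = m4 C := fun C hC => Mem.set_ne _ _ _ hC
  have y20 : (m4.set 43 0 q) 20 = m 20 := by rw [y 20 (by decide), e20]
  have y21 : (m4.set 43 0 q) 21 = m 21 := by rw [y 21 (by decide), e21]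
  have y22 : (m4.set 43 0 q) 22 = m 22 := by rw [y 22 (by decide), e22]
  have y23 : (m4.set 43 0 q) 23 = m 23 := by rw [y 23 (by decide), e23]
  have y24 : (m4.set 43 0 q) 24 = m 24 := by rw [y 24 (by decide), e24]
  refine (tri_update (K := K) (Y₀ := Y₀) (Y₁ := Y₁) (g₀ := g₀)
      (g₁ := g₁) hT5 h1 h2 ?_ ?_ ?_ ?_ ?_).mono (by omega) ?_
  · rw [y 41 (by decide), e41]; exact hY₀
  · rw [y 42 (by decide)]; exact hY₁
  · rw [y 35 (by decide), e35]
  · rw [y 35 (by decide), e35]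
  · rw [nums_congr y21, nums_congr y20, Mem.set_self, if_pos rfl, hq]
  · rintro m6 - - ⟨q1, q2, q3, q4, q5, q6⟩
    have z24 : opn n (m4.set 43 0 q) = opn n m := by
      ext x; rw [mem_opn, mem_opn, y24]
    rw [nums_congr y20] at q1 q2 q4 q5
    rw [nums_congr y21] at q2 q4 q5
    rw [rows_congr y22] at q3 q4 q5
    rw [rows_congr y23] at q4 q5
    rw [z24] at q6
    exact ⟨g₀, g₁, Y₀, Y₁, by simpa using hB₀, by simpa using hB₁, q1, q2, q3, q4, q5, q6⟩

end Unit

/-! ### The loop over the blocks -/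

section Main

open Ex

variable {n K w t : ℕ} {ρ : ℕ → ℕ} {m : Mem} {G : SimpleGraph (Fin n)} {o : Fin n}

/-- Two EBCs share at most one vertex. So an ordered pair of distinct vertices lies in at most one
EBC, and the squares of the sizes of the EBCs add up to at most `2 * n ^ 2`. -/
theorem sum_ncard_sq_le (hG : G.Connected) :
    ∑ i ∈ units G o, (ext G (blk G i.1 i.2)).ncard ^ 2 ≤ 2 * n ^ 2 := by
  classical
  set e : Fin n × Fin n → Finset (Fin n) := fun i =>
      (Set.toFinite (ext G (blk G i.1 i.2))).toFinset with he
  have hmem : ∀ i x, x ∈ e i ↔ x ∈ ext G (blk G i.1 i.2) := fun i x => by simp [he]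
  -- two vertices in the same two EBCs would be joints, and then lie in the same two blocks
  have hdisj : ∀ i ∈ units G o, ∀ j ∈ units G o, i ≠ j → Disjoint (e i).offDiag (e j).offDiag := by
    intro i hi j hj hne
    rw [mem_units] at hi hj
    rw [Finset.disjoint_left]
    rintro ⟨x, y⟩ hx hy
    rw [Finset.mem_offDiag] at hx hy
    simp only [hmem] at hx hy
    have hb : blk G i.1 i.2 = blk G j.1 j.2 := by
      by_cases h1 : Joint G x
      · by_cases h2 : Joint G y
        · exact hi.isBlk.eq hj.isBlk hx.2.2 (h1.mem_of_mem_ext hG hx.1)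
              (h2.mem_of_mem_ext hG hx.2.1)
            (h1.mem_of_mem_ext hG hy.1) (h2.mem_of_mem_ext hG hy.2.1)
        · exact hi.isBlk.eq_of_mem_ext hG hj.isBlk hx.2.1 hy.2.1 h2
      · exact hi.isBlk.eq_of_mem_ext hG hj.isBlk hx.1 hy.1 h1
    obtain ⟨h1, h2⟩ := hi.eq_of_blk hG hj hb
    exact hne (Prod.ext h1 h2)
  have h2 : ∀ i ∈ units G o, (ext G (blk G i.1 i.2)).ncard ^ 2 ≤ 2 * (e i).offDiag.card := by
    intro i hi
    rw [mem_units] at hi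
    have hc : (ext G (blk G i.1 i.2)).ncard = (e i).card :=
        Set.ncard_eq_toFinset_card _ (Set.toFinite _)
    have hge : 2 ≤ (e i).card := by
      have := Finset.one_lt_card.2 ⟨i.1, (hmem i _).2 (.inl hi.fst_mem), i.2,
          (hmem i _).2 (.inl hi.snd_mem), hi.ne⟩
      omega
    rw [hc, Finset.offDiag_card, sq]
    have : 2 * (e i).card ≤ (e i).card * (e i).card := Nat.mul_le_mul_right _ hge
    omega
  calc _ ≤ ∑ i ∈ units G o, 2 * (e i).offDiag.card := Finset.sum_le_sum h2
    _ = 2 * ((units G o).biUnion fun i => (e i).offDiag).card := by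
        rw [← Finset.mul_sum, Finset.card_biUnion hdisj]
    _ ≤ 2 * (Finset.univ : Finset (Fin n × Fin n)).card :=
        Nat.mul_le_mul_left _ (Finset.card_le_card (Finset.subset_univ _))
    _ = 2 * n ^ 2 := by simp [sq]

/-- The position of a block in the order in which the blocks are dealt with: those whose gate is
farther from `o` come first. -/
noncomputable def rank (G : SimpleGraph (Fin n)) (o : Fin n) (i : Fin n × Fin n) : ℕ :=
  ((n - 1 - G.dist o i.1) * n + i.1) * n + i.2

theorem dist_lt_card (hG : G.Connected) (x y : Fin n) : G.dist x y < n := by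
  obtain ⟨p, hp, hl⟩ := hG.exists_path_of_dist x y
  rw [← hl]
  simpa using hp.length_lt

theorem rank_eq_iff {j c v : Fin n} {i : Fin n × Fin n} :
    rank G o i = (j * n + c) * n + v ↔ n - 1 - G.dist o i.1 = j ∧ i = (c, v) := by
  rw [rank, idx_inj i.2.2 v.2, idx_inj i.1.2 c.2, Prod.ext_iff, Fin.ext_iff, Fin.ext_iff, and_assoc]

theorem rank_lt (i : Fin n × Fin n) : rank G o i < n * n * n := by
  have h0 : 0 < n := i.1.pos
  have h1 : (n - 1 - G.dist o i.1) * n + i.1 < n * n := by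
    have : (n - 1 - G.dist o i.1) * n ≤ (n - 1) * n := Nat.mul_le_mul_right _ (by omega)
    have h2 : (n - 1) * n + n = n * n := by
      rw [← Nat.succ_mul]; congr 1; omega
    have := i.1.2
    omega
  have : ((n - 1 - G.dist o i.1) * n + i.1 + 1) * n ≤ n * n * n := Nat.mul_le_mul_right _ h1
  have := i.2.2
  rw [rank]
  nlinarith

/-- The blocks that are not yet dealt with. -/
noncomputable def undone (G : SimpleGraph (Fin n)) (o : Fin n) (r : ℕ) : Finset (Fin n × Fin n) :=
  (units G o).filter fun i => r ≤ rank G o i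

/-- A bound for the time spent on the blocks before position `r`. -/
noncomputable def spent (G : SimpleGraph (Fin n)) (o : Fin n) (C r : ℕ) : ℕ :=
  ∑ i ∈ (units G o).filter fun i => rank G o i < r, C * (ext G (blk G i.1 i.2)).ncard ^ 2

theorem spent_mono (C : ℕ) : Monotone (spent G o C) := fun r r' h =>
  Finset.sum_le_sum_of_subset fun i hi => by
    rw [Finset.mem_filter] at hi ⊢
    exact ⟨hi.1, hi.2.trans_le h⟩

theorem spent_le (hG : G.Connected) (C r : ℕ) : spent G o C r ≤ C * (2 * n ^ 2) := by
  refine le_trans ?_ (Nat.mul_le_mul_left C (sum_ncard_sq_le (o := o) hG))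
  rw [Finset.mul_sum]
  exact Finset.sum_le_sum_of_subset (Finset.filter_subset _ _)

theorem le_spent {i : Fin n × Fin n} (hi : i ∈ units G o) (C : ℕ) :
    spent G o C (rank G o i) + C * (ext G (blk G i.1 i.2)).ncard ^ 2 ≤ spent G o C
        (rank G o i + 1) := by
  have h : (units G o).filter (fun j => rank G o j < rank G o i) ⊆
      ((units G o).filter fun j => rank G o j < rank G o i + 1).erase i := by
    intro j hj
    rw [Finset.mem_filter] at hj
    rw [Finset.mem_erase, Finset.mem_filter]
    exact ⟨by rintro rfl; omega, hj.1, by omega⟩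
  have hmem : i ∈ (units G o).filter fun j => rank G o j < rank G o i + 1 :=
    Finset.mem_filter.2 ⟨hi, Nat.lt_succ_self _⟩
  rw [spent, spent, ← Finset.sum_erase_add _ _ hmem]
  exact Nat.add_le_add_right (Finset.sum_le_sum_of_subset h) _

/-- The invariant of the loop over the blocks, before position `r`. -/
structure Progress (G : SimpleGraph (Fin n)) (o : Fin n) (K r : ℕ)
    (m : Mem) : Prop extends Tabs G o m where
  width : m 4 0 = K
  gate : ∀ i ∈ undone G o r, i.1 ∈ opn n m
  ch : ∀ i ∈ undone G o r, (graphTask G K).ch i ⊆ opn n m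
  inv : (graphTask G K).Inv ((n + 2) ^ 2) (units G o) (undone G o r) (opn n m) (nums m 20)
      (nums m 21)
    (rows m 22) (rows m 23)

/-- The test whether the block spanned by `1` and `2` is at the current position. -/
def procE : Ex := conj (same (bin .add (bin .add (ix 5 (num 0) (var 1)) (num 1)) (var 0)) nn)
    (ix 19 (var 1) (var 2))

/-- The loop over the blocks, those farther from vertex `0` first. -/
def blocksS : Pg := forS 2 <| forS 2 <| forS 2 <| iteS procE unitS skipS

/-- The rule for the body of the loop. Positions that are not the rank of a block take constant
time; the time for a block is counted by `spent`. -/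
theorem tri_position (ho : (o : ℕ) = 0) (hG : G.Connected) (hK : 1 ≤ K) (hKn : K ≤ n)
    {j c v : Fin n}
    (hP : Progress G o K ((j * n + c) * n + v) m) (h0 : ρ 0 = j) (h1 : ρ 1 = c) (h2 : ρ 2 = v) :
    Tri (n + 2) w 3 t ρ m (iteS procE unitS skipS 3 t)
      (50 + (spent G o (20000 * ((n + 1) ^ K * K)) ((j * n + c) * n + v + 1) -
        spent G o (20000 * ((n + 1) ^ K * K)) ((j * n + c) * n + v)))
      (Progress G o K ((j * n + c) * n + v + 1)) := by
  classical
  set r := ((j : ℕ) * n + c) * n + v with hr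
  have htr : procE.tr m 3 ρ ↔ (c, v) ∈ units G o ∧ rank G o (c, v) = r := by
    have hz : ∀ x : Fin n, m 5 (0 * n + x) = G.dist o x := fun x => by rw [← ho]; exact hP.dist o x
    simp only [procE, Ex.tr_conj, Ex.tr_same, Ex.eval_add, Ex.eval_ix, Ex.eval_num, Ex.eval_var,
        Ex.eval_nn, h0,
      h1, h2, hP.size, hz, Ex.tr_ix, hP.unit, mem_units, hr, rank_eq_iff, and_true]
    rw [and_comm]
    refine and_congr_right fun _ => ?_
    have := dist_lt_card hG o c
    omega
  have hlt : ∀ i, i ∈ undone G o (r + 1) ↔ i ∈ undone G o r ∧ rank G o i ≠ r := by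
    intro i
    simp only [undone, Finset.mem_filter]
    constructor
    · rintro ⟨a, b⟩; exact ⟨⟨a, by omega⟩, by omega⟩
    · rintro ⟨⟨a, b⟩, d⟩; exact ⟨a, by omega⟩
  refine (Tri.ite' (T := spent G o (20000 * ((n + 1) ^ K * K)) (r + 1) -
        spent G o (20000 * ((n + 1) ^ K * K)) r + 1)
            (T' := 50 + (spent G o (20000 * ((n + 1) ^ K * K)) (r + 1) -
        spent G o (20000 * ((n + 1) ^ K * K)) r)) rfl
            (by simp [Ex.cost, procE, conj, same, neg, disj, less, ix, nn]; omega)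
            (fun h => ?_) fun h => ?_)
  · obtain ⟨hu, hrk⟩ := htr.1 h
    have huD : (c, v) ∈ undone G o r := Finset.mem_filter.2 ⟨hu, hrk.ge⟩
    have hDe : undone G o (r + 1) = (undone G o r).erase (c, v) := by
      ext i
      rw [hlt, Finset.mem_erase, and_comm]
      refine and_congr_left fun hi => not_congr ?_
      rw [hr, rank_eq_iff]
      rw [hr, rank_eq_iff] at hrk
      constructor
      · exact fun h => h.2
      · rintro rfl; exact hrk
    have hfree : ∀ i ∈ (undone G o r).erase (c, v),
        (graphTask G K).gate i ∉ (graphTask G K).ch (c, v) ∧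
        Disjoint ((graphTask G K).ch i) ((graphTask G K).ch (c, v)) := by
      intro i hi
      rw [Finset.mem_erase, undone, Finset.mem_filter] at hi
      refine free_of_dist_le hG hu hi.2.1 hi.1 ?_
      by_contra hlt
      have hle := hi.2.2
      rw [← hrk, rank, rank] at hle
      simp only at hle hlt
      have a1 := dist_lt_card hG o i.1
      have a2 : n - 1 - G.dist o i.1 + 1 ≤ n - 1 - G.dist o c := by omega
      have a3 := Nat.mul_le_mul_right n a2
      have a4 : (n - 1 - G.dist o i.1) * n + i.1 + 1 ≤ (n - 1 - G.dist o c) * n + c := by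
        have := i.1.2
        rw [Nat.add_mul] at a3
        omega
      have a5 := Nat.mul_le_mul_right n a4
      have := i.2.2
      rw [Nat.add_mul] at a5
      omega
    refine (tri_unit hG hP.toTabs hP.width hK hKn (mem_units.1 hu) h1 h2).mono ?_ ?_
    · have := le_spent hu (20000 * ((n + 1) ^ K * K))
      rw [hrk] at this
      dsimp only at this ⊢
      have e : 20000 * ((n + 1) ^ K * (ext G (blk G c v)).ncard ^ 2 * K) =
        20000 * ((n + 1) ^ K * K) * (ext G (blk G c v)).ncard ^ 2 := by ring
      omega
    · rintro m' hfr - ⟨g₀, g₁, Y₀, Y₁, hB₀, hB₁, q1, q2, q3, q4, q5, q6⟩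
      refine ⟨hP.toTabs.congr fun A hA hA' => hfr A (by simp at hA' ⊢; omega), ?_, ?_, ?_, ?_⟩
      · rw [hfr 4 (by simp), hP.width]
      · intro i hi
        rw [hDe] at hi
        rw [q6, Finset.mem_sdiff]
        exact ⟨hP.gate i (Finset.mem_of_mem_erase hi), (hfree i hi).1⟩
      · intro i hi
        rw [hDe] at hi
        rw [q6]
        exact Finset.subset_sdiff.2 ⟨hP.ch i (Finset.mem_of_mem_erase hi), (hfree i hi).2⟩
      · rw [q6, hDe]
        exact hP.inv.step (Finset.filter_subset _ _) huD (hP.gate _ huD) (hP.ch _ huD)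
          (fun h => (mem_ch.1 h).2.2 rfl) hfree hB₀ hB₁ q1 q2 q3 q4 q5
  · refine (Tri.skip ?_).mono (by omega) fun _ _ _ h => h
    have hDe : undone G o (r + 1) = undone G o r := by
      ext i
      rw [hlt]
      refine and_iff_left_of_imp fun hi hrk => h (htr.2 ?_)
      have : i = (c, v) := by
        rw [hr, rank_eq_iff] at hrk
        exact hrk.2
      subst this
      exact ⟨(Finset.mem_filter.1 hi).1, hrk⟩
    refine ⟨hP.toTabs, hP.width, ?_, ?_, ?_⟩ <;> rw [hDe]
    exacts [hP.gate, hP.ch, hP.inv]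

/-- A sum of increments telescopes. -/
theorem sum_steps {F : ℕ → ℕ} (hF : Monotone F) (k a b : ℕ) :
    ∑ x ∈ Finset.range k, (a + (F (x + 1) - F x) + b) = (a + b) * k + (F k - F 0) := by
  rw [← Finset.sum_range_tsub hF k, Finset.sum_add_distrib, Finset.sum_add_distrib]
  simp
  ring

/-- The rule for the loop over the blocks. The cubic term counts the positions, and the other one is
the sum of `20000 * ((n + 1) ^ K * K) * s ^ 2` over the sizes `s` of the EBCs. -/
theorem tri_blocks (ho : (o : ℕ) = 0) (hG : G.Connected) (hK : 1 ≤ K) (hKn : K ≤ n)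
    (hP : Progress G o K 0 m) :
    Tri (n + 2) w 0 t ρ m (blocksS 0 t) (100 * n ^ 3 + 40000 * ((n + 1) ^ K * K) * n ^ 2)
      (Progress G o K (n * n * n)) := by
  have hn0 : 0 < n := o.pos
  set F := spent G o (20000 * ((n + 1) ^ K * K)) with hF
  have hFm : Monotone F := spent_mono _
  refine (Tri.for (T := fun j => (5 + 8 * n + 53 * (n * n)) + (F ((j + 1) * n * n) - F (j * n * n)))
    (fun j => Progress G o K (j * n * n)) (by simpa using hP) ?_ ?_).mono
    (T := ∑ j ∈ Finset.range (m 2 0), ((5 + 8 * n + 53 * (n * n)) +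
        (F ((j + 1) * n * n) - F (j * n * n)) + 3) + 5) ?_
      fun _ _ _ h => h
  · rintro j hj m1 - - hP1
    rw [hP.size] at hj
    refine (Tri.for (T := fun c => (5 + 53 * n) + (F ((j * n + (c + 1)) * n) - F ((j * n + c) * n)))
      (fun c => Progress G o K ((j * n + c) * n)) (by simpa using hP1) ?_ ?_).mono
      (T := ∑ c ∈ Finset.range (m1 2 0), ((5 + 53 * n) +
          (F ((j * n + (c + 1)) * n) - F ((j * n + c) * n)) + 3) + 5) ?_
        fun _ _ _ h => h
    · rintro c hc m2 - - hP2
      rw [hP1.size] at hc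
      refine (Tri.for (T := fun v => 50 + (F ((j * n + c) * n + (v + 1)) - F ((j * n + c) * n + v)))
        (fun v => Progress G o K ((j * n + c) * n + v)) (by simpa using hP2) ?_ ?_).mono
        (T := ∑ v ∈ Finset.range (m2 2 0), (50 +
            (F ((j * n + c) * n + (v + 1)) - F ((j * n + c) * n + v)) + 3) + 5) ?_
          fun _ _ _ h => h
      · rintro v hv m3 - - hP3
        rw [hP2.size] at hv
        exact tri_position (j := ⟨j, hj⟩) (c := ⟨c, hc⟩) (v := ⟨v, hv⟩) ho hG hK hKn hP3 (by simp)
            (by simp) (by simp)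
      · rintro m3 - - hP3
        rw [hP2.size] at hP3
        convert hP3 using 1
        ring
      · rw [hP2.size, sum_steps (F := fun v => F ((j * n + c) * n + v))
            (fun a b h => hFm (by omega))]
        simp only [add_zero]
        have : (j * n + c) * n + n = (j * n + (c + 1)) * n := by ring
        rw [this]; omega
    · rintro m2 - - hP2
      rw [hP1.size] at hP2
      convert hP2 using 1
      ring
    · rw [hP1.size, sum_steps (F := fun c => F ((j * n + c) * n))
        (fun a b h => hFm (Nat.mul_le_mul_right _ (by omega)))]
      simp only [add_zero]
      have h1 : (j * n + n) * n = (j + 1) * n * n := by ring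
      have h2 : (5 + 53 * n + 3) * n = 8 * n + 53 * (n * n) := by ring
      rw [h1, h2]; omega
  · rintro m1 - - hP1
    rwa [hP.size] at hP1
  · rw [hP.size, sum_steps (F := fun j => F (j * n * n))
      (fun a b h => hFm (Nat.mul_le_mul_right _ (Nat.mul_le_mul_right _ h)))]
    have h1 := spent_le (o := o) hG (20000 * ((n + 1) ^ K * K)) (n * n * n)
    rw [← hF] at h1
    have h2 : 20000 * ((n + 1) ^ K * K) * (2 * n ^ 2) = 40000 * ((n + 1) ^ K * K) * n ^ 2 := by ring
    have h3 : (5 + 8 * n + 53 * (n * n) + 3) * n = 8 * n + 8 * n ^ 2 + 53 * n ^ 3 := by ring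
    have h4 : n ≤ n ^ 3 := Nat.le_self_pow (by omega) n
    have h5 : n ^ 2 ≤ n ^ 3 := Nat.pow_le_pow_right hn0 (by omega)
    omega

end Main

/-! ### Reading off the result -/

section Result

variable {n K : ℕ} {G : SimpleGraph (Fin n)} {o : Fin n} {tot : ℕ} {S : Finset (Fin n)}

/-- The problem in terms of distances and blocks. -/
theorem isEBCBoundedResolving_iff (hG : G.Connected) (R : Finset (Fin n)) :
    IsEBCBoundedResolving G K R ↔ (∀ u v, u ≠ v → Res G (R : Set (Fin n)) u v) ∧
      ∀ B, IsBlk G B → ((R : Set (Fin n)) ∩ ext G B).ncard ≤ K := by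
  refine and_congr Iff.rfl ⟨fun h B hB => h _ ((isEBC_iff hG _).2 ⟨B, hB, rfl⟩), fun h S hS => ?_⟩
  obtain ⟨B, hB, rfl⟩ := (isEBC_iff hG S).1 hS
  exact h B hB

/-- The outcome of the dynamic program: `tot` is the optimal cost, and `S` attains it. -/
structure Optimum (G : SimpleGraph (Fin n)) (o : Fin n) (K tot : ℕ)
    (S : Finset (Fin n)) : Prop where
  lower : ∀ σ, (graphTask G K).Feasible (units G o) σ → tot ≤ (graphTask G K).total (units G o) σ
  upper : tot < (n + 2) ^ 2 → ∃ τ, (graphTask G K).Feasible (units G o) τ ∧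
    (graphTask G K).total (units G o) τ ≤ tot ∧ (graphTask G K).result (units G o) τ = S

theorem Optimum.le_card (h : Optimum G o K tot S) (hG : G.Connected) {R : Finset (Fin n)}
    (hR : IsEBCBoundedResolving G K R) : tot ≤ R.card := by
  rw [isEBCBoundedResolving_iff hG] at hR
  obtain ⟨σ, h1, h2⟩ := exists_feasible (o := o) hG hR.1 hR.2
  exact (h.lower σ h1).trans h2

/-- The optimal cost is zero only for graphs with neither blocks nor joints, the paths. There, local
conditions do not suffice for a resolving set, as the empty set meets them. -/
theorem Optimum.pos_iff (h : Optimum G o K tot S) (hG : G.Connected) (hn : n ≠ 1) (ht : tot ≤ n) :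
    0 < tot ↔ (∃ B, IsBlk G B) ∨ ∃ c, Joint G c := by
  obtain ⟨τ, h1, h2, h3⟩ := h.upper (by nlinarith)
  constructor
  · intro hpos
    by_contra hX
    push Not at hX
    have hU : units G o = ∅ := Finset.eq_empty_of_forall_notMem fun i hi =>
      hX.1 _ (mem_units.1 hi).isBlk
    have := h.lower τ h1
    have h0 : (graphTask G K).total (units G o) τ = 0 := by
      rw [Task.total, Task.val, hU, Finset.sum_empty, add_zero]
      refine Finset.sum_eq_zero fun x _ => ?_
      have e1 : (graphTask G K).all x = ∅ :=
        Finset.eq_empty_of_forall_notMem fun y hy => hX.2 x (by simp [graphTask] at hy; exact hy.1)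
      have e2 : (graphTask G K).few x = ∅ :=
        Finset.subset_empty.1 (e1 ▸ few_subset_all x)
      simp [sel, e1, e2]
    omega
  · intro hX
    by_contra h0
    have hS : (graphTask G K).result (units G o) τ = ∅ := by
      rw [← Finset.card_eq_zero]
      have := card_result_le (G := G) (o := o) (K := K) (σ := τ)
      omega
    have hres := fun u v (huv : u ≠ v) => (h1.local hG).res hG hX huv
    rw [hS] at hres
    have h2 : 2 ≤ n := by have := o.pos; omega
    obtain ⟨w, hw, -⟩ := hres ⟨0, by omega⟩ ⟨1, by omega⟩ (by simp)
    simp at hw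

/-- If the optimal cost is positive, the dynamic program yields a minimum solution. -/
theorem Optimum.isMin (h : Optimum G o K tot S) (hG : G.Connected) (ht : tot ≤ n) (hpos : 0 < tot) :
    IsMinEBCBoundedResolving G K S ∧ S.card = tot := by
  obtain ⟨τ, h1, h2, h3⟩ := h.upper (by nlinarith)
  have hX : (∃ B, IsBlk G B) ∨ ∃ c, Joint G c := by
    by_cases hn : n = 1
    · exfalso
      subst hn
      have : IsEBCBoundedResolving G K (∅ : Finset (Fin 1)) :=
        ⟨fun u v huv => absurd (Subsingleton.elim u v) huv, fun B _ => by simp⟩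
      have := h.le_card hG this
      simp at this
      omega
    · exact (h.pos_iff hG hn ht).1 hpos
  have hS : IsEBCBoundedResolving G K S := by
    rw [isEBCBoundedResolving_iff hG, ← h3]
    exact ⟨fun u v huv => (h1.local hG).res hG hX huv, fun B hB => h1.ncard_le hG hB⟩
  refine ⟨⟨hS, fun R hR => ?_⟩, le_antisymm ?_ (h.le_card hG hS)⟩
  · have := h.le_card hG hR
    rw [← h3]
    exact card_result_le.trans (h2.trans this)
  · rw [← h3]
    exact card_result_le.trans h2

/-- If the optimal cost is zero and there are at least two vertices, then a single vertex that
resolves all pairs is a minimum solution. -/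
theorem Optimum.isMin_single (h : Optimum G o K tot S) (hG : G.Connected) (h0 : tot = 0)
    (hn : n ≠ 1) :
    (∃ x, ∀ u v, u ≠ v → G.dist u x ≠ G.dist v x) ∧
    ∀ x, (∀ u v, u ≠ v → G.dist u x ≠ G.dist v x) → IsMinEBCBoundedResolving G K {x} := by
  have hX : ¬ ((∃ B, IsBlk G B) ∨ ∃ c, Joint G c) := by
    rw [← h.pos_iff hG hn (by omega)]; omega
  rw [not_or] at hX
  refine ⟨exists_single_res hG hX.1 hX.2, fun x hx => ⟨?_, fun R hR => ?_⟩⟩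
  · rw [isEBCBoundedResolving_iff hG]
    exact ⟨fun u v huv => ⟨x, by simp, hx u v huv⟩, fun B hB => absurd ⟨B, hB⟩ hX.1⟩
  · have h2 : 2 ≤ n := by have := o.pos; omega
    obtain ⟨w, hw, -⟩ := hR.1 ⟨0, by omega⟩ ⟨1, by omega⟩ (by simp)
    simpa using Finset.card_pos.2 ⟨w, hw⟩

/-- In a graph with one vertex, the empty set is resolving. -/
theorem Optimum.isMin_empty (h0 : n = 1) : IsMinEBCBoundedResolving G K (∅ : Finset (Fin n)) := by
  subst h0
  exact ⟨⟨fun u v huv => absurd (Subsingleton.elim u v) huv, fun B _ => by simp⟩, fun R _ =>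
      by simp⟩

theorem Optimum.isEBCBounded_iff (h : Optimum G o K tot S) (hG : G.Connected) :
    IsEBCBounded G K ↔ tot ≤ n := by
  constructor
  · rintro ⟨-, R, hR⟩
    exact (h.le_card hG hR).trans (by simpa using Finset.card_le_univ R)
  · intro ht
    refine ⟨hG, ?_⟩
    by_cases h0 : tot = 0
    · by_cases hn : n = 1
      · exact ⟨∅, (isMin_empty hn).1⟩
      · obtain ⟨⟨x, hx⟩, h1⟩ := h.isMin_single hG h0 hn
        exact ⟨{x}, (h1 x hx).1⟩
    · exact ⟨S, (h.isMin hG ht (by omega)).1.1⟩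

open Ex

/-- The vertex `0` alone resolves all pairs. -/
def soloE : Ex := all 2 (all 2 (disj (same (var 1) (var 2))
    (neg (same (ix 5 (var 1) (var 0)) (ix 5 (var 2) (var 0))))))

/-- Reading off the result: array `44` tells whether there is a solution, array `1` holds one and
array `45` its size, but at least one. -/
def resultS : Pg :=
  seqS (storeS 46 (num 0) (sum 2 (ite (get 24 (var 0)) (get 21 (var 0)) (num 0)))) <|
  seqS (storeS 44 (num 0) (neg (less nn (get 46 (num 0))))) <|
  seqS (storeS 45 (num 0) (ite (get 46 (num 0)) (get 46 (num 0)) (num 1))) <|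
  seqS (storeS 47 (num 0) (find 2 soloE))
  (tab1 1 (ite (get 46 (num 0)) (exi 2 (conj (get 24 (var 1)) (ix 23 (var 1) (var 0))))
    (conj (less (num 1) nn) (same (var 0) (get 47 (num 0))))))

open Classical in
/-- The set in array `1`. -/
noncomputable def outs (n : ℕ) (m : Mem) : Finset (Fin n) := Finset.univ.filter fun x => m 1 x ≠ 0

theorem mem_outs {m : Mem} {x : Fin n} : x ∈ outs n m ↔ m 1 x ≠ 0 := by simp [outs]

/-- The memory holds the correct result. -/
structure Solved (G : SimpleGraph (Fin n)) (K : ℕ) (m : Mem) : Prop where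
  le : m 44 0 ≤ 1
  iff : m 44 0 = 1 ↔ IsEBCBounded G K
  isMin : IsEBCBounded G K → IsMinEBCBoundedResolving G K (outs n m)
  num : IsEBCBounded G K → m 45 0 = max 1 (outs n m).card

variable {w t : ℕ} {ρ : ℕ → ℕ} {m : Mem}

/-- The rule for `resultS`: when all blocks are decided, the result is read off the table `23`. -/
theorem tri_result (hG : G.Connected) (hT : Tabs G o m)
    (h : Optimum G o K (∑ x ∈ opn n m, nums m 21 x) ((opn n m).biUnion (rows m 23))) :
    Tri (n + 2) w 0 t ρ m (resultS 0 t) (1000 * n ^ 3) (Solved G K) := by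
  classical
  have hn0 : 0 < n := o.pos
  have hnM : n < (n + 2) ^ 2 := by nlinarith
  have hn := hT.size
  set tot := ∑ x ∈ opn n m, nums m 21 x with htot
  have h3 : 1 ≤ n ^ 3 := Nat.one_le_pow _ _ hn0
  have h13 : n ≤ n ^ 3 := Nat.le_self_pow (by omega) n
  refine Tri.seq (T₁ := 100 * n ^ 3) (T₂ := 900 * n ^ 3)
      (Tri.store' (Q := fun m' => m' = m.set 46 0 (min tot ((n + 2) ^ 2)))
    rfl rfl ?_ ?_) (by omega) ?_
  · simp [Ex.cost, hn]; omega
  · simp only [Ex.eval_sum, Ex.eval_ite, Ex.tr_get, Ex.eval_var, Function.update_self, Ex.eval_get,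
        Ex.eval_num, hn]
    rw [Finset.sum_range (n := n) fun x => if m 24 x ≠ 0 then m 21 x else 0, htot, opn,
        Finset.sum_filter]
    rfl
  rintro m1 - - hm1
  have e46 : m1 46 0 = min tot ((n + 2) ^ 2) := by rw [hm1, Mem.set_self, if_pos rfl]
  have hn1 : m1 2 0 = n := by rw [hm1, Mem.set_ne _ _ _ (by decide), hn]
  refine Tri.seq (T₁ := 50 * n ^ 3) (T₂ := 850 * n ^ 3)
      (Tri.store' (Q := fun m' => ∃ q, m' = m1.set 44 0 q ∧ q ≤ 1 ∧
    (q = 1 ↔ tot ≤ n)) rfl rfl ?_ ?_) (by omega) ?_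
  · simp [Ex.cost, neg, less, nn]; omega
  · refine ⟨_, rfl, ?_⟩
    have e : (neg (less nn (get 46 (num 0)))).eval m1 0 ρ = if n < m1 46 0 then 0 else 1 := by
      rw [neg, Ex.eval_ite]
      simp [hn1]
    rw [e, e46]
    have : 1 ≤ (n + 2) ^ 2 := by omega
    split_ifs <;> omega
  rintro m2 - - ⟨q, hm2, hq1, hq2⟩
  refine Tri.seq (T₁ := 50 * n ^ 3) (T₂ := 800 * n ^ 3)
      (Tri.store' (Q := fun m' => ∃ q, m' = m2.set 45 0 q ∧
    (tot ≤ n → q = max 1 tot)) rfl rfl ?_ ?_) (by omega) ?_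
  · simp [Ex.cost]; omega
  · refine ⟨_, rfl, fun ht => ?_⟩
    rw [Ex.eval_ite]
    simp only [Ex.tr_get, Ex.eval_get, Ex.eval_num, hm2, Mem.set_ne _ _ _ (show 46 ≠ 44 by decide),
        e46]
    split_ifs <;> omega
  rintro m3 - - ⟨q', hm3, hq'⟩
  have hf3 : ∀ C, C ∉ [44, 45, 46] → m3 C = m C := fun C hC => by
    simp at hC
    rw [hm3, Mem.set_ne _ _ _ (by tauto), hm2, Mem.set_ne _ _ _ (by tauto), hm1,
        Mem.set_ne _ _ _ (by tauto)]
  have hT3 : Tabs G o m3 := hT.congr fun A hA _ => hf3 A (by simp; omega)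
  obtain ⟨s1, s2, s3⟩ := Ex.find_spec m3 2 soloE 0 ρ
  set z := (find 2 soloE).eval m3 0 ρ with hz
  have htr : ∀ x : Fin n, soloE.tr m3 (0 + 1) (Function.update ρ 0 x) ↔
      ∀ u v, u ≠ v → G.dist u x ≠ G.dist v x := by
    intro x
    simp only [soloE, Ex.tr_all, Ex.tr_disj, Ex.tr_neg, Ex.tr_same, Ex.eval_ix, Ex.eval_var,
        hT3.size, forall_lt_iff,
      Function.update_apply, Nat.reduceAdd, Nat.reduceEqDiff, reduceIte, zero_ne_one, one_ne_zero,
      OfNat.zero_ne_ofNat, OfNat.one_ne_ofNat, hT3.dist, Fin.val_inj, or_iff_not_imp_left, ne_eq]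
  rw [hT3.size] at s1 s2 s3
  refine Tri.seq (T₁ := 500 * n ^ 3) (T₂ := 300 * n ^ 3)
      (Tri.store' (Q := fun m' => m' = m3.set 47 0 z) rfl rfl ?_ ?_) (by omega) ?_
  · have := Ex.cost_le (m := m3) (x := n) (y := m3 3 0 + 1) (z := m3 4 0 + 1) hn0 (by omega)
        (by omega) hT3.size.le
      (by omega) (by omega) (find 2 soloE) (by decide)
    have hc : (find 2 soloE).cst ≤ 400 := by decide
    simp only [show (find 2 soloE).deg 2 = 3 by decide, show (find 2 soloE).deg 3 = 0 by decide,
        show (find 2 soloE).deg 4 = 0 by decide, pow_zero, mul_one] at this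
    have h4 := this.trans (Nat.mul_le_mul_right (n ^ 3) hc)
    simp only [Ex.cost.eq_1]
    omega
  · rw [← hz, min_eq_left (by omega)]; rfl
  rintro m4 - - hm4
  have hf4 : ∀ C, C ∉ [44, 45, 46, 47] → m4 C = m C := fun C hC => by
    simp at hC
    rw [hm4, Mem.set_ne _ _ _ (by tauto), hf3 C (by simp; tauto)]
  have f46 : m4 46 0 = min tot ((n + 2) ^ 2) := by
    rw [hm4, Mem.set_ne _ _ _ (by decide), hm3, Mem.set_ne _ _ _ (by decide), hm2,
        Mem.set_ne _ _ _ (by decide), e46]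
  have f44 : m4 44 0 = q := by
    rw [hm4, Mem.set_ne _ _ _ (by decide), hm3, Mem.set_ne _ _ _ (by decide), hm2, Mem.set_self,
        if_pos rfl]
  have f45 : m4 45 0 = q' := by
    rw [hm4, Mem.set_ne _ _ _ (by decide), hm3, Mem.set_self, if_pos rfl]
  have f47 : m4 47 0 = z := by rw [hm4, Mem.set_self, if_pos rfl]
  refine Tri.fill1 (D := 1) (by rw [hf4 2 (by simp), hn]) hn0 (by decide) ?_ ?_
  · have h23 : n ^ 2 ≤ n ^ 3 := Nat.pow_le_pow_right hn0 (by omega)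
    exact Nat.mul_le_mul (by decide) h23
  rintro m5 hf5 hv -
  have hout : ∀ x : Fin n, x ∈ outs n m5 ↔ if tot ≠ 0 then x ∈ (opn n m).biUnion (rows m 23)
      else n ≠ 1 ∧ (x : ℕ) = z := by
    intro x
    rw [mem_outs, hv x x.2, min_ne_zero_iff (by omega), ← Ex.tr_iff, Ex.tr_ite]
    simp only [Ex.tr_get, Ex.tr_exi, Ex.tr_conj, Ex.tr_ix, Ex.eval_var, Ex.eval_num, Ex.tr_less,
        Ex.tr_same, Ex.eval_get,
      f46, f47, Ex.eval_nn, hf4 2 (by simp), hf4 24 (by simp), hf4 23 (by simp), hn, exists_lt_iff,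
      Function.update_self, env1_zero,
      Function.update_apply, zero_ne_one, if_false, Finset.mem_biUnion, mem_opn, mem_rows]
    have e1 : min tot ((n + 2) ^ 2) ≠ 0 ↔ tot ≠ 0 := min_ne_zero_iff (by omega) _
    have e2 : 1 < n ↔ n ≠ 1 := by omega
    rw [e1, e2]
    split_ifs with h0 <;> simp [h0]
  have g44 : m5 44 0 = q := by rw [hf5 44 (by decide), f44]
  have hiff := h.isEBCBounded_iff hG
  have hcase : tot ≤ n → IsMinEBCBoundedResolving G K (outs n m5) ∧
      max 1 tot = max 1 (outs n m5).card := by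
    intro ht
    by_cases h0 : tot = 0
    · by_cases h1 : n = 1
      · have : outs n m5 = ∅ := by
          ext x; rw [hout]; simp [h0, h1]
        rw [this]
        exact ⟨Optimum.isMin_empty h1, by simp [h0]⟩
      · obtain ⟨⟨x, hx⟩, h2⟩ := h.isMin_single hG h0 h1
        have hzn : z < n := s3.2 ⟨x, x.2, (htr x).2 hx⟩
        have hz' := (htr ⟨z, hzn⟩).1 (s2 hzn)
        have : outs n m5 = {⟨z, hzn⟩} := by
          ext y; rw [hout]; simp [h0, h1, Fin.ext_iff]
        rw [this]
        exact ⟨h2 _ hz', by simp [h0]⟩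
    · obtain ⟨h1, h2⟩ := h.isMin hG ht (by omega)
      have : outs n m5 = (opn n m).biUnion (rows m 23) := by
        ext x; rw [hout, if_pos h0]
      rw [this, h2]
      exact ⟨h1, rfl⟩
  exact ⟨by rw [g44]; exact hq1, by rw [g44, hq2, hiff], fun hb => (hcase (hiff.1 hb)).1,
      fun hb => by
    rw [hf5 45 (by decide), f45, hq' (hiff.1 hb), (hcase (hiff.1 hb)).2]⟩

end Result

/-! ### The whole program -/

section Core

open Ex

/-- All vertices are reachable from the vertex `0`. -/
def connE : Ex := all 2 (less (ix 5 (num 0) (var 0)) nn)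

/-- The program that solves the problem for the bound in cell `0` of array `4`. -/
def coreS : Pg :=
  seqS distS <| iteS connE (seqS compS <| seqS tablesS <|
      seqS blocksS resultS) (storeS 44 (num 0) (num 0))

theorem coreS_stores {A : ℕ} (d t : ℕ) (hA : A ∈ [0, 2, 4, 48]) : A ∉ (coreS d t).stores := by
  simp only [List.mem_cons, List.not_mem_nil, or_false] at hA
  rcases hA with rfl | rfl | rfl | rfl <;>
    simp [coreS, distS, compS, mergeS, tablesS, blocksS, resultS]

variable {n : ℕ} {G : SimpleGraph (Fin n)}

/-- When all blocks are dealt with, the dynamic program has computed an optimum. -/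
theorem Optimum.of_progress {o : Fin n} {K : ℕ} {m : Mem} (h : Progress G o K (n * n * n) m) :
    Optimum G o K (∑ x ∈ opn n m, nums m 21 x) ((opn n m).biUnion (rows m 23)) := by
  have hD : undone G o (n * n * n) = ∅ := Finset.eq_empty_of_forall_notMem fun i hi =>
    absurd (Finset.mem_filter.1 hi).2 (not_le.2 (rank_lt i))
  have := h.inv
  rw [hD] at this
  exact ⟨this.final.1, this.final.2⟩

/-- The program `coreS` solves the problem for the bound `K`. It keeps its input and the arrays `4`
and `48`, so that it can be run again. -/
theorem tri_core : ∃ C : ℕ, ∀ {n K : ℕ} {G : SimpleGraph (Fin n)} {m : Mem} {w t : ℕ} {ρ : ℕ → ℕ},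
    Holds G m → m 4 0 = K → 1 ≤ K → K ≤ n →
      Tri (n + 2) w 0 t ρ m (coreS 0 t) (C * ((n + 1) ^ K * K * n ^ 2)) fun m' =>
        Solved G K m' ∧ ∀ A ∈ [0, 2, 4, 48], m' A = m A := by
  obtain ⟨C₁, h₁⟩ := tri_dist
  obtain ⟨C₂, h₂⟩ := tri_comp
  refine ⟨C₁ + C₂ + 100000, fun {n K G m w t ρ} hm h4 hK hKn => ?_⟩
  have hn0 : 0 < n := by omega
  set X := (n + 1) ^ K * K * n ^ 2 with hX
  have hn3 : n ^ 3 ≤ X := by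
    have : n ≤ (n + 1) ^ K * K := ((Nat.le_succ n).trans (Nat.le_self_pow (by omega) _)).trans
      (Nat.le_mul_of_pos_right _ hK)
    calc n ^ 3 = n * n ^ 2 := by ring
      _ ≤ X := Nat.mul_le_mul_right _ this
  have hn1 : n ≤ n ^ 3 := Nat.le_self_pow (by omega) n
  have hC1 : C₁ * n ^ 3 ≤ C₁ * X := Nat.mul_le_mul_left _ hn3
  have hC2 : C₂ * n ^ 3 ≤ C₂ * X := Nat.mul_le_mul_left _ hn3
  have hexp : (C₁ + C₂ + 100000) * X = C₁ * X + C₂ * X + 100000 * X := by ring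
  suffices h : Tri (n + 2) w 0 t ρ m (coreS 0 t) ((C₁ + C₂ + 100000) * X) (Solved G K) from
    h.mono le_rfl fun m' hf _ hs => ⟨hs, fun A hA => hf A (coreS_stores 0 t hA)⟩
  refine Tri.seq (T₁ := C₁ * X) (T₂ := C₂ * X + 100000 * X) ((h₁ hn0 hm).mono hC1 fun _ _ _ h => h)
      (by omega) ?_
  rintro m1 hfr1 - ⟨hd1, hd2⟩
  have hf1 : ∀ C, C ≠ 5 → m1 C = m C := fun C hC => hfr1 C (by simpa [distS] using hC)
  have hm1 : Holds G m1 := hm.congr (hf1 0 (by decide)) (hf1 2 (by decide))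
  have hconn : connE.tr m1 0 ρ ↔ G.Connected := by
    simp only [connE, Ex.tr_all, Ex.tr_less, Ex.eval_ix, Ex.eval_num, Ex.eval_var, Ex.eval_nn,
        hm1.size,
      Function.update_self, forall_lt_iff]
    constructor
    · intro h
      have hr : ∀ x, G.Reachable ⟨0, hn0⟩ x := fun x => hd1 ⟨0, hn0⟩ x (h x)
      have : Nonempty (Fin n) := ⟨⟨0, hn0⟩⟩
      exact ⟨fun x y => (hr x).symm.trans (hr y)⟩
    · intro hG x
      have := hd2 hG ⟨0, hn0⟩ x
      simp only at this
      rw [this]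
      exact dist_lt_card hG _ _
  refine Tri.ite' (T := C₂ * X + 99000 * X) rfl ?_ (fun h => ?_) (fun h => ?_)
  · have := Ex.cost_le (m := m1) (x := n) (y := m1 3 0 + 1) (z := m1 4 0 + 1) hn0 (by omega)
        (by omega)
      hm1.size.le (by omega) (by omega) connE (by decide)
    simp only [show connE.deg 2 = 1 by decide, show connE.deg 3 = 0 by decide,
        show connE.deg 4 = 0 by decide,
      pow_zero, mul_one, pow_one] at this
    have := this.trans (Nat.mul_le_mul_right n (show connE.cst ≤ 100 by decide))
    omega
  · have hG := hconn.1 h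
    have hd := hd2 hG
    refine Tri.seq (T₁ := C₂ * X) (T₂ := 99000 * X) ((h₂ hn0 hm1).mono hC2 fun _ _ _ h => h)
        (by omega) ?_
    rintro m2 hfr2 - hl
    have hf2 : ∀ C, C ∉ [6, 7, 8] → m2 C = m1 C := fun C hC =>
        hfr2 C (by simp [compS, mergeS] at hC ⊢; tauto)
    have hm2 : Holds G m2 := hm1.congr (hf2 0 (by decide)) (hf2 2 (by decide))
    refine Tri.seq (T₁ := 16000 * X) (T₂ := 83000 * X) ((tri_tables (o := ⟨0, hn0⟩) rfl hG hm2
      (by rw [hf2 5 (by decide)]; exact hd) hl K).mono (Nat.mul_le_mul_left _ hn3) fun _ _ _ h => h)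
          (by omega) ?_
    rintro m3 hfr3 - ⟨hT, h20, h21, h22, h23, h24⟩
    have e4 : m3 4 0 = K := by
      rw [hfr3 4 (by simp [tablesS]), hf2 4 (by decide), hf1 4 (by decide), h4]
    have hop : opn n m3 = Finset.univ := by
      ext x; simp [mem_opn, h24]
    have hun : undone G ⟨0, hn0⟩ 0 = units G ⟨0, hn0⟩ := by simp [undone]
    have hP : Progress G ⟨0, hn0⟩ K 0 m3 := by
      refine ⟨hT, e4, fun i _ => by simp [hop], fun i _ => by simp [hop], ?_⟩
      rw [hun, hop, show (nums m3 20 : Fin n → ℕ) = fun x =>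
          ((graphTask G K).all x).card from funext h20,
        show (nums m3 21 : Fin n → ℕ) = fun x => ((graphTask G K).few x).card from funext h21,
        show (rows m3 22 : Fin n → Finset (Fin n)) = (graphTask G K).all from
          funext fun x => by ext y; rw [mem_rows, h22],
        show (rows m3 23 : Fin n → Finset (Fin n)) = (graphTask G K).few from
          funext fun x => by ext y; rw [mem_rows, h23]]
      exact Task.Inv.init _ _
    refine Tri.seq (T₁ := 41000 * X) (T₂ := 42000 * X)
        ((tri_blocks rfl hG hK hKn hP).mono ?_ fun _ _ _ h => h) (by omega) ?_
    · have : 40000 * ((n + 1) ^ K * K) * n ^ 2 = 40000 * X := by rw [hX]; ring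
      omega
    rintro m4 - - hP4
    exact (tri_result hG hP4.toTabs (Optimum.of_progress hP4)).mono (by omega) fun _ _ _ h => h
  · refine Tri.store' rfl rfl (by simp [Ex.cost]; omega) ?_
    have hb : ¬ IsEBCBounded G K := fun hb => h (hconn.2 hb.1)
    exact ⟨by simp [Mem.set_self], by simp [Mem.set_self, hb], fun h => absurd h hb, fun h =>
        absurd h hb⟩

end Core

/-! ### The programs of the theorem -/

section Programs

variable {n k : ℕ} {G : SimpleGraph (Fin n)}

/-- An EBC has at most `n` vertices, so that bounds greater than `n` can be replaced by `n`. -/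
theorem atMostPerEBC_min (R : Finset (Fin n)) : AtMostPerEBC G (min k n) R ↔
    AtMostPerEBC G k R := by
  refine forall₂_congr fun S _ => ?_
  have h : ((R : Set (Fin n)) ∩ S).ncard ≤ n := by
    have := Set.ncard_le_ncard (Set.subset_univ ((R : Set (Fin n)) ∩ S)) (Set.toFinite _)
    simpa [Set.ncard_univ] using this
  omega

theorem isEBCBoundedResolving_min (R : Finset (Fin n)) :
    IsEBCBoundedResolving G (min k n) R ↔ IsEBCBoundedResolving G k R :=
  and_congr Iff.rfl (atMostPerEBC_min R)

theorem isEBCBounded_min : IsEBCBounded G (min k n) ↔ IsEBCBounded G k := by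
  simp only [IsEBCBounded, isEBCBoundedResolving_min]

theorem isMinEBCBoundedResolving_min (R : Finset (Fin n)) :
    IsMinEBCBoundedResolving G (min k n) R ↔ IsMinEBCBoundedResolving G k R := by
  simp only [IsMinEBCBoundedResolving, isEBCBoundedResolving_min]

theorem IsEBCBounded.pos (h : IsEBCBounded G k) : 0 < n := by
  obtain ⟨x⟩ := h.1.nonempty
  exact x.pos

/-- Setting up the registers and the arrays `2` and `4`, which hold the number `n` of vertices and
the smaller one of `n` and `k`. -/
def startP (k : ℕ) : Prog :=
  .seq (.const 4 2) <| .seq (.arith .add 1 0 4) <| .seq (.arith .mul 1 1 1) <| .seq (.const 4 0) <|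
  .seq (.store 2 4 0) <| .seq (.const 6 k) <| .seq (.arith .sub 8 6 0) <| .seq (.arith .sub 6 6 8)
    (.store 4 4 6)

/-- The setup of registers and arrays. The word length must allow for the constant `k`. -/
theorem start_exec (G : SimpleGraph (Fin n)) {w : ℕ} (hw : k + 3 ≤ w) :
    ∃ s, Exec ((n + 2) ^ w) (startP k) (initState G) 9 s ∧ s.reg 1 = (n + 2) ^ 2 ∧
      Holds G s.arr ∧ s.arr 4 0 = min k n ∧ ∀ A i, s.arr A i ≤ (n + 2) ^ 2 := by
  classical
  have hM : 2 ≤ n + 2 := by omega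
  have hsq : (n + 2) ^ 2 = (n + 2) * (n + 2) := sq _
  have hn2 : n + 2 ≤ (n + 2) ^ 2 := Nat.le_self_pow (by omega) _
  have hW2 : (n + 2) ^ 2 < (n + 2) ^ w := Nat.pow_lt_pow_right (by omega) (by omega)
  have hWk : k < (n + 2) ^ w := by
    calc k < 2 ^ k := Nat.lt_two_pow_self
      _ ≤ (n + 2) ^ k := Nat.pow_le_pow_left hM k
      _ ≤ _ := Nat.pow_le_pow_right (by omega) (by omega)
  set s0 := initState G with hs0
  have hx : Exec ((n + 2) ^ w) (startP k) s0 9 _ :=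
    .seq (t' := 8) (.const s0 4 2 (by omega)) <|
    .seq (t' := 7) (.arith _ .add 1 0 4 (by simp [hs0, initState, State.setReg, Op.eval]; omega)) <|
    .seq (t' := 6) (.arith _ .mul 1 1 1 (by simp [hs0, initState, State.setReg, Op.eval]; omega)) <|
    .seq (t' := 5) (.const _ 4 0 (by omega)) <|
    .seq (t' := 4) (.store _ 2 4 0) <|
    .seq (t' := 3) (.const _ 6 k hWk) <|
    .seq (t' := 2) (.arith _ .sub 8 6 0
      (by simp [hs0, initState, State.setReg, State.setArr, Op.eval]; omega)) <|
    .seq (t' := 1) (.arith _ .sub 6 6 8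
      (by simp [hs0, initState, State.setReg, State.setArr, Op.eval]; omega))
    (.store _ 4 4 6)
  refine ⟨_, hx, ?_, ⟨?_, fun i j => ?_⟩, ?_, fun A x => ?_⟩
  · simp [hs0, initState, State.setReg, State.setArr, Op.eval, sq]
  · simp [hs0, initState, State.setReg, State.setArr, Op.eval]
  · simp only [hs0, initState, State.setReg, State.setArr, Op.eval, Function.update_apply,
      OfNat.zero_ne_ofNat, if_false, true_and, ne_eq, ite_eq_right_iff, one_ne_zero, imp_false,
      not_not]
    constructor
    · rintro ⟨i', j', h, he⟩
      obtain ⟨h1, h2⟩ := (idx_inj j.2 j'.2).1 he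
      rwa [Fin.ext h1, Fin.ext h2]
    · exact fun h => ⟨i, j, h, rfl⟩
  · simp [hs0, initState, State.setReg, State.setArr, Op.eval]
    omega
  · clear hx hW2 hsq
    have h1 : n + 1 ≤ (n + 2) ^ 2 := by nlinarith
    generalize (n + 2) ^ 2 = b at h1
    have h2 : k - (k - n) ≤ b := by omega
    simp only [hs0, initState, State.setReg, State.setArr, Op.eval]
    rcases eq_or_ne A 4 with rfl | hA4
    · rcases eq_or_ne x 0 with rfl | hx0 <;> simp [*]
    rcases eq_or_ne A 2 with rfl | hA2
    · rcases eq_or_ne x 0 with rfl | hx0 <;> simp [*]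
      omega
    simp only [Function.update_of_ne hA4, Function.update_of_ne hA2]
    split_ifs <;> omega

/-- Loading the output number from cell `0` of the array `A` into register `0`. -/
def endP (A : ℕ) : Prog := .seq (.const 0 0) (.load 0 A 0)

/-- From a triple for a program to the running time of the program with setup and output. The word
length of `k + 1003` allows for the constant `k` and for the numbers that occur in the evaluation of
expressions. -/
theorem halts {w k A T : ℕ} {P : Pg} {Q : Mem → Prop} (hw : k + 1003 ≤ w)
    (h : ∀ m, Holds G m → m 4 0 = min k n → Tri (n + 2) w 0 0 (fun _ => 0) m (P 0 0) T Q) :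
    HaltsWithin (.seq (startP k) (.seq (P 0 0) (endP A))) w G (T + 11)
      fun s => Q s.arr ∧ s.reg 0 = s.arr A 0 := by
  obtain ⟨s, h1, h2, h3, h4, h5⟩ := start_exec (k := k) G (w := w) (by omega)
  obtain ⟨τ, s', a, b, -, -, -, c⟩ := h s.arr h3 h4 (by omega) (by omega) h5 (by simp) s rfl h2
      (by simp)
  refine ⟨_, _, .seq h1 (.seq a (.seq (.const s' 0 0 (Nat.pow_pos (by omega))) (.load _ 0 A 0))),
      by omega, c, ?_⟩
  simp [State.setReg]

theorem pow_le_timeBound (G : SimpleGraph (Fin n)) (k : ℕ) : n ^ k * n ^ 2 ≤ timeBound k G := by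
  rw [timeBound, sq, ← mul_assoc]
  exact Nat.mul_le_mul_left _ (Nat.le_add_right _ _)

theorem time_le (hn : 0 < n) (G : SimpleGraph (Fin n)) (k : ℕ) :
    (n + 1) ^ k * n ^ 2 ≤ 2 ^ k * timeBound k G := by
  calc (n + 1) ^ k * n ^ 2 ≤ (2 * n) ^ k * n ^ 2 :=
        Nat.mul_le_mul_right _ (Nat.pow_le_pow_left (by omega) _)
    _ = 2 ^ k * (n ^ k * n ^ 2) := by rw [mul_pow, mul_assoc]
    _ ≤ _ := Nat.mul_le_mul_left _ (pow_le_timeBound G k)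

theorem one_le_timeBound (hn : 0 < n) (G : SimpleGraph (Fin n)) (k : ℕ) : 1 ≤ timeBound k G :=
  (Nat.mul_pos (Nat.pow_pos hn) (Nat.pow_pos hn)).trans_le (pow_le_timeBound G k)

/-- The time of the core program within the time bound of the problem, the constant being `C * k * 2
^ k`, since `n + 1 ≤ 2 * n`. -/
theorem core_time_le (hn : 0 < n) (G : SimpleGraph (Fin n)) {K k : ℕ} (hK : K ≤ k) (C : ℕ) :
    C * ((n + 1) ^ K * K * n ^ 2) ≤ C * k * 2 ^ k * timeBound k G := by
  calc C * ((n + 1) ^ K * K * n ^ 2) = C * K * ((n + 1) ^ K * n ^ 2) := by ring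
    _ ≤ C * k * ((n + 1) ^ k * n ^ 2) := Nat.mul_le_mul (Nat.mul_le_mul_left _ hK)
        (Nat.mul_le_mul_right _ (Nat.pow_le_pow_right (by omega) hK))
    _ ≤ C * k * (2 ^ k * timeBound k G) := Nat.mul_le_mul_left _ (time_le hn G k)
    _ = _ := by ring

/-- For fixed `k`, a program solves the problem within the time bound and outputs the number in
cell `0` of the array `A`. -/
theorem exists_program (k A : ℕ) (hk : 0 < k) : ∃ (P : Prog) (w C : ℕ), ∀ (n : ℕ)
    (G : SimpleGraph (Fin n)), 0 < n → HaltsWithin P w G (C * timeBound k G)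
      fun s => Solved G (min k n) s.arr ∧ s.reg 0 = s.arr A 0 := by
  obtain ⟨C, hC⟩ := tri_core
  refine ⟨.seq (startP k) (.seq (coreS 0 0) (endP A)), k + 1003, C * k * 2 ^ k + 11, fun n G hn =>
      ?_⟩
  obtain ⟨τ, s, h1, h2, h3⟩ := halts (G := G) (A := A) (k := k) (w := k + 1003) (P := coreS) le_rfl
    fun m hm h4 => (hC hm h4 (by omega) (min_le_right _ _)).mono le_rfl fun m' _ _ h => h.1
  refine ⟨τ, s, h1, h2.trans ?_, h3⟩
  have := core_time_le hn G (min_le_left k n) C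
  have := one_le_timeBound hn G k
  rw [Nat.add_mul]
  omega

open Ex

/-- Trying the bounds `1, 2, …` until there is a solution. -/
def searchLeastS : Pg :=
  seqS (storeS 48 (num 0) (num 1)) <| whileS 48 <| seqS coreS <|
    iteS (get 44 (num 0)) (storeS 48 (num 0) (num 0))
        (storeS 4 (num 0) (bin .add (get 4 (num 0)) (num 1)))

/-- The rule for `searchLeastS`: the loop ends with the least bound `k`, after `k` rounds that are
at most as long as the last one. -/
theorem tri_searchLeast : ∃ C : ℕ, ∀ {n k : ℕ} {G : SimpleGraph (Fin n)} {m : Mem} {w t : ℕ}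
    {ρ : ℕ → ℕ},
    Holds G m → m 4 0 = 1 → IsLeast {k : ℕ | 0 < k ∧ IsEBCBounded G k} k → k ≤ n →
      Tri (n + 2) w 0 t ρ m (searchLeastS 0 t) (k * (C * k * 2 ^ k * timeBound k G + 50) + 50)
        fun m' => m' 4 0 = k := by
  obtain ⟨C, hC⟩ := tri_core
  refine ⟨C, fun {n k G m w t ρ} hm h4 hk hkn => ?_⟩
  have hn0 : 0 < n := hk.1.2.pos
  have hM : n + 2 ≤ (n + 2) ^ 2 := Nat.le_self_pow (by omega) _
  refine Tri.seq (T₁ := 10) (T₂ := k * (C * k * 2 ^ k * timeBound k G + 50) + 40) (Tri.store'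
    (Q := fun m' => m' = m.set 48 0 1) rfl rfl (by simp [Ex.cost]) ?_) (by omega) ?_
  · rw [Ex.eval_num, Ex.eval_num, min_eq_left (by omega)]
  rintro m1 - - rfl
  refine Tri.while k (fun j m' => (∀ A ∈ [0, 2], m' A = m A) ∧
      (j < k → m' 48 0 ≠ 0 ∧ m' 4 0 = j + 1) ∧
    (j = k → m' 48 0 = 0 ∧ m' 4 0 = k)) (T := C * k * 2 ^ k * timeBound k G + 40)
    (by nlinarith) ?_ ?_ ?_
  · refine ⟨fun A hA => Mem.set_ne _ _ _ (by rintro rfl; simp at hA), fun _ =>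
        ⟨by simp [Mem.set_self], ?_⟩,
      fun h => absurd hk.1.1 (by omega)⟩
    rw [Mem.set_ne _ _ _ (by decide), h4]
  · rintro j hj m2 - - ⟨hf, h1, -⟩
    obtain ⟨h48, h4'⟩ := h1 hj
    refine ⟨h48, ?_⟩
    refine Tri.seq (T₁ := C * k * 2 ^ k * timeBound k G) (T₂ := 30)
        ((hC (hm.congr (hf 0 (by decide)) (hf 2 (by decide)))
      h4' (by omega) (by omega)).mono (core_time_le hn0 G (by omega) C) fun _ _ _ h => h)
          (by omega) ?_
    rintro m3 - - ⟨hs, hf3⟩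
    have hf3' : ∀ A ∈ [0, 2], m3 A = m A := fun A hA => by
      rw [hf3 A (by simp at hA ⊢; omega), hf A hA]
    refine Tri.ite' (T := 20) rfl (by simp [Ex.cost]) (fun h => ?_) (fun h => ?_)
    · have hb : IsEBCBounded G (j + 1) := by
        rw [← hs.iff]
        have := hs.le
        simp only [Ex.tr_get, Ex.eval_num] at h
        omega
      have hjk : j + 1 = k := le_antisymm (by omega) (hk.2 ⟨by omega, hb⟩)
      refine Tri.store' rfl rfl (by simp [Ex.cost])
          ⟨fun A hA => ?_, fun h => by omega, fun _ => ⟨by simp [Mem.set_self], ?_⟩⟩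
      · rw [Mem.set_ne _ _ _ (by rintro rfl; simp at hA), hf3' A hA]
      · rw [Mem.set_ne _ _ _ (by decide), hf3 4 (by decide), h4', hjk]
    · have hb : ¬ IsEBCBounded G (j + 1) := by
        rw [← hs.iff]
        simp only [Ex.tr_get, Ex.eval_num] at h
        omega
      have hjk : j + 1 ≠ k := fun he => hb (he ▸ hk.1.2)
      refine Tri.store' rfl rfl (by simp [Ex.cost])
          ⟨fun A hA => ?_, fun _ => ⟨?_, ?_⟩, fun h => absurd h hjk⟩
      · rw [Mem.set_ne _ _ _ (by rintro rfl; simp at hA), hf3' A hA]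
      · rw [Mem.set_ne _ _ _ (by decide), hf3 48 (by decide)]
        exact h48
      · simp only [Mem.set_self, Ex.eval_num, Ex.eval_add, Ex.eval_get, hf3 4 (by decide), h4',
            if_true]
        omega
  · rintro m2 - - ⟨-, -, h⟩
    exact h rfl

/-- One program finds the least bound, within a time that is bounded in terms of it. -/
theorem exists_program_least : ∃ (P : Prog) (w : ℕ) (C : ℕ → ℕ), ∀ (n k : ℕ)
    (G : SimpleGraph (Fin n)),
    IsLeast {k : ℕ | 0 < k ∧ IsEBCBounded G k} k →
      HaltsWithin P w G (C k * timeBound k G) fun s => s.reg 0 = k := by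
  obtain ⟨C, hC⟩ := tri_searchLeast
  refine ⟨.seq (startP 1) (.seq (searchLeastS 0 0) (endP 4)), 1004, fun k =>
      k * (C * k * 2 ^ k + 50) + 61,
    fun n k G hk => ?_⟩
  have hn : 0 < n := hk.1.2.pos
  have hkn : k ≤ n := by
    have := hk.2 ⟨(lt_min hk.1.1 hn : 0 < min k n), isEBCBounded_min.2 hk.1.2⟩
    omega
  obtain ⟨τ, s, h1, h2, h3, h4⟩ := halts (G := G) (A := 4) (k := 1) (w := 1004)
      (P := searchLeastS) le_rfl
    fun m hm h4 => hC hm (by omega) hk hkn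
  refine ⟨τ, s, h1, h2.trans ?_, h4.trans h3⟩
  have := one_le_timeBound hn G k
  nlinarith [Nat.mul_le_mul_left k this]

theorem outSet_eq (s : State) : outSet n s = outs n s.arr := by
  ext x; simp [outSet, outs]

theorem IsResolving.mono {R R' : Finset (Fin n)} (h : IsResolving G R)
    (hR : R ⊆ R') : IsResolving G R' :=
  fun u v huv => let ⟨w, hw, hd⟩ := h u v huv; ⟨w, hR hw, hd⟩

/-- The metric dimension is positive by definition, also for the graph with one vertex. -/
theorem IsMinResolving.hasMetricDimension (hn : 0 < n) {R : Finset (Fin n)}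
    (h : IsMinResolving G R) :
    HasMetricDimension G (max 1 R.card) := by
  refine ⟨⟨by omega, ?_⟩, fun d ⟨hd, R', hR', hc⟩ => max_le hd (hc ▸ h.2 R' hR')⟩
  by_cases h0 : R = ∅
  · exact ⟨{⟨0, hn⟩}, h.1.mono (by simp [h0]), by simp [h0]⟩
  · have := Finset.card_pos.2 (Finset.nonempty_iff_ne_empty.2 h0)
    exact ⟨R, h.1, by omega⟩

end Programs

end EBC

theorem mainTheorem4 :
    -- deciding whether a graph is `k`-EBC-bounded
    (∀ k : ℕ, 0 < k → ∃ (P : EBC.Prog) (w C : ℕ), ∀ (n : ℕ) (G : SimpleGraph (Fin n)), 0 < n →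
      EBC.HaltsWithin P w G (C * EBC.timeBound k G) (fun s =>
        (EBC.IsEBCBounded G k ∧ EBC.outNum s = 1) ∨
        (¬ EBC.IsEBCBounded G k ∧ EBC.outNum s = 0))) ∧
    -- finding the least `k'` for the members of EBC-bounded sets of graphs
    (∃ (P : EBC.Prog) (w : ℕ) (C : ℕ → ℕ), ∀ B : Set EBC.FinGraph, EBC.IsEBCBoundedSet B →
      ∀ (n : ℕ) (G : SimpleGraph (Fin n)), (⟨n, G⟩ : EBC.FinGraph) ∈ B →
        ∃ k' : ℕ, IsLeast {k : ℕ | 0 < k ∧ EBC.IsEBCBounded G k} k' ∧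
          EBC.HaltsWithin P w G (C k' * EBC.timeBound k' G) (fun s => EBC.outNum s = k')) ∧
    -- computing a minimum `k`-EBC-bounded resolving set
    (∀ k : ℕ, 0 < k → ∃ (P : EBC.Prog) (w C : ℕ), ∀ (n : ℕ) (G : SimpleGraph (Fin n)),
      EBC.IsEBCBounded G k →
      EBC.HaltsWithin P w G (C * EBC.timeBound k G) (fun s =>
        EBC.IsMinEBCBoundedResolving G k (EBC.outSet n s))) ∧
    -- computing a minimum resolving set and the metric dimension
    (∀ k : ℕ, 0 < k → ∃ (P : EBC.Prog) (w C : ℕ), ∀ (n : ℕ) (G : SimpleGraph (Fin n)),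
      EBC.IsMinimumEBCBounded G k →
      EBC.HaltsWithin P w G (C * EBC.timeBound k G) (fun s =>
        EBC.IsMinResolving G (EBC.outSet n s) ∧
        EBC.HasMetricDimension G (EBC.outNum s))) := by
  refine ⟨fun k hk => ?_, ?_, fun k hk => ?_, fun k hk => ?_⟩
  · obtain ⟨P, w, C, h⟩ := EBC.exists_program k 44 hk
    refine ⟨P, w, C, fun n G hn => ?_⟩
    obtain ⟨τ, s, h1, h2, h3, h4⟩ := h n G hn
    refine ⟨τ, s, h1, h2, ?_⟩
    simp only [EBC.outNum]
    rw [h4, ← EBC.isEBCBounded_min, ← h3.iff]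
    have := h3.le
    omega
  · obtain ⟨P, w, C, h⟩ := EBC.exists_program_least
    refine ⟨P, w, C, fun B hB n G hG => ?_⟩
    classical
    have hex : ∃ k : ℕ, 0 < k ∧ EBC.IsEBCBounded G k := hB _ hG
    have hk : IsLeast {k : ℕ | 0 < k ∧ EBC.IsEBCBounded G k} (Nat.find hex) :=
      ⟨Nat.find_spec hex, fun k hk => Nat.find_min' hex hk⟩
    exact ⟨_, hk, h n _ G hk⟩
  · obtain ⟨P, w, C, h⟩ := EBC.exists_program k 45 hk
    refine ⟨P, w, C, fun n G hG => ?_⟩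
    obtain ⟨τ, s, h1, h2, h3, -⟩ := h n G hG.pos
    refine ⟨τ, s, h1, h2, ?_⟩
    beta_reduce
    rw [EBC.outSet_eq, ← EBC.isMinEBCBoundedResolving_min]
    exact h3.isMin (EBC.isEBCBounded_min.2 hG)
  · obtain ⟨P, w, C, h⟩ := EBC.exists_program k 45 hk
    refine ⟨P, w, C, fun n G hG => ?_⟩
    obtain ⟨hconn, R, hR, hRk⟩ := hG
    have hb : EBC.IsEBCBounded G k := ⟨hconn, R, hR.1, hRk⟩
    obtain ⟨τ, s, h1, h2, h3, h4⟩ := h n G hb.pos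
    have hmin := h3.isMin (EBC.isEBCBounded_min.2 hb)
    rw [EBC.isMinEBCBoundedResolving_min] at hmin
    -- as `R` is a minimum resolving set, the minimum EBC-bounded one is not larger
    have hres : EBC.IsMinResolving G (EBC.outs n s.arr) :=
      ⟨hmin.1.1, fun R' hR' => (hmin.2 R ⟨hR.1, hRk⟩).trans (hR.2 R' hR')⟩
    refine ⟨τ, s, h1, h2, ?_, ?_⟩
    · rwa [EBC.outSet_eq]
    · rw [EBC.outNum, h4, h3.num (EBC.isEBCBounded_min.2 hb)]
      exact hres.hasMetricDimension hb.pos
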